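/- Let $G\rightrightarrows M$ be a Lie groupoid with range $r$, source $s$ and compact unit space $M$ (smooth Hausdorff second countable manifolds without boundary, $\dim M=n^{(0)}$, $\dim G=n^{(1)}+n^{(0)}$); $M$ is regarded as a subset of $G$ through the units. Let $AG=\ker ds|_M$ be its Lie algebroid and, for a real vector bundle $E$, let $\Omega^\alpha(E)$ be the line bundle of complex $\alpha$-densities on $E$. Put $$\Omega^{1/2}=\Omega^{1/2}(r^*AG)\otimes\Omega^{1/2}(s^*AG),\qquad \Omega^{1/2}_0=\Omega^{-1/2}(r^*AG)\otimes\Omega^{-1/2}(s^*AG)\otimes\Omega^1(TG),$$ $$C_c^\infty(G)=C_c^\infty(G,\Omega^{1/2}),\qquad \mathcal D(G)=C_c^\infty(G,\Omega^{1/2}_0).$$ The space $\mathcal D(G)$ is a bimodule over the convolution algebra $C_c^\infty(G)$ through $$\xi\star\chi(\gamma)=\int_{\alpha\in G_{s(\gamma)}}\xi(\gamma\alpha^{-1})\,\chi(\alpha),\qquad \chi\star\xi(\gamma)=\int_{\alpha\in G_{s(\gamma)}}\chi(\gamma\alpha^{-1})\,\xi(\alpha)\qquad(\xi\in C_c^\infty(G),\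 \chi\in\mathcal D(G)),$$ where $G_x=s^{-1}(x)$. The integrands are one-densities along $G_{s(\gamma)}$ with values in the fibre of $\Omega_0^{1/2}$ at $\gamma$: right translation identifies $A_{r(\alpha)}G$ with $T_\alpha G_{s(\alpha)}$, and one uses the canonical isomorphisms $$\Omega_0^{1/2}\simeq\Omega^{1/2}(r^*AG)\otimes\Omega^{-1/2}(s^*AG)\otimes s^*\Omega^1(TM)$$ in the first case and $$\Omega_0^{1/2}\simeq\Omega^{-1/2}(r^*AG)\otimes\Omega^{1/2}(s^*AG)\otimes r^*\Omega^1(TM)$$ in the second, which result from the exact sequences $0\to\ker ds\to TG\to s^*TM\to0$ and $0\to\ker dr\to TG\to r^*TM\to0$ together with the isomorphisms $\ker ds\simeq r^*AG$ (by right translations) and $\ker dr\simeq s^*AG$ (by inversion and left translations). **Theorem.** Let $V$ be an open neighborhood of $M$ in $G$ and let $\omega\in\mathcal D(G)$. Then $\omega$ is a finite sum of elements of the form $\xi\star\chi$, where $\xi\in C_c^\infty(G)$, $\operatorname{supp}\xi\subset V$, $\chi\in\mathcal D(G)$ and $\operatorname{supp}\chi\subset\operatorname{supp}\omega$. Likewise,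 $\omega$ is a finite sum of elements of the form $\chi\star\xi$, with $\xi$ and $\chi$ subject to the same conditions. -/

import Mathlib

open scoped Manifold ContDiff

/-- A tuple of vectors `v` of `E` is a frame (an ordered basis) of the subspace `W`. -/
def IsFrame {E : Type*} [AddCommGroup E] [Module ℝ E] {k : ℕ} (W : Submodule ℝ E)
    (v : Fin k → E) : Prop :=
  LinearIndependent ℝ v ∧ Submodule.span ℝ (Set.range v) = W

/-- `δ` is an `α`-density on the `k`-dimensional subspace `W` of `E`: a complex function of the
frames of `W` that is homogeneous of degree `α` in the volume element `v₁ ∧ ⋯ ∧ v_k`.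
It is defined on all `k`-tuples of vectors of `E` and put equal to zero off the frames of `W`, so
that the `α`-densities on `W` form a complex line. -/
structure IsDensity {E : Type*} [AddCommGroup E] [Module ℝ E] {k : ℕ} (α : ℝ)
    (W : Submodule ℝ E) (δ : (Fin k → E) → ℂ) : Prop where
  zero_of_not_frame : ∀ v, ¬ IsFrame W v → δ v = 0
  homogeneous : ∀ v, IsFrame W v → ∀ P : Matrix (Fin k) (Fin k) ℝ, P.det ≠ 0 →
    δ (fun i => ∑ j, P i j • v j) = ((|P.det| ^ α : ℝ) : ℂ) * δ v

/-- A Lie groupoid `G ⇉ M` with `dim G = n₁ + n₀` and `dim M = n₀`. The multiplication is written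
as a total function; only its values on the set `{(α, β) | s α = r β}` of composable pairs, which
is a closed submanifold of `G × G`, are meaningful. -/
structure LieGroupoid (n₁ n₀ : ℕ) (G M : Type*)
    [TopologicalSpace G] [ChartedSpace (EuclideanSpace ℝ (Fin (n₁ + n₀))) G]
    [TopologicalSpace M] [ChartedSpace (EuclideanSpace ℝ (Fin n₀)) M] where
  /-- range -/
  r : G → M
  /-- source -/
  s : G → M
  /-- units -/
  unit : M → G
  /-- inversion -/
  inv : G → G
  /-- multiplication -/
  mul : G → G → G
  r_surjective : Function.Surjective r
  s_surjective : Function.Surjective s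
  r_submersion : Manifold.IsSubmersion (𝓡 (n₁ + n₀)) (𝓡 n₀) ∞ r
  s_submersion : Manifold.IsSubmersion (𝓡 (n₁ + n₀)) (𝓡 n₀) ∞ s
  unit_smooth : ContMDiff (𝓡 n₀) (𝓡 (n₁ + n₀)) ∞ unit
  inv_smooth : ContMDiff (𝓡 (n₁ + n₀)) (𝓡 (n₁ + n₀)) ∞ inv
  mul_smooth : ContMDiffOn ((𝓡 (n₁ + n₀)).prod (𝓡 (n₁ + n₀))) (𝓡 (n₁ + n₀)) ∞
    (fun p : G × G => mul p.1 p.2) {p : G × G | s p.1 = r p.2}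
  r_unit : ∀ x, r (unit x) = x
  s_unit : ∀ x, s (unit x) = x
  r_mul : ∀ α β, s α = r β → r (mul α β) = r α
  s_mul : ∀ α β, s α = r β → s (mul α β) = s β
  unit_mul : ∀ α, mul (unit (r α)) α = α
  mul_unit : ∀ α, mul α (unit (s α)) = α
  r_inv : ∀ α, r (inv α) = s α
  s_inv : ∀ α, s (inv α) = r α
  mul_inv : ∀ α, mul α (inv α) = unit (r α)
  inv_mul : ∀ α, mul (inv α) α = unit (s α)
  mul_assoc : ∀ α β γ, s α = r β → s β = r γ → mul (mul α β) γ = mul α (mul β γ)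

namespace LieGroupoid

/- All tangent spaces `T_γ G` are, in Mathlib, copies of the model space
`EuclideanSpace ℝ (Fin (n₁ + n₀))`, and all `T_x M` are copies of `EuclideanSpace ℝ (Fin n₀)`. -/

/-- A section over `G` of functions of a tuple of vectors of `T_{r(γ)} G` and a tuple of vectors of
`T_{s(γ)} G` (units being identified with points of `M`). -/
abbrev HalfField (n₁ n₀ : ℕ) (G : Type*) : Type _ :=
  G → (Fin n₁ → EuclideanSpace ℝ (Fin (n₁ + n₀))) →
    (Fin n₁ → EuclideanSpace ℝ (Fin (n₁ + n₀))) → ℂ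

/-- A section over `G` of functions of a tuple of vectors of `T_{r(γ)} G`, a tuple of vectors of
`T_{s(γ)} G`, and a tuple of `dim G` vectors of `T_γ G`. -/
abbrev TestField (n₁ n₀ : ℕ) (G : Type*) : Type _ :=
  G → (Fin n₁ → EuclideanSpace ℝ (Fin (n₁ + n₀))) →
    (Fin n₁ → EuclideanSpace ℝ (Fin (n₁ + n₀))) →
    (Fin (n₁ + n₀) → EuclideanSpace ℝ (Fin (n₁ + n₀))) → ℂ

variable {n₁ n₀ : ℕ} {G M : Type*}
    [TopologicalSpace G] [ChartedSpace (EuclideanSpace ℝ (Fin (n₁ + n₀))) G]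
    [TopologicalSpace M] [ChartedSpace (EuclideanSpace ℝ (Fin n₀)) M]
    (𝒢 : LieGroupoid n₁ n₀ G M)

/-- The fibre at `x` of the Lie algebroid `AG = ker ds |_M`, a subspace of `T_x G`. -/
noncomputable def algebroid (x : M) : Submodule ℝ (EuclideanSpace ℝ (Fin (n₁ + n₀))) :=
  LinearMap.ker (mfderiv (𝓡 (n₁ + n₀)) (𝓡 n₀) 𝒢.s (𝒢.unit x)).toLinearMap

/-- `X` is a smooth local frame of the vector bundle `AG → M` over the open set `U`. -/
structure IsAlgebroidFrame [IsManifold (𝓡 (n₁ + n₀)) ∞ G]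
    (U : Set M)
    (X : M → Fin n₁ → EuclideanSpace ℝ (Fin (n₁ + n₀))) : Prop where
  isOpen : IsOpen U
  frame : ∀ x ∈ U, IsFrame (𝒢.algebroid x) (X x)
  smooth : ∀ i, ContMDiffOn (𝓡 n₀) (𝓡 (n₁ + n₀)).tangent ∞
    (fun x => (⟨𝒢.unit x, X x i⟩ : TangentBundle (𝓡 (n₁ + n₀)) G)) U

/-- `Z` is a smooth local frame of the tangent bundle `TG → G` over the open set `W`. -/
structure IsTangentFrame [IsManifold (𝓡 (n₁ + n₀)) ∞ G]
    (W : Set G)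
    (Z : G → Fin (n₁ + n₀) → EuclideanSpace ℝ (Fin (n₁ + n₀))) : Prop where
  isOpen : IsOpen W
  frame : ∀ γ ∈ W, IsFrame ⊤ (Z γ)
  smooth : ∀ i, ContMDiffOn (𝓡 (n₁ + n₀)) (𝓡 (n₁ + n₀)).tangent ∞
    (fun γ => (⟨γ, Z γ i⟩ : TangentBundle (𝓡 (n₁ + n₀)) G)) W

/-- `f ∈ C_c^∞(G) = C_c^∞(G, Ω^{1/2})`, where `Ω^{1/2} = Ω^{1/2}(r^*AG) ⊗ Ω^{1/2}(s^*AG)`. An element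
of a tensor product of density lines is given by a function of several frames, a density in each
of them; a section is smooth if its values on smooth local frames are. -/
structure IsCompactHalfDensity [IsManifold (𝓡 (n₁ + n₀)) ∞ G]
    (f : HalfField n₁ n₀ G) : Prop where
  density_r : ∀ γ b, IsDensity (1 / 2) (𝒢.algebroid (𝒢.r γ)) (fun a => f γ a b)
  density_s : ∀ γ a, IsDensity (1 / 2) (𝒢.algebroid (𝒢.s γ)) (fun b => f γ a b)
  smooth : ∀ U X U' X', 𝒢.IsAlgebroidFrame U X → 𝒢.IsAlgebroidFrame U' X' →
    ContMDiffOn (𝓡 (n₁ + n₀)) 𝓘(ℝ, ℂ) ∞ (fun γ => f γ (X (𝒢.r γ)) (X' (𝒢.s γ)))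
      (𝒢.r ⁻¹' U ∩ 𝒢.s ⁻¹' U')
  compact : HasCompactSupport f

/-- `τ ∈ 𝒟(G) = C_c^∞(G, Ω_0^{1/2})`, where
`Ω_0^{1/2} = Ω^{-1/2}(r^*AG) ⊗ Ω^{-1/2}(s^*AG) ⊗ Ω^1(TG)`. -/
structure IsTestFunction [IsManifold (𝓡 (n₁ + n₀)) ∞ G]
    (τ : TestField n₁ n₀ G) : Prop where
  density_r : ∀ γ b t, IsDensity (-1 / 2) (𝒢.algebroid (𝒢.r γ)) (fun a => τ γ a b t)
  density_s : ∀ γ a t, IsDensity (-1 / 2) (𝒢.algebroid (𝒢.s γ)) (fun b => τ γ a b t)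
  density_G : ∀ γ a b, IsDensity 1 ⊤ (fun t => τ γ a b t)
  smooth : ∀ U X U' X' W Z, 𝒢.IsAlgebroidFrame U X → 𝒢.IsAlgebroidFrame U' X' →
    IsTangentFrame W Z →
    ContMDiffOn (𝓡 (n₁ + n₀)) 𝓘(ℝ, ℂ) ∞ (fun γ => τ γ (X (𝒢.r γ)) (X' (𝒢.s γ)) (Z γ))
      (𝒢.r ⁻¹' U ∩ 𝒢.s ⁻¹' U' ∩ W)
  compact : HasCompactSupport τ

/-- The differential at the unit `r(γ)` of right translation `β ↦ βγ`, which is defined on the fibre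
`s⁻¹(r(γ))`; it maps `A_{r(γ)} G = ker ds` isomorphically onto `ker ds ⊆ T_γ G`. Only its values on
`A_{r(γ)} G` are meaningful, and these do not depend on the choice made by `mfderivWithin`. -/
noncomputable def rightTrans (γ : G) :
    EuclideanSpace ℝ (Fin (n₁ + n₀)) →L[ℝ] EuclideanSpace ℝ (Fin (n₁ + n₀)) :=
  mfderivWithin (𝓡 (n₁ + n₀)) (𝓡 (n₁ + n₀)) (fun β => 𝒢.mul β γ)
    (𝒢.s ⁻¹' {𝒢.r γ}) (𝒢.unit (𝒢.r γ))

/-- The differential at the unit `s(γ)` of `β ↦ γβ⁻¹`, which is defined on the fibre `s⁻¹(s(γ))`; it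
maps `A_{s(γ)} G` isomorphically onto `ker dr ⊆ T_γ G`. -/
noncomputable def leftTransInv (γ : G) :
    EuclideanSpace ℝ (Fin (n₁ + n₀)) →L[ℝ] EuclideanSpace ℝ (Fin (n₁ + n₀)) :=
  mfderivWithin (𝓡 (n₁ + n₀)) (𝓡 (n₁ + n₀)) (fun β => 𝒢.mul γ (𝒢.inv β))
    (𝒢.s ⁻¹' {𝒢.s γ}) (𝒢.unit (𝒢.s γ))

/-- A lift to `T_γ G` of a tangent vector of `M` at `s(γ)`, along the surjection `ds`. -/
noncomputable def sLift (γ : G) (c : EuclideanSpace ℝ (Fin n₀)) :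
    EuclideanSpace ℝ (Fin (n₁ + n₀)) :=
  Function.invFun (mfderiv (𝓡 (n₁ + n₀)) (𝓡 n₀) 𝒢.s γ) c

/-- A lift to `T_γ G` of a tangent vector of `M` at `r(γ)`, along the surjection `dr`. -/
noncomputable def rLift (γ : G) (c : EuclideanSpace ℝ (Fin n₀)) :
    EuclideanSpace ℝ (Fin (n₁ + n₀)) :=
  Function.invFun (mfderiv (𝓡 (n₁ + n₀)) (𝓡 n₀) 𝒢.r γ) c

/-- The canonical isomorphism `Ω_0^{1/2} ≃ Ω^{1/2}(r^*AG) ⊗ Ω^{-1/2}(s^*AG) ⊗ s^*Ω^1(TM)`, from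
`0 → ker ds ≃ r^*AG → TG → s^*TM → 0`: here `a`, `b`, `c` are frames of `A_{r(γ)} G`, `A_{s(γ)} G`,
`T_{s(γ)} M`. The result does not depend on the choice of the lifts. -/
noncomputable def sForm (τ : TestField n₁ n₀ G) (γ : G)
    (a b : Fin n₁ → EuclideanSpace ℝ (Fin (n₁ + n₀))) (c : Fin n₀ → EuclideanSpace ℝ (Fin n₀)) : ℂ :=
  τ γ a b (Fin.append (fun i => 𝒢.rightTrans γ (a i)) (fun j => 𝒢.sLift γ (c j)))

/-- The canonical isomorphism `Ω_0^{1/2} ≃ Ω^{-1/2}(r^*AG) ⊗ Ω^{1/2}(s^*AG) ⊗ r^*Ω^1(TM)`, from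
`0 → ker dr ≃ s^*AG → TG → r^*TM → 0`: here `a`, `b`, `c` are frames of `A_{r(γ)} G`, `A_{s(γ)} G`,
`T_{r(γ)} M`. -/
noncomputable def rForm (τ : TestField n₁ n₀ G) (γ : G)
    (a b : Fin n₁ → EuclideanSpace ℝ (Fin (n₁ + n₀))) (c : Fin n₀ → EuclideanSpace ℝ (Fin n₀)) : ℂ :=
  τ γ a b (Fin.append (fun i => 𝒢.leftTransInv γ (b i)) (fun j => 𝒢.rLift γ (c j)))

/-- A smooth chart of the submanifold `G_x = s⁻¹(x)` of `G`: a homeomorphism from an open subset of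
`G_x` to an open subset of `ℝ^{n₁}` whose inverse is a smooth immersion into `G`. -/
structure FiberChart (x : M) extends
    OpenPartialHomeomorph {α : G // 𝒢.s α = x} (EuclideanSpace ℝ (Fin n₁)) where
  smooth_symm : ContMDiffOn (𝓡 n₁) (𝓡 (n₁ + n₀)) ∞
    (fun u => ((toOpenPartialHomeomorph.symm u : {α : G // 𝒢.s α = x}) : G))
    toOpenPartialHomeomorph.target
  immersion_symm : ∀ u ∈ toOpenPartialHomeomorph.target, Function.Injective
    (mfderiv (𝓡 n₁) (𝓡 (n₁ + n₀))
      (fun w => ((toOpenPartialHomeomorph.symm w : {α : G // 𝒢.s α = x}) : G)) u)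

/-- The inverse of a chart of `G_x`, with values in `G`. -/
def FiberChart.param {𝒢 : LieGroupoid n₁ n₀ G M} {x : M} (e : 𝒢.FiberChart x)
    (u : EuclideanSpace ℝ (Fin n₁)) : G :=
  ((e.toOpenPartialHomeomorph.symm u : {α : G // 𝒢.s α = x}) : G)

/-- The frame of `A_{r(α)} G`, `α = e.param u`, that right translation by `α` maps to the coordinate
frame `∂/∂u₁, …, ∂/∂u_{n₁}` of `T_α G_x`: the partial derivatives at `w = u` of
`(e.param w) (e.param u)⁻¹`. -/
noncomputable def FiberChart.coordFrame {𝒢 : LieGroupoid n₁ n₀ G M} {x : M} (e : 𝒢.FiberChart x)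
    (u : EuclideanSpace ℝ (Fin n₁)) (i : Fin n₁) : EuclideanSpace ℝ (Fin (n₁ + n₀)) :=
  mfderiv (𝓡 n₁) (𝓡 (n₁ + n₀)) (fun w => 𝒢.mul (e.param w) (𝒢.inv (e.param u))) u
    (EuclideanSpace.single i (1 : ℝ))

/-- `∫_{G_x} θ = I`, for a compactly supported one-density `θ` along the fibre `G_x`: `θ α` is a
density on `A_{r(α)} G ≃ T_α G_x`. As usual, `θ` is cut into finitely many pieces `ρ j • θ` by smooth
functions that sum to one on the support of `θ`; each piece is compactly supported in the domain of
a chart `e j` of `G_x`, and there it is integrated against Lebesgue measure after evaluation on the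
coordinate frame. -/
def HasFiberIntegral (x : M) (θ : G → (Fin n₁ → EuclideanSpace ℝ (Fin (n₁ + n₀))) → ℂ)
    (I : ℂ) : Prop :=
  ∃ (N : ℕ) (e : Fin N → 𝒢.FiberChart x) (ρ : Fin N → G → ℝ),
    (∀ j, ContMDiff (𝓡 (n₁ + n₀)) 𝓘(ℝ, ℝ) ∞ (ρ j)) ∧
    (∀ α, 𝒢.s α = x → θ α ≠ 0 → ∑ j, ρ j α = 1) ∧
    (∀ j, ∃ K : Set {α : G // 𝒢.s α = x}, IsCompact K ∧
      K ⊆ (e j).toOpenPartialHomeomorph.source ∧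
      ∀ α : {α : G // 𝒢.s α = x}, α ∉ K → ρ j (α : G) • θ (α : G) = 0) ∧
    I = ∑ j, ∫ u in (e j).toOpenPartialHomeomorph.target,
      (ρ j ((e j).param u) : ℂ) * θ ((e j).param u) ((e j).coordFrame u)

/-- `f ⋆ τ = η` for `f ∈ C_c^∞(G)` and `τ ∈ 𝒟(G)`, with `η ∈ 𝒟(G)`, that is,
`η(γ) = ∫_{α ∈ G_{s(γ)}} f(γα⁻¹) τ(α)`. Through `sForm`, the integrand is a one-density along
`G_{s(γ)}` with coefficients in the fibre of `Ω_0^{1/2}` at `γ`; note that `r(γα⁻¹) = r(γ)`,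
`s(γα⁻¹) = r(α)` and `s(α) = s(γ)`. -/
structure IsLeftConvolution [IsManifold (𝓡 (n₁ + n₀)) ∞ G]
    (f : HalfField n₁ n₀ G) (τ η : TestField n₁ n₀ G) : Prop where
  isTestFunction : 𝒢.IsTestFunction η
  integral : ∀ γ a b c, IsFrame (𝒢.algebroid (𝒢.r γ)) a → IsFrame (𝒢.algebroid (𝒢.s γ)) b →
    IsFrame ⊤ c →
    𝒢.HasFiberIntegral (𝒢.s γ)
      (fun α e => f (𝒢.mul γ (𝒢.inv α)) a e * 𝒢.sForm τ α e b c) (𝒢.sForm η γ a b c)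

/-- `τ ⋆ f = η` for `τ ∈ 𝒟(G)` and `f ∈ C_c^∞(G)`, with `η ∈ 𝒟(G)`, that is,
`η(γ) = ∫_{α ∈ G_{s(γ)}} τ(γα⁻¹) f(α)`. Through `rForm`, the integrand is a one-density along
`G_{s(γ)}` with coefficients in the fibre of `Ω_0^{1/2}` at `γ`. -/
structure IsRightConvolution [IsManifold (𝓡 (n₁ + n₀)) ∞ G]
    (τ : TestField n₁ n₀ G) (f : HalfField n₁ n₀ G)
    (η : TestField n₁ n₀ G) : Prop where
  isTestFunction : 𝒢.IsTestFunction η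
  integral : ∀ γ a b c, IsFrame (𝒢.algebroid (𝒢.r γ)) a → IsFrame (𝒢.algebroid (𝒢.s γ)) b →
    IsFrame ⊤ c →
    𝒢.HasFiberIntegral (𝒢.s γ)
      (fun α e => 𝒢.rForm τ (𝒢.mul γ (𝒢.inv α)) a e c * f α e b) (𝒢.rForm η γ a b c)

end LieGroupoid

open scoped Manifold ContDiff

/-! ### The inverse function theorem with smooth inverse -/

section SmoothInverse

open Set Filter Topology

/-! The argument is that of Dixmier and Malliavin. On the line, the Dirac mass is written weakly as
u(0) = ∫ f · Pu + ∫ g · u, where P is an infinite product ∏ (1 - mⱼ D) D³ and f, g are smooth with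
support in a short interval [0, b]. The product is built one factor at a time. The truncated
exponential e^{-t/m}/m (`expKernel`) inverts 1 - mD up to an error (`expError`) that tends to zero
with all its derivatives as m → 0. Convolution with this kernel gains one derivative for f and moves
f and g as little as desired. Hence f and g converge with all derivatives, while each mⱼ may be
required to be as small as one likes in terms of the earlier ones (`exists_dirac_factorization`).

Given a vector field X and a test function h, the mⱼ are chosen so small that the partial products
applied to h converge to a smooth χ with support in that of h. Along an orbit c of X the field acts
as d/dt, and the identity on the line becomes h(c(0)) = ∫ f(t) χ(c(t)) dt + ∫ g(t) h(c(t)) dt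
(`exists_factorization_along_vectorField`). Doing this for n₁ fields in succession expresses h at
the starting point as a sum of 2^{n₁} integrals over a cube of flow times
(`exists_iterated_factorization`).

On G the fields are the right-invariant ones generated by a local frame of AG. By right invariance,
flowing from γ amounts to multiplying γ on the left by the result of flowing from the unit at r(γ).
The inverse function theorem makes the times of the successive flows into coordinates t ↦ β_t of the
source fibre of that unit. In such a flow box, h(γ) is a sum of averages ∫ f(t) χ(β_t γ) dt
(`exists_flowBox`). Substituting α = β_t γ, so that γα⁻¹ = β_t⁻¹, turns each average into a
convolution ξ ⋆ χ with ξ concentrated near the units (`FlowBox.isLeftConvolution`). The same applied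
to h composed with inversion gives χ ⋆ ξ (`FlowBox.isRightConvolution`).

What remains is the treatment of densities. A partition of unity localizes the test function, and
local frames of AG together with a frame of TG adapted to `sForm` or `rForm` turn it into a scalar
coefficient. The coefficient of ξ is f divided by a determinant, so that the fibre integral of
densities becomes the Lebesgue integral over the flow times. The lifts in `sForm` and `rForm` are
arbitrary choices. Their effect is controlled by a block determinant identity
(`tupleDet_append_mul_dualDet`), which shows that only their images in the base matter. -/

theorem exists_openPartialHomeomorph_of_contDiffOn {E F : Type*} [NormedAddCommGroup E]
    [NormedSpace ℝ E] [CompleteSpace E] [NormedAddCommGroup F] [NormedSpace ℝ F] {f : E → F}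
    {O : Set E} (hO : IsOpen O) {a : E} (ha : a ∈ O) (hf : ContDiffOn ℝ ∞ f O)
    {f' : E ≃L[ℝ] F} (hf' : HasFDerivAt f (f' : E →L[ℝ] F) a) :
    ∃ e : OpenPartialHomeomorph E F, (e : E → F) = f ∧ a ∈ e.source ∧ e.source ⊆ O ∧
      ContDiffOn ℝ ∞ e.symm e.target := by
  have hfa : ContDiffAt ℝ ∞ f a := hf.contDiffAt (hO.mem_nhds ha)
  have hn : (∞ : WithTop ℕ∞) ≠ 0 := by simp
  let e₀ := hfa.toOpenPartialHomeomorph f hf' hn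
  have hcont : ContinuousOn (fderiv ℝ f) O := hf.continuousOn_fderiv_of_isOpen hO (by simp)
  -- Invertibility of the derivative is an open condition. On S it holds at every point, so the
  -- inverse is smooth on the whole target and not only at the image of a.
  let S : Set E := O ∩ fderiv ℝ f ⁻¹' (range ContinuousLinearEquiv.toContinuousLinearMap)
  have hS : IsOpen S := hcont.isOpen_inter_preimage hO (ContinuousLinearEquiv.isOpen)
  refine ⟨e₀.restrOpen S hS, rfl, ?_, ?_, ?_⟩
  · refine ⟨hfa.mem_toOpenPartialHomeomorph_source hf' hn, ha, ?_⟩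
    exact ⟨f', hf'.fderiv.symm⟩
  · exact fun x hx => hx.2.1
  · intro y hy
    have hy' := (e₀.restrOpen S hS).map_target hy
    obtain ⟨hO', ⟨g, hg⟩⟩ := hy'.2
    have hcd : ContDiffAt ℝ ∞ f ((e₀.restrOpen S hS).symm y) := hf.contDiffAt (hO.mem_nhds hO')
    refine ((e₀.restrOpen S hS).contDiffAt_symm (f₀' := g) hy ?_ hcd).contDiffWithinAt
    rw [hg]
    exact (hcd.differentiableAt (by simp)).hasFDerivAt

end SmoothInverse

/-! ### Superposition operators on spaces of continuous curves -/

section Superposition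

open Set Filter Topology

variable {T : Type*} [TopologicalSpace T] [CompactSpace T]

/-- Pointwise application of a continuous family of operators. -/
noncomputable def pointwiseApply (T : Type*) [TopologicalSpace T] [CompactSpace T]
    (E F : Type*) [NormedAddCommGroup E] [NormedSpace ℝ E]
    [NormedAddCommGroup F] [NormedSpace ℝ F] :
    C(T, E →L[ℝ] F) →L[ℝ] C(T, E) →L[ℝ] C(T, F) :=
  LinearMap.mkContinuous₂
    (LinearMap.mk₂ ℝ (fun (A : C(T, E →L[ℝ] F)) (c : C(T, E)) =>
        (⟨fun t => A t (c t), by fun_prop⟩ : C(T, F)))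
      (by intros; ext; simp) (by intros; ext; simp) (by intros; ext; simp) (by intros; ext; simp))
    1 (by
      intro A c
      rw [one_mul, ContinuousMap.norm_le _ (by positivity)]
      intro t
      exact ((A t).le_opNorm _).trans
        (mul_le_mul (A.norm_coe_le_norm t) (c.norm_coe_le_norm t) (norm_nonneg (c t)) (norm_nonneg A)))

/-- Compact support makes the derivative of f uniformly continuous, so the mean value inequality
bounds the first-order remainder uniformly in t, that is, in the supremum norm. -/
theorem hasFDerivAt_superposition {E F : Type*} [NormedAddCommGroup E] [NormedSpace ℝ E]
    [NormedAddCommGroup F] [NormedSpace ℝ F] {f : E → F} (hf : ContDiff ℝ 1 f)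
    (hc : HasCompactSupport f) (c : C(T, E)) :
    HasFDerivAt (fun c : C(T, E) => (ContinuousMap.mk f hf.continuous).comp c)
      (pointwiseApply T E F
        ((ContinuousMap.mk (fderiv ℝ f) (hf.continuous_fderiv one_ne_zero)).comp c)) c := by
  have huc : UniformContinuous (fderiv ℝ f) :=
    (hc.fderiv ℝ).uniformContinuous_of_continuous (hf.continuous_fderiv one_ne_zero)
  rw [hasFDerivAt_iff_isLittleO_nhds_zero, Asymptotics.isLittleO_iff]
  intro ε hε
  obtain ⟨δ, hδ, H⟩ := Metric.uniformContinuous_iff.1 huc ε hε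
  filter_upwards [Metric.ball_mem_nhds (0 : C(T, E)) hδ] with h hh
  rw [ContinuousMap.norm_le _ (by positivity)]
  intro t
  have hht : ‖h t‖ < δ := (h.norm_coe_le_norm t).trans_lt (by simpa using hh)
  have key : ‖f (c t + h t) - f (c t) - fderiv ℝ f (c t) (c t + h t - c t)‖
      ≤ ε * ‖c t + h t - c t‖ := by
    refine Convex.norm_image_sub_le_of_norm_fderiv_le' (s := Metric.ball (c t) δ)
      (𝕜 := ℝ) (φ := fderiv ℝ f (c t)) (fun x _ => (hf.differentiable one_ne_zero) x) ?_
      (convex_ball _ _) (Metric.mem_ball_self hδ) (by simpa using hht)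
    intro x hx
    have := H (a := x) (b := c t) hx
    rw [dist_eq_norm] at this
    exact this.le
  simp only [add_sub_cancel_left] at key
  refine key.trans ?_
  gcongr
  exact h.norm_coe_le_norm t

universe u

/-- The derivative is superposition with `fderiv ℝ f`, followed by a continuous linear map, whence
induction on n. The space F is quantified inside, in the universe of E, because the induction passes
from F to E →L[ℝ] F. -/
theorem contDiff_superposition {E : Type u} [NormedAddCommGroup E] [NormedSpace ℝ E] (n : ℕ) :
    ∀ {F : Type u} [NormedAddCommGroup F] [NormedSpace ℝ F] {f : E → F} (hf : ContDiff ℝ ∞ f)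
    (_ : HasCompactSupport f),
    ContDiff ℝ n (fun c : C(T, E) => (ContinuousMap.mk f hf.continuous).comp c) := by
  induction n with
  | zero =>
    intro F _ _ f hf hc
    exact contDiff_zero.2 (ContinuousMap.continuous_postcomp _)
  | succ n ih =>
    intro F _ _ f hf hc
    have h1 : ContDiff ℝ 1 f := hf.of_le (by simp)
    have hd := hasFDerivAt_superposition (T := T) h1 hc
    push_cast
    rw [contDiff_succ_iff_fderiv]
    refine ⟨fun c => (hd c).differentiableAt, by simp, ?_⟩
    have : fderiv ℝ (fun c : C(T, E) => (ContinuousMap.mk f hf.continuous).comp c) =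
        fun c => pointwiseApply T E F
        ((ContinuousMap.mk (fderiv ℝ f) (h1.continuous_fderiv one_ne_zero)).comp c) :=
      funext fun c => (hd c).fderiv
    rw [this]
    have hf' : ContDiff ℝ ∞ (fderiv ℝ f) := hf.fderiv_right (m := ∞) (by simp)
    exact (pointwiseApply T E F).contDiff.comp (ih hf' (hc.fderiv ℝ))

end Superposition

/-! ### Smooth local flows of vector fields -/

section Flow

open Set Filter Topology unitInterval

variable {E : Type*} [NormedAddCommGroup E] [NormedSpace ℝ E]

/-- `c ↦ (s ↦ ∫₀ˢ c)` on curves parametrized by the unit interval. -/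
noncomputable def primitiveCLM (E : Type*) [NormedAddCommGroup E] [NormedSpace ℝ E] :
    C(I, E) →L[ℝ] C(I, E) :=
  LinearMap.mkContinuous
    { toFun := fun c => ⟨fun s => ∫ v in (0 : ℝ)..s, c (projIcc 0 1 zero_le_one v), by
        have h : Continuous fun v : ℝ => c (projIcc 0 1 zero_le_one v) :=
          c.continuous.comp continuous_projIcc
        exact (intervalIntegral.continuous_primitive
          (fun a b => h.intervalIntegrable a b) 0).comp continuous_subtype_val⟩
      map_add' := by
        intro c d
        ext s
        have h (c : C(I, E)) : Continuous fun v : ℝ => c (projIcc 0 1 zero_le_one v) :=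
          c.continuous.comp continuous_projIcc
        simp [intervalIntegral.integral_add ((h c).intervalIntegrable _ _)
          ((h d).intervalIntegrable _ _)]
      map_smul' := by
        intro r c
        ext s
        simp }
    1 (by
      intro c
      rw [one_mul, ContinuousMap.norm_le _ (norm_nonneg _)]
      intro s
      have := intervalIntegral.norm_integral_le_of_norm_le_const (a := (0 : ℝ)) (b := s)
        (f := fun v => c (projIcc 0 1 zero_le_one v)) (C := ‖c‖)
        (fun _ _ => c.norm_coe_le_norm _)
      refine this.trans ?_
      have h1 : |(s : ℝ) - 0| ≤ 1 := by
        rw [sub_zero, abs_of_nonneg s.2.1]; exact s.2.2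
      exact mul_le_of_le_one_right (norm_nonneg c) h1)

theorem primitiveCLM_apply (c : C(I, E)) (s : I) :
    primitiveCLM E c s = ∫ v in (0 : ℝ)..s, c (projIcc 0 1 zero_le_one v) := rfl

/-- Curves solving `c = z + T • ∫ f ∘ c` depend smoothly on `T` near `0` and on `z`. -/
theorem exists_smooth_solution_curves [CompleteSpace E] {f : E → E} (hf : ContDiff ℝ ∞ f)
    (hc : HasCompactSupport f) (z₀ : E) :
    ∃ c : ℝ × E → C(I, E), ∃ U ∈ 𝓝 ((0 : ℝ), z₀), ContDiffOn ℝ ∞ c U ∧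
      ∀ a ∈ U, c a = ContinuousMap.const I a.2 +
        a.1 • primitiveCLM E ((ContinuousMap.mk f hf.continuous).comp (c a)) := by
  let N : C(I, E) → C(I, E) := fun c => (ContinuousMap.mk f hf.continuous).comp c
  have hN : ContDiff ℝ ∞ N := contDiff_infty.2 fun n => contDiff_superposition n hf hc
  let K : E →L[ℝ] C(I, E) := ContinuousLinearMap.const ℝ I
  -- The third component is the defect of the integral equation, so the solution is read off from
  -- the local inverse of Θ at the points (T, z, 0).
  let Θ : ℝ × E × C(I, E) → ℝ × E × C(I, E) :=
    fun a => (a.1, a.2.1, a.2.2 - K a.2.1 - a.1 • primitiveCLM E (N a.2.2))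
  have hΘ : ContDiff ℝ ∞ Θ := by
    have : ContDiff ℝ ∞ fun a : ℝ × E × C(I, E) => N a.2.2 := hN.comp (by fun_prop)
    have h2 := (primitiveCLM E).contDiff (n := ∞) |>.comp this
    refine contDiff_fst.prodMk ((by fun_prop : ContDiff ℝ ∞ _).prodMk ?_)
    exact (ContDiff.sub (by fun_prop) (K.contDiff.comp (by fun_prop))).sub (contDiff_fst.smul h2)
  let w := primitiveCLM E (N (K z₀))
  -- At T = 0 the nonlinear term contributes only its derivative w in T, so the differential of Θ is
  -- unipotent triangular and its inverse is explicit.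
  let L : (ℝ × E × C(I, E)) ≃L[ℝ] (ℝ × E × C(I, E)) :=
    ContinuousLinearEquiv.equivOfInverse
      ((ContinuousLinearMap.fst ℝ ℝ (E × C(I, E))).prod
        (((ContinuousLinearMap.fst ℝ E C(I, E)).comp (ContinuousLinearMap.snd ℝ ℝ (E × C(I, E)))).prod
        ((ContinuousLinearMap.snd ℝ E C(I, E)).comp (ContinuousLinearMap.snd ℝ ℝ (E × C(I, E)))
          - K.comp ((ContinuousLinearMap.fst ℝ E C(I, E)).comp
            (ContinuousLinearMap.snd ℝ ℝ (E × C(I, E))))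
          - (ContinuousLinearMap.fst ℝ ℝ (E × C(I, E))).smulRight w)))
      ((ContinuousLinearMap.fst ℝ ℝ (E × C(I, E))).prod
        (((ContinuousLinearMap.fst ℝ E C(I, E)).comp (ContinuousLinearMap.snd ℝ ℝ (E × C(I, E)))).prod
        ((ContinuousLinearMap.snd ℝ E C(I, E)).comp (ContinuousLinearMap.snd ℝ ℝ (E × C(I, E)))
          + K.comp ((ContinuousLinearMap.fst ℝ E C(I, E)).comp
            (ContinuousLinearMap.snd ℝ ℝ (E × C(I, E))))
          + (ContinuousLinearMap.fst ℝ ℝ (E × C(I, E))).smulRight w)))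
      (by rintro ⟨a, b, c⟩; simp; abel) (by rintro ⟨a, b, c⟩; simp; abel)
  have hL : HasFDerivAt Θ (L : (ℝ × E × C(I, E)) →L[ℝ] _) (0, z₀, K z₀) := by
    have hfst : HasFDerivAt (fun a : ℝ × E × C(I, E) => a.1)
      (ContinuousLinearMap.fst ℝ ℝ (E × C(I, E))) (0, z₀, K z₀) := hasFDerivAt_fst
    have hsnd : HasFDerivAt (fun a : ℝ × E × C(I, E) => a.2)
      (ContinuousLinearMap.snd ℝ ℝ (E × C(I, E))) (0, z₀, K z₀) := hasFDerivAt_snd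
    have hz := hsnd.fst
    have hcc := hsnd.snd
    have hG : DifferentiableAt ℝ (fun a : ℝ × E × C(I, E) => primitiveCLM E (N a.2.2))
        (0, z₀, K z₀) := by
      have : ContDiff ℝ ∞ fun a : ℝ × E × C(I, E) => N a.2.2 := hN.comp (by fun_prop)
      exact ((primitiveCLM E).contDiff (n := ∞) |>.comp this).differentiable (by simp) _
    have h3 := hfst.smul hG.hasFDerivAt
    have := hfst.prodMk (hz.prodMk ((hcc.sub (K.hasFDerivAt.comp _ hz)).sub h3))
    refine this.congr_fderiv ?_
    ext a <;> simp [L, w]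
  obtain ⟨e, he, hmem, -, hsymm⟩ := exists_openPartialHomeomorph_of_contDiffOn isOpen_univ
    (mem_univ _) hΘ.contDiffOn hL
  have hΘ0 : Θ (0, z₀, K z₀) = (0, z₀, 0) := by simp [Θ]
  have htgt : ((0 : ℝ), z₀, (0 : C(I, E))) ∈ e.target := by
    have := e.map_source hmem
    rwa [he, hΘ0] at this
  let j : ℝ × E → ℝ × E × C(I, E) := fun a => (a.1, a.2, 0)
  have hj : ContDiff ℝ ∞ j := by fun_prop
  refine ⟨fun a => (e.symm (j a)).2.2, j ⁻¹' e.target, ?_, ?_, ?_⟩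
  · exact hj.continuous.continuousAt.preimage_mem_nhds (e.open_target.mem_nhds htgt)
  · exact contDiff_snd.comp_contDiffOn (contDiff_snd.comp_contDiffOn
      (hsymm.comp hj.contDiffOn (fun _ h => h)))
  · intro a ha
    have h := e.right_inv ha
    rw [he] at h
    simp only [Θ, j, Prod.mk.injEq] at h
    obtain ⟨h1, h2, h3⟩ := h
    rw [h1, h2, sub_sub, sub_eq_zero] at h3
    exact h3


/-- The rescaled equation c' = T f(c) on [0, 1] has a solution depending smoothly on (T, z), and its
value at 1 is the flow at time T. That this is a flow follows from the scaling identity c(Ts, z)(1)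
= c(T, z)(s), which is uniqueness for the differential equation. -/
theorem exists_smooth_flow_of_hasCompactSupport [CompleteSpace E] {f : E → E}
    (hf : ContDiff ℝ ∞ f) (hc : HasCompactSupport f) (z₀ : E) :
    ∃ θ : ℝ → E → E, ∃ ε > 0,
      ContDiffOn ℝ ∞ (Function.uncurry θ) (Metric.ball (0 : ℝ) ε ×ˢ Metric.ball z₀ ε) ∧
      ∀ z ∈ Metric.ball z₀ ε, θ 0 z = z ∧
        ∀ t ∈ Metric.ball (0 : ℝ) ε, HasDerivAt (fun t => θ t z) (f (θ t z)) t := by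
  obtain ⟨c, U, hU, hsm, hfix⟩ := exists_smooth_solution_curves hf hc z₀
  obtain ⟨ε, hε, hball⟩ := Metric.mem_nhds_iff.1 hU
  rw [← ball_prod_same] at hball
  obtain ⟨K, hK⟩ := (hf.of_le (by simp : (1 : WithTop ℕ∞) ≤ ∞)).lipschitzWith_of_hasCompactSupport
    hc one_ne_zero
  let ev : C(I, E) →L[ℝ] E := ContinuousMap.evalCLM ℝ (1 : I)
  -- The right-hand side of the integral equation is defined for all real s and has two-sided
  -- derivatives at the ends of [0, 1], where it agrees with the curve.
  let y : ℝ → E → ℝ → E := fun T z s =>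
    z + T • ∫ v in (0 : ℝ)..s, f (c (T, z) (projIcc 0 1 zero_le_one v))
  have hy : ∀ T z s, HasDerivAt (y T z) (T • f (c (T, z) (projIcc 0 1 zero_le_one s))) s := by
    intro T z s
    have h : Continuous fun v : ℝ => f (c (T, z) (projIcc 0 1 zero_le_one v)) :=
      hf.continuous.comp ((c (T, z)).continuous.comp continuous_projIcc)
    exact ((intervalIntegral.integral_hasDerivAt_right (h.intervalIntegrable _ _)
      (h.stronglyMeasurableAtFilter _ _) h.continuousAt).const_smul T).const_add z
  have hyc : ∀ T ∈ Metric.ball (0 : ℝ) ε, ∀ z ∈ Metric.ball z₀ ε, ∀ s ∈ Icc (0 : ℝ) 1,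
      c (T, z) (projIcc 0 1 zero_le_one s) = y T z s := by
    intro T hT z hz s hs
    have h := hfix (T, z) (hball ⟨hT, hz⟩)
    have h2 := congrArg (fun g : C(I, E) => g (projIcc 0 1 zero_le_one s)) h
    simp only [ContinuousMap.add_apply, ContinuousMap.const_apply, ContinuousMap.smul_apply,
      primitiveCLM_apply, projIcc_of_mem zero_le_one hs] at h2
    simpa [y, projIcc_of_mem zero_le_one hs] using h2
  have hy' : ∀ T ∈ Metric.ball (0 : ℝ) ε, ∀ z ∈ Metric.ball z₀ ε, ∀ s ∈ Icc (0 : ℝ) 1,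
      HasDerivAt (y T z) (T • f (y T z s)) s := by
    intro T hT z hz s hs
    have := hy T z s
    rwa [hyc T hT z hz s hs] at this
  have hev : ∀ T ∈ Metric.ball (0 : ℝ) ε, ∀ z ∈ Metric.ball z₀ ε, c (T, z) 1 = y T z 1 := by
    intro T hT z hz
    have := hyc T hT z hz 1 (by simp)
    rwa [projIcc_right] at this
  have hscale : ∀ T ∈ Metric.ball (0 : ℝ) ε, ∀ z ∈ Metric.ball z₀ ε, ∀ s ∈ Icc (0 : ℝ) 1,
      c (T * s, z) 1 = y T z s := by
    intro T hT z hz s hs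
    have hTs : T * s ∈ Metric.ball (0 : ℝ) ε := by
      rw [mem_ball_zero_iff, norm_mul] at *
      refine lt_of_le_of_lt ?_ hT
      refine mul_le_of_le_one_right (norm_nonneg _) ?_
      rw [Real.norm_of_nonneg hs.1]; exact hs.2
    rw [hev _ hTs z hz]
    have hmem : ∀ r ∈ Icc (0 : ℝ) 1, s * r ∈ Icc (0 : ℝ) 1 := fun r hr =>
      ⟨mul_nonneg hs.1 hr.1, mul_le_one₀ hs.2 hr.1 hr.2⟩
    have hd1 : ∀ r ∈ Icc (0 : ℝ) 1, HasDerivAt (y (T * s) z) ((T * s) • f (y (T * s) z r)) r :=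
      fun r hr => hy' _ hTs z hz r hr
    have hd2 : ∀ r ∈ Icc (0 : ℝ) 1, HasDerivAt (fun r => y T z (s * r))
        ((T * s) • f (y T z (s * r))) r := by
      intro r hr
      have := (hy' T hT z hz (s * r) (hmem r hr)).scomp r ((hasDerivAt_id r).const_mul s)
      exact this.congr_deriv (by rw [mul_one, smul_smul, mul_comm s T])
    have := ODE_solution_unique (v := fun _ x => (T * s) • f x) (K := ‖T * s‖₊ * K) (a := 0) (b := 1)
      (f := y (T * s) z) (g := fun r => y T z (s * r))
      (fun _ => (lipschitzWith_smul (T * s)).comp hK)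
      (fun r hr => (hd1 r hr).continuousAt.continuousWithinAt)
      (fun r hr => (hd1 r (Ico_subset_Icc_self hr)).hasDerivWithinAt)
      (fun r hr => (hd2 r hr).continuousAt.continuousWithinAt)
      (fun r hr => (hd2 r (Ico_subset_Icc_self hr)).hasDerivWithinAt) (by simp [y])
    simpa using this (right_mem_Icc.2 zero_le_one)
  have hsmooth : ContDiffOn ℝ ∞ (Function.uncurry fun t z => c (t, z) 1)
      (Metric.ball (0 : ℝ) ε ×ˢ Metric.ball z₀ ε) :=
    ev.contDiff.comp_contDiffOn (hsm.mono hball)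
  refine ⟨fun t z => c (t, z) 1, ε, hε, hsmooth, fun z hz => ⟨?_, fun t ht => ?_⟩⟩
  · show c (0, z) 1 = z
    rw [hev 0 (Metric.mem_ball_self hε) z hz]
    simp [y]
  · have hdiff : DifferentiableAt ℝ (fun t => c (t, z) 1) t := by
      have h1 : ContDiffAt ℝ ∞ (Function.uncurry fun t z => c (t, z) 1) (t, z) :=
        hsmooth.contDiffAt ((Metric.isOpen_ball.prod Metric.isOpen_ball).mem_nhds ⟨ht, hz⟩)
      exact (h1.differentiableAt (by simp)).comp t
        (differentiableAt_id.prodMk (differentiableAt_const z) :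
          DifferentiableAt ℝ (fun t : ℝ => (t, z)) t)
    have key : ∀ T ∈ Metric.ball (0 : ℝ) ε, T ≠ 0 → ∀ s ∈ Icc (0 : ℝ) 1, t = T * s →
        HasDerivAt (fun t => c (t, z) 1) (f (c (t, z) 1)) t := by
      intro T hT hT0 s hs hts
      have h1 : HasDerivWithinAt (fun s => c (T * s, z) 1) (T • f (y T z s)) (Icc 0 1) s :=
        ((hy' T hT z hz s hs).hasDerivWithinAt).congr (fun r hr => hscale T hT z hz r hr)
          (hscale T hT z hz s hs)
      have h2 : HasDerivWithinAt (fun s => c (T * s, z) 1) (T • deriv (fun t => c (t, z) 1) t)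
          (Icc 0 1) s := by
        have h3 : HasDerivAt (fun t => c (t, z) 1) (deriv (fun t => c (t, z) 1) t) (T * s) := by
          rw [← hts]; exact hdiff.hasDerivAt
        have := h3.scomp s ((hasDerivAt_id s).const_mul T)
        rw [mul_one] at this
        exact this.hasDerivWithinAt
      have h4 := (uniqueDiffOn_Icc zero_lt_one s hs).eq_deriv _ h1 h2
      have h5 := smul_right_injective E hT0 h4
      rw [← hscale T hT z hz s hs, ← hts] at h5
      rw [h5]
      exact hdiff.hasDerivAt
    rw [mem_ball_zero_iff, Real.norm_eq_abs] at ht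
    rcases le_or_gt 0 t with h0 | h0
    · rw [abs_of_nonneg h0] at ht
      -- The midpoint of t and ε is an admissible nonzero T that is at least t.
      refine key ((t + ε) / 2) ?_ (by positivity) (t / ((t + ε) / 2)) ⟨by positivity, ?_⟩ ?_
      · rw [mem_ball_zero_iff, Real.norm_eq_abs, abs_of_pos (by positivity)]; linarith
      · rw [div_le_one (by positivity)]; linarith
      · field_simp
    · rw [abs_of_neg h0] at ht
      have hneg : (t - ε) / 2 < 0 := by linarith
      refine key ((t - ε) / 2) ?_ hneg.ne (t / ((t - ε) / 2))
        ⟨div_nonneg_of_nonpos h0.le hneg.le, ?_⟩ ?_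
      · rw [mem_ball_zero_iff, Real.norm_eq_abs, abs_of_neg hneg]; linarith
      · rw [div_le_one_of_neg hneg]; linarith
      · rw [mul_div_cancel₀ _ hneg.ne]

/-- A smooth vector field has a local flow that is smooth in time and initial value. -/
theorem exists_smooth_flow [CompleteSpace E] [HasContDiffBump E] [FiniteDimensional ℝ E]
    {f : E → E} {O : Set E} (hO : IsOpen O)
    (hf : ContDiffOn ℝ ∞ f O) {z₀ : E} (hz₀ : z₀ ∈ O) :
    ∃ θ : ℝ → E → E, ∃ ε > 0,
      ContDiffOn ℝ ∞ (Function.uncurry θ) (Metric.ball (0 : ℝ) ε ×ˢ Metric.ball z₀ ε) ∧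
      ∀ z ∈ Metric.ball z₀ ε, θ 0 z = z ∧
        ∀ t ∈ Metric.ball (0 : ℝ) ε, θ t z ∈ O ∧ HasDerivAt (fun t => θ t z) (f (θ t z)) t := by
  obtain ⟨R, hR, hRO⟩ := Metric.isOpen_iff.1 hO z₀ hz₀
  -- The truncated field agrees with f on the ball of radius R / 3. Times and initial points are
  -- restricted later so that the flow stays there.
  let φ : ContDiffBump z₀ := ⟨R / 3, R / 2, by positivity, by linarith⟩
  have hφO : tsupport φ ⊆ O := by
    rw [φ.tsupport_eq]
    exact (Metric.closedBall_subset_ball (by simp [φ]; linarith)).trans hRO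
  have hsm : ContDiff ℝ ∞ fun z => φ z • f z := by
    rw [contDiff_iff_contDiffAt]
    intro z
    by_cases hz : z ∈ O
    · exact φ.contDiffAt.smul (hf.contDiffAt (hO.mem_nhds hz))
    · have : (fun z => φ z • f z) =ᶠ[𝓝 z] fun _ => 0 := by
        filter_upwards [(isClosed_tsupport φ).isOpen_compl.mem_nhds (fun h => hz (hφO h))] with w hw
        rw [image_eq_zero_of_notMem_tsupport hw, zero_smul]
      exact contDiffAt_const.congr_of_eventuallyEq this
  obtain ⟨θ, ε, hε, hθ, hθ'⟩ := exists_smooth_flow_of_hasCompactSupport hsm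
    (φ.hasCompactSupport.smul_right) z₀
  have hcont : ContinuousAt (Function.uncurry θ) (0, z₀) :=
    (hθ.continuousOn).continuousAt
      ((Metric.isOpen_ball.prod Metric.isOpen_ball).mem_nhds
        ⟨Metric.mem_ball_self hε, Metric.mem_ball_self hε⟩)
  have hval : Function.uncurry θ (0, z₀) = z₀ := (hθ' z₀ (Metric.mem_ball_self hε)).1
  have hnb : Function.uncurry θ ⁻¹' Metric.ball z₀ (R / 3) ∈ 𝓝 ((0 : ℝ), z₀) := by
    apply hcont.preimage_mem_nhds
    rw [hval]
    exact Metric.ball_mem_nhds _ (by positivity)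
  obtain ⟨ε', hε', hsub⟩ := Metric.mem_nhds_iff.1 hnb
  rw [← ball_prod_same] at hsub
  have hb1 : ∀ {X : Type _} [PseudoMetricSpace X] (x : X),
      Metric.ball x (min ε ε') ⊆ Metric.ball x ε := fun x =>
    Metric.ball_subset_ball (min_le_left _ _)
  have hb2 : ∀ {X : Type _} [PseudoMetricSpace X] (x : X),
      Metric.ball x (min ε ε') ⊆ Metric.ball x ε' := fun x =>
    Metric.ball_subset_ball (min_le_right _ _)
  refine ⟨θ, min ε ε', lt_min hε hε', hθ.mono (prod_mono
    (Metric.ball_subset_ball (min_le_left _ _)) (Metric.ball_subset_ball (min_le_left _ _))),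
    fun z hz => ⟨(hθ' z (hb1 _ hz)).1, fun t ht => ?_⟩⟩
  have ht1 : t ∈ Metric.ball (0 : ℝ) ε := Metric.ball_subset_ball (min_le_left _ _) ht
  have ht2 : t ∈ Metric.ball (0 : ℝ) ε' := Metric.ball_subset_ball (min_le_right _ _) ht
  have hmem : θ t z ∈ Metric.ball z₀ (R / 3) := hsub (⟨ht2, hb2 _ hz⟩ : (t, z) ∈ _ ×ˢ _)
  refine ⟨hRO (Metric.ball_subset_ball (by linarith) hmem), ?_⟩
  have := (hθ' z (hb1 _ hz)).2 t ht1
  rwa [φ.one_of_mem_closedBall (Metric.ball_subset_closedBall hmem), one_smul] at this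

end Flow

/-! ### The truncated exponential kernel and its error term -/

section ExponentialKernel

open Set Filter Topology MeasureTheory
open scoped Convolution

/-- A smooth function on the line equal to `1` on `(-∞, b/3]` and to `0` on `[2b/3, ∞)`. -/
noncomputable def stepDown (b t : ℝ) : ℝ := Real.smoothTransition (2 - 3 * t / b)

/-- `e^{-t/m} / m` on `t > 0`, cut off at `b`. -/
noncomputable def expKernel (b m t : ℝ) : ℝ :=
  (Ioi (0 : ℝ)).indicator (fun t => m⁻¹ * (stepDown b t * Real.exp (-t / m))) t

/-- The error term of `expKernel`. -/
noncomputable def expError (b m t : ℝ) : ℝ := deriv (stepDown b) t * Real.exp (-t / m)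

theorem contDiff_stepDown (b : ℝ) : ContDiff ℝ ∞ (stepDown b) :=
  Real.smoothTransition.contDiff.comp (by fun_prop)

theorem stepDown_of_le {b t : ℝ} (hb : 0 < b) (ht : t ≤ b / 3) : stepDown b t = 1 := by
  apply Real.smoothTransition.one_of_one_le
  have : 3 * t / b ≤ 1 := by rw [div_le_one hb]; linarith
  linarith

theorem stepDown_of_ge {b t : ℝ} (hb : 0 < b) (ht : 2 * b / 3 ≤ t) : stepDown b t = 0 := by
  apply Real.smoothTransition.zero_of_nonpos
  have : 2 ≤ 3 * t / b := by rw [le_div_iff₀ hb]; linarith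
  linarith

theorem stepDown_nonneg (b t : ℝ) : 0 ≤ stepDown b t := Real.smoothTransition.nonneg _

theorem deriv_stepDown_of_lt {b t : ℝ} (hb : 0 < b) (ht : t < b / 3) :
    deriv (stepDown b) t = 0 := by
  have : stepDown b =ᶠ[𝓝 t] fun _ => 1 := by
    filter_upwards [Iio_mem_nhds ht] with s hs using stepDown_of_le hb (le_of_lt hs)
  rw [this.deriv_eq, deriv_const]

theorem deriv_stepDown_of_gt {b t : ℝ} (hb : 0 < b) (ht : 2 * b / 3 < t) :
    deriv (stepDown b) t = 0 := by
  have : stepDown b =ᶠ[𝓝 t] fun _ => 0 := by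
    filter_upwards [Ioi_mem_nhds ht] with s hs using stepDown_of_ge hb (le_of_lt hs)
  rw [this.deriv_eq, deriv_const]

theorem support_deriv_stepDown {b : ℝ} (hb : 0 < b) :
    Function.support (deriv (stepDown b)) ⊆ Icc (b / 3) (2 * b / 3) := by
  intro t ht
  constructor
  · by_contra h
    exact ht (deriv_stepDown_of_lt hb (not_le.1 h))
  · by_contra h
    exact ht (deriv_stepDown_of_gt hb (not_le.1 h))

theorem support_expError {b : ℝ} (hb : 0 < b) (m : ℝ) :
    Function.support (expError b m) ⊆ Icc (b / 3) (2 * b / 3) :=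
  fun _ ht => support_deriv_stepDown hb fun h => ht (by rw [expError, h, zero_mul])

theorem support_expKernel {b : ℝ} (hb : 0 < b) (m : ℝ) :
    Function.support (expKernel b m) ⊆ Ioc 0 (2 * b / 3) := by
  intro t ht
  have h0 : 0 < t := by
    by_contra h
    exact ht (indicator_of_notMem h _)
  refine ⟨h0, ?_⟩
  by_contra h
  refine ht ?_
  rw [expKernel, indicator_of_mem (show t ∈ Ioi (0 : ℝ) from h0),
    stepDown_of_ge hb (not_le.1 h).le, zero_mul, mul_zero]

theorem hasCompactSupport_of_support_subset_Icc {F : Type*} [Zero F] {f : ℝ → F} {a b : ℝ}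
    (h : Function.support f ⊆ Icc a b) : HasCompactSupport f :=
  HasCompactSupport.intro isCompact_Icc fun _ hx => by_contra fun h' => hx (h h')

theorem contDiff_expError (b m : ℝ) : ContDiff ℝ ∞ (expError b m) := by
  have h : ContDiff ℝ ∞ (deriv (stepDown b)) :=
    (contDiff_infty_iff_deriv.1 (contDiff_stepDown b)).2
  exact h.mul (by fun_prop)

theorem expKernel_nonneg {b m : ℝ} (hm : 0 < m) (t : ℝ) : 0 ≤ expKernel b m t := by
  refine indicator_nonneg (fun t _ => ?_) t
  have := stepDown_nonneg b t
  positivity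

theorem integrable_expError {b : ℝ} (hb : 0 < b) (m : ℝ) : Integrable (expError b m) :=
  (contDiff_expError b m).continuous.integrable_of_hasCompactSupport
    (hasCompactSupport_of_support_subset_Icc (support_expError hb m))

theorem integrable_expKernel {b : ℝ} (hb : 0 < b) (m : ℝ) : Integrable (expKernel b m) := by
  have hc : Continuous fun t => m⁻¹ * (stepDown b t * Real.exp (-t / m)) :=
    continuous_const.mul ((contDiff_stepDown b).continuous.mul (by fun_prop))
  have h1 : IntegrableOn (expKernel b m) (Icc 0 b) :=
    (hc.continuousOn.integrableOn_Icc).indicator measurableSet_Ioi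
  refine (integrableOn_iff_integrable_of_support_subset ?_).1 h1
  exact (support_expKernel hb m).trans
    (Ioc_subset_Icc_self.trans (Icc_subset_Icc le_rfl (by linarith)))

/-- Integration against e^{-t/m}/m on the half-line undoes 1 - mD at the origin, and the truncation
costs the term with the derivative of `stepDown`. The proof is the fundamental theorem of calculus
on [0, b] for the product of `stepDown`, the exponential and v. -/
theorem expKernel_identity {F : Type*} [NormedAddCommGroup F] [NormedSpace ℝ F] [CompleteSpace F]
    {b m : ℝ} (hb : 0 < b) (hm : 0 < m) {v : ℝ → F} (hv : ContDiff ℝ 1 v) :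
    v 0 = (∫ t, expKernel b m t • (v t - m • deriv v t)) - ∫ t, expError b m t • v t := by
  have hvd : Continuous (deriv v) := hv.continuous_deriv le_rfl
  have hψ := contDiff_stepDown b
  have hψd : Continuous (deriv (stepDown b)) := hψ.continuous_deriv (by simp)
  let w : ℝ → F := fun t => (stepDown b t * Real.exp (-t / m)) • v t
  let w₁ : ℝ → F := fun t => (m⁻¹ * (stepDown b t * Real.exp (-t / m))) • (v t - m • deriv v t)
  let w₂ : ℝ → F := fun t => expError b m t • v t
  have hw : ∀ t, HasDerivAt w (w₂ t - w₁ t) t := by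
    intro t
    have h1 : HasDerivAt (stepDown b) (deriv (stepDown b) t) t :=
      (hψ.differentiable (by simp) t).hasDerivAt
    have h2 : HasDerivAt (fun t => Real.exp (-t / m)) (Real.exp (-t / m) * (-1 / m)) t :=
      ((hasDerivAt_id t).neg.div_const m).exp
    have h3 : HasDerivAt v (deriv v t) t := (hv.differentiable one_ne_zero t).hasDerivAt
    refine ((h1.mul h2).smul h3).congr_deriv ?_
    simp only [w₁, w₂, expError, smul_sub, smul_smul, Pi.mul_apply]
    rw [mul_comm _ m, ← mul_assoc m, mul_inv_cancel₀ hm.ne', one_mul, add_smul]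
    have : stepDown b t * (Real.exp (-t / m) * (-1 / m)) =
      -(m⁻¹ * (stepDown b t * Real.exp (-t / m))) := by ring
    rw [this, neg_smul]
    abel
  have hc1 : Continuous w₁ := by
    exact (continuous_const.mul (hψ.continuous.mul (by fun_prop))).smul
      (hv.continuous.sub (hvd.const_smul m))
  have hc2 : Continuous w₂ := (contDiff_expError b m).continuous.smul hv.continuous
  have hint := intervalIntegral.integral_eq_sub_of_hasDerivAt (a := 0) (b := b)
    (fun t _ => hw t) ((hc2.sub hc1).intervalIntegrable _ _)
  rw [intervalIntegral.integral_sub (hc2.intervalIntegrable _ _) (hc1.intervalIntegrable _ _)]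
    at hint
  have hwb : w b = 0 := by simp [w, stepDown_of_ge hb (by linarith : 2 * b / 3 ≤ b)]
  have hw0 : w 0 = v 0 := by simp [w, stepDown_of_le hb (by positivity : (0 : ℝ) ≤ b / 3)]
  have e2 : ∫ t in (0 : ℝ)..b, w₂ t = ∫ t, expError b m t • v t := by
    apply intervalIntegral.integral_eq_integral_of_support_subset
    intro t ht
    have : t ∈ Icc (b / 3) (2 * b / 3) :=
      support_expError hb m fun h => ht (by simp only [w₂, h, zero_smul])
    exact ⟨by linarith [this.1], by linarith [this.2]⟩
  have e1 : ∫ t in (0 : ℝ)..b, w₁ t = ∫ t, expKernel b m t • (v t - m • deriv v t) := by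
    rw [← intervalIntegral.integral_eq_integral_of_support_subset (a := 0) (b := b)]
    · refine intervalIntegral.integral_congr_ae ?_
      refine Eventually.of_forall fun t ht => ?_
      rw [uIoc_of_le hb.le] at ht
      simp only [w₁, expKernel]
      rw [indicator_of_mem (show t ∈ Ioi (0 : ℝ) from ht.1)]
    · intro t ht
      have : t ∈ Ioc 0 (2 * b / 3) :=
        support_expKernel hb m fun h => ht (by simp only [h, zero_smul])
      exact ⟨this.1, by linarith [this.2]⟩
  rw [← e1, ← e2]
  rw [hwb, hw0, zero_sub] at hint
  rw [← neg_sub, hint, neg_neg]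

theorem integral_expKernel {b m : ℝ} (hb : 0 < b) (hm : 0 < m) :
    ∫ t, expKernel b m t = 1 + ∫ t, expError b m t := by
  have := expKernel_identity hb hm (v := fun _ => (1 : ℝ)) contDiff_const
  simp only [deriv_const', smul_eq_mul, mul_zero, sub_zero, mul_one] at this
  linarith

/-- Where ζ does not vanish the exponential is at most e^{-b/m}, which beats every power of 1/m.
Each derivative that falls on the exponential produces one such power, hence the arbitrary exponent
j in the induction. -/
theorem eventually_iteratedDeriv_mul_exp_le {b : ℝ} (hb : 0 < b) (i : ℕ) :
    ∀ (j : ℕ) {ζ : ℝ → ℝ} (_ : ContDiff ℝ ∞ ζ) (_ : HasCompactSupport ζ)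
      (_ : ∀ t < b, ζ t = 0) {ε : ℝ} (_ : 0 < ε),
      ∀ᶠ m in 𝓝[>] (0 : ℝ), ∀ t,
        |m⁻¹ ^ j * iteratedDeriv i (fun t => ζ t * Real.exp (-t / m)) t| ≤ ε := by
  induction i with
  | zero =>
    intro j ζ hζ hc h0 ε hε
    obtain ⟨C, hC⟩ := hc.exists_bound_of_continuous hζ.continuous
    have hC0 : 0 ≤ C := (norm_nonneg _).trans (hC 0)
    have hlim : Tendsto (fun m : ℝ => (b / m) ^ j * Real.exp (-(b / m))) (𝓝[>] 0) (𝓝 0) :=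
      (Real.tendsto_pow_mul_exp_neg_atTop_nhds_zero j).comp
        (tendsto_inv_nhdsGT_zero.const_mul_atTop hb)
    have hlim2 : Tendsto (fun m : ℝ => C * (b⁻¹ ^ j * ((b / m) ^ j * Real.exp (-(b / m)))))
        (𝓝[>] 0) (𝓝 0) := by simpa using (hlim.const_mul (b⁻¹ ^ j)).const_mul C
    filter_upwards [hlim2.eventually (gt_mem_nhds hε), self_mem_nhdsWithin] with m hm hm0 t
    have hm0 : 0 < m := hm0
    rw [iteratedDeriv_zero]
    rcases lt_or_ge t b with ht | ht
    · simp [h0 t ht, hε.le]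
    · refine le_trans ?_ hm.le
      have e1 : b⁻¹ ^ j * ((b / m) ^ j * Real.exp (-(b / m))) = m⁻¹ ^ j * Real.exp (-(b / m)) := by
        rw [← mul_assoc, ← mul_pow]
        congr 2
        field_simp
      rw [e1, abs_mul, abs_mul, abs_of_nonneg (by positivity : 0 ≤ m⁻¹ ^ j), abs_of_pos (Real.exp_pos _)]
      have e2 : Real.exp (-t / m) ≤ Real.exp (-(b / m)) := by
        apply Real.exp_le_exp.2
        rw [neg_div, neg_le_neg_iff]
        gcongr
      have e3 : |ζ t| ≤ C := hC t
      calc m⁻¹ ^ j * (|ζ t| * Real.exp (-t / m)) ≤ m⁻¹ ^ j * (C * Real.exp (-(b / m))) := by gcongr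
        _ = _ := by ring
  | succ i ih =>
    intro j ζ hζ hc h0 ε hε
    have hζ' : ContDiff ℝ ∞ (deriv ζ) := (contDiff_infty_iff_deriv.1 hζ).2
    have h0' : ∀ t < b, deriv ζ t = 0 := by
      intro t ht
      have : ζ =ᶠ[𝓝 t] fun _ => 0 := by
        filter_upwards [Iio_mem_nhds ht] with s hs using h0 s hs
      rw [this.deriv_eq, deriv_const]
    filter_upwards [ih j hζ' hc.deriv h0' (half_pos hε), ih (j + 1) hζ hc h0 (half_pos hε)]
      with m h1 h2 t
    have hd : deriv (fun t => ζ t * Real.exp (-t / m)) = fun t =>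
        deriv ζ t * Real.exp (-t / m) - m⁻¹ * (ζ t * Real.exp (-t / m)) := by
      funext t
      have h2 : HasDerivAt (fun t => Real.exp (-t / m)) (Real.exp (-t / m) * (-1 / m)) t :=
        ((hasDerivAt_id t).neg.div_const m).exp
      have h3 := ((hζ.differentiable (by simp) t).hasDerivAt.mul h2).deriv
      rw [show (fun t => ζ t * Real.exp (-t / m)) = ζ * fun t => Real.exp (-t / m) from rfl, h3]
      ring
    have hs1 : ContDiff ℝ ∞ fun t => deriv ζ t * Real.exp (-t / m) := hζ'.mul (by fun_prop)
    have hs2 : ContDiff ℝ ∞ fun t => ζ t * Real.exp (-t / m) := hζ.mul (by fun_prop)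
    have hle : ((i : ℕ) : WithTop ℕ∞) ≤ ∞ := by exact_mod_cast le_top
    rw [iteratedDeriv_succ', hd, iteratedDeriv_fun_sub (hs1.of_le hle).contDiffAt
      (contDiffAt_const.mul (hs2.of_le hle).contDiffAt),
      iteratedDeriv_const_mul m⁻¹ (hs2.of_le hle).contDiffAt, mul_sub, ← mul_assoc, ← pow_succ]
    calc _ ≤ _ := abs_sub _ _
      _ ≤ ε / 2 + ε / 2 := add_le_add (h1 t) (h2 t)
      _ = ε := add_halves ε

theorem eventually_iteratedDeriv_expError_le {b : ℝ} (hb : 0 < b) (i : ℕ) {ε : ℝ} (hε : 0 < ε) :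
    ∀ᶠ m in 𝓝[>] (0 : ℝ), ∀ t, |iteratedDeriv i (expError b m) t| ≤ ε := by
  have := eventually_iteratedDeriv_mul_exp_le (b := b / 3) (by positivity) i 0
    (contDiff_infty_iff_deriv.1 (contDiff_stepDown b)).2
    (hasCompactSupport_of_support_subset_Icc (support_deriv_stepDown hb))
    (fun t ht => deriv_stepDown_of_lt hb ht) hε
  simp only [pow_zero, one_mul] at this
  exact this

theorem eventually_integral_abs_expError_le {b : ℝ} (hb : 0 < b) {ε : ℝ} (hε : 0 < ε) :
    ∀ᶠ m in 𝓝[>] (0 : ℝ), ∫ t, |expError b m t| ≤ ε := by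
  filter_upwards [eventually_iteratedDeriv_expError_le hb 0 (div_pos hε hb)] with m hm
  have hsupp : Function.support (fun t => |expError b m t|) ⊆ Ioc 0 b := by
    intro t ht
    have : t ∈ Icc (b / 3) (2 * b / 3) := support_expError hb m fun h => ht (by simp [h])
    exact ⟨by linarith [this.1], by linarith [this.2]⟩
  rw [← intervalIntegral.integral_eq_integral_of_support_subset hsupp]
  have := intervalIntegral.norm_integral_le_of_norm_le_const (a := (0 : ℝ)) (b := b)
    (f := fun t => |expError b m t|) (C := ε / b) (fun t _ => by
      have := hm t
      rw [iteratedDeriv_zero] at this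
      simpa using this)
  rw [sub_zero, abs_of_pos hb, div_mul_cancel₀ _ hb.ne'] at this
  exact (le_abs_self _).trans this

end ExponentialKernel

/-! ### Inverting the factors 1 - mD by convolution -/

section ConvolutionPowers

open Set Filter Topology MeasureTheory
open scoped Convolution

/-- Translation average `s ↦ ∫ k(t) u(s + t) dt`. -/
noncomputable def translationAverage (k : ℝ → ℝ) (u : ℝ → ℂ) (s : ℝ) : ℂ := ∫ t, k t • u (s + t)

/-- Convolution of real functions on the line. -/
noncomputable def lineConv (k f : ℝ → ℝ) : ℝ → ℝ :=
  k ⋆[ContinuousLinearMap.lsmul ℝ ℝ, volume] f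

theorem lineConv_apply (k f : ℝ → ℝ) (x : ℝ) : lineConv k f x = ∫ t, k t * f (x - t) := rfl

theorem translationAverage_eq (k : ℝ → ℝ) (u : ℝ → ℂ) : translationAverage k u =
    (fun t => k (-t)) ⋆[ContinuousLinearMap.lsmul ℝ ℝ, volume] u := by
  funext s
  rw [translationAverage, convolution_def, ← integral_neg_eq_self]
  simp [sub_eq_add_neg]

theorem contDiff_translationAverage {k : ℝ → ℝ} (hk : Integrable k) {u : ℝ → ℂ}
    (hu : ContDiff ℝ ∞ u) (hc : HasCompactSupport u) : ContDiff ℝ ∞ (translationAverage k u) := by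
  rw [translationAverage_eq]
  exact hc.contDiff_convolution_right _ hk.comp_neg.locallyIntegrable hu

theorem hasCompactSupport_translationAverage {k : ℝ → ℝ} (hk : HasCompactSupport k) {u : ℝ → ℂ}
    (hc : HasCompactSupport u) : HasCompactSupport (translationAverage k u) := by
  rw [translationAverage_eq]
  exact (hk.comp_homeomorph (Homeomorph.neg ℝ)).convolution _ hc

theorem deriv_translationAverage {k : ℝ → ℝ} (hk : Integrable k) {u : ℝ → ℂ}
    (hu : ContDiff ℝ ∞ u) (hc : HasCompactSupport u) :
    deriv (translationAverage k u) = translationAverage k (deriv u) := by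
  funext s
  rw [translationAverage_eq, translationAverage_eq]
  exact (hc.hasDerivAt_convolution_right _ hk.comp_neg.locallyIntegrable
    (hu.of_le (by simp)) s).deriv

/-- Convolution with k and translation average with k are adjoint, by Fubini and translation
invariance. -/
theorem integral_lineConv_smul {k f : ℝ → ℝ} (hk : Integrable k) (hf : Integrable f)
    {w : ℝ → ℂ} (hw : Continuous w) (hc : HasCompactSupport w) :
    ∫ x, lineConv k f x • w x = ∫ s, f s • translationAverage k w s := by
  obtain ⟨C, hC⟩ := hc.exists_bound_of_continuous hw
  have h1 : Integrable (Function.uncurry fun x t => (k t * f (x - t)) • w x)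
      (volume.prod volume) := by
    have h := hk.convolution_integrand (ContinuousLinearMap.lsmul ℝ ℝ) hf
    exact Integrable.smul_bdd (φ := fun p : ℝ × ℝ => k p.2 * f (p.1 - p.2))
      (f := fun p : ℝ × ℝ => w p.1) h C
      (hw.comp continuous_fst).aestronglyMeasurable (Eventually.of_forall fun p => hC p.1)
  have h2 : Integrable (Function.uncurry fun t s => (k t * f s) • w (s + t))
      (volume.prod volume) := by
    exact Integrable.smul_bdd (φ := fun p : ℝ × ℝ => k p.1 * f p.2)
      (f := fun p : ℝ × ℝ => w (p.2 + p.1)) (hk.mul_prod hf) C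
      (by fun_prop) (Eventually.of_forall fun p => hC _)
  calc ∫ x, lineConv k f x • w x = ∫ x, ∫ t, (k t * f (x - t)) • w x := by
        simp only [lineConv_apply, integral_smul_const]
    _ = ∫ t, ∫ x, (k t * f (x - t)) • w x := integral_integral_swap h1
    _ = ∫ t, ∫ s, (k t * f s) • w (s + t) := by
        refine integral_congr_ae (Eventually.of_forall fun t => ?_)
        have := integral_add_right_eq_self (μ := volume) (fun x => (k t * f (x - t)) • w x) t
        simp only [add_sub_cancel_right] at this
        exact this.symm
    _ = ∫ s, ∫ t, (k t * f s) • w (s + t) := integral_integral_swap h2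
    _ = _ := by
        refine integral_congr_ae (Eventually.of_forall fun s => ?_)
        simp only [translationAverage]
        rw [← integral_smul]
        simp only [smul_smul, mul_comm]

/-- The operator `∏ (1 - m D) D³`, `m` in the given list. -/
noncomputable def diffProd : List ℝ → (ℝ → ℂ) → ℝ → ℂ
  | [], u => deriv (deriv (deriv u))
  | m :: l, u => fun t => diffProd l u t - m • deriv (diffProd l u) t

theorem contDiff_diffProd (l : List ℝ) {u : ℝ → ℂ} (hu : ContDiff ℝ ∞ u) :
    ContDiff ℝ ∞ (diffProd l u) := by
  have hd : ∀ {u : ℝ → ℂ}, ContDiff ℝ ∞ u → ContDiff ℝ ∞ (deriv u) :=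
    fun h => (contDiff_infty_iff_deriv.1 h).2
  induction l with
  | nil => exact hd (hd (hd hu))
  | cons m l ih => exact ih.sub ((hd ih).const_smul m)

theorem hasCompactSupport_diffProd (l : List ℝ) {u : ℝ → ℂ} (hc : HasCompactSupport u) :
    HasCompactSupport (diffProd l u) := by
  induction l with
  | nil => exact hc.deriv.deriv.deriv
  | cons m l ih => exact ih.sub (ih.deriv.smul_left (f := fun _ => m))

theorem diffProd_translationAverage {k : ℝ → ℝ} (hk : Integrable k) (l : List ℝ) {u : ℝ → ℂ}
    (hu : ContDiff ℝ ∞ u) (hc : HasCompactSupport u) :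
    diffProd l (translationAverage k u) = translationAverage k (diffProd l u) := by
  have hd : ∀ {u : ℝ → ℂ}, ContDiff ℝ ∞ u → ContDiff ℝ ∞ (deriv u) :=
    fun h => (contDiff_infty_iff_deriv.1 h).2
  induction l with
  | nil =>
    simp only [diffProd]
    rw [deriv_translationAverage hk hu hc, deriv_translationAverage hk (hd hu) hc.deriv,
      deriv_translationAverage hk (hd (hd hu)) hc.deriv.deriv]
  | cons m l ih =>
    have h1 := contDiff_diffProd l hu
    have h2 := hasCompactSupport_diffProd l hc
    funext s
    simp only [diffProd]
    rw [ih, deriv_translationAverage hk h1 h2]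
    simp only [translationAverage]
    have hi : ∀ {w : ℝ → ℂ}, Continuous w → HasCompactSupport w →
        Integrable fun t => k t • w (s + t) := by
      intro w hw hwc
      obtain ⟨C, hC⟩ := hwc.exists_bound_of_continuous hw
      exact hk.smul_bdd C (f := fun t => w (s + t))
        (hw.comp (continuous_const.add continuous_id)).aestronglyMeasurable
        (Eventually.of_forall fun t => hC _)
    simp only [smul_sub]
    rw [integral_sub (hi h1.continuous h2)]
    · congr 1
      rw [← integral_smul]
      simp only [smul_smul, mul_comm]
    · have := (hi (hd h1).continuous h2.deriv).smul m
      simpa only [Pi.smul_def, smul_comm m] using this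

/-- This is `expKernel_identity` based at each point s: averaging with the kernel inverts 1 - mD up
to the average with the error. -/
theorem eq_translationAverage_expKernel {b m : ℝ} (hb : 0 < b) (hm : 0 < m) {w : ℝ → ℂ}
    (hw : ContDiff ℝ ∞ w) (s : ℝ) :
    w s = translationAverage (expKernel b m) (fun t => w t - m • deriv w t) s -
      translationAverage (expError b m) w s := by
  have hv : ContDiff ℝ 1 fun t => w (s + t) := (hw.of_le (by simp)).comp (by fun_prop)
  have := expKernel_identity hb hm hv
  simp only [deriv_comp_const_add, add_zero] at this
  exact this

/-- `f` and `g` represent the Dirac mass: `δ = diffProd l f + g` in the weak sense. -/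
def RepresentsDirac (l : List ℝ) (f g : ℝ → ℝ) : Prop :=
  ∀ u : ℝ → ℂ, ContDiff ℝ ∞ u → HasCompactSupport u →
    u 0 = (∫ t, f t • diffProd l u t) + ∫ t, g t • u t

/-- Let q be the kernel and r its error. With 1 - mD inverted on `diffProd l u`, adjointness moves
the average with q onto f. The remaining term is `diffProd l` of the r-average of u, integrated
against f. The hypothesis applied to that average evaluates the term as the integral of (r - r * g)
u, which is subtracted. -/
theorem RepresentsDirac.cons {l : List ℝ} {f g : ℝ → ℝ} (h : RepresentsDirac l f g)
    (hf : Continuous f) (hfc : HasCompactSupport f) (hg : Continuous g) (hgc : HasCompactSupport g)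
    {b m : ℝ} (hb : 0 < b) (hm : 0 < m) :
    RepresentsDirac (m :: l) (lineConv (expKernel b m) f)
      (fun t => g t - expError b m t + lineConv (expError b m) g t) := by
  intro u hu huc
  have hq := integrable_expKernel hb m
  have hr := integrable_expError hb m
  have hrc : HasCompactSupport (expError b m) :=
    hasCompactSupport_of_support_subset_Icc (support_expError hb m)
  have hrs := (contDiff_expError b m).continuous
  have hfi := hf.integrable_of_hasCompactSupport (μ := volume) hfc
  have hgi := hg.integrable_of_hasCompactSupport (μ := volume) hgc
  have hw := contDiff_diffProd l hu
  have hwc := hasCompactSupport_diffProd l huc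
  have hAw := contDiff_diffProd (m :: l) hu
  have hAwc := hasCompactSupport_diffProd (m :: l) huc
  have hru := contDiff_translationAverage hr hu huc
  have hruc := hasCompactSupport_translationAverage hrc huc
  have e1 : ∫ t, f t • diffProd l u t =
      (∫ t, lineConv (expKernel b m) f t • diffProd (m :: l) u t) -
        ∫ t, f t • diffProd l (translationAverage (expError b m) u) t := by
    rw [integral_lineConv_smul hq hfi hAw.continuous hAwc, diffProd_translationAverage hr l hu huc,
      ← integral_sub]
    · refine integral_congr_ae (Eventually.of_forall fun s => ?_)
      simp only
      rw [← smul_sub]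
      exact congrArg _ (eq_translationAverage_expKernel hb hm hw s)
    · exact (hf.smul (contDiff_translationAverage hq hAw hAwc).continuous).integrable_of_hasCompactSupport
        hfc.smul_right
    · exact (hf.smul (contDiff_translationAverage hr hw hwc).continuous).integrable_of_hasCompactSupport
        hfc.smul_right
  have e2 := h _ hru hruc
  rw [← integral_lineConv_smul hr hgi hu.continuous huc] at e2
  have e3 : translationAverage (expError b m) u 0 = ∫ t, expError b m t • u t := by
    simp [translationAverage]
  rw [e3] at e2
  have hcv : Continuous (lineConv (expError b m) g) :=
    hrc.continuous_convolution_left _ hrs hgi.locallyIntegrable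
  have i1 : Integrable fun t => (g t - expError b m t) • u t :=
    ((hg.sub hrs).smul hu.continuous).integrable_of_hasCompactSupport huc.smul_left
  have i2 : Integrable fun t => lineConv (expError b m) g t • u t :=
    (hcv.smul hu.continuous).integrable_of_hasCompactSupport huc.smul_left
  have i3 : Integrable fun t => g t • u t :=
    (hg.smul hu.continuous).integrable_of_hasCompactSupport huc.smul_left
  have i4 : Integrable fun t => expError b m t • u t :=
    (hrs.smul hu.continuous).integrable_of_hasCompactSupport huc.smul_left
  simp only [add_smul]
  rw [integral_add i1 i2]
  simp only [sub_smul]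
  rw [integral_sub i3 i4, h u hu huc, e1, e2]
  abel

theorem hasDerivAt_lineConv {k f : ℝ → ℝ} (hk : Integrable k) (hf : ContDiff ℝ 1 f)
    (hc : HasCompactSupport f) (x : ℝ) :
    HasDerivAt (lineConv k f) (lineConv k (deriv f) x) x :=
  hc.hasDerivAt_convolution_right _ hk.locallyIntegrable hf x

theorem iteratedDeriv_lineConv {k : ℝ → ℝ} (hk : Integrable k) (n : ℕ) :
    ∀ {f : ℝ → ℝ} (_ : ContDiff ℝ n f) (_ : HasCompactSupport f),
    iteratedDeriv n (lineConv k f) = lineConv k (iteratedDeriv n f) := by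
  induction n with
  | zero => intro f _ _; simp
  | succ n ih =>
    intro f hf hc
    have h1 : ContDiff ℝ 1 f := hf.of_le (by exact_mod_cast Nat.le_add_left 1 n)
    have hd : deriv (lineConv k f) = lineConv k (deriv f) :=
      funext fun x => (hasDerivAt_lineConv hk h1 hc x).deriv
    have hf' : ContDiff ℝ n (deriv f) := by
      push_cast at hf
      exact (contDiff_succ_iff_deriv.1 hf).2.2
    rw [iteratedDeriv_succ', iteratedDeriv_succ', hd, ih hf' hc.deriv]

theorem abs_lineConv_le {k f : ℝ → ℝ} (hk : Integrable k) {C : ℝ} (hf : ∀ x, |f x| ≤ C) (x : ℝ) :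
    |lineConv k f x| ≤ C * ∫ t, |k t| := by
  rw [lineConv_apply, ← integral_const_mul]
  refine (abs_integral_le_integral_abs).trans ?_
  refine integral_mono_of_nonneg (Eventually.of_forall fun _ => abs_nonneg _)
    (hk.abs.const_mul C) (Eventually.of_forall fun t => ?_)
  simp only [abs_mul]
  rw [mul_comm]
  exact mul_le_mul_of_nonneg_right (hf _) (abs_nonneg _)

/-- The identity serves twice. It shows that smoothing by the kernel changes f by a quantity that is
small with m, and it expresses the derivative of the smoothed function without differentiating f. -/
theorem lineConv_expKernel_identity {b m : ℝ} (hb : 0 < b) (hm : 0 < m) {f : ℝ → ℝ}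
    (hf : ContDiff ℝ 1 f) (hfc : HasCompactSupport f) (x : ℝ) :
    f x = lineConv (expKernel b m) f x + m * lineConv (expKernel b m) (deriv f) x -
      lineConv (expError b m) f x := by
  have hv : ContDiff ℝ 1 fun t => f (x - t) := hf.comp (by fun_prop)
  have hfd := hf.continuous_deriv le_rfl
  have h := expKernel_identity hb hm hv
  have hi : ∀ {w : ℝ → ℝ}, Continuous w → HasCompactSupport w →
      Integrable fun t => expKernel b m t * w (x - t) := by
    intro w hw hwc
    obtain ⟨C, hC⟩ := hwc.exists_bound_of_continuous hw
    exact (integrable_expKernel hb m).smul_bdd C (f := fun t => w (x - t))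
      (hw.comp (continuous_const.sub continuous_id)).aestronglyMeasurable
      (Eventually.of_forall fun t => hC _)
  simp only [deriv_comp_const_sub, sub_zero, smul_eq_mul] at h
  rw [lineConv_apply, lineConv_apply, lineConv_apply, ← integral_const_mul, ← integral_add
    (hi hf.continuous hfc) ((hi hfd hfc.deriv).const_mul m)]
  rw [h]
  congr 2
  funext t
  ring

/-- Solved for (q * f)', the identity f = q * f + m (q * f)' - r * f gives a right-hand side as
regular as f, so one derivative is gained. -/
theorem contDiff_lineConv_expKernel {b m : ℝ} (hb : 0 < b) (hm : 0 < m) {f : ℝ → ℝ} {n : ℕ}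
    (hf : ContDiff ℝ (n + 1 : ℕ) f) (hfc : HasCompactSupport f) :
    ContDiff ℝ (n + 2 : ℕ) (lineConv (expKernel b m) f) := by
  have h1 : ContDiff ℝ 1 f := hf.of_le (by exact_mod_cast Nat.le_add_left 1 n)
  have hq := integrable_expKernel hb m
  have hr := integrable_expError hb m
  have hc1 : ContDiff ℝ (n + 1 : ℕ) (lineConv (expKernel b m) f) := by
    have := hfc.contDiff_convolution_right (n := ((n + 1 : ℕ) : ℕ∞)) (ContinuousLinearMap.lsmul ℝ ℝ)
      hq.locallyIntegrable (by exact_mod_cast hf)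
    exact_mod_cast this
  have hc2 : ContDiff ℝ (n + 1 : ℕ) (lineConv (expError b m) f) := by
    have := hfc.contDiff_convolution_right (n := ((n + 1 : ℕ) : ℕ∞)) (ContinuousLinearMap.lsmul ℝ ℝ)
      hr.locallyIntegrable (by exact_mod_cast hf)
    exact_mod_cast this
  have hd : deriv (lineConv (expKernel b m) f) = fun x =>
      m⁻¹ * (f x - lineConv (expKernel b m) f x + lineConv (expError b m) f x) := by
    funext x
    rw [(hasDerivAt_lineConv hq h1 hfc x).deriv]
    have := lineConv_expKernel_identity hb hm h1 hfc x
    field_simp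
    linarith
  have e : ((n + 2 : ℕ) : WithTop ℕ∞) = ((n + 1 : ℕ) : WithTop ℕ∞) + 1 := by push_cast; ring
  rw [e, contDiff_succ_iff_deriv]
  refine ⟨fun x => (hasDerivAt_lineConv hq h1 hfc x).differentiableAt, by simp, ?_⟩
  rw [hd]
  exact contDiff_const.mul ((hf.sub hc1).add hc2)

theorem integral_abs_expKernel_le {b m : ℝ} (hb : 0 < b) (hm : 0 < m) :
    ∫ t, |expKernel b m t| ≤ 1 + ∫ t, |expError b m t| := by
  simp only [abs_of_nonneg (expKernel_nonneg hm _)]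
  rw [integral_expKernel hb hm]
  exact add_le_add le_rfl ((le_abs_self _).trans abs_integral_le_integral_abs)

end ConvolutionPowers

/-! ### The initial representation of the Dirac mass and the inductive step -/

section ConvolutionPowers

open Set Filter Topology MeasureTheory

theorem contDiff_one_max_sq : ContDiff ℝ 1 fun t : ℝ => (max t 0) ^ 2 := by
  have h : ∀ t : ℝ, HasDerivAt (fun t : ℝ => (max t 0) ^ 2) (2 * max t 0) t := by
    intro t
    rcases lt_trichotomy t 0 with ht | ht | ht
    · have : (fun t : ℝ => (max t 0) ^ 2) =ᶠ[𝓝 t] fun _ => 0 := by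
        filter_upwards [Iio_mem_nhds ht] with s hs
        rw [max_eq_right (le_of_lt hs)]; simp
      rw [max_eq_right ht.le, mul_zero]
      exact (hasDerivAt_const t (0 : ℝ)).congr_of_eventuallyEq this
    · subst ht
      rw [hasDerivAt_iff_isLittleO_nhds_zero]
      simp only [zero_add, max_self, mul_zero, smul_zero, sub_zero, ne_eq, OfNat.ofNat_ne_zero,
        not_false_eq_true, zero_pow]
      have h1 : (fun h : ℝ => (max h 0) ^ 2) =O[𝓝 0] fun h : ℝ => h ^ 2 := by
        refine Asymptotics.IsBigO.of_bound 1 (Eventually.of_forall fun h => ?_)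
        rw [one_mul, norm_pow, norm_pow]
        refine pow_le_pow_left₀ (norm_nonneg _) ?_ 2
        rw [Real.norm_of_nonneg (le_max_right _ _)]
        exact max_le (le_abs_self _) (norm_nonneg _)
      exact h1.trans_isLittleO (Asymptotics.isLittleO_pow_id one_lt_two)
    · have : (fun t : ℝ => (max t 0) ^ 2) =ᶠ[𝓝 t] fun s => s ^ 2 := by
        filter_upwards [Ioi_mem_nhds ht] with s hs
        rw [max_eq_left (le_of_lt hs)]
      rw [max_eq_left ht.le]
      exact ((hasDerivAt_pow 2 t).congr_deriv (by ring)).congr_of_eventuallyEq this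
  rw [contDiff_one_iff_deriv]
  refine ⟨fun t => (h t).differentiableAt, ?_⟩
  rw [show deriv (fun t : ℝ => (max t 0) ^ 2) = fun t => 2 * max t 0 from funext fun t => (h t).deriv]
  fun_prop

/-- Up to sign, t₊²/2 inverts D³, and cutting it off leaves a smooth remainder. The third order is
what makes f of class C¹, which is the regularity that `RepresentsDirac.eventually_cons` needs at n
= 0. -/
theorem exists_representsDirac_nil {b : ℝ} (hb : 0 < b) : ∃ f g : ℝ → ℝ,
    ContDiff ℝ 1 f ∧ Function.support f ⊆ Icc 0 b ∧ ContDiff ℝ ∞ g ∧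
      Function.support g ⊆ Icc 0 b ∧ RepresentsDirac [] f g := by
  have hd : ∀ {F : Type} [NormedAddCommGroup F] [NormedSpace ℝ F] {u : ℝ → F},
      ContDiff ℝ ∞ u → ContDiff ℝ ∞ (deriv u) := fun h => (contDiff_infty_iff_deriv.1 h).2
  have hda : ∀ {F : Type} [NormedAddCommGroup F] [NormedSpace ℝ F] {u : ℝ → F} (t : ℝ),
      ContDiff ℝ ∞ u → HasDerivAt u (deriv u t) t :=
    fun t h => (h.differentiable (by simp) t).hasDerivAt
  let a : ℝ → ℝ := fun t => t ^ 2 / 2 * stepDown b t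
  have ha : ContDiff ℝ ∞ a := (by fun_prop : ContDiff ℝ ∞ fun t : ℝ => t ^ 2 / 2).mul
    (contDiff_stepDown b)
  have hlow : ∀ t < b / 3, a =ᶠ[𝓝 t] fun t => t ^ 2 / 2 := by
    intro t ht
    filter_upwards [Iio_mem_nhds ht] with s hs
    simp only [a]
    rw [stepDown_of_le hb (le_of_lt hs), mul_one]
  have hhigh : ∀ t, 2 * b / 3 < t → a =ᶠ[𝓝 t] fun _ => 0 := by
    intro t ht
    filter_upwards [Ioi_mem_nhds ht] with s hs
    simp only [a]
    rw [stepDown_of_ge hb (le_of_lt hs), mul_zero]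
  have d1 : deriv (fun t : ℝ => t ^ 2 / 2) = fun t => t := by
    funext t; simp
  have hlow1 : ∀ t < b / 3, deriv a =ᶠ[𝓝 t] fun t => t := fun t ht => d1 ▸ (hlow t ht).deriv
  have hlow2 : ∀ t < b / 3, deriv (deriv a) =ᶠ[𝓝 t] fun _ => 1 := by
    intro t ht
    have := (hlow1 t ht).deriv
    simpa using this
  have hlow3 : ∀ t < b / 3, deriv (deriv (deriv a)) t = 0 := by
    intro t ht
    rw [(hlow2 t ht).deriv_eq, deriv_const]
  have hhigh1 : ∀ t, 2 * b / 3 < t → deriv a =ᶠ[𝓝 t] fun _ => 0 := by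
    intro t ht
    have := (hhigh t ht).deriv
    rwa [deriv_const'] at this
  have hhigh2 : ∀ t, 2 * b / 3 < t → deriv (deriv a) =ᶠ[𝓝 t] fun _ => 0 := by
    intro t ht
    have := (hhigh1 t ht).deriv
    rwa [deriv_const'] at this
  have hhigh3 : ∀ t, 2 * b / 3 < t → deriv (deriv (deriv a)) t = 0 := by
    intro t ht
    rw [(hhigh2 t ht).deriv_eq, deriv_const]
  -- Only f is truncated at 0. To the left of b / 3 the function a is quadratic, so its third
  -- derivative vanishes there and g needs no truncation.
  refine ⟨fun t => -((max t 0) ^ 2 / 2 * stepDown b t), fun t => -deriv (deriv (deriv a)) t,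
    ?_, ?_, (hd (hd (hd ha))).neg, ?_, ?_⟩
  · exact ((contDiff_one_max_sq.div_const 2).mul ((contDiff_stepDown b).of_le (by simp))).neg
  · intro t ht
    constructor
    · by_contra h
      refine ht ?_
      simp only
      rw [max_eq_right (not_le.1 h).le]; simp
    · by_contra h
      refine ht ?_
      simp only
      rw [stepDown_of_ge hb (by linarith), mul_zero, neg_zero]
  · intro t ht
    constructor
    · by_contra h
      exact ht (by simp only [hlow3 t (by linarith), neg_zero])
    · by_contra h
      exact ht (by simp only [hhigh3 t (by linarith), neg_zero])
  · intro u hu huc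
    -- Integration by parts three times at once: the mixed terms in the derivative of W cancel,
    -- while W(0) = u(0) and W(b) = 0.
    let W : ℝ → ℂ := fun t =>
      a t • deriv (deriv u) t - deriv a t • deriv u t + deriv (deriv a) t • u t
    let W' : ℝ → ℂ := fun t => a t • deriv (deriv (deriv u)) t + deriv (deriv (deriv a)) t • u t
    have hW : ∀ t, HasDerivAt W (W' t) t := by
      intro t
      have h := (((hda t ha).smul (hda t (hd (hd hu)))).sub
        ((hda t (hd ha)).smul (hda t (hd hu)))).add ((hda t (hd (hd ha))).smul (hda t hu))
      refine h.congr_deriv ?_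
      simp only [W']
      abel
    have c1 : Continuous fun t => a t • deriv (deriv (deriv u)) t :=
      ha.continuous.smul (hd (hd (hd hu))).continuous
    have c2 : Continuous fun t => deriv (deriv (deriv a)) t • u t :=
      (hd (hd (hd ha))).continuous.smul hu.continuous
    have h := intervalIntegral.integral_eq_sub_of_hasDerivAt (a := 0) (b := b)
      (fun t _ => hW t) ((c1.add c2).intervalIntegrable _ _)
    have hW0 : W 0 = u 0 := by
      have h0 : (0 : ℝ) < b / 3 := by positivity
      simp only [W]
      rw [(hlow 0 h0).eq_of_nhds, (hlow1 0 h0).eq_of_nhds, (hlow2 0 h0).eq_of_nhds]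
      simp
    have hWb : W b = 0 := by
      have h0 : 2 * b / 3 < b := by linarith
      simp only [W]
      rw [(hhigh b h0).eq_of_nhds, (hhigh1 b h0).eq_of_nhds, (hhigh2 b h0).eq_of_nhds]
      simp
    rw [hWb, hW0, intervalIntegral.integral_add (c1.intervalIntegrable _ _)
      (c2.intervalIntegrable _ _), zero_sub] at h
    have e1 : ∫ t, (-((max t 0) ^ 2 / 2 * stepDown b t)) • diffProd [] u t =
        -∫ t in (0 : ℝ)..b, a t • deriv (deriv (deriv u)) t := by
      rw [← intervalIntegral.integral_neg, ← intervalIntegral.integral_eq_integral_of_support_subset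
        (a := 0) (b := b)]
      · refine intervalIntegral.integral_congr_ae (Eventually.of_forall fun t ht => ?_)
        rw [uIoc_of_le hb.le] at ht
        simp only [a, diffProd, neg_smul]
        rw [max_eq_left ht.1.le]
      · intro t ht
        constructor
        · by_contra h
          refine ht ?_
          simp only
          rw [max_eq_right (not_lt.1 h)]; simp
        · by_contra h
          refine ht ?_
          simp only
          rw [stepDown_of_ge hb (by linarith), mul_zero, neg_zero, zero_smul]
    have e2 : ∫ t, (-deriv (deriv (deriv a)) t) • u t =
        -∫ t in (0 : ℝ)..b, deriv (deriv (deriv a)) t • u t := by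
      rw [← intervalIntegral.integral_neg, ← intervalIntegral.integral_eq_integral_of_support_subset
        (a := 0) (b := b)]
      · simp only [neg_smul]
      · intro t ht
        constructor
        · by_contra h
          exact ht (by simp only [hlow3 t (by linarith), neg_zero, zero_smul])
        · by_contra h
          exact ht (by simp only [hhigh3 t (by linarith), neg_zero, zero_smul])
    rw [e1, e2, ← neg_add, h, neg_neg]

/-- The i-th derivative of f changes by r * f⁽ⁱ⁾ - m q * f⁽ⁱ⁺¹⁾. One more derivative of f than is to
be controlled makes this small with m. The change r * g - r of g is small because the derivatives of
r are. The kernel is truncated at b - a, so that supports grow from [0, a] at most to [0, b]. -/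
theorem RepresentsDirac.eventually_cons {l : List ℝ} {f g : ℝ → ℝ} (h : RepresentsDirac l f g)
    {n : ℕ} {a b : ℝ} (ha : 0 ≤ a) (hab : a < b) (hf : ContDiff ℝ (n + 1 : ℕ) f)
    (hfs : Function.support f ⊆ Icc 0 a) (hg : ContDiff ℝ ∞ g)
    (hgs : Function.support g ⊆ Icc 0 a) {ε : ℝ} (hε : 0 < ε) :
    ∀ᶠ m in 𝓝[>] (0 : ℝ), ∃ f' g' : ℝ → ℝ, RepresentsDirac (m :: l) f' g' ∧
      ContDiff ℝ (n + 2 : ℕ) f' ∧ Function.support f' ⊆ Icc 0 b ∧ ContDiff ℝ ∞ g' ∧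
      Function.support g' ⊆ Icc 0 b ∧
      (∀ i ≤ n, ∀ x, |iteratedDeriv i f' x - iteratedDeriv i f x| ≤ ε) ∧
      (∀ i ≤ n, ∀ x, |iteratedDeriv i g' x - iteratedDeriv i g x| ≤ ε) := by
  have hd : 0 < b - a := sub_pos.2 hab
  have hfc := hasCompactSupport_of_support_subset_Icc hfs
  have hgc := hasCompactSupport_of_support_subset_Icc hgs
  have hgi := hg.continuous.integrable_of_hasCompactSupport (μ := volume) hgc
  have hcs : ∀ {i : ℕ}, HasCompactSupport (iteratedDeriv i f) := by
    intro i
    induction i with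
    | zero => simpa using hfc
    | succ i ih => rw [iteratedDeriv_succ]; exact ih.deriv
  have hfi : ∀ i ≤ n, ContDiff ℝ 1 (iteratedDeriv i f) := by
    intro i hi
    rw [iteratedDeriv_eq_iterate]
    exact ContDiff.iterate_deriv' 1 i (hf.of_le (by exact_mod_cast (by omega : 1 + i ≤ n + 1)))
  have hB : ∃ B > 0, ∀ i ≤ n + 1, ∀ x, |iteratedDeriv i f x| ≤ B := by
    have : ∀ i ∈ Finset.range (n + 2), ∃ B : ℝ, ∀ x, |iteratedDeriv i f x| ≤ B := by
      intro i hi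
      exact hcs.exists_bound_of_continuous (hf.continuous_iteratedDeriv i
        (by have := Finset.mem_range.1 hi; exact_mod_cast (by omega : i ≤ n + 1)))
    choose! B hB using this
    refine ⟨1 + ∑ i ∈ Finset.range (n + 2), |B i|, by positivity, fun i hi x => ?_⟩
    have hi' : i ∈ Finset.range (n + 2) := Finset.mem_range.2 (by omega)
    have := Finset.single_le_sum (f := fun i => |B i|) (fun i _ => abs_nonneg _) hi'
    have h2 := (hB i hi' x).trans (le_abs_self _)
    linarith
  obtain ⟨B, hB0, hB⟩ := hB
  have hr0 : ∀ᶠ m in 𝓝[>] (0 : ℝ), ∀ i ∈ Finset.range (n + 1), ∀ t,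
      |iteratedDeriv i (expError (b - a) m) t| ≤ ε / (1 + ∫ t, |g t|) := by
    rw [Filter.eventually_all_finset]
    intro i _
    refine eventually_iteratedDeriv_expError_le hd i (div_pos hε ?_)
    have : 0 ≤ ∫ t, |g t| := integral_nonneg fun _ => abs_nonneg _
    linarith
  -- An error of mass at most 1 bounds the mass of the kernel by 2. The masses ε / (2B) and the
  -- parameter bound ε / (4B) then contribute ε / 2 each.
  have hρ : (0 : ℝ) < min 1 (ε / (2 * B)) := by positivity
  have hm1 : ∀ᶠ m in 𝓝[>] (0 : ℝ), m < ε / (4 * B) :=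
    mem_nhdsWithin_of_mem_nhds (Iio_mem_nhds (by positivity))
  filter_upwards [hr0, eventually_integral_abs_expError_le hd hρ, hm1, self_mem_nhdsWithin]
    with m hm hρm hm1 hm0
  have hm0 : 0 < m := hm0
  have hq := integrable_expKernel hd m
  have hr := integrable_expError hd m
  have hrs := contDiff_expError (b - a) m
  have hrc : HasCompactSupport (expError (b - a) m) :=
    hasCompactSupport_of_support_subset_Icc (support_expError hd m)
  have hsuppadd : ∀ {k w : ℝ → ℝ}, Function.support k ⊆ Icc 0 (b - a) →
      Function.support w ⊆ Icc 0 a → Function.support (lineConv k w) ⊆ Icc 0 b := by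
    intro k w hk hw x hx
    obtain ⟨y, hy, z, hz, rfl⟩ := support_convolution_subset _ hx
    have h1 := hk hy
    have h2 := hw hz
    exact ⟨add_nonneg h1.1 h2.1, by have := add_le_add h1.2 h2.2; simpa using this⟩
  have hqs : Function.support (expKernel (b - a) m) ⊆ Icc 0 (b - a) :=
    (support_expKernel hd m).trans (Ioc_subset_Icc_self.trans (Icc_subset_Icc le_rfl (by linarith)))
  have hrs' : Function.support (expError (b - a) m) ⊆ Icc 0 (b - a) :=
    (support_expError hd m).trans (Icc_subset_Icc (by positivity) (by linarith))
  have hrg : ContDiff ℝ ∞ (lineConv g (expError (b - a) m)) :=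
    hrc.contDiff_convolution_right _ hgi.locallyIntegrable hrs
  -- After the exchange, derivatives of the convolution fall on the error, whose derivatives are the
  -- small ones.
  have hcomm : lineConv (expError (b - a) m) g = lineConv g (expError (b - a) m) := by
    funext x
    rw [lineConv_apply, lineConv_apply, ← integral_sub_left_eq_self _ _ x]
    simp [mul_comm]
  refine ⟨_, _, h.cons hf.continuous hfc hg.continuous hgc hd hm0,
    contDiff_lineConv_expKernel hd hm0 hf hfc, hsuppadd hqs hfs, ?_, ?_, ?_, ?_⟩
  · rw [hcomm]
    exact (hg.sub hrs).add hrg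
  · intro x hx
    by_contra hx'
    refine hx ?_
    have h1 : g x = 0 := by_contra fun h => hx' (Icc_subset_Icc le_rfl hab.le (hgs h))
    have h2 : expError (b - a) m x = 0 := by_contra fun h => hx'
      (Icc_subset_Icc le_rfl (by linarith) (hrs' h))
    have h3 : lineConv (expError (b - a) m) g x = 0 := by_contra fun h => hx' (hsuppadd hrs' hgs h)
    simp only [h1, h2, h3, sub_zero, add_zero]
  · intro i hi x
    rw [iteratedDeriv_lineConv hq i (hf.of_le (by exact_mod_cast (by omega : i ≤ n + 1))) hfc]
    have key := lineConv_expKernel_identity hd hm0 (hfi i hi) hcs x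
    rw [← iteratedDeriv_succ] at key
    have b1 := abs_lineConv_le hq (hB (i + 1) (by omega)) x
    have b2 := abs_lineConv_le hr (hB i (by omega)) x
    have b3 := integral_abs_expKernel_le hd hm0
    have b4 : ∫ t, |expKernel (b - a) m t| ≤ 2 := by
      have := hρm.trans (min_le_left _ _)
      linarith
    have b5 := hρm.trans (min_le_right _ _)
    rw [show lineConv (expKernel (b - a) m) (iteratedDeriv i f) x - iteratedDeriv i f x =
      lineConv (expError (b - a) m) (iteratedDeriv i f) x -
        m * lineConv (expKernel (b - a) m) (iteratedDeriv (i + 1) f) x by linarith]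
    refine (abs_sub _ _).trans ?_
    rw [abs_mul, abs_of_pos hm0]
    have c1 : B * ∫ t, |expError (b - a) m t| ≤ ε / 2 := by
      calc _ ≤ B * (ε / (2 * B)) := by gcongr
        _ = ε / 2 := by field_simp
    have c2 : m * |lineConv (expKernel (b - a) m) (iteratedDeriv (i + 1) f) x| ≤ ε / 2 := by
      calc _ ≤ (ε / (4 * B)) * (B * 2) := by
            gcongr
            exact b1.trans (by gcongr)
        _ = ε / 2 := by field_simp; norm_num
    linarith
  · intro i hi x
    have hle : ((i : ℕ) : WithTop ℕ∞) ≤ ∞ := by exact_mod_cast le_top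
    rw [hcomm, iteratedDeriv_fun_add ((hg.sub hrs).of_le hle).contDiffAt (hrg.of_le hle).contDiffAt,
      iteratedDeriv_fun_sub (hg.of_le hle).contDiffAt (hrs.of_le hle).contDiffAt,
      iteratedDeriv_lineConv hgi i (hrs.of_le hle) hrc]
    have hb := hm i (Finset.mem_range.2 (by omega))
    have b1 := hb x
    have b2 := abs_lineConv_le hgi hb x
    have hg0 : 0 ≤ ∫ t, |g t| := integral_nonneg fun _ => abs_nonneg _
    have e : ε / (1 + ∫ t, |g t|) + ε / (1 + ∫ t, |g t|) * ∫ t, |g t| = ε := by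
      field_simp
    calc _ = |lineConv g (iteratedDeriv i (expError (b - a) m)) x -
          iteratedDeriv i (expError (b - a) m) x| := by congr 1; ring
      _ ≤ _ := abs_sub _ _
      _ ≤ ε := by linarith

end ConvolutionPowers

/-! ### Passage to the limit in the one-dimensional factorization -/

section ConvolutionPowers

open Set Filter Topology MeasureTheory

/-- The n-th function is only Cⁿ. To obtain Cᵏ for the limit, the telescoping series is started at
index k, from where its derivatives up to order k are dominated by a geometric series. -/
theorem exists_contDiff_limit {E F : Type*} [NormedAddCommGroup E] [NormedSpace ℝ E]
    [NormedAddCommGroup F] [NormedSpace ℝ F] [CompleteSpace F] {h : ℕ → E → F}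
    (hh : ∀ n : ℕ, ContDiff ℝ n (h n))
    (hd : ∀ n, ∀ i ≤ n, ∀ x,
      ‖iteratedFDeriv ℝ i (fun x => h (n + 1) x - h n x) x‖ ≤ (1 / 2 : ℝ) ^ n) :
    ∃ f : E → F, ContDiff ℝ ∞ f ∧ ∀ n x, ‖h n x - f x‖ ≤ 2 * (1 / 2 : ℝ) ^ n := by
  have hs : Summable fun n : ℕ => (1 / 2 : ℝ) ^ n := summable_geometric_two
  let f : E → F := fun x => h 0 x + ∑' n, (h (n + 1) x - h n x)
  have hb : ∀ x n, ‖h (n + 1) x - h n x‖ ≤ (1 / 2 : ℝ) ^ n := fun x n => by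
    simpa using hd n 0 (Nat.zero_le n) x
  have hsx : ∀ x, Summable fun n => h (n + 1) x - h n x := fun x =>
    Summable.of_norm_bounded hs (hb x)
  have htail : ∀ k x, f x = h k x + ∑' n, (h (n + k + 1) x - h (n + k) x) := by
    intro k x
    have h1 := (hsx x).sum_add_tsum_nat_add k
    have h2 : ∑ i ∈ Finset.range k, (h (i + 1) x - h i x) = h k x - h 0 x :=
      Finset.sum_range_sub (fun i => h i x) k
    simp only [f]
    rw [← h1, h2]
    abel
  refine ⟨f, ?_, fun n x => ?_⟩
  · rw [contDiff_infty]
    intro k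
    have hfk : f = fun x => h k x + ∑' n, (h (n + k + 1) x - h (n + k) x) := funext (htail k)
    rw [hfk]
    have hle : ∀ n : ℕ, ContDiff ℝ k (h (n + k)) := fun n =>
      (hh (n + k)).of_le (by exact_mod_cast Nat.le_add_left k n)
    have hle' : ∀ n : ℕ, ContDiff ℝ k (h (n + k + 1)) := fun n =>
      (hh (n + k + 1)).of_le (by exact_mod_cast (by omega : k ≤ n + k + 1))
    refine (hh k).add ?_
    have := contDiff_tsum (𝕜 := ℝ) (N := (k : ℕ∞)) (f := fun n x => h (n + k + 1) x - h (n + k) x)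
      (v := fun _ n => (1 / 2 : ℝ) ^ (n + k)) (fun n => (hle' n).sub (hle n))
      (fun i _ => (summable_nat_add_iff k).2 hs) (fun i n x hi => ?_)
    · exact_mod_cast this
    · have hi' : i ≤ k := by exact_mod_cast hi
      exact hd (n + k) i (by omega) x
  · rw [htail n x, sub_add_cancel_left, norm_neg]
    have hg : HasSum (fun m => (1 / 2 : ℝ) ^ n * (1 / 2 : ℝ) ^ m) ((1 / 2 : ℝ) ^ n * 2) :=
      hasSum_geometric_two.mul_left _
    have := tsum_of_norm_bounded hg (f := fun m => h (m + n + 1) x - h (m + n) x) (fun m => by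
      rw [← pow_add, add_comm n m]; exact hb x (m + n))
    linarith

theorem exists_contDiff_limit_of_iteratedDeriv (F : ℕ → ℝ → ℝ) (hF : ∀ n : ℕ, ContDiff ℝ n (F n))
    (hd : ∀ n, ∀ i ≤ n, ∀ t,
      |iteratedDeriv i (F (n + 1)) t - iteratedDeriv i (F n) t| ≤ (1 / 2 : ℝ) ^ n) :
    ∃ f : ℝ → ℝ, ContDiff ℝ ∞ f ∧ ∀ n x, |F n x - f x| ≤ 2 * (1 / 2 : ℝ) ^ n := by
  refine exists_contDiff_limit hF fun n i hi t => ?_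
  rw [norm_iteratedFDeriv_eq_norm_iteratedDeriv, iteratedDeriv_fun_sub
    ((hF (n + 1)).of_le (by exact_mod_cast hi.trans n.le_succ)).contDiffAt
    ((hF n).of_le (by exact_mod_cast hi)).contDiffAt]
  exact hd n i hi t

theorem tendsto_of_abs_sub_le {F : ℕ → ℝ → ℝ} {f : ℝ → ℝ}
    (h : ∀ n x, |F n x - f x| ≤ 2 * (1 / 2 : ℝ) ^ n) (x : ℝ) :
    Tendsto (fun n => F n x) atTop (𝓝 (f x)) := by
  have hz : Tendsto (fun n : ℕ => 2 * (1 / 2 : ℝ) ^ n) atTop (𝓝 0) := by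
    simpa using (tendsto_pow_atTop_nhds_zero_of_lt_one (by norm_num : (0 : ℝ) ≤ 1 / 2)
      (by norm_num)).const_mul 2
  rw [tendsto_iff_norm_sub_tendsto_zero]
  exact squeeze_zero (fun _ => norm_nonneg _) (fun n => h n x) hz

theorem support_subset_of_tendsto {F : ℕ → ℝ → ℝ} {f : ℝ → ℝ} {K : Set ℝ}
    (h : ∀ x, Tendsto (fun n => F n x) atTop (𝓝 (f x)))
    (hF : ∀ n, Function.support (F n) ⊆ K) : Function.support f ⊆ K := by
  intro x hx
  by_contra hx'
  refine hx (tendsto_nhds_unique (h x) ?_)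
  have : ∀ n, F n x = 0 := fun n => by_contra fun h0 => hx' (hF n h0)
  simp [this]

theorem tendsto_integral_smul {F : ℕ → ℝ → ℝ} {f : ℝ → ℝ} {w : ℕ → ℝ → ℂ} {v : ℝ → ℂ} {δ : ℝ}
    (hFc : ∀ n, Continuous (F n)) (hFs : ∀ n, Function.support (F n) ⊆ Icc 0 δ)
    (hfc : Continuous f) (hF : ∀ n x, |F n x - f x| ≤ 2 * (1 / 2 : ℝ) ^ n)
    (hwc : ∀ n, Continuous (w n)) (hvc : ContinuousOn v (Icc 0 δ))
    (hw : TendstoUniformlyOn w v atTop (Icc 0 δ)) :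
    Tendsto (fun n => ∫ t, F n t • w n t) atTop (𝓝 (∫ t, f t • v t)) := by
  obtain ⟨Bv, hBv⟩ := isCompact_Icc.exists_bound_of_continuousOn hvc
  obtain ⟨Bf, hBf⟩ := (isCompact_Icc (a := (0 : ℝ)) (b := δ)).exists_bound_of_continuousOn
    hfc.continuousOn
  have hconv : ∀ {k : ℝ → ℝ} {w : ℝ → ℂ}, Function.support k ⊆ Icc 0 δ →
      ∫ t, k t • w t = ∫ t in Icc 0 δ, k t • w t := by
    intro k w hk
    rw [setIntegral_eq_integral_of_forall_compl_eq_zero]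
    intro x hx
    have : k x = 0 := by_contra fun h => hx (hk h)
    rw [this, zero_smul]
  rw [hconv (support_subset_of_tendsto (tendsto_of_abs_sub_le hF) hFs)]
  simp only [hconv (hFs _)]
  refine tendsto_integral_filter_of_dominated_convergence (fun _ => (Bf + 2) * (Bv + 1)) ?_ ?_ ?_ ?_
  · exact Eventually.of_forall fun n => ((hFc n).smul (hwc n)).aestronglyMeasurable
  · filter_upwards [Metric.tendstoUniformlyOn_iff.1 hw 1 one_pos] with n hn
    filter_upwards [ae_restrict_mem measurableSet_Icc] with t ht
    rw [norm_smul]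
    have e1 : ‖F n t‖ ≤ Bf + 2 := by
      have h1 := hF n t
      have h2 : (1 / 2 : ℝ) ^ n ≤ 1 := pow_le_one₀ (by norm_num) (by norm_num)
      have h3 := hBf t ht
      calc ‖F n t‖ = ‖f t + (F n t - f t)‖ := by congr 1; ring
        _ ≤ ‖f t‖ + |F n t - f t| := norm_add_le _ _
        _ ≤ Bf + 2 := by linarith
    have e2 : ‖w n t‖ ≤ Bv + 1 := by
      have h1 := (hn t ht).le
      rw [dist_comm, dist_eq_norm] at h1
      calc ‖w n t‖ = ‖v t + (w n t - v t)‖ := by congr 1; ring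
        _ ≤ ‖v t‖ + ‖w n t - v t‖ := norm_add_le _ _
        _ ≤ Bv + 1 := add_le_add (hBv t ht) h1
    exact mul_le_mul e1 e2 (norm_nonneg _) ((norm_nonneg _).trans e1)
  · exact integrable_const _
  · filter_upwards [ae_restrict_mem measurableSet_Icc] with t ht
    exact (tendsto_of_abs_sub_le hF t).smul (hw.tendsto_at ht)

theorem exists_seq_of_step {α : Type*} {P : ℕ → α → Prop} {R : ℕ → α → α → Prop}
    (h0 : ∃ x, P 0 x) (h : ∀ n x, P n x → ∃ y, P (n + 1) y ∧ R n x y) :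
    ∃ S : ℕ → α, (∀ n, P n (S n)) ∧ ∀ n, R n (S n) (S (n + 1)) := by
  obtain ⟨x₀, hx₀⟩ := h0
  choose! next hP hR using h
  let S : ℕ → α := fun n => Nat.rec x₀ (fun n x => next n x) n
  have hS : ∀ n, P n (S n) := by
    intro n
    induction n with
    | zero => exact hx₀
    | succ n ih => exact hP n (S n) ih
  exact ⟨S, hS, fun n => hR n (S n) (hS n)⟩

/-- The one-dimensional Dixmier-Malliavin lemma. The parameters `m₀, m₁, …` may be chosen
successively, each one arbitrarily small in terms of the preceding ones. -/
theorem exists_dirac_factorization {δ : ℝ} (hδ : 0 < δ) (C : List ℝ → ℝ → Prop)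
    (hC : ∀ l, ∀ᶠ m in 𝓝[>] (0 : ℝ), C l m) :
    ∃ (l : ℕ → List ℝ) (f g : ℝ → ℝ),
      (∀ n, (l n).length = n ∧ ∃ m, C (l n) m ∧ l (n + 1) = m :: l n) ∧
      ContDiff ℝ ∞ f ∧ ContDiff ℝ ∞ g ∧
      Function.support f ⊆ Icc 0 δ ∧ Function.support g ⊆ Icc 0 δ ∧
      ∀ u : ℝ → ℂ, ContDiff ℝ ∞ u → HasCompactSupport u → ∀ v : ℝ → ℂ,
        TendstoUniformlyOn (fun n => diffProd (l n) u) v atTop (Icc 0 δ) →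
        u 0 = (∫ t, f t • v t) + ∫ t, g t • u t := by
  -- The supports at stage n lie in [0, a n]. The sequence increases strictly and stays below δ, so
  -- every stage leaves room for the next kernel.
  let a : ℕ → ℝ := fun n => δ * (1 - (1 / 2) ^ (n + 1))
  have ha0 : ∀ n, 0 ≤ a n := fun n => mul_nonneg hδ.le
    (sub_nonneg.2 (pow_le_one₀ (by norm_num) (by norm_num)))
  have ha1 : ∀ n, a n < a (n + 1) := by
    intro n
    have : ((1 : ℝ) / 2) ^ (n + 1 + 1) < (1 / 2) ^ (n + 1) :=
      pow_lt_pow_right_of_lt_one₀ (by norm_num) (by norm_num) (Nat.lt_succ_self _)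
    exact mul_lt_mul_of_pos_left (by linarith) hδ
  have ha2 : ∀ n, a n ≤ δ := fun n => mul_le_of_le_one_right hδ.le (by
    have : (0 : ℝ) ≤ (1 / 2) ^ (n + 1) := by positivity
    linarith)
  let P : ℕ → List ℝ × (ℝ → ℝ) × (ℝ → ℝ) → Prop := fun n x =>
    x.1.length = n ∧ RepresentsDirac x.1 x.2.1 x.2.2 ∧ ContDiff ℝ (n + 1 : ℕ) x.2.1 ∧
      Function.support x.2.1 ⊆ Icc 0 (a n) ∧ ContDiff ℝ ∞ x.2.2 ∧
      Function.support x.2.2 ⊆ Icc 0 (a n)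
  let R : ℕ → List ℝ × (ℝ → ℝ) × (ℝ → ℝ) → List ℝ × (ℝ → ℝ) × (ℝ → ℝ) → Prop := fun n x y =>
    (∃ m, C x.1 m ∧ y.1 = m :: x.1) ∧
    (∀ i ≤ n, ∀ t, |iteratedDeriv i y.2.1 t - iteratedDeriv i x.2.1 t| ≤ (1 / 2 : ℝ) ^ n) ∧
    (∀ i ≤ n, ∀ t, |iteratedDeriv i y.2.2 t - iteratedDeriv i x.2.2 t| ≤ (1 / 2 : ℝ) ^ n)
  have hstep : ∀ n x, P n x → ∃ y, P (n + 1) y ∧ R n x y := by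
    rintro n ⟨l, f, g⟩ ⟨hl, hrep, hf, hfs, hg, hgs⟩
    -- Closeness to the preceding stage and the external requirement C both hold for all small m >
    -- 0, hence for a common one.
    obtain ⟨m, ⟨f', g', h1, h2, h3, h4, h5, h6, h7⟩, hm⟩ :=
      ((hrep.eventually_cons (ha0 n) (ha1 n) hf hfs hg hgs
        (by positivity : (0 : ℝ) < (1 / 2) ^ n)).and (hC l)).exists
    exact ⟨⟨m :: l, f', g'⟩, ⟨by simpa using hl, h1, h2, h3, h4, h5⟩, ⟨m, hm, rfl⟩, h6, h7⟩
  obtain ⟨f₀, g₀, h1, h2, h3, h4, h5⟩ := exists_representsDirac_nil (b := a 0)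
    (by simp only [a]; positivity)
  obtain ⟨S, hP, hS⟩ := exists_seq_of_step ⟨⟨[], f₀, g₀⟩, rfl, h5, by simpa using h1, h2, h3, h4⟩
    hstep
  have hcf : ∀ n : ℕ, ContDiff ℝ n (S n).2.1 := fun n =>
    (hP n).2.2.1.of_le (by exact_mod_cast Nat.le_succ n)
  have hcg : ∀ n : ℕ, ContDiff ℝ n (S n).2.2 := fun n =>
    (hP n).2.2.2.2.1.of_le (by exact_mod_cast le_top)
  obtain ⟨f, hf, hfl⟩ := exists_contDiff_limit_of_iteratedDeriv (fun n => (S n).2.1) hcf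
    fun n => (hS n).2.1
  obtain ⟨g, hg, hgl⟩ := exists_contDiff_limit_of_iteratedDeriv (fun n => (S n).2.2) hcg
    fun n => (hS n).2.2
  have hIcc : ∀ n, Icc 0 (a n) ⊆ Icc 0 δ := fun n => Icc_subset_Icc le_rfl (ha2 n)
  have hSf : ∀ n, Function.support (S n).2.1 ⊆ Icc 0 δ := fun n =>
    (hP n).2.2.2.1.trans (hIcc n)
  have hSg : ∀ n, Function.support (S n).2.2 ⊆ Icc 0 δ := fun n =>
    (hP n).2.2.2.2.2.trans (hIcc n)
  refine ⟨fun n => (S n).1, f, g, fun n => ⟨(hP n).1, (hS n).1⟩, hf, hg,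
    support_subset_of_tendsto (tendsto_of_abs_sub_le hfl) hSf,
    support_subset_of_tendsto (tendsto_of_abs_sub_le hgl) hSg, ?_⟩
  intro u hu huc v hv
  have hvc : ContinuousOn v (Icc 0 δ) := hv.continuousOn
    (Frequently.of_forall fun n => (contDiff_diffProd _ hu).continuous.continuousOn)
  have t1 := tendsto_integral_smul (fun n => (hP n).2.2.1.continuous) hSf hf.continuous hfl
    (fun n => (contDiff_diffProd (S n).1 hu).continuous) hvc hv
  have t2 := tendsto_integral_smul (w := fun _ => u) (v := u) (fun n => (hP n).2.2.2.2.1.continuous) hSg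
    hg.continuous hgl (fun n => hu.continuous) hu.continuous.continuousOn
    (Metric.tendstoUniformlyOn_iff.2 fun ε hε => Eventually.of_forall fun n x _ => by simpa using hε)
  refine tendsto_nhds_unique ?_ (t1.add t2)
  have : ∀ n, (∫ t, (S n).2.1 t • diffProd (S n).1 u t) + ∫ t, (S n).2.2 t • u t = u 0 :=
    fun n => ((hP n).2.1 u hu huc).symm
  simp only [this]
  exact tendsto_const_nhds

end ConvolutionPowers

/-! ### Factorization along the orbits of one vector field -/

section VectorFields

open Set Filter Topology MeasureTheory

variable {E : Type*} [NormedAddCommGroup E] [NormedSpace ℝ E]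

/-- The derivative of `h` along the vector field `V`. -/
noncomputable def dirDeriv (V : E → E) (h : E → ℂ) (z : E) : ℂ := fderiv ℝ h z (V z)

theorem tsupport_dirDeriv_subset (V : E → E) (h : E → ℂ) :
    tsupport (dirDeriv V h) ⊆ tsupport h := by
  refine (closure_mono ?_).trans (tsupport_fderiv_subset ℝ (f := h))
  intro z hz h0
  exact hz (by rw [dirDeriv, h0]; rfl)

theorem contDiff_dirDeriv {V : E → E} {O : Set E} (hO : IsOpen O) (hV : ContDiffOn ℝ ∞ V O)
    {h : E → ℂ} (hh : ContDiff ℝ ∞ h) (hs : tsupport h ⊆ O) : ContDiff ℝ ∞ (dirDeriv V h) := by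
  rw [contDiff_iff_contDiffAt]
  intro z
  by_cases hz : z ∈ O
  · exact (hh.fderiv_right (m := ∞) (by simp)).contDiffAt.clm_apply
      (hV.contDiffAt (hO.mem_nhds hz))
  · have : dirDeriv V h =ᶠ[𝓝 z] fun _ => 0 := by
      filter_upwards [(isClosed_tsupport h).isOpen_compl.mem_nhds (fun h' => hz (hs h'))] with w hw
      exact image_eq_zero_of_notMem_tsupport fun h' => hw (tsupport_dirDeriv_subset V h h')
    exact contDiffAt_const.congr_of_eventuallyEq this

/-- The operator `∏ (1 - m V) V³`, `m` in the given list. -/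
noncomputable def dirDerivProd (V : E → E) : List ℝ → (E → ℂ) → E → ℂ
  | [], h => dirDeriv V (dirDeriv V (dirDeriv V h))
  | m :: l, h => fun z => dirDerivProd V l h z - m • dirDeriv V (dirDerivProd V l h) z

theorem tsupport_dirDerivProd_subset (V : E → E) (l : List ℝ) (h : E → ℂ) :
    tsupport (dirDerivProd V l h) ⊆ tsupport h := by
  induction l with
  | nil =>
    exact (tsupport_dirDeriv_subset _ _).trans ((tsupport_dirDeriv_subset _ _).trans
      (tsupport_dirDeriv_subset _ _))
  | cons m l ih =>
    refine closure_minimal (fun z hz => ?_) (isClosed_tsupport h)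
    by_contra hz'
    refine hz ?_
    simp only [dirDerivProd]
    rw [image_eq_zero_of_notMem_tsupport fun h' => hz' (ih h'),
      image_eq_zero_of_notMem_tsupport fun h' => hz' (ih (tsupport_dirDeriv_subset _ _ h')),
      smul_zero, sub_zero]

theorem contDiff_dirDerivProd {V : E → E} {O : Set E} (hO : IsOpen O) (hV : ContDiffOn ℝ ∞ V O)
    {h : E → ℂ} (hh : ContDiff ℝ ∞ h) (hs : tsupport h ⊆ O) (l : List ℝ) :
    ContDiff ℝ ∞ (dirDerivProd V l h) := by
  induction l with
  | nil =>
    have h1 := contDiff_dirDeriv hO hV hh hs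
    have s1 := (tsupport_dirDeriv_subset V h).trans hs
    have h2 := contDiff_dirDeriv hO hV h1 s1
    exact contDiff_dirDeriv hO hV h2 ((tsupport_dirDeriv_subset V _).trans s1)
  | cons m l ih =>
    exact ih.sub ((contDiff_dirDeriv hO hV ih
      ((tsupport_dirDerivProd_subset V l h).trans hs)).const_smul m)

/-- The extension by zero of a function given in a chart `κ` with domain `src`. -/
noncomputable def chartExt {Y E : Type*} (src : Set Y) (κ : Y → E) (d : E → ℂ) : Y → ℂ :=
  src.indicator (d ∘ κ)

theorem chartExt_of_mem {Y E : Type*} {src : Set Y} {κ : Y → E} (d : E → ℂ) {y : Y} (hy : y ∈ src) :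
    chartExt src κ d y = d (κ y) := indicator_of_mem hy _

theorem chartExt_of_notMem {Y E : Type*} {src : Set Y} {κ : Y → E} (d : E → ℂ) {y : Y}
    (hy : y ∉ src) : chartExt src κ d y = 0 := indicator_of_notMem hy _

/-- `c` is an orbit of the vector field `V` on a neighbourhood of `[0, δ]`, as far as functions
supported in `K` can see. -/
def IsOrbit {Y : Type*} (src : Set Y) (κ : Y → E) (V : E → E) (K : Set E) (δ : ℝ) (c : ℝ → Y) :
    Prop :=
  ∃ ε > 0, ∀ d : E → ℂ, ContDiff ℝ ∞ d → tsupport d ⊆ K → ∀ t ∈ Ioo (-ε) (δ + ε),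
    HasDerivAt (fun t => chartExt src κ d (c t)) (chartExt src κ (dirDeriv V d) (c t)) t

/-- Along an orbit the field acts as d/dt, so the one-dimensional lemma applies to t ↦ h(c(t)). The
functions f, g, χ are constructed from V, h and δ before any orbit is given, which makes the formula
uniform in the starting point. -/
theorem exists_factorization_along_vectorField {V : E → E} {O : Set E} (hO : IsOpen O)
    (hV : ContDiffOn ℝ ∞ V O) {h : E → ℂ} (hh : ContDiff ℝ ∞ h) (hs : tsupport h ⊆ O)
    (hc : HasCompactSupport h) {δ : ℝ} (hδ : 0 < δ) :
    ∃ (f g : ℝ → ℝ) (χ : E → ℂ), ContDiff ℝ ∞ f ∧ ContDiff ℝ ∞ g ∧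
      Function.support f ⊆ Icc 0 δ ∧ Function.support g ⊆ Icc 0 δ ∧
      ContDiff ℝ ∞ χ ∧ tsupport χ ⊆ tsupport h ∧
      ∀ {Y : Type*} (src : Set Y) (κ : Y → E) (c : ℝ → Y), IsOrbit src κ V (tsupport h) δ c →
        chartExt src κ h (c 0) = (∫ t, f t • chartExt src κ χ (c t)) +
          ∫ t, g t • chartExt src κ h (c t) := by
  have hsm := contDiff_dirDerivProd hO hV hh hs
  have hts := fun l => tsupport_dirDerivProd_subset V l h
  have hX : ∀ l, ContDiff ℝ ∞ (dirDeriv V (dirDerivProd V l h)) := fun l =>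
    contDiff_dirDeriv hO hV (hsm l) ((hts l).trans hs)
  have hXs : ∀ l, tsupport (dirDeriv V (dirDerivProd V l h)) ⊆ tsupport h := fun l =>
    (tsupport_dirDeriv_subset V _).trans (hts l)
  have hle : ∀ i : ℕ, ((i : ℕ) : WithTop ℕ∞) ≤ ∞ := fun i => by exact_mod_cast le_top
  -- Adding the factor 1 - mV changes the product by -m times its derivative along V. This condition
  -- bounds the change as `exists_contDiff_limit` requires.
  let C : List ℝ → ℝ → Prop := fun l m => ∀ i ∈ Finset.range (l.length + 1), ∀ z,
    ‖m‖ * ‖iteratedFDeriv ℝ i (dirDeriv V (dirDerivProd V l h)) z‖ ≤ (1 / 2 : ℝ) ^ l.length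
  have hC : ∀ l, ∀ᶠ m in 𝓝[>] (0 : ℝ), C l m := by
    intro l
    rw [Filter.eventually_all_finset]
    intro i _
    have hcl : HasCompactSupport (dirDeriv V (dirDerivProd V l h)) :=
      hc.of_isClosed_subset (isClosed_tsupport _) (hXs l)
    obtain ⟨B, hB⟩ := (hcl.iteratedFDeriv (𝕜 := ℝ) i).exists_bound_of_continuous ((hX l).continuous_iteratedFDeriv (hle i))
    have hB0 : 0 ≤ B := (norm_nonneg _).trans (hB 0)
    have hlim : Tendsto (fun m : ℝ => ‖m‖ * B) (𝓝[>] 0) (𝓝 0) := by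
      have : Tendsto (fun m : ℝ => ‖m‖ * B) (𝓝 0) (𝓝 (‖(0 : ℝ)‖ * B)) :=
        (continuous_norm.mul continuous_const).continuousAt
      rw [norm_zero, zero_mul] at this
      exact this.mono_left nhdsWithin_le_nhds
    filter_upwards [hlim.eventually (gt_mem_nhds (by positivity : (0 : ℝ) < (1 / 2) ^ l.length))]
      with m hm z
    exact (mul_le_mul_of_nonneg_left (hB z) (norm_nonneg m)).trans hm.le
  obtain ⟨l, f, g, hl, hf, hg, hfs, hgs, hfg⟩ := exists_dirac_factorization hδ C hC
  obtain ⟨χ, hχ, hlim⟩ := exists_contDiff_limit (h := fun n => dirDerivProd V (l n) h)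
    (fun n => (hsm (l n)).of_le (hle n)) (fun n i hi z => by
      obtain ⟨hlen, m, hm, hl'⟩ := hl n
      have e : (fun z => dirDerivProd V (l (n + 1)) h z - dirDerivProd V (l n) h z) =
          fun z => (-m) • dirDeriv V (dirDerivProd V (l n) h) z := by
        funext z
        rw [hl']
        simp [dirDerivProd]
      rw [e, iteratedFDeriv_const_smul_apply' ((hX _).of_le (hle i)).contDiffAt, norm_smul,
        norm_neg]
      have := hm i (Finset.mem_range.2 (by omega)) z
      rwa [hlen] at this)
  have hz : Tendsto (fun n : ℕ => 2 * (1 / 2 : ℝ) ^ n) atTop (𝓝 0) := by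
    simpa using (tendsto_pow_atTop_nhds_zero_of_lt_one (by norm_num : (0 : ℝ) ≤ 1 / 2)
      (by norm_num)).const_mul 2
  refine ⟨f, g, χ, hf, hg, hfs, hgs, hχ, ?_, ?_⟩
  · refine closure_minimal (fun z hz' => ?_) (isClosed_tsupport h)
    by_contra hz''
    refine hz' (tendsto_nhds_unique (f := fun n => dirDerivProd V (l n) h z) ?_ ?_ (l := atTop))
    · rw [tendsto_iff_norm_sub_tendsto_zero]
      exact squeeze_zero (fun _ => norm_nonneg _) (fun n => hlim n z) hz
    · have : ∀ n, dirDerivProd V (l n) h z = 0 := fun n =>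
        image_eq_zero_of_notMem_tsupport fun h' => hz'' (hts _ h')
      simp [this]
  · rintro Y src κ c ⟨ε, hε, horb⟩
    let U : (E → ℂ) → ℝ → ℂ := fun d t => chartExt src κ d (c t)
    -- Differentiating d along the orbit gives `dirDeriv V d` along the orbit, a function of the
    -- same kind, so regularity follows by induction.
    have hU : ∀ n : ℕ, ∀ d, ContDiff ℝ ∞ d → tsupport d ⊆ tsupport h →
        ContDiffOn ℝ n (U d) (Ioo (-ε) (δ + ε)) := by
      intro n
      induction n with
      | zero =>
        intro d hd hds
        exact contDiffOn_zero.2 fun t ht => (horb d hd hds t ht).continuousAt.continuousWithinAt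
      | succ n ih =>
        intro d hd hds
        push_cast
        rw [contDiffOn_succ_iff_deriv_of_isOpen isOpen_Ioo]
        refine ⟨fun t ht => (horb d hd hds t ht).differentiableAt.differentiableWithinAt, by simp, ?_⟩
        exact (ih _ (contDiff_dirDeriv hO hV hd (hds.trans hs))
          ((tsupport_dirDeriv_subset V d).trans hds)).congr fun t ht => (horb d hd hds t ht).deriv
    -- The orbit is controlled only on (-ε, δ + ε). A cutoff that is 1 near [0, δ] produces a
    -- compactly supported function on the whole line.
    let ψ : ContDiffBump (δ / 2) := ⟨δ / 2 + ε / 2, δ / 2 + 3 * ε / 4, by positivity, by linarith⟩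
    let u : ℝ → ℂ := fun t => ψ t • U h t
    have hψJ : tsupport ψ ⊆ Ioo (-ε) (δ + ε) := by
      rw [ψ.tsupport_eq, Real.closedBall_eq_Icc]
      refine Icc_subset_Ioo ?_ ?_ <;> simp only [ψ] <;> linarith
    have hus : ContDiff ℝ ∞ u := by
      rw [contDiff_iff_contDiffAt]
      intro t
      by_cases ht : t ∈ Ioo (-ε) (δ + ε)
      · exact ψ.contDiffAt.smul ((contDiffOn_infty.2 fun n => hU n h hh subset_rfl).contDiffAt
          (isOpen_Ioo.mem_nhds ht))
      · have : u =ᶠ[𝓝 t] fun _ => 0 := by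
          filter_upwards [(isClosed_tsupport ψ).isOpen_compl.mem_nhds fun h' => ht (hψJ h')] with s hs
          simp only [u]
          rw [image_eq_zero_of_notMem_tsupport hs, zero_smul]
        exact contDiffAt_const.congr_of_eventuallyEq this
    have huc : HasCompactSupport u := ψ.hasCompactSupport.smul_right
    have hψ1 : ∀ t ∈ Ioo (-(ε / 2)) (δ + ε / 2), ψ t = 1 := by
      intro t ht
      apply ψ.one_of_mem_closedBall
      rw [Real.closedBall_eq_Icc]
      simp only [ψ]
      exact ⟨by linarith [ht.1], by linarith [ht.2]⟩
    have hsub : Ioo (-(ε / 2)) (δ + ε / 2) ⊆ Ioo (-ε) (δ + ε) :=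
      Ioo_subset_Ioo (by linarith) (by linarith)
    have huU : ∀ t ∈ Ioo (-(ε / 2)) (δ + ε / 2), u t = U h t := fun t ht => by
      simp only [u]
      rw [hψ1 t ht, one_smul]
    have hder : ∀ {w : ℝ → ℂ} {d : E → ℂ}, ContDiff ℝ ∞ d → tsupport d ⊆ tsupport h →
        (∀ t ∈ Ioo (-(ε / 2)) (δ + ε / 2), w t = U d t) →
        ∀ t ∈ Ioo (-(ε / 2)) (δ + ε / 2), deriv w t = U (dirDeriv V d) t := by
      intro w d hd hds hw t ht
      have : w =ᶠ[𝓝 t] U d := by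
        filter_upwards [isOpen_Ioo.mem_nhds ht] with s hs using hw s hs
      rw [this.deriv_eq]
      exact (horb d hd hds t (hsub ht)).deriv
    have hprod : ∀ l, ∀ t ∈ Ioo (-(ε / 2)) (δ + ε / 2), diffProd l u t = U (dirDerivProd V l h) t := by
      intro l
      induction l with
      | nil =>
        have h1 := contDiff_dirDeriv hO hV hh hs
        have s1 := tsupport_dirDeriv_subset V h
        have h2 := contDiff_dirDeriv hO hV h1 (s1.trans hs)
        have s2 := (tsupport_dirDeriv_subset V (dirDeriv V h)).trans s1
        exact hder h2 s2 (hder h1 s1 (hder hh subset_rfl huU))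
      | cons m l ih =>
        intro t ht
        simp only [diffProd]
        rw [ih t ht, hder (hsm l) (hts l) ih t ht]
        simp only [U]
        by_cases hy : c t ∈ src
        · simp [chartExt_of_mem _ hy, dirDerivProd]
        · simp [chartExt_of_notMem _ hy]
    have hIcc : Icc 0 δ ⊆ Ioo (-(ε / 2)) (δ + ε / 2) := Icc_subset_Ioo (by linarith) (by linarith)
    have hunif : TendstoUniformlyOn (fun n => diffProd (l n) u) (U χ) atTop (Icc 0 δ) := by
      rw [Metric.tendstoUniformlyOn_iff]
      intro η hη
      filter_upwards [hz.eventually (gt_mem_nhds hη)] with n hn t ht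
      rw [hprod _ t (hIcc ht), dist_comm, dist_eq_norm]
      refine lt_of_le_of_lt ?_ hn
      simp only [U]
      by_cases hy : c t ∈ src
      · rw [chartExt_of_mem _ hy, chartExt_of_mem _ hy]
        exact hlim n _
      · rw [chartExt_of_notMem _ hy, chartExt_of_notMem _ hy]
        simp
    have := hfg u hus huc _ hunif
    rw [huU 0 (hIcc (left_mem_Icc.2 hδ.le))] at this
    rw [show chartExt src κ h (c 0) = U h 0 from rfl, this]
    congr 1
    refine integral_congr_ae (Eventually.of_forall fun t => ?_)
    simp only
    by_cases ht : t ∈ Icc 0 δ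
    · rw [huU t (hIcc ht)]
    · have : g t = 0 := by_contra fun h' => ht (hgs h')
      rw [this, zero_smul, zero_smul]

end VectorFields

/-! ### Factorization along several vector fields in succession -/

section IteratedFactorization

open Set Filter Topology MeasureTheory

theorem integrable_fin_snoc {F : Type*} [NormedAddCommGroup F] {n : ℕ}
    {w : (Fin (n + 1) → ℝ) → F} (hw : Integrable w) :
    Integrable (fun p : (Fin n → ℝ) × ℝ => w (Fin.snoc (α := fun _ => ℝ) p.1 p.2))
      (volume.prod volume) := by
  have h := volume_preserving_piFinSuccAbove (fun _ : Fin (n + 1) => ℝ) (Fin.last n)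
  have h2 := ((h.symm.integrable_comp_emb (MeasurableEquiv.measurableEmbedding _)).2 hw).swap
  refine h2.congr (Eventually.of_forall fun p => ?_)
  simp [MeasurableEquiv.piFinSuccAbove, Fin.insertNthEquiv, Fin.insertNth_last']

theorem integral_fin_snoc {F : Type*} [NormedAddCommGroup F] [NormedSpace ℝ F] {n : ℕ}
    {w : (Fin (n + 1) → ℝ) → F} (hw : Integrable w) :
    ∫ t, w t = ∫ t : Fin n → ℝ, ∫ a : ℝ, w (Fin.snoc (α := fun _ => ℝ) t a) := by
  have h := volume_preserving_piFinSuccAbove (fun _ : Fin (n + 1) => ℝ) (Fin.last n)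
  have h2 := (h.symm.integrable_comp_emb (MeasurableEquiv.measurableEmbedding _)).2 hw
  rw [← h.symm.integral_comp' w, Measure.volume_eq_prod]
  refine (integral_prod_symm _ h2).trans ?_
  simp [MeasurableEquiv.piFinSuccAbove, Fin.insertNthEquiv, Fin.insertNth_last']

theorem integrable_smul_of_support_subset {X F : Type*} [TopologicalSpace X] [T2Space X]
    [MeasurableSpace X] [OpensMeasurableSpace X] {μ : Measure X} [IsFiniteMeasureOnCompacts μ]
    [NormedAddCommGroup F] [NormedSpace ℝ F] [SecondCountableTopologyEither X F]
    {K : Set X} (hK : IsCompact K)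
    {f : X → ℝ} {w : X → F} (hf : ContinuousOn f K) (hs : Function.support f ⊆ K)
    (hw : ContinuousOn w K) : Integrable (fun t => f t • w t) μ := by
  refine (integrableOn_iff_integrable_of_support_subset ?_).1 ((hf.smul hw).integrableOn_compact hK)
  exact fun t ht => hs fun h => ht (by simp only [h, zero_smul])

variable {E : Type*} [NormedAddCommGroup E] [NormedSpace ℝ E]

theorem IsOrbit.mono {Y : Type*} {src : Set Y} {κ : Y → E} {V : E → E} {K K' : Set E} {δ : ℝ}
    {c : ℝ → Y} (h : IsOrbit src κ V K δ c) (hK : K' ⊆ K) : IsOrbit src κ V K' δ c := by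
  obtain ⟨ε, hε, H⟩ := h
  exact ⟨ε, hε, fun d hd hs => H d hd (hs.trans hK)⟩

/-- By induction, each term at the endpoint Ψ n t is factored along the orbit of the next field that
starts there, and the weights multiply. The Boolean in the new index tells whether the term carries
the new function with weight f₁ or keeps the old one with weight g₁. -/
theorem exists_iterated_factorization {V : ℕ → E → E} {O : Set E} (hO : IsOpen O)
    (hV : ∀ i, ContDiffOn ℝ ∞ (V i) O) {h : E → ℂ} (hh : ContDiff ℝ ∞ h) (hs : tsupport h ⊆ O)
    (hc : HasCompactSupport h) {δ : ℝ} (hδ : 0 < δ) (n : ℕ) :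
    ∃ (J : Type) (_ : Fintype J) (f : J → (Fin n → ℝ) → ℝ) (χ : J → E → ℂ),
      (∀ j, ContDiff ℝ ∞ (f j) ∧ Function.support (f j) ⊆ Icc 0 (fun _ => δ) ∧
        ContDiff ℝ ∞ (χ j) ∧ tsupport (χ j) ⊆ tsupport h) ∧
      ∀ {Y : Type*} (src : Set Y) (κ : Y → E) (Ψ : ∀ k : ℕ, (Fin k → ℝ) → Y),
        (∀ k < n, ∀ t ∈ Icc (0 : Fin k → ℝ) (fun _ => δ),
          Ψ (k + 1) (Fin.snoc (α := fun _ => ℝ) t 0) = Ψ k t ∧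
          IsOrbit src κ (V k) (tsupport h) δ
            (fun a => Ψ (k + 1) (Fin.snoc (α := fun _ => ℝ) t a))) →
        (∀ k ≤ n, ∀ d : E → ℂ, ContDiff ℝ ∞ d → tsupport d ⊆ tsupport h →
          ContinuousOn (fun t => chartExt src κ d (Ψ k t)) (Icc 0 (fun _ => δ))) →
        chartExt src κ h (Ψ 0 0) = ∑ j, ∫ t, f j t • chartExt src κ (χ j) (Ψ n t) := by
  induction n with
  | zero =>
    refine ⟨Unit, inferInstance, fun _ _ => 1, fun _ => h, fun _ => ⟨contDiff_const, ?_, hh,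
      subset_rfl⟩, ?_⟩
    · intro t _
      rw [Subsingleton.elim t 0]
      exact ⟨le_rfl, fun i => i.elim0⟩
    · intro Y src κ Ψ _ _
      simp only [one_smul, Finset.univ_unique, Finset.sum_const, Finset.card_singleton]
      rw [volume_pi, Measure.pi_of_empty (x := 0), integral_dirac]
  | succ n ih =>
    obtain ⟨J, hJ, f, χ, hfχ, H⟩ := ih
    choose f₁ g₁ χ₁ hf₁ hg₁ hfs₁ hgs₁ hχ₁ hχs₁ H₁ using fun j =>
      exists_factorization_along_vectorField hO (hV n) (hfχ j).2.2.1
        ((hfχ j).2.2.2.trans hs) (hc.of_isClosed_subset (isClosed_tsupport _) (hfχ j).2.2.2) hδ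
    let F : J × Bool → ℝ → ℝ := fun p => if p.2 then f₁ p.1 else g₁ p.1
    let X : J × Bool → E → ℂ := fun p => if p.2 then χ₁ p.1 else χ p.1
    have hF : ∀ p, ContDiff ℝ ∞ (F p) := by
      rintro ⟨j, b⟩
      cases b
      · exact hg₁ j
      · exact hf₁ j
    have hFs : ∀ p, Function.support (F p) ⊆ Icc 0 δ := by
      rintro ⟨j, b⟩
      cases b
      · exact hgs₁ j
      · exact hfs₁ j
    have hX : ∀ p, ContDiff ℝ ∞ (X p) := by
      rintro ⟨j, b⟩
      cases b
      · exact (hfχ j).2.2.1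
      · exact hχ₁ j
    have hXs : ∀ p, tsupport (X p) ⊆ tsupport h := by
      rintro ⟨j, b⟩
      cases b
      · exact (hfχ j).2.2.2
      · exact (hχs₁ j).trans (hfχ j).2.2.2
    let f' : J × Bool → (Fin (n + 1) → ℝ) → ℝ := fun p t =>
      f p.1 (fun i => t i.castSucc) * F p (t (Fin.last n))
    have hf' : ∀ p, ContDiff ℝ ∞ (f' p) := fun p =>
      ((hfχ p.1).1.comp (by fun_prop)).mul ((hF p).comp (by fun_prop))
    have hfs' : ∀ p, Function.support (f' p) ⊆ Icc 0 (fun _ => δ) := by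
      intro p t ht
      have h1 := (hfχ p.1).2.1 (left_ne_zero_of_mul ht)
      have h2 := hFs p (right_ne_zero_of_mul ht)
      constructor
      · intro i
        refine Fin.lastCases ?_ (fun i => ?_) i
        · exact h2.1
        · exact h1.1 i
      · intro i
        refine Fin.lastCases ?_ (fun i => ?_) i
        · exact h2.2
        · exact h1.2 i
    refine ⟨J × Bool, inferInstance, f', X, fun p => ⟨hf' p, hfs' p, hX p, hXs p⟩, ?_⟩
    intro Y src κ Ψ hΨ hcont
    rw [H src κ Ψ (fun k hk => hΨ k (hk.trans n.lt_succ_self))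
      (fun k hk => hcont k (hk.trans n.le_succ)), Fintype.sum_prod_type]
    refine Finset.sum_congr rfl fun j _ => ?_
    have hint : ∀ p, Integrable fun t => f' p t • chartExt src κ (X p) (Ψ (n + 1) t) := fun p =>
      integrable_smul_of_support_subset isCompact_Icc (hf' p).continuous.continuousOn (hfs' p)
        (hcont (n + 1) le_rfl _ (hX p) (hXs p))
    have hsnoc : ∀ p, ∫ t, f' p t • chartExt src κ (X p) (Ψ (n + 1) t) =
        ∫ t : Fin n → ℝ, f p.1 t • ∫ a : ℝ, F p a •
          chartExt src κ (X p) (Ψ (n + 1) (Fin.snoc (α := fun _ => ℝ) t a)) := by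
      intro p
      rw [integral_fin_snoc (hint p)]
      refine integral_congr_ae (Eventually.of_forall fun t => ?_)
      simp only [f', Fin.snoc_castSucc, Fin.snoc_last, mul_smul]
      rw [integral_smul]
    have hint2 : ∀ p, Integrable fun t : Fin n → ℝ => f p.1 t • ∫ a : ℝ, F p a •
          chartExt src κ (X p) (Ψ (n + 1) (Fin.snoc (α := fun _ => ℝ) t a)) := by
      intro p
      refine (integrable_fin_snoc (hint p)).integral_prod_left.congr
        (Eventually.of_forall fun t => ?_)
      simp only [f', Fin.snoc_castSucc, Fin.snoc_last, mul_smul]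
      rw [integral_smul]
    simp only [Fintype.sum_bool, hsnoc]
    rw [← integral_add (hint2 (j, true)) (hint2 (j, false))]
    refine integral_congr_ae (Eventually.of_forall fun t => ?_)
    simp only
    -- Orbits are only assumed for t in the cube; elsewhere the weight vanishes.
    by_cases ht : t ∈ Icc (0 : Fin n → ℝ) (fun _ => δ)
    · obtain ⟨h0, horb⟩ := hΨ n n.lt_succ_self t ht
      have := H₁ j src κ _ (horb.mono (hfχ j).2.2.2)
      simp only [h0] at this
      rw [this, smul_add]
      rfl
    · have : f j t = 0 := by_contra fun h' => ht ((hfχ j).2.1 h')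
      rw [this]
      simp

end IteratedFactorization
-- Charts adapted to a submersion and a section
section Submersion
open Set Filter Topology Manifold

variable {E E' E₁ : Type*} [NormedAddCommGroup E] [NormedSpace ℝ E] [NormedAddCommGroup E']
  [NormedSpace ℝ E'] [NormedAddCommGroup E₁] [NormedSpace ℝ E₁]
  {X Y : Type*} [TopologicalSpace X] [ChartedSpace E X] [TopologicalSpace Y] [ChartedSpace E' Y]

/-- The charts of a submersion `f`, unpacked: `f` is the first projection in the charts. -/
theorem Manifold.IsSubmersionAt.exists_charts {f : X → Y} {a : X}
    (h : IsSubmersionAt 𝓘(ℝ, E) 𝓘(ℝ, E') ∞ f a) :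
    ∃ (A : E ≃L[ℝ] (E' × h.complement)) (d : OpenPartialHomeomorph X E)
      (k : OpenPartialHomeomorph Y E'),
      a ∈ d.source ∧ d ∈ IsManifold.maximalAtlas 𝓘(ℝ, E) ∞ X ∧
      k ∈ IsManifold.maximalAtlas 𝓘(ℝ, E') ∞ Y ∧ MapsTo f d.source k.source ∧
      ∀ x ∈ d.source, k (f x) = (A (d x)).1 := by
  refine ⟨h.equiv, h.domChart, h.codChart, h.mem_domChart_source, h.domChart_mem_maximalAtlas,
    h.codChart_mem_maximalAtlas, fun x hx => h.source_subset_preimage_source hx, fun x hx => ?_⟩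
  have hx' : h.domChart x ∈ (h.domChart.extend 𝓘(ℝ, E)).target := by
    simpa using h.domChart.map_source hx
  have := h.writtenInCharts hx'
  simpa [h.domChart.left_inv hx] using this

/-- A submersion has a smooth local section through every point. -/
theorem Manifold.IsSubmersionAt.exists_local_section {f : X → Y} {a : X}
    (h : IsSubmersionAt 𝓘(ℝ, E) 𝓘(ℝ, E') ∞ f a) :
    ∃ σ : Y → X, ContMDiffAt 𝓘(ℝ, E') 𝓘(ℝ, E) ∞ σ (f a) ∧ σ (f a) = a ∧
      ∀ᶠ y in 𝓝 (f a), f (σ y) = y := by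
  obtain ⟨A, d, k, ha, hd, hk, hm, hA⟩ := h.exists_charts
  have hkf : f a ∈ k.source := hm ha
  have e0 : A.symm (k (f a), (A (d a)).2) = d a := by
    rw [hA a ha, Prod.mk.eta, A.symm_apply_apply]
  have h1 : ContMDiffAt 𝓘(ℝ, E') 𝓘(ℝ, E) ∞ (fun y => A.symm (k y, (A (d a)).2)) (f a) := by
    have hk' := (contMDiffOn_of_mem_maximalAtlas hk).contMDiffAt (k.open_source.mem_nhds hkf)
    have h2 : ContDiff ℝ ∞ (fun z : E' => A.symm (z, (A (d a)).2)) := by fun_prop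
    exact h2.contMDiff.contMDiffAt.comp _ hk'
  refine ⟨fun y => d.symm (A.symm (k y, (A (d a)).2)), ?_, ?_, ?_⟩
  · refine ContMDiffAt.comp (f a) (g := d.symm) (I' := 𝓘(ℝ, E)) ?_ h1
    simp only [e0]
    exact (contMDiffOn_symm_of_mem_maximalAtlas hd).contMDiffAt
      (d.open_target.mem_nhds (d.map_source ha))
  · simp only [e0, d.left_inv ha]
  · have h3 : ∀ᶠ y in 𝓝 (f a), A.symm (k y, (A (d a)).2) ∈ d.target :=
      h1.continuousAt.eventually_mem (d.open_target.mem_nhds (by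
        simpa only [e0] using d.map_source ha))
    filter_upwards [h3, k.open_source.mem_nhds hkf] with y hy hy'
    refine k.injOn (hm (d.map_target hy)) hy' ?_
    rw [hA _ (d.map_target hy), d.right_inv hy, A.apply_symm_apply]

theorem Manifold.IsSubmersionAt.mfderiv_surjective {f : X → Y} {a : X}
    (h : IsSubmersionAt 𝓘(ℝ, E) 𝓘(ℝ, E') ∞ f a) :
    Function.Surjective (mfderiv 𝓘(ℝ, E) 𝓘(ℝ, E') f a) := by
  obtain ⟨σ, hσ, h0, h1⟩ := h.exists_local_section
  have hf : MDifferentiableAt 𝓘(ℝ, E) 𝓘(ℝ, E') f (σ (f a)) := by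
    rw [h0]; exact h.contMDiffAt.mdifferentiableAt (by simp)
  have h2 := mfderiv_comp (f a) hf (hσ.mdifferentiableAt (by simp))
  have h3 : f ∘ σ =ᶠ[𝓝 (f a)] id := h1
  rw [h3.mfderiv_eq, mfderiv_id] at h2
  intro v
  have h4 := DFunLike.congr_fun h2 v
  rw [h0] at h4
  exact ⟨_, h4.symm⟩

/-- Near a point of a smooth section `u` of a submersion `f` there is a chart whose second
component is a chart of the base, and which maps the section into the zero section. -/
theorem Manifold.IsSubmersion.exists_chart_along_section [FiniteDimensional ℝ E]
    [FiniteDimensional ℝ E'] [FiniteDimensional ℝ E₁]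
    (hdim : Module.finrank ℝ E = Module.finrank ℝ E₁ + Module.finrank ℝ E')
    {f : X → Y} (h : IsSubmersion 𝓘(ℝ, E) 𝓘(ℝ, E') ∞ f) {u : Y → X}
    (hu : ContMDiff 𝓘(ℝ, E') 𝓘(ℝ, E) ∞ u) (hfu : ∀ y, f (u y) = y) (y₀ : Y) :
    ∃ (k : OpenPartialHomeomorph Y E') (e : OpenPartialHomeomorph X (E₁ × E')),
      k ∈ IsManifold.maximalAtlas 𝓘(ℝ, E') ∞ Y ∧
      ContMDiffOn 𝓘(ℝ, E) 𝓘(ℝ, E₁ × E') ∞ e e.source ∧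
      ContMDiffOn 𝓘(ℝ, E₁ × E') 𝓘(ℝ, E) ∞ e.symm e.target ∧
      u y₀ ∈ e.source ∧ (∀ x ∈ e.source, f x ∈ k.source ∧ (e x).2 = k (f x)) ∧
      ∀ y, u y ∈ e.source → e (u y) = (0, k y) := by
  obtain ⟨A, d, k, ha, hd, hk, hm, hA⟩ := (h.isSubmersionAt (u y₀)).exists_charts
  set F := (h.isSubmersionAt (u y₀)).complement
  have hfF : FiniteDimensional ℝ (E' × F) := A.toLinearEquiv.finiteDimensional
  have hfF' : FiniteDimensional ℝ F :=
    FiniteDimensional.of_injective (LinearMap.inr ℝ E' F) LinearMap.inr_injective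
  have hFd : Module.finrank ℝ F = Module.finrank ℝ E₁ := by
    have h1 : Module.finrank ℝ E = Module.finrank ℝ E' + Module.finrank ℝ F :=
      A.toLinearEquiv.finrank_eq.trans Module.finrank_prod
    omega
  let T : F ≃L[ℝ] E₁ := ContinuousLinearEquiv.ofFinrankEq hFd
  have hdc := contMDiffOn_of_mem_maximalAtlas hd
  have hds := contMDiffOn_symm_of_mem_maximalAtlas hd
  have hkc := contMDiffOn_of_mem_maximalAtlas hk
  have hks := contMDiffOn_symm_of_mem_maximalAtlas hk
  have hf : ContMDiff 𝓘(ℝ, E) 𝓘(ℝ, E') ∞ f := h.contMDiff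
  have huf : ContMDiff 𝓘(ℝ, E) 𝓘(ℝ, E) ∞ (fun x => u (f x)) := hu.comp hf
  let w : E' → F := fun z => (A (d (u (k.symm z)))).2
  let S : Set X := d.source ∩ (fun x => u (f x)) ⁻¹' d.source
  have hS : IsOpen S := d.open_source.inter (d.open_source.preimage huf.continuous)
  let P : Set E' := k.target ∩ k.symm ⁻¹' (u ⁻¹' d.source)
  have hP : IsOpen P := k.isOpen_inter_preimage_symm (d.open_source.preimage hu.continuous)
  have hAs : ContDiff ℝ ∞ (fun x => (A x).2) := by fun_prop
  have hAf : ContDiff ℝ ∞ (fun x => (A x).1) := by fun_prop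
  have hw : ContMDiffOn 𝓘(ℝ, E') 𝓘(ℝ, F) ∞ w P :=
    hAs.contMDiff.comp_contMDiffOn (hdc.comp
      (hu.comp_contMDiffOn (hks.mono inter_subset_left)) (fun z hz => hz.2))
  let g : E₁ × E' → E := fun q => A.symm (q.2, T.symm q.1 + w q.2)
  have hg : ContMDiffOn 𝓘(ℝ, E₁ × E') 𝓘(ℝ, E) ∞ g (Prod.snd ⁻¹' P) := by
    have hwd : ContDiffOn ℝ ∞ w P := contMDiffOn_iff_contDiffOn.1 hw
    rw [contMDiffOn_iff_contDiffOn]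
    have h1 : ContDiffOn ℝ ∞ (fun q : E₁ × E' => w q.2) (Prod.snd ⁻¹' P) :=
      hwd.comp contDiff_snd.contDiffOn (fun q hq => hq)
    exact A.symm.contDiff.comp_contDiffOn (contDiff_snd.contDiffOn.prodMk
      ((T.symm.contDiff.comp contDiff_fst).contDiffOn.add h1))
  -- Subtracting the fibre coordinate of u(f(x)) straightens the section u to the zero section.
  let ef : X → E₁ × E' := fun x => (T ((A (d x)).2 - (A (d (u (f x)))).2), k (f x))
  have hef : ContMDiffOn 𝓘(ℝ, E) 𝓘(ℝ, E₁ × E') ∞ ef S := by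
    have h1 : ContMDiffOn 𝓘(ℝ, E) 𝓘(ℝ, E) ∞ d S := hdc.mono inter_subset_left
    have h2 : ContMDiffOn 𝓘(ℝ, E) 𝓘(ℝ, E) ∞ (fun x => d (u (f x))) S :=
      hdc.comp huf.contMDiffOn (fun x hx => hx.2)
    have h3 : ContMDiffOn 𝓘(ℝ, E) 𝓘(ℝ, E') ∞ (fun x => k (f x)) S :=
      hkc.comp hf.contMDiffOn (fun x hx => hm hx.1)
    have h4 := (T.contDiff (n := ∞)).contMDiff.comp_contMDiffOn
      ((hAs.contMDiff.comp_contMDiffOn h1).sub (hAs.contMDiff.comp_contMDiffOn h2))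
    exact h4.prodMk_space h3
  have hwk : ∀ x, f x ∈ k.source → w (k (f x)) = (A (d (u (f x)))).2 := fun x hx => by
    simp only [w, k.left_inv hx]
  have hgef : ∀ x ∈ S, g (ef x) = d x := fun x hx => by
    simp only [g, ef, hwk x (hm hx.1), T.symm_apply_apply, sub_add_cancel]
    rw [hA x hx.1, Prod.mk.eta, A.symm_apply_apply]
  have hfd : ∀ q, q.2 ∈ P → g q ∈ d.target → f (d.symm (g q)) = k.symm q.2 := by
    intro q hq hq'
    refine k.injOn (hm (d.map_target hq')) (k.map_target hq.1) ?_
    rw [hA _ (d.map_target hq'), d.right_inv hq', k.right_inv hq.1]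
    simp only [g, A.apply_symm_apply]
  let e : OpenPartialHomeomorph X (E₁ × E') :=
    { toFun := ef
      invFun := fun q => d.symm (g q)
      source := S
      target := Prod.snd ⁻¹' P ∩ g ⁻¹' d.target
      map_source' := by
        intro x hx
        refine ⟨⟨k.map_source (hm hx.1), ?_⟩, ?_⟩
        · simpa [ef, k.left_inv (hm hx.1)] using hx.2
        · simpa [hgef x hx] using d.map_source hx.1
      map_target' := by
        rintro q ⟨hq, hq'⟩
        refine ⟨d.map_target hq', ?_⟩
        simpa [hfd q hq hq'] using hq.2
      left_inv' := by
        intro x hx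
        simp only [hgef x hx, d.left_inv hx.1]
      right_inv' := by
        rintro q ⟨hq, hq'⟩
        refine Prod.ext ?_ ?_
        · simp only [ef, hfd q hq hq', d.right_inv hq']
          simp [g, w]
        · simp only [ef, hfd q hq hq', k.right_inv hq.1]
      open_source := hS
      open_target := hg.continuousOn.isOpen_inter_preimage (hP.preimage continuous_snd)
        d.open_target
      continuousOn_toFun := hef.continuousOn
      continuousOn_invFun := (hds.comp (hg.mono inter_subset_left)
        (fun q hq => hq.2)).continuousOn }
  refine ⟨k, e, hk, hef, hds.comp (hg.mono inter_subset_left) (fun q hq => hq.2), ⟨ha, ?_⟩,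
    fun x hx => ⟨hm hx.1, rfl⟩, fun y hy => ?_⟩
  · simpa [hfu] using ha
  · change ef (u y) = _
    simp [ef, hfu]
end Submersion
-- Charts near the units and left translations in them
namespace LieGroupoid
section UnitChart
open Set Filter Topology

variable {n₁ n₀ : ℕ} {G M : Type*}
    [TopologicalSpace G] [ChartedSpace (EuclideanSpace ℝ (Fin (n₁ + n₀))) G]
    [TopologicalSpace M] [ChartedSpace (EuclideanSpace ℝ (Fin n₀)) M]
    {𝒢 : LieGroupoid n₁ n₀ G M}

variable (𝒢) in
/-- A chart of `G` near units, whose second component is a chart of `M` composed with the source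
map, and in which units have vanishing first component. -/
structure UnitChart where
  /-- the chart of `M` -/
  k : OpenPartialHomeomorph M (EuclideanSpace ℝ (Fin n₀))
  /-- the chart of `G` -/
  e : OpenPartialHomeomorph G (EuclideanSpace ℝ (Fin n₁) × EuclideanSpace ℝ (Fin n₀))
  k_smooth : ContMDiffOn (𝓡 n₀) (𝓡 n₀) ∞ k k.source
  k_symm_smooth : ContMDiffOn (𝓡 n₀) (𝓡 n₀) ∞ k.symm k.target
  e_smooth : ContMDiffOn (𝓡 (n₁ + n₀))
    𝓘(ℝ, EuclideanSpace ℝ (Fin n₁) × EuclideanSpace ℝ (Fin n₀)) ∞ e e.source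
  e_symm_smooth : ContMDiffOn 𝓘(ℝ, EuclideanSpace ℝ (Fin n₁) × EuclideanSpace ℝ (Fin n₀))
    (𝓡 (n₁ + n₀)) ∞ e.symm e.target
  s_mem : ∀ β ∈ e.source, 𝒢.s β ∈ k.source
  e_snd : ∀ β ∈ e.source, (e β).2 = k (𝒢.s β)
  e_unit : ∀ x, 𝒢.unit x ∈ e.source → e (𝒢.unit x) = (0, k x)

theorem r_contMDiff : ContMDiff (𝓡 (n₁ + n₀)) (𝓡 n₀) ∞ 𝒢.r := 𝒢.r_submersion.contMDiff

theorem s_contMDiff : ContMDiff (𝓡 (n₁ + n₀)) (𝓡 n₀) ∞ 𝒢.s := 𝒢.s_submersion.contMDiff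

theorem inv_inv (α : G) : 𝒢.inv (𝒢.inv α) = α := by
  have h1 := 𝒢.mul_assoc (𝒢.inv (𝒢.inv α)) (𝒢.inv α) α (𝒢.s_inv _) (𝒢.s_inv _)
  rw [𝒢.inv_mul (𝒢.inv α), 𝒢.s_inv, 𝒢.unit_mul, 𝒢.inv_mul] at h1
  have h2 := 𝒢.mul_unit (𝒢.inv (𝒢.inv α))
  rw [𝒢.s_inv, 𝒢.r_inv] at h2
  exact h2.symm.trans h1.symm

theorem inv_unit (x : M) : 𝒢.inv (𝒢.unit x) = 𝒢.unit x := by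
  have h := 𝒢.mul_inv (𝒢.unit x)
  have h2 := 𝒢.unit_mul (𝒢.inv (𝒢.unit x))
  rw [𝒢.r_inv, 𝒢.s_unit] at h2
  rw [h2, 𝒢.r_unit] at h
  exact h

theorem mul_inv_cancel_right {α β : G} (h : 𝒢.s α = 𝒢.r β) :
    𝒢.mul (𝒢.mul α β) (𝒢.inv β) = α := by
  rw [𝒢.mul_assoc _ _ _ h (𝒢.r_inv β).symm, 𝒢.mul_inv, ← h, 𝒢.mul_unit]

theorem inv_mul_cancel_right {α β : G} (h : 𝒢.s α = 𝒢.s β) :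
    𝒢.mul (𝒢.mul α (𝒢.inv β)) β = α := by
  rw [𝒢.mul_assoc _ _ _ (by rw [h, 𝒢.r_inv]) (𝒢.s_inv β), 𝒢.inv_mul, ← h, 𝒢.mul_unit]

theorem mul_inv_rev {α β : G} (h : 𝒢.s α = 𝒢.r β) :
    𝒢.inv (𝒢.mul α β) = 𝒢.mul (𝒢.inv β) (𝒢.inv α) := by
  have h1 : 𝒢.s (𝒢.inv β) = 𝒢.r (𝒢.inv α) := by rw [𝒢.s_inv, 𝒢.r_inv, h]
  have h2 : 𝒢.mul (𝒢.mul (𝒢.inv β) (𝒢.inv α)) (𝒢.mul α β) = 𝒢.unit (𝒢.s β) := by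
    rw [𝒢.mul_assoc _ _ _ h1 (by rw [𝒢.s_inv, 𝒢.r_mul _ _ h]),
      ← 𝒢.mul_assoc _ α β (𝒢.s_inv α) h, 𝒢.inv_mul, h, 𝒢.unit_mul, 𝒢.inv_mul]
  have h3 := mul_inv_cancel_right (𝒢 := 𝒢) (α := 𝒢.mul (𝒢.inv β) (𝒢.inv α)) (β := 𝒢.mul α β)
    (by rw [𝒢.s_mul _ _ h1, 𝒢.s_inv, 𝒢.r_mul _ _ h])
  have h4 := 𝒢.unit_mul (𝒢.inv (𝒢.mul α β))
  rw [𝒢.r_inv, 𝒢.s_mul _ _ h] at h4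
  rw [← h3, h2, h4]

namespace UnitChart

theorem exists_mem_source (x₀ : M) : ∃ c : 𝒢.UnitChart, 𝒢.unit x₀ ∈ c.e.source := by
  obtain ⟨k, e, hk, he, hes, h0, h1, h2⟩ :=
    𝒢.s_submersion.exists_chart_along_section (E₁ := EuclideanSpace ℝ (Fin n₁))
      (by simp) 𝒢.unit_smooth 𝒢.s_unit x₀
  exact ⟨⟨k, e, contMDiffOn_of_mem_maximalAtlas hk, contMDiffOn_symm_of_mem_maximalAtlas hk,
    he, hes, fun β hβ => (h1 β hβ).1, fun β hβ => (h1 β hβ).2, h2⟩, h0⟩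

/-- Restriction of a chart near units to an open set. -/
def restr (c : 𝒢.UnitChart) (W : Set G) (hW : IsOpen W) : 𝒢.UnitChart where
  k := c.k
  e := c.e.restrOpen W hW
  k_smooth := c.k_smooth
  k_symm_smooth := c.k_symm_smooth
  e_smooth := c.e_smooth.mono (by simp)
  e_symm_smooth := c.e_symm_smooth.mono fun _ hq => hq.1
  s_mem β hβ := c.s_mem β (by simp at hβ; exact hβ.1)
  e_snd β hβ := c.e_snd β (by simp at hβ; exact hβ.1)
  e_unit x hx := c.e_unit x (by simp at hx; exact hx.1)

theorem restr_source (c : 𝒢.UnitChart) {W : Set G} (hW : IsOpen W) :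
    (c.restr W hW).e.source = c.e.source ∩ W := by simp [restr]

variable (c : 𝒢.UnitChart)

theorem s_symm {q : EuclideanSpace ℝ (Fin n₁) × EuclideanSpace ℝ (Fin n₀)}
    (hq : q ∈ c.e.target) : 𝒢.s (c.e.symm q) = c.k.symm q.2 := by
  have h := c.e.map_target hq
  rw [← c.k.left_inv (c.s_mem _ h), ← c.e_snd _ h, c.e.right_inv hq]

/-- The set of base points whose units lie in the domain of the chart. -/
def base : Set M := 𝒢.unit ⁻¹' c.e.source

theorem isOpen_base : IsOpen c.base := c.e.open_source.preimage 𝒢.unit_smooth.continuous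

theorem base_subset : c.base ⊆ c.k.source := fun x hx => by
  have := c.s_mem _ hx
  rwa [𝒢.s_unit] at this

variable {c}

theorem zero_mem {x : M} (hx : x ∈ c.base) :
    ((0 : EuclideanSpace ℝ (Fin n₁)), c.k x) ∈ c.e.target := by
  rw [← c.e_unit x hx]; exact c.e.map_source hx

theorem symm_zero {x : M} (hx : x ∈ c.base) :
    c.e.symm ((0 : EuclideanSpace ℝ (Fin n₁)), c.k x) = 𝒢.unit x := by
  rw [← c.e_unit x hx, c.e.left_inv hx]

theorem s_symm_of_mem {x : M} (hx : x ∈ c.k.source) {y : EuclideanSpace ℝ (Fin n₁)}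
    (hq : (y, c.k x) ∈ c.e.target) : 𝒢.s (c.e.symm (y, c.k x)) = x := by
  rw [c.s_symm hq, c.k.left_inv hx]

variable (c)

/-- Left translation of `γ` by the element with coordinate `y` of the fibre over `r(γ)`. -/
noncomputable def trans (y : EuclideanSpace ℝ (Fin n₁)) (γ : G) : G :=
  𝒢.mul (c.e.symm (y, c.k (𝒢.r γ))) γ

/-- The domain of `trans`. -/
def transDomain : Set (EuclideanSpace ℝ (Fin n₁) × G) :=
  {q | 𝒢.r q.2 ∈ c.base ∧ (q.1, c.k (𝒢.r q.2)) ∈ c.e.target}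

theorem trans_aux : ContMDiffOn (𝓘(ℝ, EuclideanSpace ℝ (Fin n₁)).prod (𝓡 (n₁ + n₀)))
    𝓘(ℝ, EuclideanSpace ℝ (Fin n₁) × EuclideanSpace ℝ (Fin n₀)) ∞
    (fun q : EuclideanSpace ℝ (Fin n₁) × G => (q.1, c.k (𝒢.r q.2)))
    (Prod.snd ⁻¹' (𝒢.r ⁻¹' c.base)) :=
  contMDiffOn_fst.prodMk_space (c.k_smooth.comp
    (r_contMDiff.comp contMDiff_snd).contMDiffOn (fun _ hq => c.base_subset hq))

theorem isOpen_transDomain : IsOpen c.transDomain :=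
  c.trans_aux.continuousOn.isOpen_inter_preimage ((c.isOpen_base.preimage
    r_contMDiff.continuous).preimage continuous_snd) c.e.open_target

theorem zero_mem_transDomain {γ : G} (hγ : 𝒢.r γ ∈ c.base) :
    ((0 : EuclideanSpace ℝ (Fin n₁)), γ) ∈ c.transDomain := ⟨hγ, zero_mem hγ⟩

theorem trans_zero {γ : G} (hγ : 𝒢.r γ ∈ c.base) : c.trans 0 γ = γ := by
  rw [trans, symm_zero hγ, 𝒢.unit_mul]

theorem s_trans {y : EuclideanSpace ℝ (Fin n₁)} {γ : G} (h : (y, γ) ∈ c.transDomain) :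
    𝒢.s (c.trans y γ) = 𝒢.s γ :=
  𝒢.s_mul _ _ (s_symm_of_mem (c.base_subset h.1) h.2)

theorem contMDiffOn_trans : ContMDiffOn (𝓘(ℝ, EuclideanSpace ℝ (Fin n₁)).prod (𝓡 (n₁ + n₀)))
    (𝓡 (n₁ + n₀)) ∞ (fun q : EuclideanSpace ℝ (Fin n₁) × G => c.trans q.1 q.2) c.transDomain :=
  𝒢.mul_smooth.comp (t := {p : G × G | 𝒢.s p.1 = 𝒢.r p.2})
    (f := fun q : EuclideanSpace ℝ (Fin n₁) × G => (c.e.symm (q.1, c.k (𝒢.r q.2)), q.2))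
    ((c.e_symm_smooth.comp (c.trans_aux.mono fun _ h => h.1) fun _ h => h.2).prodMk
      contMDiffOn_snd) fun _ h => s_symm_of_mem (c.base_subset h.1) h.2

end UnitChart
end UnitChart
end LieGroupoid
-- Right-invariant vector fields generated by the translations
namespace LieGroupoid
section TransField
open Set Filter Topology

variable {n₁ n₀ : ℕ} {G M : Type*}
    [TopologicalSpace G] [ChartedSpace (EuclideanSpace ℝ (Fin (n₁ + n₀))) G]
    [TopologicalSpace M] [ChartedSpace (EuclideanSpace ℝ (Fin n₀)) M]
    {𝒢 : LieGroupoid n₁ n₀ G M} {H : Type*} [NormedAddCommGroup H] [NormedSpace ℝ H]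

/-- A chart with values in some normed space that is smooth in both directions. -/
structure IsSmoothChart (n : ℕ) {G H : Type*} [TopologicalSpace G]
    [ChartedSpace (EuclideanSpace ℝ (Fin n)) G] [NormedAddCommGroup H] [NormedSpace ℝ H]
    (κ : OpenPartialHomeomorph G H) : Prop where
  smooth : ContMDiffOn (𝓡 n) 𝓘(ℝ, H) ∞ κ κ.source
  symm_smooth : ContMDiffOn 𝓘(ℝ, H) (𝓡 n) ∞ κ.symm κ.target

theorem isSmoothChart_chartAt [IsManifold (𝓡 (n₁ + n₀)) ∞ G] (γ : G) :
    IsSmoothChart (n₁ + n₀) (chartAt (EuclideanSpace ℝ (Fin (n₁ + n₀))) γ) :=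
  ⟨contMDiffOn_chart, contMDiffOn_chart_symm⟩

namespace UnitChart

variable (c : 𝒢.UnitChart) (κ : OpenPartialHomeomorph G H)

theorem isSmoothChart : IsSmoothChart (n₁ + n₀) c.e := ⟨c.e_smooth, c.e_symm_smooth⟩

/-- The translations `trans`, read in a chart `κ` of `G`. -/
noncomputable def transMap (q : EuclideanSpace ℝ (Fin n₁) × H) : H :=
  κ (c.trans q.1 (κ.symm q.2))

/-- The vector field generated by the translations along the `i`-th coordinate, read in a chart. -/
noncomputable def transField (i : Fin n₁) (w : H) : H :=
  fderiv ℝ (c.transMap κ) (0, w) (EuclideanSpace.single i 1, 0)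

/-- The domain of `transMap`. -/
def transMapDomain {H : Type*} [TopologicalSpace H] (κ : OpenPartialHomeomorph G H) :
    Set (EuclideanSpace ℝ (Fin n₁) × H) :=
  {q | (q.2 ∈ κ.target ∧ (q.1, κ.symm q.2) ∈ c.transDomain) ∧ c.trans q.1 (κ.symm q.2) ∈ κ.source}

/-- The domain of `transField`. -/
def fieldDomain {H : Type*} [TopologicalSpace H] (κ : OpenPartialHomeomorph G H) : Set H :=
  κ.target ∩ κ.symm ⁻¹' (𝒢.r ⁻¹' c.base)

theorem isOpen_fieldDomain {H : Type*} [TopologicalSpace H] (κ : OpenPartialHomeomorph G H) :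
    IsOpen (c.fieldDomain κ) :=
  κ.isOpen_inter_preimage_symm (c.isOpen_base.preimage r_contMDiff.continuous)

variable {c κ}

theorem zero_mem_transMapDomain {H : Type*} [TopologicalSpace H] {κ : OpenPartialHomeomorph G H}
    {w : H} (hw : w ∈ c.fieldDomain κ) :
    ((0 : EuclideanSpace ℝ (Fin n₁)), w) ∈ c.transMapDomain κ := by
  refine ⟨⟨hw.1, c.zero_mem_transDomain hw.2⟩, ?_⟩
  simp only [c.trans_zero hw.2]
  exact κ.map_target hw.1

theorem isOpen_and_contMDiffOn_transMap (hκ : IsSmoothChart (n₁ + n₀) κ) : IsOpen (c.transMapDomain κ) ∧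
    ContDiffOn ℝ ∞ (c.transMap κ) (c.transMapDomain κ) := by
  have h0 : ContMDiffOn 𝓘(ℝ, EuclideanSpace ℝ (Fin n₁) × H)
      (𝓘(ℝ, EuclideanSpace ℝ (Fin n₁)).prod (𝓡 (n₁ + n₀))) ∞
      (fun q : EuclideanSpace ℝ (Fin n₁) × H => (q.1, κ.symm q.2)) (Prod.snd ⁻¹' κ.target) :=
    contDiff_fst.contMDiff.contMDiffOn.prodMk
      (hκ.symm_smooth.comp contDiff_snd.contMDiff.contMDiffOn fun _ hq => hq)
  have h1 : IsOpen {q : EuclideanSpace ℝ (Fin n₁) × H |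
      q.2 ∈ κ.target ∧ (q.1, κ.symm q.2) ∈ c.transDomain} :=
    h0.continuousOn.isOpen_inter_preimage (κ.open_target.preimage continuous_snd)
      c.isOpen_transDomain
  have hsub : {q : EuclideanSpace ℝ (Fin n₁) × H |
      q.2 ∈ κ.target ∧ (q.1, κ.symm q.2) ∈ c.transDomain} ⊆ Prod.snd ⁻¹' κ.target :=
    fun q hq => hq.1
  have h2 := c.contMDiffOn_trans.comp (h0.mono hsub) fun q hq => hq.2
  refine ⟨h2.continuousOn.isOpen_inter_preimage h1 κ.open_source, ?_⟩
  rw [← contMDiffOn_iff_contDiffOn]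
  exact hκ.smooth.comp (h2.mono fun q hq => hq.1) fun q hq => hq.2

theorem contDiffAt_transMap (hκ : IsSmoothChart (n₁ + n₀) κ) {w : H} (hw : w ∈ c.fieldDomain κ) :
    ContDiffAt ℝ ∞ (c.transMap κ) (0, w) :=
  (isOpen_and_contMDiffOn_transMap hκ).2.contDiffAt
    ((isOpen_and_contMDiffOn_transMap hκ).1.mem_nhds (zero_mem_transMapDomain hw))

theorem contDiffOn_transField (hκ : IsSmoothChart (n₁ + n₀) κ) (i : Fin n₁) :
    ContDiffOn ℝ ∞ (c.transField κ i) (c.fieldDomain κ) := by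
  intro w hw
  have h1 : ContDiffAt ℝ ∞ (fderiv ℝ (c.transMap κ)) (0, w) :=
    (contDiffAt_transMap hκ hw).fderiv_right (m := ∞) (by simp)
  have h2 : ContDiffAt ℝ ∞ (fun w : H => ((0 : EuclideanSpace ℝ (Fin n₁)), w)) w := by fun_prop
  exact ((h1.comp w h2).clm_apply contDiffAt_const).contDiffWithinAt

/-- The derivative of `trans` along a coordinate, read in a chart. -/
theorem hasFDerivAt_trans (hκ : IsSmoothChart (n₁ + n₀) κ) {γ : G} (hγ : γ ∈ κ.source)
    (hr : 𝒢.r γ ∈ c.base) :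
    ∃ L : EuclideanSpace ℝ (Fin n₁) →L[ℝ] H, HasFDerivAt (fun y => κ (c.trans y γ)) L 0 ∧
      ∀ i, L (EuclideanSpace.single i 1) = c.transField κ i (κ γ) := by
  have hw : κ γ ∈ c.fieldDomain κ :=
    ⟨κ.map_source hγ, by simpa only [mem_preimage, κ.left_inv hγ] using hr⟩
  have h1 := ((contDiffAt_transMap hκ hw).differentiableAt (by simp)).hasFDerivAt
  have h2 := h1.comp (0 : EuclideanSpace ℝ (Fin n₁)) (hasFDerivAt_prodMk_left (𝕜 := ℝ)
    (0 : EuclideanSpace ℝ (Fin n₁)) (κ γ))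
  refine ⟨_, h2.congr_of_eventuallyEq (.of_forall fun y => ?_), fun i => ?_⟩
  · simp [transMap, κ.left_inv hγ]
  · simp [transField]

end UnitChart

/-- In the Hausdorff space G the image of the compact support of d is closed, so the extension by
zero is smooth across the boundary of the chart domain. -/
theorem contMDiff_chartExt [T2Space G] {κ : OpenPartialHomeomorph G H}
    (hκ : IsSmoothChart (n₁ + n₀) κ) {d : H → ℂ} (hd : ContDiff ℝ ∞ d)
    (hc : HasCompactSupport d)
    (hs : tsupport d ⊆ κ.target) :
    ContMDiff (𝓡 (n₁ + n₀)) 𝓘(ℝ, ℂ) ∞ (chartExt κ.source κ d) ∧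
      tsupport (chartExt κ.source κ d) ⊆ κ.symm '' tsupport d := by
  have hK : IsCompact (κ.symm '' tsupport d) :=
    hc.isCompact.image_of_continuousOn (κ.continuousOn_symm.mono hs)
  have h0 : ∀ γ ∉ κ.symm '' tsupport d, chartExt κ.source κ d γ = 0 := by
    intro γ hγ
    by_cases h : γ ∈ κ.source
    · rw [chartExt_of_mem d h]
      by_contra h'
      exact hγ ⟨κ γ, subset_tsupport _ h', κ.left_inv h⟩
    · exact chartExt_of_notMem d h
  have h1 : tsupport (chartExt κ.source κ d) ⊆ κ.symm '' tsupport d :=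
    closure_minimal (fun γ hγ => by_contra fun h => hγ (h0 γ h)) hK.isClosed
  refine ⟨fun γ => ?_, h1⟩
  by_cases h : γ ∈ κ.source
  · have h2 := (hκ.smooth.contMDiffAt (κ.open_source.mem_nhds h))
    refine (hd.contMDiff.contMDiffAt.comp γ h2).congr_of_eventuallyEq ?_
    filter_upwards [κ.open_source.mem_nhds h] with β hβ
    exact chartExt_of_mem d hβ
  · have h2 : (κ.symm '' tsupport d)ᶜ ∈ 𝓝 γ := hK.isClosed.isOpen_compl.mem_nhds (by
      rintro ⟨w, hw, rfl⟩
      exact h (κ.map_target (hs hw)))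
    refine (contMDiffAt_const (c := (0 : ℂ))).congr_of_eventuallyEq ?_
    filter_upwards [h2] with β hβ
    exact h0 β hβ

namespace UnitChart
variable {c : 𝒢.UnitChart} {κ : OpenPartialHomeomorph G H}

/-- The derivative along `transField` of a function supported in a chart. -/
theorem hasDerivAt_chartExt_trans [T2Space G] (hκ : IsSmoothChart (n₁ + n₀) κ) {d : H → ℂ}
    (hd : ContDiff ℝ ∞ d) (hc : HasCompactSupport d) (hs : tsupport d ⊆ κ.target) (i : Fin n₁)
    {γ : G} (hγ : 𝒢.r γ ∈ c.base) :
    HasDerivAt (fun ε : ℝ => chartExt κ.source κ d (c.trans (ε • EuclideanSpace.single i 1) γ))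
      (chartExt κ.source κ (dirDeriv (c.transField κ i) d) γ) 0 := by
  have hcont : ContinuousAt (fun y => c.trans y γ) 0 := by
    have h1 := (c.contMDiffOn_trans.contMDiffAt (c.isOpen_transDomain.mem_nhds
      (c.zero_mem_transDomain hγ))).continuousAt
    exact ContinuousAt.comp' (f := fun y : EuclideanSpace ℝ (Fin n₁) => (y, γ))
      (g := fun q : EuclideanSpace ℝ (Fin n₁) × G => c.trans q.1 q.2) h1 (by fun_prop)
  have hline : HasDerivAt (fun ε : ℝ => ε • (EuclideanSpace.single i 1 : EuclideanSpace ℝ (Fin n₁)))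
      (EuclideanSpace.single i 1) 0 := by
    simpa using (hasDerivAt_id (0 : ℝ)).smul_const (EuclideanSpace.single i (1 : ℝ))
  have hline0 : Tendsto (fun ε : ℝ => ε • (EuclideanSpace.single i 1 : EuclideanSpace ℝ (Fin n₁)))
      (𝓝 0) (𝓝 0) := by
    have := hline.continuousAt.tendsto
    rwa [zero_smul] at this
  have hcont0 : Tendsto (fun y => c.trans y γ) (𝓝 0) (𝓝 γ) := by
    have := hcont.tendsto
    rwa [c.trans_zero hγ] at this
  have ht := hcont0.comp hline0
  by_cases h : γ ∈ κ.source
  · obtain ⟨L, hL, hLi⟩ := hasFDerivAt_trans hκ h hγ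
    have h1 : HasFDerivAt d (fderiv ℝ d (κ γ))
        (κ (c.trans ((0 : ℝ) • EuclideanSpace.single i 1) γ)) := by
      rw [zero_smul, c.trans_zero hγ]
      exact (hd.differentiable (by simp) _).hasFDerivAt
    have hL' : HasFDerivAt (fun y => κ (c.trans y γ)) L
        ((0 : ℝ) • (EuclideanSpace.single i 1 : EuclideanSpace ℝ (Fin n₁))) := by
      rwa [zero_smul]
    have h2 := h1.comp_hasDerivAt (0 : ℝ) (hL'.comp_hasDerivAt (0 : ℝ) hline)
    rw [chartExt_of_mem _ h, dirDeriv, ← hLi]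
    refine h2.congr_of_eventuallyEq ?_
    filter_upwards [ht (κ.open_source.mem_nhds h)] with ε hε
    exact chartExt_of_mem d hε
  -- A point outside the chart domain is off the closed support of the extension, and so are its
  -- translates by elements close to the unit.
  · rw [chartExt_of_notMem _ h]
    refine (hasDerivAt_const (0 : ℝ) (0 : ℂ)).congr_of_eventuallyEq ?_
    have h3 : γ ∉ tsupport (chartExt κ.source κ d) := fun h4 => by
      obtain ⟨w, hw, rfl⟩ := (contMDiff_chartExt hκ hd hc hs).2 h4
      exact h (κ.map_target (hs hw))
    filter_upwards [ht ((isClosed_tsupport _).isOpen_compl.mem_nhds h3)] with ε hε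
    exact image_eq_zero_of_notMem_tsupport hε

end UnitChart
end TransField
end LieGroupoid
-- Integral curves of the invariant fields
namespace LieGroupoid
section Orbit
open Set Filter Topology

variable {n₁ n₀ : ℕ} {G M : Type*}
    [TopologicalSpace G] [ChartedSpace (EuclideanSpace ℝ (Fin (n₁ + n₀))) G]
    [TopologicalSpace M] [ChartedSpace (EuclideanSpace ℝ (Fin n₀)) M]
    {𝒢 : LieGroupoid n₁ n₀ G M} {H : Type*} [NormedAddCommGroup H] [NormedSpace ℝ H]

namespace UnitChart

variable {c : 𝒢.UnitChart} {κ : OpenPartialHomeomorph G H}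

theorem tendsto_trans {γ : G} (hγ : 𝒢.r γ ∈ c.base) :
    Tendsto (fun y => c.trans y γ) (𝓝 0) (𝓝 γ) := by
  have h1 := (c.contMDiffOn_trans.contMDiffAt (c.isOpen_transDomain.mem_nhds
    (c.zero_mem_transDomain hγ))).continuousAt
  have h2 := (ContinuousAt.comp' (f := fun y : EuclideanSpace ℝ (Fin n₁) => (y, γ))
    (g := fun q : EuclideanSpace ℝ (Fin n₁) × G => c.trans q.1 q.2) h1 (by fun_prop)).tendsto
  rwa [c.trans_zero hγ] at h2

theorem eventually_mem_transDomain {γ : G} (hγ : 𝒢.r γ ∈ c.base) :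
    ∀ᶠ y in 𝓝 0, (y, γ) ∈ c.transDomain := by
  have h1 : ContinuousAt (fun y : EuclideanSpace ℝ (Fin n₁) => (y, γ)) 0 := by fun_prop
  exact h1.eventually_mem (c.isOpen_transDomain.mem_nhds (c.zero_mem_transDomain hγ))

/-- Left translation preserves the source, and the source determines the second coordinate. So the
fields are tangent to the source fibres. -/
theorem snd_transField (i : Fin n₁) {z : EuclideanSpace ℝ (Fin n₁) × EuclideanSpace ℝ (Fin n₀)}
    (hz : z ∈ c.fieldDomain c.e) : (c.transField c.e i z).2 = 0 := by
  obtain ⟨L, hL, hLi⟩ := hasFDerivAt_trans c.isSmoothChart (c.e.map_target hz.1) hz.2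
  rw [← c.e.right_inv hz.1, ← hLi]
  have h1 : HasFDerivAt (fun y => (c.e (c.trans y (c.e.symm z))).2)
      ((ContinuousLinearMap.snd ℝ _ _).comp L) 0 := hasFDerivAt_snd.comp _ hL
  have h2 : (fun y => (c.e (c.trans y (c.e.symm z))).2) =ᶠ[𝓝 0] fun _ => z.2 := by
    filter_upwards [tendsto_trans hz.2 (c.e.open_source.mem_nhds (c.e.map_target hz.1)),
      eventually_mem_transDomain hz.2] with y hy hy'
    rw [c.e_snd _ hy, c.s_trans hy', ← c.e_snd _ (c.e.map_target hz.1), c.e.right_inv hz.1]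
  have h3 := h1.unique ((hasFDerivAt_const z.2 0).congr_of_eventuallyEq h2)
  exact DFunLike.congr_fun h3 (EuclideanSpace.single i 1)

theorem zero_mem_fieldDomain {x : M} (hx : x ∈ c.base) :
    ((0 : EuclideanSpace ℝ (Fin n₁)), c.k x) ∈ c.fieldDomain c.e :=
  ⟨zero_mem hx, by simpa only [mem_preimage, symm_zero hx, 𝒢.r_unit] using hx⟩

/-- Translating a unit by the element with coordinate y gives that element itself. This
normalization is what later makes the differential of the iterated flows the identity. -/
theorem transField_zero (i : Fin n₁) {x : M} (hx : x ∈ c.base) :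
    c.transField c.e i (0, c.k x) = (EuclideanSpace.single i 1, 0) := by
  have hr : 𝒢.r (𝒢.unit x) ∈ c.base := by rwa [𝒢.r_unit]
  obtain ⟨L, hL, hLi⟩ := hasFDerivAt_trans c.isSmoothChart hx hr
  rw [← c.e_unit x hx, ← hLi]
  have h2 : (fun y => c.e (c.trans y (𝒢.unit x))) =ᶠ[𝓝 0] fun y => (y, c.k x) := by
    filter_upwards [eventually_mem_transDomain hr] with y hy
    have h3 := hy.2
    have h4 := c.s_symm_of_mem (c.base_subset hr) h3
    simp only [𝒢.r_unit] at h3 h4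
    simp only [trans, 𝒢.r_unit]
    conv_lhs => rw [← h4]
    rw [h4]
    have h5 := 𝒢.mul_unit (c.e.symm (y, c.k x))
    rw [h4] at h5
    rw [h5, c.e.right_inv h3]
  have h3 := hL.unique (HasFDerivAt.congr_of_eventuallyEq
    (hasFDerivAt_prodMk_left (𝕜 := ℝ) (0 : EuclideanSpace ℝ (Fin n₁)) (c.k x)) h2)
  rw [h3]
  rfl

/-- Left translation of `γ` along an integral curve of the vector field generated by the
translations, seen by functions supported in a chart. -/
theorem hasDerivAt_chartExt_mul [T2Space G] (hκ : IsSmoothChart (n₁ + n₀) κ) {d : H → ℂ}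
    (hd : ContDiff ℝ ∞ d) (hc : HasCompactSupport d) (hs : tsupport d ⊆ κ.target) (i : Fin n₁)
    {z : ℝ → EuclideanSpace ℝ (Fin n₁) × EuclideanSpace ℝ (Fin n₀)} {t : ℝ}
    (hz : z t ∈ c.fieldDomain c.e) (hzd : HasDerivAt z (c.transField c.e i (z t)) t)
    (hz2 : ∀ᶠ t' in 𝓝 t, (z t').2 = (z t).2) {γ : G} (hγ : 𝒢.s (c.e.symm (z t)) = 𝒢.r γ) :
    HasDerivAt (fun t => chartExt κ.source κ d (𝒢.mul (c.e.symm (z t)) γ))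
      (chartExt κ.source κ (dirDeriv (c.transField κ i) d) (𝒢.mul (c.e.symm (z t)) γ)) t := by
  have hD := (contMDiff_chartExt hκ hd hc hs).1
  set D := chartExt κ.source κ d
  have hsym : ∀ y, (y, (z t).2) ∈ c.e.target → 𝒢.s (c.e.symm (y, (z t).2)) = 𝒢.r γ := by
    intro y hy
    rw [c.s_symm hy, ← hγ, c.s_symm hz.1]
  let U : Set (EuclideanSpace ℝ (Fin n₁)) := {y | (y, (z t).2) ∈ c.e.target}
  have hU : IsOpen U := c.e.open_target.preimage (by fun_prop)
  have hyU : (z t).1 ∈ U := hz.1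
  -- Both the integral curve times γ and the translates of the product are compositions of this
  -- function with curves in the fibre coordinate, and these curves have the same velocity.
  let a : EuclideanSpace ℝ (Fin n₁) → ℂ := fun y => D (𝒢.mul (c.e.symm (y, (z t).2)) γ)
  have ha : ContMDiffOn 𝓘(ℝ, EuclideanSpace ℝ (Fin n₁)) 𝓘(ℝ, ℂ) ∞ a U := by
    have h1 : ContMDiff 𝓘(ℝ, EuclideanSpace ℝ (Fin n₁))
        𝓘(ℝ, EuclideanSpace ℝ (Fin n₁) × EuclideanSpace ℝ (Fin n₀)) ∞
        (fun y : EuclideanSpace ℝ (Fin n₁) => (y, (z t).2)) :=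
      ContDiff.contMDiff (by fun_prop)
    have h2 := c.e_symm_smooth.comp h1.contMDiffOn (s := U) fun y hy => hy
    have h3 : ContMDiffOn 𝓘(ℝ, EuclideanSpace ℝ (Fin n₁))
        ((𝓡 (n₁ + n₀)).prod (𝓡 (n₁ + n₀))) ∞
        (fun y : EuclideanSpace ℝ (Fin n₁) => (c.e.symm (y, (z t).2), γ)) U :=
      h2.prodMk contMDiffOn_const
    exact hD.comp_contMDiffOn (𝒢.mul_smooth.comp h3 fun y hy => hsym y hy)
  have ha' := (((contMDiffOn_iff_contDiffOn.1 ha).contDiffAt (hU.mem_nhds hyU)).differentiableAt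
    (by simp)).hasFDerivAt
  have h1 : HasDerivAt (fun t' => a (z t').1) (fderiv ℝ a (z t).1 (c.transField c.e i (z t)).1) t :=
    HasFDerivAt.comp_hasDerivAt t (f := fun t' => (z t').1) ha'
      ((hasFDerivAt_fst (𝕜 := ℝ) (p := z t)).comp_hasDerivAt t hzd)
  have h1' : HasDerivAt (fun t => D (𝒢.mul (c.e.symm (z t)) γ))
      (fderiv ℝ a (z t).1 (c.transField c.e i (z t)).1) t := by
    refine h1.congr_of_eventuallyEq ?_
    filter_upwards [hz2] with t' ht'
    simp only [a, ← ht', Prod.mk.eta]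
  have hβ : 𝒢.r (𝒢.mul (c.e.symm (z t)) γ) ∈ c.base := by
    rw [𝒢.r_mul _ _ hγ]; exact hz.2
  have h2 := hasDerivAt_chartExt_trans (c := c) hκ hd hc hs i hβ
  have hline : HasDerivAt (fun ε : ℝ => ε • (EuclideanSpace.single i 1 : EuclideanSpace ℝ (Fin n₁)))
      (EuclideanSpace.single i 1) 0 := by
    simpa using (hasDerivAt_id (0 : ℝ)).smul_const (EuclideanSpace.single i (1 : ℝ))
  have hline0 : Tendsto (fun ε : ℝ => ε • (EuclideanSpace.single i 1 : EuclideanSpace ℝ (Fin n₁)))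
      (𝓝 0) (𝓝 0) := by
    have := hline.continuousAt.tendsto
    rwa [zero_smul] at this
  obtain ⟨L, hL, hLi⟩ := hasFDerivAt_trans c.isSmoothChart (c.e.map_target hz.1) hz.2
  have hL' : HasFDerivAt (fun y => c.e (c.trans y (c.e.symm (z t)))) L
      ((0 : ℝ) • (EuclideanSpace.single i 1 : EuclideanSpace ℝ (Fin n₁))) := by
    rwa [zero_smul]
  have h3 := hasFDerivAt_fst.comp_hasDerivAt (0 : ℝ) (hL'.comp_hasDerivAt (0 : ℝ) hline)
  rw [hLi, c.e.right_inv hz.1] at h3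
  have ha'' : HasFDerivAt a (fderiv ℝ a (z t).1)
      (c.e (c.trans ((0 : ℝ) • EuclideanSpace.single i 1) (c.e.symm (z t)))).1 := by
    rw [zero_smul, c.trans_zero hz.2, c.e.right_inv hz.1]
    exact ha'
  have h4 := ha''.comp_hasDerivAt (0 : ℝ) h3
  -- Right invariance of the fields: by associativity, translating the product βγ is the same as
  -- translating β and then multiplying by γ.
  have h5 : (fun ε : ℝ => D (c.trans (ε • EuclideanSpace.single i 1)
      (𝒢.mul (c.e.symm (z t)) γ))) =ᶠ[𝓝 0]
      fun ε => a (c.e (c.trans (ε • EuclideanSpace.single i 1) (c.e.symm (z t)))).1 := by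
    filter_upwards [hline0 (eventually_mem_transDomain hz.2),
      hline0 (tendsto_trans hz.2 (c.e.open_source.mem_nhds (c.e.map_target hz.1)))] with ε hε hε'
    have e1 : (c.e (c.trans (ε • EuclideanSpace.single i 1) (c.e.symm (z t)))).2 = (z t).2 := by
      rw [c.e_snd _ hε', c.s_trans hε, ← c.e_snd _ (c.e.map_target hz.1), c.e.right_inv hz.1]
    simp only [a]
    rw [← e1, Prod.mk.eta, c.e.left_inv hε']
    simp only [trans]
    rw [𝒢.r_mul _ _ hγ, 𝒢.mul_assoc _ _ _ (c.s_symm_of_mem (c.base_subset hε.1) hε.2) hγ]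
  rw [h2.unique (h4.congr_of_eventuallyEq h5)]
  exact h1'

end UnitChart
end Orbit
end LieGroupoid
-- Iterated flows
section FlowIter
open Set Filter Topology Metric

/-- Successive application of the flows `θ 0, …, θ (k - 1)` to the points `(0, x)`. -/
def flowIter {A B : Type*} [Zero A] (θ : ℕ → ℝ → A × B → A × B) : ∀ k : ℕ, (Fin k → ℝ) → B → A × B
  | 0, _, x => (0, x)
  | k + 1, t, x => θ k (t (Fin.last k)) (flowIter θ k (Fin.init t) x)

theorem flowIter_snoc {A B : Type*} [Zero A] (θ : ℕ → ℝ → A × B → A × B) (k : ℕ) (t : Fin k → ℝ) (a : ℝ) (x : B) :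
    flowIter θ (k + 1) (Fin.snoc (α := fun _ => ℝ) t a) x = θ k a (flowIter θ k t x) := by
  simp [flowIter]

theorem norm_finInit_le {k : ℕ} (t : Fin (k + 1) → ℝ) :
    ‖(Fin.init t : Fin k → ℝ)‖ ≤ ‖t‖ :=
  (pi_norm_le_iff_of_nonneg (norm_nonneg t)).2 fun i => norm_le_pi_norm t i.castSucc

theorem norm_finSnoc_lt {k : ℕ} {t : Fin k → ℝ} {a ρ : ℝ} (ht : ‖t‖ < ρ) (ha : |a| < ρ) :
    ‖(Fin.snoc (α := fun _ => ℝ) t a : Fin (k + 1) → ℝ)‖ < ρ := by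
  rw [pi_norm_lt_iff ((norm_nonneg t).trans_lt ht)]
  intro i
  refine Fin.lastCases ?_ (fun j => ?_) i
  · simpa using ha
  · simpa using (norm_le_pi_norm t j).trans_lt ht

variable {A B : Type*} [NormedAddCommGroup A] [NormedAddCommGroup B]
  {θ : ℕ → ℝ → A × B → A × B} {ε : ℕ → ℝ} {x₀ : B}

/-- When only the j-th time is nonzero, all other flows act at time zero and do nothing. -/
theorem flowIter_single {n : ℕ} {ρ : ℝ}
    (h0 : ∀ k, ∀ z ∈ ball ((0 : A), x₀) (ε k), θ k 0 z = z)
    (h : ∀ k ≤ n, (∀ t ∈ ball (0 : Fin k → ℝ) ρ, ∀ x ∈ ball x₀ ρ,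
        flowIter θ k t x ∈ ball ((0 : A), x₀) (ε k)) ∧
      ∀ x ∈ ball x₀ ρ, flowIter θ k 0 x = (0, x)) {s : ℝ} (hs : |s| < ρ) {x : B}
    (hx : x ∈ ball x₀ ρ) : ∀ k ≤ n, ∀ j : Fin k,
      flowIter θ k (Pi.single j s) x = θ j s (0, x) := by
  intro k
  induction k with
  | zero => exact fun _ j => j.elim0
  | succ k ih =>
    intro hk j
    refine Fin.lastCases ?_ (fun j => ?_) j
    · have e1 : (Fin.init (Pi.single (Fin.last k) s : Fin (k + 1) → ℝ) : Fin k → ℝ) = 0 := by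
        ext i
        simp [Fin.init, (Fin.castSucc_lt_last i).ne]
      rw [flowIter, e1, Pi.single_eq_same, (h k (by omega)).2 x hx, Fin.val_last]
    · have e1 : (Fin.init (Pi.single j.castSucc s : Fin (k + 1) → ℝ) : Fin k → ℝ) = Pi.single j s := by
        ext i
        by_cases hij : i = j
        · subst hij; simp [Fin.init]
        · simp [Fin.init, hij]
      have e2 : (Pi.single j.castSucc s : Fin (k + 1) → ℝ) (Fin.last k) = 0 :=
        Pi.single_eq_of_ne (Fin.castSucc_lt_last j).ne' _
      have hmem : (Pi.single j s : Fin k → ℝ) ∈ ball 0 ρ := by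
        rw [mem_ball_zero_iff, pi_norm_lt_iff ((abs_nonneg s).trans_lt hs)]
        intro i
        by_cases hij : i = j
        · subst hij; simpa using hs
        · simpa [hij] using (abs_nonneg s).trans_lt hs
      rw [flowIter, e1, e2, h0 k _ ((h k (by omega)).1 _ hmem x hx), ih (by omega) j,
        Fin.val_castSucc]

variable [NormedSpace ℝ A] [NormedSpace ℝ B]

/-- Smoothness and the mapping into an arbitrary neighbourhood N are proved together, because the
next flow is controlled only on a ball about (0, x₀), which the preceding flows must not leave. -/
theorem flowIter_regular (hε : ∀ k, 0 < ε k)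
    (hθ : ∀ k, ContDiffOn ℝ ∞ (Function.uncurry (θ k))
      (ball (0 : ℝ) (ε k) ×ˢ ball ((0 : A), x₀) (ε k)))
    (h0 : ∀ k, ∀ z ∈ ball ((0 : A), x₀) (ε k), θ k 0 z = z) (k : ℕ) :
    ∀ N ∈ 𝓝 ((0 : A), x₀), ∃ ρ > 0,
      ContDiffOn ℝ ∞ (Function.uncurry (flowIter θ k)) (ball (0 : Fin k → ℝ) ρ ×ˢ ball x₀ ρ) ∧
      (∀ t ∈ ball (0 : Fin k → ℝ) ρ, ∀ x ∈ ball x₀ ρ, flowIter θ k t x ∈ N) ∧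
      ∀ x ∈ ball x₀ ρ, flowIter θ k 0 x = (0, x) := by
  induction k with
  | zero =>
    intro N hN
    obtain ⟨ρ, hρ, hsub⟩ := Metric.mem_nhds_iff.1 hN
    refine ⟨ρ, hρ, ?_, fun t _ x hx => hsub ?_, fun x _ => rfl⟩
    · have : ContDiff ℝ ∞ (fun q : (Fin 0 → ℝ) × B => ((0 : A), q.2)) := by fun_prop
      exact this.contDiffOn
    · rw [← ball_prod_same]
      exact ⟨mem_ball_self hρ, hx⟩
  | succ k ih =>
    intro N hN
    obtain ⟨ρ₁, hρ₁, hc, hN₁, hz⟩ := ih _ (ball_mem_nhds _ (hε k))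
    set ρ₂ := min ρ₁ (ε k)
    have hρ₂ : 0 < ρ₂ := lt_min hρ₁ (hε k)
    have hi : ∀ t ∈ ball (0 : Fin (k + 1) → ℝ) ρ₂, (Fin.init t : Fin k → ℝ) ∈ ball 0 ρ₁ ∧
        t (Fin.last k) ∈ ball (0 : ℝ) (ε k) := fun t ht => by
      rw [mem_ball_zero_iff] at ht
      exact ⟨mem_ball_zero_iff.2 ((norm_finInit_le t).trans_lt (ht.trans_le (min_le_left _ _))),
        mem_ball_zero_iff.2 ((norm_le_pi_norm t _).trans_lt (ht.trans_le (min_le_right _ _)))⟩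
    have hb : ball x₀ ρ₂ ⊆ ball x₀ ρ₁ := ball_subset_ball (min_le_left _ _)
    have h1 : ContDiff ℝ ∞ (fun q : (Fin (k + 1) → ℝ) × B => ((Fin.init q.1 : Fin k → ℝ), q.2)) := by
      refine ContDiff.prodMk (contDiff_pi.2 fun i => ?_) contDiff_snd
      exact (contDiff_apply ℝ ℝ i.castSucc).comp contDiff_fst
    have h2 : ContDiff ℝ ∞ (fun q : (Fin (k + 1) → ℝ) × B => q.1 (Fin.last k)) :=
      (contDiff_apply ℝ ℝ (Fin.last k)).comp contDiff_fst
    have h3 : ContDiffOn ℝ ∞ (Function.uncurry (flowIter θ (k + 1)))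
        (ball (0 : Fin (k + 1) → ℝ) ρ₂ ×ˢ ball x₀ ρ₂) := by
      refine (hθ k).comp (f := fun q : (Fin (k + 1) → ℝ) × B =>
        (q.1 (Fin.last k), flowIter θ k (Fin.init q.1) q.2)) (h2.contDiffOn.prodMk
          (hc.comp h1.contDiffOn ?_)) ?_
      · rintro ⟨t, x⟩ ⟨ht, hx⟩
        exact ⟨(hi t ht).1, hb hx⟩
      · rintro ⟨t, x⟩ ⟨ht, hx⟩
        exact ⟨(hi t ht).2, hN₁ _ (hi t ht).1 _ (hb hx)⟩
    have h4 : ∀ x ∈ ball x₀ ρ₂, flowIter θ (k + 1) 0 x = (0, x) := by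
      intro x hx
      have e1 : (Fin.init (0 : Fin (k + 1) → ℝ) : Fin k → ℝ) = 0 := rfl
      have e2 := hN₁ 0 (mem_ball_self hρ₁) x (hb hx)
      rw [flowIter, e1, Pi.zero_apply, h0 k _ e2, hz x (hb hx)]
    have h5 : ContinuousAt (Function.uncurry (flowIter θ (k + 1)))
        ((0 : Fin (k + 1) → ℝ), x₀) :=
      h3.continuousOn.continuousAt ((isOpen_ball.prod isOpen_ball).mem_nhds
        ⟨mem_ball_self hρ₂, mem_ball_self hρ₂⟩)
    have h6 : Function.uncurry (flowIter θ (k + 1)) ⁻¹' N ∈ 𝓝 ((0 : Fin (k + 1) → ℝ), x₀) := by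
      refine h5 ?_
      rwa [Function.uncurry_apply_pair, h4 x₀ (mem_ball_self hρ₂)]
    obtain ⟨ρ₃, hρ₃, hsub⟩ := Metric.mem_nhds_iff.1 h6
    rw [← ball_prod_same] at hsub
    have hm2 := min_le_left ρ₂ ρ₃
    have hm3 := min_le_right ρ₂ ρ₃
    exact ⟨min ρ₂ ρ₃, lt_min hρ₂ hρ₃, h3.mono (prod_mono (ball_subset_ball hm2)
      (ball_subset_ball hm2)), fun t ht x hx =>
        hsub (mk_mem_prod (ball_subset_ball hm3 ht) (ball_subset_ball hm3 hx)),
        fun x hx => h4 x (ball_subset_ball hm2 hx)⟩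

theorem flowIter_regular_le (hε : ∀ k, 0 < ε k)
    (hθ : ∀ k, ContDiffOn ℝ ∞ (Function.uncurry (θ k))
      (ball (0 : ℝ) (ε k) ×ˢ ball ((0 : A), x₀) (ε k)))
    (h0 : ∀ k, ∀ z ∈ ball ((0 : A), x₀) (ε k), θ k 0 z = z) (n : ℕ) :
    ∃ ρ > 0, ∀ k ≤ n, ρ ≤ ε k ∧
      ContDiffOn ℝ ∞ (Function.uncurry (flowIter θ k)) (ball (0 : Fin k → ℝ) ρ ×ˢ ball x₀ ρ) ∧
      (∀ t ∈ ball (0 : Fin k → ℝ) ρ, ∀ x ∈ ball x₀ ρ,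
        flowIter θ k t x ∈ ball ((0 : A), x₀) (ε k)) ∧
      ∀ x ∈ ball x₀ ρ, flowIter θ k 0 x = (0, x) := by
  have key : ∀ k, ∃ ρ > 0, ρ ≤ ε k ∧
      ContDiffOn ℝ ∞ (Function.uncurry (flowIter θ k)) (ball (0 : Fin k → ℝ) ρ ×ˢ ball x₀ ρ) ∧
      (∀ t ∈ ball (0 : Fin k → ℝ) ρ, ∀ x ∈ ball x₀ ρ,
        flowIter θ k t x ∈ ball ((0 : A), x₀) (ε k)) ∧
      ∀ x ∈ ball x₀ ρ, flowIter θ k 0 x = (0, x) := fun k => by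
    obtain ⟨ρ, hρ, h1, h2, h3⟩ := flowIter_regular hε hθ h0 k _ (ball_mem_nhds _ (hε k))
    have hm := min_le_left ρ (ε k)
    exact ⟨min ρ (ε k), lt_min hρ (hε k), min_le_right _ _, h1.mono (prod_mono
      (ball_subset_ball hm) (ball_subset_ball hm)), fun t ht x hx => h2 t (ball_subset_ball hm ht) x
        (ball_subset_ball hm hx), fun x hx => h3 x (ball_subset_ball hm hx)⟩
  choose ρ hρ h1 h2 h3 h4 using key
  have hne : (Finset.range (n + 1)).Nonempty := ⟨0, by simp⟩
  refine ⟨(Finset.range (n + 1)).inf' hne ρ, (Finset.lt_inf'_iff hne).2 fun k _ => hρ k,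
    fun k hk => ?_⟩
  have hm : (Finset.range (n + 1)).inf' hne ρ ≤ ρ k := Finset.inf'_le _ (by simp; omega)
  exact ⟨hm.trans (h1 k), (h2 k).mono (prod_mono (ball_subset_ball hm) (ball_subset_ball hm)),
    fun t ht x hx => h3 k t (ball_subset_ball hm ht) x (ball_subset_ball hm hx),
    fun x hx => h4 k x (ball_subset_ball hm hx)⟩

end FlowIter
-- Flow times as coordinates
section FlowBox
open Set Filter Topology Metric

variable {n₁ : ℕ} {B : Type*} [NormedAddCommGroup B] [NormedSpace ℝ B]

theorem snd_eq_of_hasDerivAt {A : Type*} [NormedAddCommGroup A] [NormedSpace ℝ A] {ε : ℝ}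
    {z : ℝ → A × B} {z' : ℝ → A × B} (hz : ∀ t ∈ ball (0 : ℝ) ε, HasDerivAt z (z' t) t)
    (h0 : ∀ t ∈ ball (0 : ℝ) ε, (z' t).2 = 0) {t : ℝ} (ht : t ∈ ball (0 : ℝ) ε) :
    (z t).2 = (z 0).2 := by
  have h1 : ∀ s ∈ ball (0 : ℝ) ε, HasDerivWithinAt (fun s => (z s).2) 0 (ball (0 : ℝ) ε) s := by
    intro s hs
    have := (hasFDerivAt_snd (𝕜 := ℝ) (p := z s)).comp_hasDerivAt s (hz s hs)
    rw [← h0 s hs]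
    exact this.hasDerivWithinAt
  have h2 := (convex_ball (0 : ℝ) ε).norm_image_sub_le_of_norm_hasDerivWithin_le (C := 0) h1
    (by simp) (mem_ball_self (pos_of_mem_ball ht)) ht
  simpa [sub_eq_zero] using h2

variable [FiniteDimensional ℝ B]

/-- Successive flows of vector fields `f i` on an open set `O` of `ℝ^{n₁} × B` that are tangent to
`ℝ^{n₁}` and coincide with the coordinate fields at `(0, x₀)`. -/
theorem exists_flowIter [HasContDiffBump (EuclideanSpace ℝ (Fin n₁) × B)]
    {f : ℕ → EuclideanSpace ℝ (Fin n₁) × B → EuclideanSpace ℝ (Fin n₁) × B}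
    {O : Set (EuclideanSpace ℝ (Fin n₁) × B)} (hO : IsOpen O)
    (hf : ∀ k, ContDiffOn ℝ ∞ (f k) O) {x₀ : B} (h₀ : (0, x₀) ∈ O)
    (hsnd : ∀ k, ∀ z ∈ O, (f k z).2 = 0)
    (hunit : ∀ i : Fin n₁, f i (0, x₀) = (EuclideanSpace.single i 1, 0)) :
    ∃ θ : ℕ → ℝ → EuclideanSpace ℝ (Fin n₁) × B → EuclideanSpace ℝ (Fin n₁) × B, ∃ ρ > 0,
      (∀ k ≤ n₁, ContDiffOn ℝ ∞ (Function.uncurry (flowIter θ k))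
        (ball (0 : Fin k → ℝ) ρ ×ˢ ball x₀ ρ)) ∧
      (∀ k ≤ n₁, ∀ t ∈ ball (0 : Fin k → ℝ) ρ, ∀ x ∈ ball x₀ ρ,
        flowIter θ k t x ∈ O ∧ (flowIter θ k t x).2 = x) ∧
      (∀ k ≤ n₁, ∀ x ∈ ball x₀ ρ, flowIter θ k 0 x = (0, x)) ∧
      (∀ k < n₁, ∀ t ∈ ball (0 : Fin k → ℝ) ρ, ∀ x ∈ ball x₀ ρ,
        flowIter θ (k + 1) (Fin.snoc (α := fun _ => ℝ) t 0) x = flowIter θ k t x ∧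
        ∀ a ∈ ball (0 : ℝ) ρ, HasDerivAt
          (fun a => flowIter θ (k + 1) (Fin.snoc (α := fun _ => ℝ) t a) x)
          (f k (flowIter θ (k + 1) (Fin.snoc (α := fun _ => ℝ) t a) x)) a) ∧
      HasFDerivAt (fun q : EuclideanSpace ℝ (Fin n₁) × B => flowIter θ n₁ q.1.ofLp q.2)
        (ContinuousLinearMap.id ℝ _) (0, x₀) := by
  choose θ ε hε hθ hflow using fun k => exists_smooth_flow hO (hf k) h₀
  have h0 : ∀ k, ∀ z ∈ ball ((0 : EuclideanSpace ℝ (Fin n₁)), x₀) (ε k), θ k 0 z = z :=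
    fun k z hz => (hflow k z hz).1
  obtain ⟨ρ, hρ, hreg⟩ := flowIter_regular_le hε hθ h0 n₁
  have hsnd' : ∀ k, ∀ z ∈ ball ((0 : EuclideanSpace ℝ (Fin n₁)), x₀) (ε k),
      ∀ t ∈ ball (0 : ℝ) (ε k), (θ k t z).2 = z.2 := by
    intro k z hz t ht
    have h1 := snd_eq_of_hasDerivAt (fun s hs => ((hflow k z hz).2 s hs).2)
      (fun s hs => hsnd k _ ((hflow k z hz).2 s hs).1) ht
    rwa [h0 k z hz] at h1
  have hOb : ∀ k, ball ((0 : EuclideanSpace ℝ (Fin n₁)), x₀) (ε k) ⊆ O := by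
    intro k z hz
    have := ((hflow k z hz).2 0 (mem_ball_self (hε k))).1
    rwa [h0 k z hz] at this
  have hbρ : ∀ k ≤ n₁, ball (0 : ℝ) ρ ⊆ ball (0 : ℝ) (ε k) := fun k hk =>
    ball_subset_ball (hreg k hk).1
  refine ⟨θ, ρ, hρ, fun k hk => (hreg k hk).2.1, fun k hk t ht x hx =>
    ⟨hOb k ((hreg k hk).2.2.1 t ht x hx), ?_⟩, fun k hk => (hreg k hk).2.2.2,
    fun k hk t ht x hx => ?_, ?_⟩
  · induction k with
    | zero => rfl
    | succ k ih =>
      have ht' : (Fin.init t : Fin k → ℝ) ∈ ball 0 ρ := by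
        rw [mem_ball_zero_iff] at ht ⊢
        exact (norm_finInit_le t).trans_lt ht
      have hl : t (Fin.last k) ∈ ball (0 : ℝ) ρ := by
        rw [mem_ball_zero_iff] at ht ⊢
        exact (norm_le_pi_norm t _).trans_lt ht
      rw [flowIter, hsnd' k _ ((hreg k (by omega)).2.2.1 _ ht' x hx) _ (hbρ k (by omega) hl),
        ih (by omega) _ ht']
  · have hz := (hreg k hk.le).2.2.1 t ht x hx
    simp only [flowIter_snoc]
    exact ⟨h0 k _ hz, fun a ha => ((hflow k _ hz).2 a (hbρ k hk.le ha)).2⟩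
  -- The differential is computed on generators. In the base directions the flows at time zero fix
  -- (0, x). Along the i-th time axis only the i-th flow moves, with initial velocity the i-th
  -- coordinate vector.
  · set Λ := fun q : EuclideanSpace ℝ (Fin n₁) × B => flowIter θ n₁ q.1.ofLp q.2
    have hx₀ := mem_ball_self (x := x₀) hρ
    have hd : DifferentiableAt ℝ Λ (0, x₀) := by
      have h1 : ContDiffAt ℝ ∞ (Function.uncurry (flowIter θ n₁)) ((0 : Fin n₁ → ℝ), x₀) :=
        (hreg n₁ le_rfl).2.1.contDiffAt ((isOpen_ball.prod isOpen_ball).mem_nhds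
          (mk_mem_prod (mem_ball_self hρ) hx₀))
      have h2 : ContDiff ℝ ∞ (fun q : EuclideanSpace ℝ (Fin n₁) × B => (q.1.ofLp, q.2)) :=
        ((PiLp.contDiff_ofLp (p := 2)).comp contDiff_fst).prodMk contDiff_snd
      exact (ContDiffAt.comp ((0 : EuclideanSpace ℝ (Fin n₁)), x₀)
        (f := fun q : EuclideanSpace ℝ (Fin n₁) × B => (q.1.ofLp, q.2))
        (g := Function.uncurry (flowIter θ n₁)) h1 h2.contDiffAt).differentiableAt (by simp)
    have hL := hd.hasFDerivAt
    set L := fderiv ℝ Λ (0, x₀)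
    have e1 : ∀ v, L (0, v) = (0, v) := by
      have h1 := hL.comp x₀ (hasFDerivAt_prodMk_right (𝕜 := ℝ)
        (0 : EuclideanSpace ℝ (Fin n₁)) x₀)
      have h2 : Λ ∘ (fun y => ((0 : EuclideanSpace ℝ (Fin n₁)), y)) =ᶠ[𝓝 x₀]
          fun y => ((0 : EuclideanSpace ℝ (Fin n₁)), y) := by
        filter_upwards [isOpen_ball.mem_nhds hx₀] with y hy
        exact (hreg n₁ le_rfl).2.2.2 y hy
      have h3 := h1.unique ((hasFDerivAt_prodMk_right (𝕜 := ℝ)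
        (0 : EuclideanSpace ℝ (Fin n₁)) x₀).congr_of_eventuallyEq h2)
      intro v
      simpa using DFunLike.congr_fun h3 v
    have e2 : ∀ i, L (EuclideanSpace.single i 1, 0) = (EuclideanSpace.single i 1, 0) := by
      intro i
      have hline : HasDerivAt (fun s : ℝ => ((s • EuclideanSpace.single i (1 : ℝ) :
          EuclideanSpace ℝ (Fin n₁)), x₀)) (EuclideanSpace.single i 1, 0) 0 := by
        have h1 : HasDerivAt (fun s : ℝ => (s • EuclideanSpace.single i (1 : ℝ) :
          EuclideanSpace ℝ (Fin n₁))) (EuclideanSpace.single i 1) 0 := by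
          simpa using (hasDerivAt_id (0 : ℝ)).smul_const (EuclideanSpace.single i (1 : ℝ))
        exact h1.prodMk (hasDerivAt_const _ _)
      have hL' : HasFDerivAt Λ L ((0 : ℝ) • EuclideanSpace.single i (1 : ℝ), x₀) := by
        rwa [zero_smul]
      have h1 := hL'.comp_hasDerivAt (0 : ℝ) hline
      have hz₀ : ((0 : EuclideanSpace ℝ (Fin n₁)), x₀) ∈ ball (0, x₀) (ε i) := mem_ball_self (hε i)
      have h2 := ((hflow i _ hz₀).2 0 (mem_ball_self (hε i))).2
      rw [h0 i _ hz₀, hunit] at h2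
      refine h1.unique (h2.congr_of_eventuallyEq ?_)
      filter_upwards [ball_mem_nhds (0 : ℝ) hρ] with s hs
      have e3 : (s • EuclideanSpace.single i (1 : ℝ) : EuclideanSpace ℝ (Fin n₁)).ofLp =
          Pi.single i s := by
        ext j
        by_cases hij : j = i
        · subst hij; simp
        · simp [hij]
      have hs' : |s| < ρ := by simpa using hs
      change flowIter θ n₁ (s • EuclideanSpace.single i (1 : ℝ)).ofLp x₀ = _
      rw [e3]
      exact flowIter_single h0 (fun k hk => (hreg k hk).2.2) hs' hx₀ n₁ le_rfl i
    have hLid : L = ContinuousLinearMap.id ℝ _ := by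
      have h4 : ∀ v, L (v, 0) = (v, 0) := by
        let L1 : EuclideanSpace ℝ (Fin n₁) →ₗ[ℝ] EuclideanSpace ℝ (Fin n₁) × B :=
          L.toLinearMap.comp (LinearMap.inl ℝ _ _)
        have h5 : L1 = LinearMap.inl ℝ _ _ :=
          (EuclideanSpace.basisFun (Fin n₁) ℝ).toBasis.ext fun i => by simpa [L1] using e2 i
        exact fun v => DFunLike.congr_fun h5 v
      ext1
      · exact ContinuousLinearMap.ext h4
      · exact ContinuousLinearMap.ext e1
    rwa [hLid] at hL

end FlowBox
-- Flow boxes and changes of fibre coordinates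
namespace LieGroupoid
section FlowBox
open Set Filter Topology Metric MeasureTheory

variable {n₁ n₀ : ℕ} {G M : Type*}
    [TopologicalSpace G] [ChartedSpace (EuclideanSpace ℝ (Fin (n₁ + n₀))) G]
    [TopologicalSpace M] [ChartedSpace (EuclideanSpace ℝ (Fin n₀)) M]
    {𝒢 : LieGroupoid n₁ n₀ G M}

/-- The cube `[0, δ]^n` in Euclidean space. -/
def euclideanBox (n : ℕ) (δ : ℝ) : Set (EuclideanSpace ℝ (Fin n)) :=
  WithLp.ofLp ⁻¹' Icc 0 fun _ => δ

theorem isCompact_euclideanBox (n : ℕ) (δ : ℝ) : IsCompact (euclideanBox n δ) :=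
  (PiLp.homeomorph (p := 2) (fun _ : Fin n => ℝ)).isCompact_preimage.2 isCompact_Icc

variable (𝒢) in
/-- A chart `c` of `G` near units over `B`, in which every smooth function supported in a chart
over `B` is a finite sum of averages of its translates. -/
structure FlowBox (W : Set G) where
  /-- the chart -/
  c : 𝒢.UnitChart
  /-- the set of base points -/
  B : Set M
  /-- the size of the box -/
  δ : ℝ
  source_subset : c.e.source ⊆ W
  isOpen_B : IsOpen B
  B_subset : B ⊆ c.base
  box_mem : ∀ t ∈ euclideanBox n₁ δ, ∀ x ∈ B, (t, c.k x) ∈ c.fieldDomain c.e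
  factor : ∀ (κ : OpenPartialHomeomorph G (EuclideanSpace ℝ (Fin (n₁ + n₀)))),
    IsSmoothChart (n₁ + n₀) κ → ∀ h : EuclideanSpace ℝ (Fin (n₁ + n₀)) → ℂ, ContDiff ℝ ∞ h →
    HasCompactSupport h → tsupport h ⊆ κ.target ∩ κ.symm ⁻¹' (𝒢.r ⁻¹' B) →
    ∃ (J : Type) (_ : Fintype J) (f : J → EuclideanSpace ℝ (Fin n₁) → ℝ)
      (χ : J → EuclideanSpace ℝ (Fin (n₁ + n₀)) → ℂ),
      (∀ j, ContDiff ℝ ∞ (f j) ∧ Function.support (f j) ⊆ euclideanBox n₁ δ ∧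
        ContDiff ℝ ∞ (χ j) ∧ tsupport (χ j) ⊆ tsupport h) ∧
      ∀ γ, 𝒢.r γ ∈ B → chartExt κ.source κ h γ =
        ∑ j, ∫ t, f j t • chartExt κ.source κ (χ j) (c.trans t γ)

namespace UnitChart

/-- The vector field `transField`, with an arbitrary natural number as index. -/
noncomputable def natField {H : Type*} [NormedAddCommGroup H] [NormedSpace ℝ H] (c : 𝒢.UnitChart)
    (κ : OpenPartialHomeomorph G H) (k : ℕ) : H → H :=
  if h : k < n₁ then c.transField κ ⟨k, h⟩ else 0

theorem natField_of_lt {H : Type*} [NormedAddCommGroup H] [NormedSpace ℝ H] (c : 𝒢.UnitChart)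
    (κ : OpenPartialHomeomorph G H) {k : ℕ} (h : k < n₁) :
    c.natField κ k = c.transField κ ⟨k, h⟩ := dif_pos h

theorem contDiffOn_natField {H : Type*} [NormedAddCommGroup H] [NormedSpace ℝ H] {c : 𝒢.UnitChart}
    {κ : OpenPartialHomeomorph G H} (hκ : IsSmoothChart (n₁ + n₀) κ) (k : ℕ) :
    ContDiffOn ℝ ∞ (c.natField κ k) (c.fieldDomain κ) := by
  by_cases h : k < n₁
  · rw [natField_of_lt c κ h]
    exact contDiffOn_transField hκ _
  · rw [natField, dif_neg h]
    exact contDiffOn_const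

/-- Change of the coordinates of the fibres in a chart near units. -/
noncomputable def comp (c : 𝒢.UnitChart) (a : OpenPartialHomeomorph
    (EuclideanSpace ℝ (Fin n₁) × EuclideanSpace ℝ (Fin n₀))
    (EuclideanSpace ℝ (Fin n₁) × EuclideanSpace ℝ (Fin n₀)))
    (ha : ContDiffOn ℝ ∞ a a.source) (ha' : ContDiffOn ℝ ∞ a.symm a.target)
    (h2 : ∀ q ∈ a.source, (a q).2 = q.2)
    (h0 : ∀ y, ((0 : EuclideanSpace ℝ (Fin n₁)), y) ∈ a.source → a (0, y) = (0, y)) :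
    𝒢.UnitChart where
  k := c.k
  -- The restriction puts (0, k(s(β))) into the source of a, so that `h0` applies and units keep a
  -- vanishing first coordinate.
  e := (c.e.trans a.symm).restrOpen
    (c.e.source ∩ {β | ((0 : EuclideanSpace ℝ (Fin n₁)), c.k (𝒢.s β)) ∈ a.source}) (by
      have h1 : ContinuousOn (fun β => ((0 : EuclideanSpace ℝ (Fin n₁)), c.k (𝒢.s β)))
          c.e.source :=
        continuousOn_const.prodMk (c.k.continuousOn.comp s_contMDiff.continuous.continuousOn
          c.s_mem)
      exact h1.isOpen_inter_preimage c.e.open_source a.open_source)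
  k_smooth := c.k_smooth
  k_symm_smooth := c.k_symm_smooth
  e_smooth := ha'.contMDiffOn.comp (c.e_smooth.mono (by simp; grind)) (by
    intro β hβ; simp at hβ; exact hβ.1.2)
  e_symm_smooth := c.e_symm_smooth.comp (ha.contMDiffOn.mono (by
    intro q hq
    have := hq.1
    simp at this
    exact this.1)) (by
    intro q hq
    have := hq.1
    simp at this
    exact this.2)
  s_mem β hβ := c.s_mem β (by simp at hβ; exact hβ.1.1)
  e_snd β hβ := by
    simp at hβ
    change (a.symm (c.e β)).2 = _
    rw [← c.e_snd β hβ.1.1, ← h2 _ (a.map_target hβ.1.2), a.right_inv hβ.1.2]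
  e_unit x hx := by
    simp [𝒢.s_unit] at hx
    change a.symm (c.e (𝒢.unit x)) = _
    rw [c.e_unit x hx.1.1]
    have := hx.2.2
    conv_lhs => rw [← h0 _ this]
    exact a.left_inv this

end UnitChart
end FlowBox
end LieGroupoid
-- Existence of flow boxes
namespace LieGroupoid
section FlowBox
open Set Filter Topology Metric MeasureTheory

variable {n₁ n₀ : ℕ} {G M : Type*}
    [TopologicalSpace G] [ChartedSpace (EuclideanSpace ℝ (Fin (n₁ + n₀))) G]
    [TopologicalSpace M] [ChartedSpace (EuclideanSpace ℝ (Fin n₀)) M]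
    {𝒢 : LieGroupoid n₁ n₀ G M}

namespace UnitChart

/-- Averages along the iterated flows of the translation fields in the chart `c₀`. -/
theorem exists_factorization [T2Space G] (c₀ : 𝒢.UnitChart)
    {θ : ℕ → ℝ → EuclideanSpace ℝ (Fin n₁) × EuclideanSpace ℝ (Fin n₀) →
      EuclideanSpace ℝ (Fin n₁) × EuclideanSpace ℝ (Fin n₀)} {ρ δ : ℝ} (hδ : 0 < δ)
    (hδρ : 2 * δ < ρ) {y₀ : EuclideanSpace ℝ (Fin n₀)}
    (h1 : ∀ k ≤ n₁, ContDiffOn ℝ ∞ (Function.uncurry (flowIter θ k))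
      (ball (0 : Fin k → ℝ) ρ ×ˢ ball y₀ ρ))
    (h2 : ∀ k ≤ n₁, ∀ t ∈ ball (0 : Fin k → ℝ) ρ, ∀ x ∈ ball y₀ ρ,
      flowIter θ k t x ∈ c₀.fieldDomain c₀.e ∧ (flowIter θ k t x).2 = x)
    (h3 : ∀ k < n₁, ∀ t ∈ ball (0 : Fin k → ℝ) ρ, ∀ x ∈ ball y₀ ρ,
        flowIter θ (k + 1) (Fin.snoc (α := fun _ => ℝ) t 0) x = flowIter θ k t x ∧
        ∀ a ∈ ball (0 : ℝ) ρ, HasDerivAt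
          (fun a => flowIter θ (k + 1) (Fin.snoc (α := fun _ => ℝ) t a) x)
          (c₀.natField c₀.e k (flowIter θ (k + 1) (Fin.snoc (α := fun _ => ℝ) t a) x)) a)
    {κ : OpenPartialHomeomorph G (EuclideanSpace ℝ (Fin (n₁ + n₀)))}
    (hκ : IsSmoothChart (n₁ + n₀) κ) {h : EuclideanSpace ℝ (Fin (n₁ + n₀)) → ℂ}
    (hh : ContDiff ℝ ∞ h) (hc : HasCompactSupport h) (hs : tsupport h ⊆ c₀.fieldDomain κ) :
    ∃ (J : Type) (_ : Fintype J) (f : J → EuclideanSpace ℝ (Fin n₁) → ℝ)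
      (χ : J → EuclideanSpace ℝ (Fin (n₁ + n₀)) → ℂ),
      (∀ j, ContDiff ℝ ∞ (f j) ∧ Function.support (f j) ⊆ euclideanBox n₁ δ ∧
        ContDiff ℝ ∞ (χ j) ∧ tsupport (χ j) ⊆ tsupport h) ∧
      ∀ γ, 𝒢.r γ ∈ c₀.base → c₀.k (𝒢.r γ) ∈ ball y₀ ρ → chartExt κ.source κ h γ =
        ∑ j, ∫ t : EuclideanSpace ℝ (Fin n₁), f j t • chartExt κ.source κ (χ j)
          (𝒢.mul (c₀.e.symm (flowIter θ n₁ t.ofLp (c₀.k (𝒢.r γ)))) γ) := by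
  obtain ⟨J, hJ, f, χ, hf, hfac⟩ := exists_iterated_factorization (c₀.isOpen_fieldDomain κ)
    (contDiffOn_natField hκ) hh hs hc hδ n₁
  refine ⟨J, hJ, fun j t => f j t.ofLp, χ, fun j => ⟨(hf j).1.comp (PiLp.contDiff_ofLp (p := 2)),
    fun t ht => (hf j).2.1 ht, (hf j).2.2⟩, fun γ hγ hx => ?_⟩
  have hIcc : ∀ k, ∀ t ∈ Icc (0 : Fin k → ℝ) (fun _ => δ), t ∈ ball (0 : Fin k → ℝ) ρ := by
    intro k t ht
    rw [mem_ball_zero_iff, pi_norm_lt_iff (by linarith)]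
    intro i
    have h4 := ht.1 i
    have h5 := ht.2 i
    simp only [Pi.zero_apply] at h4
    rw [Real.norm_eq_abs, abs_of_nonneg h4]
    linarith
  have hsupp : ∀ d : EuclideanSpace ℝ (Fin (n₁ + n₀)) → ℂ, tsupport d ⊆ tsupport h →
      HasCompactSupport d ∧ tsupport d ⊆ κ.target := fun d hd =>
    ⟨hc.isCompact.of_isClosed_subset (isClosed_tsupport _) hd, fun w hw => (hs (hd hw)).1⟩
  have hsr : ∀ k ≤ n₁, ∀ t ∈ ball (0 : Fin k → ℝ) ρ,
      𝒢.s (c₀.e.symm (flowIter θ k t (c₀.k (𝒢.r γ)))) = 𝒢.r γ := by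
    intro k hk t ht
    obtain ⟨h4, h5⟩ := h2 k hk t ht _ hx
    rw [c₀.s_symm h4.1, h5, c₀.k.left_inv (c₀.base_subset hγ)]
  -- The point reached after k flows is the product of the k-fold flow of the unit at r(γ) with γ;
  -- for k = 0 it is γ itself.
  have key := hfac κ.source κ (fun k t => 𝒢.mul (c₀.e.symm (flowIter θ k t (c₀.k (𝒢.r γ)))) γ)
    ?_ ?_
  · simp only [flowIter, symm_zero hγ, 𝒢.unit_mul] at key
    rw [key]
    refine Finset.sum_congr rfl fun j _ => ?_
    exact ((PiLp.volume_preserving_ofLp (Fin n₁)).integral_comp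
      (MeasurableEquiv.measurableEmbedding (MeasurableEquiv.toLp 2 (Fin n₁ → ℝ)).symm)
      (fun t => f j t • chartExt κ.source κ (χ j)
          (𝒢.mul (c₀.e.symm (flowIter θ n₁ t (c₀.k (𝒢.r γ)))) γ))).symm
  · intro k hk t ht
    obtain ⟨h4, h5⟩ := h3 k hk t (hIcc k t ht) _ hx
    -- The margin beyond [0, δ] is taken to be δ; times up to 2δ are admissible since 2δ < ρ.
    refine ⟨by simp only [h4], δ, hδ, fun d hd hds a ha => ?_⟩
    have ha' : a ∈ ball (0 : ℝ) ρ := by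
      rw [mem_ball_zero_iff, Real.norm_eq_abs, abs_lt]
      constructor <;> linarith [ha.1, ha.2]
    have hsn : ∀ a ∈ ball (0 : ℝ) ρ,
        (Fin.snoc (α := fun _ => ℝ) t a : Fin (k + 1) → ℝ) ∈ ball 0 ρ := fun a ha =>
      mem_ball_zero_iff.2 (norm_finSnoc_lt (mem_ball_zero_iff.1 (hIcc k t ht))
        (mem_ball_zero_iff.1 ha))
    have h6 := h5 a ha'
    rw [natField_of_lt _ _ hk] at h6 ⊢
    obtain ⟨hdc, hdt⟩ := hsupp d hds
    refine hasDerivAt_chartExt_mul (c := c₀)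
      (z := fun a => flowIter θ (k + 1) (Fin.snoc (α := fun _ => ℝ) t a) (c₀.k (𝒢.r γ)))
      hκ hd hdc hdt ⟨k, hk⟩ (h2 (k + 1) hk _ (hsn a ha') _ hx).1 h6 ?_ (hsr (k + 1) hk _ (hsn a ha'))
    filter_upwards [isOpen_ball.mem_nhds ha'] with a' ha''
    rw [(h2 (k + 1) hk _ (hsn a ha') _ hx).2, (h2 (k + 1) hk _ (hsn a' ha'') _ hx).2]
  · intro k hk d hd hds
    obtain ⟨hdc, hdt⟩ := hsupp d hds
    have h4 : ContinuousOn (fun t => flowIter θ k t (c₀.k (𝒢.r γ)))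
        (Icc (0 : Fin k → ℝ) (fun _ => δ)) :=
      (h1 k hk).continuousOn.comp (f := fun t => (t, c₀.k (𝒢.r γ)))
        (continuousOn_id.prodMk continuousOn_const)
        fun t ht => mk_mem_prod (hIcc k t ht) hx
    have h5 : ContinuousOn (fun t => (c₀.e.symm (flowIter θ k t (c₀.k (𝒢.r γ))), γ))
        (Icc (0 : Fin k → ℝ) (fun _ => δ)) :=
      (c₀.e_symm_smooth.continuousOn.comp h4 fun t ht =>
        (h2 k hk t (hIcc k t ht) _ hx).1.1).prodMk continuousOn_const
    exact (contMDiff_chartExt hκ hd hdc hdt).1.continuous.comp_continuousOn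
      (𝒢.mul_smooth.continuousOn.comp h5 fun t ht => hsr k hk t (hIcc k t ht))

end UnitChart

/-- The iterated flows of the units form a local diffeomorphism, as their differential at (0, y₀) is
the identity. In the chart it defines (canonical coordinates of the second kind), left translation
by the element with coordinate t is the composite of the flows for the times t, so the integral over
flow times is an average over translates. -/
theorem exists_flowBox [T2Space G] {W : Set G} (hW : IsOpen W) (x₀ : M)
    (hx₀ : 𝒢.unit x₀ ∈ W) : ∃ b : 𝒢.FlowBox W, x₀ ∈ b.B := by
  obtain ⟨c₀, hc₀, hsub⟩ : ∃ c : 𝒢.UnitChart, 𝒢.unit x₀ ∈ c.e.source ∧ c.e.source ⊆ W := by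
    obtain ⟨c, hc⟩ := UnitChart.exists_mem_source (𝒢 := 𝒢) x₀
    refine ⟨c.restr W hW, ?_, ?_⟩ <;> rw [c.restr_source hW]
    exacts [⟨hc, hx₀⟩, inter_subset_right]
  have hb₀ : x₀ ∈ c₀.base := hc₀
  set y₀ := c₀.k x₀
  have hsndF : ∀ k, ∀ z ∈ c₀.fieldDomain c₀.e, (c₀.natField c₀.e k z).2 = 0 := by
    intro k z hz
    by_cases h : k < n₁
    · rw [c₀.natField_of_lt _ h, UnitChart.snd_transField _ hz]
    · rw [UnitChart.natField, dif_neg h]; rfl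
  obtain ⟨θ, ρ, hρ, h1, h2, h0, h3, hΛ'⟩ := exists_flowIter (c₀.isOpen_fieldDomain c₀.e)
    (UnitChart.contDiffOn_natField c₀.isSmoothChart) (UnitChart.zero_mem_fieldDomain hb₀) hsndF
    (fun i => by rw [c₀.natField_of_lt _ i.2, UnitChart.transField_zero _ hb₀])
  set Λ : EuclideanSpace ℝ (Fin n₁) × EuclideanSpace ℝ (Fin n₀) →
    EuclideanSpace ℝ (Fin n₁) × EuclideanSpace ℝ (Fin n₀) :=
    fun q => flowIter θ n₁ q.1.ofLp q.2 with hΛdef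
  have hlp : ContDiff ℝ ∞ (fun q : EuclideanSpace ℝ (Fin n₁) × EuclideanSpace ℝ (Fin n₀) =>
      (q.1.ofLp, q.2)) := ((PiLp.contDiff_ofLp (p := 2)).comp contDiff_fst).prodMk contDiff_snd
  set D : Set (EuclideanSpace ℝ (Fin n₁) × EuclideanSpace ℝ (Fin n₀)) :=
    (fun q => (q.1.ofLp, q.2)) ⁻¹' (ball (0 : Fin n₁ → ℝ) ρ ×ˢ ball y₀ ρ)
  have hD : IsOpen D := (isOpen_ball.prod isOpen_ball).preimage hlp.continuous
  have hΛ : ContDiffOn ℝ ∞ Λ D := (h1 n₁ le_rfl).comp hlp.contDiffOn fun q hq => hq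
  have hy₀D : ((0 : EuclideanSpace ℝ (Fin n₁)), y₀) ∈ D :=
    mk_mem_prod (mem_ball_self hρ) (mem_ball_self hρ)
  obtain ⟨a, hae, ha0, haD, has⟩ := exists_openPartialHomeomorph_of_contDiffOn hD hy₀D hΛ
    (f' := ContinuousLinearEquiv.refl ℝ _) hΛ'
  -- In the new chart the fibre coordinates are the flow times: its inverse is that of c₀ composed
  -- with Λ.
  let c := c₀.comp a (by rw [hae]; exact hΛ.mono haD) has
    (fun q hq => by rw [hae]; exact (h2 n₁ le_rfl _ (haD hq).1 _ (haD hq).2).2)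
    (fun y hy => by rw [hae]; exact h0 n₁ le_rfl _ (haD hy).2)
  have hcs : ∀ q, c.e.symm q = c₀.e.symm (Λ q) := fun q => by rw [← hae]; rfl
  have hck : c.k = c₀.k := rfl
  have hΛ0 : a (0, y₀) = (0, y₀) := by
    rw [hae]; exact h0 n₁ le_rfl _ (mem_ball_self hρ)
  have hbc : x₀ ∈ c.base := by
    refine ⟨⟨hc₀, ?_⟩, hc₀, ?_⟩
    · rw [mem_preimage]
      change c₀.e (𝒢.unit x₀) ∈ a.target
      rw [c₀.e_unit x₀ hc₀, ← hΛ0]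
      exact a.map_source ha0
    · simpa [𝒢.s_unit] using ha0
  have hbase : c.base ⊆ c₀.base := fun x hx => hx.1.1
  obtain ⟨η, hη, hηsub⟩ := Metric.mem_nhds_iff.1 ((c.isOpen_fieldDomain c.e).mem_nhds
    (UnitChart.zero_mem_fieldDomain hbc))
  rw [← ball_prod_same] at hηsub
  -- The cube is measured in the supremum norm and the chart domain in the Euclidean norm; η'
  -- compares the two.
  obtain ⟨η', hη', hη'sub⟩ := Metric.mem_nhds_iff.1 (((PiLp.continuous_toLp 2
    (fun _ : Fin n₁ => ℝ)).isOpen_preimage _ (isOpen_ball (x := 0) (ε := η))).mem_nhds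
      (x := 0) (by simpa using hη))
  set δ := min (ρ / 3) (η' / 2)
  have hδ : 0 < δ := lt_min (by positivity) (by positivity)
  have hδρ : 2 * δ < ρ := by
    have := min_le_left (ρ / 3) (η' / 2)
    linarith
  have hbox : ∀ t ∈ euclideanBox n₁ δ, t ∈ ball 0 η := by
    intro t ht
    refine hη'sub (a := t.ofLp) ?_
    rw [mem_ball_zero_iff, pi_norm_lt_iff hη']
    intro i
    have h4 := ht.1 i
    have h5 := ht.2 i
    simp only [Pi.zero_apply] at h4
    have := min_le_right (ρ / 3) (η' / 2)
    rw [Real.norm_eq_abs, abs_of_nonneg h4]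
    linarith
  have hBopen : IsOpen (c.base ∩ c.k ⁻¹' (ball y₀ (min ρ η))) :=
    (c.k.continuousOn.mono c.base_subset).isOpen_inter_preimage c.isOpen_base isOpen_ball
  refine ⟨{ c := c, B := c.base ∩ c.k ⁻¹' (ball y₀ (min ρ η)), δ := δ
            source_subset := fun β hβ => hsub hβ.1.1
            isOpen_B := hBopen
            B_subset := inter_subset_left
            box_mem := fun t ht x hx => hηsub (mk_mem_prod (hbox t ht)
              (ball_subset_ball (min_le_right _ _) hx.2))
            factor := fun κ hκ h hh hc hs => ?_ }, hbc, mem_ball_self (lt_min hρ hη)⟩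
  obtain ⟨J, hJ, f, χ, hf, hfac⟩ := c₀.exists_factorization hδ hδρ h1 h2 h3 hκ hh hc
    (fun w hw => ⟨(hs hw).1, hbase (hs hw).2.1⟩)
  refine ⟨J, hJ, f, χ, hf, fun γ hγ => ?_⟩
  rw [hfac γ (hbase hγ.1) (ball_subset_ball (min_le_left _ _) hγ.2)]
  simp only [UnitChart.trans, hcs, hck, hΛdef]

end FlowBox
end LieGroupoid
-- Linear algebra of densities
section Density
open Set

variable {E : Type*} [AddCommGroup E] [Module ℝ E] {k : ℕ}

/-- The matrix of the coordinates with respect to `N` of a tuple of vectors. -/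
def coordMatrix (N : E →ₗ[ℝ] EuclideanSpace ℝ (Fin k)) (a : Fin k → E) :
    Matrix (Fin k) (Fin k) ℝ := Matrix.of fun i j => N (a i) j

theorem coordMatrix_sum (N : E →ₗ[ℝ] EuclideanSpace ℝ (Fin k)) (P : Matrix (Fin k) (Fin k) ℝ)
    (a : Fin k → E) : coordMatrix N (fun i => ∑ j, P i j • a j) = P * coordMatrix N a := by
  ext i j
  simp [coordMatrix, Matrix.mul_apply]

open Classical in
/-- The `α`-density on `W` that is given by the volume element of the coordinates `N`. -/
noncomputable def coordDensity (α : ℝ) (W : Submodule ℝ E) (N : E →ₗ[ℝ] EuclideanSpace ℝ (Fin k))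
    (a : Fin k → E) : ℝ :=
  if IsFrame W a then |(coordMatrix N a).det| ^ α else 0

/-- `N` restricts to linear coordinates on the subspace `W`, with coordinate basis `X`. -/
structure IsCoordFrame (W : Submodule ℝ E) (N : E →ₗ[ℝ] EuclideanSpace ℝ (Fin k))
    (X : Fin k → E) : Prop where
  frame : IsFrame W X
  apply : ∀ i, N (X i) = EuclideanSpace.single i 1

theorem IsFrame.mem {W : Submodule ℝ E} {a : Fin k → E} (h : IsFrame W a) (i : Fin k) :
    a i ∈ W := h.2 ▸ Submodule.subset_span (mem_range_self i)

theorem IsFrame.sum_smul {W : Submodule ℝ E} {a : Fin k → E} (h : IsFrame W a)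
    {P : Matrix (Fin k) (Fin k) ℝ} (hP : P.det ≠ 0) : IsFrame W (fun i => ∑ j, P i j • a j) := by
  have hu : IsUnit P.det := isUnit_iff_ne_zero.2 hP
  have hinv : ∀ i, a i = ∑ j, P⁻¹ i j • ∑ l, P j l • a l := by
    intro i
    simp only [Finset.smul_sum, smul_smul]
    rw [Finset.sum_comm]
    simp only [← Finset.sum_smul, ← Matrix.mul_apply, Matrix.nonsing_inv_mul P hu]
    simp [Matrix.one_apply]
  refine ⟨?_, le_antisymm ?_ ?_⟩
  · rw [Fintype.linearIndependent_iff] at *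
    have h1 := Fintype.linearIndependent_iff.1 h.1
    intro g hg
    have h2 := h1 (Matrix.vecMul g P) (by
      rw [← hg]
      simp only [Matrix.vecMul, dotProduct, Finset.sum_smul, Finset.smul_sum, smul_smul]
      exact Finset.sum_comm)
    have h3 : Matrix.vecMul (Matrix.vecMul g P) P⁻¹ = 0 := by
      rw [show Matrix.vecMul g P = 0 from funext h2, Matrix.zero_vecMul]
    rw [Matrix.vecMul_vecMul, Matrix.mul_nonsing_inv P hu, Matrix.vecMul_one] at h3
    exact fun i => congrFun h3 i
  · rw [Submodule.span_le]
    rintro _ ⟨i, rfl⟩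
    exact W.sum_mem fun j _ => W.smul_mem _ (h.mem j)
  · rw [← h.2, Submodule.span_le]
    rintro _ ⟨i, rfl⟩
    rw [SetLike.mem_coe, hinv i]
    exact Submodule.sum_mem _ fun j _ => Submodule.smul_mem _ _
      (Submodule.subset_span (mem_range_self j))

variable {W : Submodule ℝ E} {N : E →ₗ[ℝ] EuclideanSpace ℝ (Fin k)} {X : Fin k → E}

theorem IsCoordFrame.sum_smul_eq (h : IsCoordFrame W N X) {v : E} (hv : v ∈ W) :
    ∑ j, N v j • X j = v := by
  rw [← h.frame.2, Submodule.mem_span_range_iff_exists_fun] at hv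
  obtain ⟨g, rfl⟩ := hv
  refine Finset.sum_congr rfl fun j _ => ?_
  simp [h.apply, Pi.single_apply]

theorem IsCoordFrame.coordMatrix_self (h : IsCoordFrame W N X) : coordMatrix N X = 1 := by
  ext i j
  simp [coordMatrix, h.apply, Matrix.one_apply, eq_comm]

theorem IsCoordFrame.det_ne_zero (h : IsCoordFrame W N X) {a : Fin k → E} (ha : IsFrame W a) :
    (coordMatrix N a).det ≠ 0 := by
  intro h0
  obtain ⟨v, hv, hv0⟩ := Matrix.exists_vecMul_eq_zero_iff.2 h0
  refine hv (funext fun i => ?_)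
  refine Fintype.linearIndependent_iff.1 ha.1 v ?_ i
  have h1 : N (∑ i, v i • a i) = 0 := by
    ext j
    simpa [Matrix.vecMul, dotProduct, coordMatrix] using congrFun hv0 j
  rw [← h.sum_smul_eq (W.sum_mem fun i _ => W.smul_mem (v i) (ha.mem i)), h1]
  simp

theorem IsCoordFrame.isFrame (h : IsCoordFrame W N X) {a : Fin k → E} (ha : ∀ i, a i ∈ W)
    (hd : (coordMatrix N a).det ≠ 0) : IsFrame W a := by
  have h1 := h.frame.sum_smul hd
  simpa only [coordMatrix, Matrix.of_apply, h.sum_smul_eq (ha _)] using h1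

theorem coordDensity_of_isFrame {α : ℝ} {a : Fin k → E} (ha : IsFrame W a) :
    coordDensity α W N a = |(coordMatrix N a).det| ^ α := if_pos ha

theorem coordDensity_of_not_isFrame {α : ℝ} {a : Fin k → E} (ha : ¬ IsFrame W a) :
    coordDensity α W N a = 0 := if_neg ha

theorem isDensity_coordDensity_mul (α : ℝ) (W : Submodule ℝ E)
    (N : E →ₗ[ℝ] EuclideanSpace ℝ (Fin k)) (z : ℂ) :
    IsDensity α W (fun a : Fin k → E => z * (coordDensity α W N a : ℂ)) where
  zero_of_not_frame a ha := by simp [coordDensity_of_not_isFrame ha]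
  homogeneous a ha P hP := by
    rw [coordDensity_of_isFrame ha, coordDensity_of_isFrame (ha.sum_smul hP), coordMatrix_sum,
      Matrix.det_mul, abs_mul, Real.mul_rpow (abs_nonneg _) (abs_nonneg _)]
    push_cast
    ring

/-- Densities form a line: expanding a in the frame X has `coordMatrix N a` as its matrix, and
homogeneity does the rest. -/
theorem IsDensity.eq_mul_coordDensity {α : ℝ} {δ : (Fin k → E) → ℂ} (hδ : IsDensity α W δ)
    (h : IsCoordFrame W N X) (a : Fin k → E) : δ a = δ X * (coordDensity α W N a : ℂ) := by
  by_cases ha : IsFrame W a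
  · have h1 := hδ.homogeneous X h.frame _ (h.det_ne_zero ha)
    have h2 : (fun i => ∑ j, coordMatrix N a i j • X j) = a :=
      funext fun i => h.sum_smul_eq (ha.mem i)
    rw [h2] at h1
    rw [h1, coordDensity_of_isFrame ha, mul_comm]
  · rw [hδ.zero_of_not_frame a ha, coordDensity_of_not_isFrame ha]
    simp

theorem coordDensity_mul {α β : ℝ} (h : IsCoordFrame W N X) (a : Fin k → E) :
    coordDensity α W N a * coordDensity β W N a = coordDensity (α + β) W N a := by
  by_cases ha : IsFrame W a
  · simp only [coordDensity_of_isFrame ha]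
    rw [Real.rpow_add (abs_pos.2 (h.det_ne_zero ha))]
  · simp only [coordDensity_of_not_isFrame ha, mul_zero]

end Density

/-! ### A block determinant identity -/

section BlockDet
open Set Matrix

variable {n₁ n₀ : ℕ}

/-- The determinant of a tuple of `n` vectors of `ℝ^n`. -/
noncomputable def tupleDet {n : ℕ} (t : Fin n → EuclideanSpace ℝ (Fin n)) : ℝ :=
  (coordMatrix LinearMap.id t).det

/-- The auxiliary determinant by which `tupleDet (Fin.append V L)` becomes block triangular. -/
noncomputable def dualDet (V : Fin n₁ → EuclideanSpace ℝ (Fin (n₁ + n₀)))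
    (S : EuclideanSpace ℝ (Fin (n₁ + n₀)) →L[ℝ] EuclideanSpace ℝ (Fin n₀)) : ℝ :=
  (Matrix.of fun l => Fin.append (fun i => V i l) fun j => S (EuclideanSpace.single l 1) j).det

/-- The mutual Gram matrix of two tuples of vectors. -/
noncomputable def gramDet {n m : ℕ} (V V₀ : Fin n → EuclideanSpace ℝ (Fin m)) : ℝ :=
  (Matrix.of fun i j => ∑ l, V i l * V₀ j l).det

/-- The product of the two matrices is block triangular because S annihilates V. The point is that
arbitrary, possibly discontinuous lifts L enter the determinant only through their images under S.
-/
theorem tupleDet_append_mul_dualDet {V V₀ : Fin n₁ → EuclideanSpace ℝ (Fin (n₁ + n₀))}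
    {L : Fin n₀ → EuclideanSpace ℝ (Fin (n₁ + n₀))}
    {S : EuclideanSpace ℝ (Fin (n₁ + n₀)) →L[ℝ] EuclideanSpace ℝ (Fin n₀)}
    (hV : ∀ i, S (V i) = 0) :
    tupleDet (Fin.append V L) * dualDet V₀ S =
      gramDet V V₀ * (coordMatrix LinearMap.id fun j => S (L j)).det := by
  have hS : ∀ v : EuclideanSpace ℝ (Fin (n₁ + n₀)), ∀ j,
      ∑ l, v l * S (EuclideanSpace.single l 1) j = S v j := by
    intro v j
    have h1 : v = ∑ l, v l • EuclideanSpace.single l (1 : ℝ) := by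
      ext l
      simp [Pi.single_apply]
    conv_rhs => rw [h1]
    simp
  rw [tupleDet, dualDet, ← Matrix.det_mul, ← Matrix.det_submatrix_equiv_self finSumFinEquiv]
  have h2 : (coordMatrix LinearMap.id (Fin.append V L) * Matrix.of fun l =>
      Fin.append (fun i => V₀ i l) fun j => S (EuclideanSpace.single l 1) j).submatrix
      finSumFinEquiv finSumFinEquiv = Matrix.fromBlocks
        (Matrix.of fun i j => ∑ l, V i l * V₀ j l) 0
        (Matrix.of fun i j => ∑ l, L i l * V₀ j l)
        (coordMatrix LinearMap.id fun j => S (L j)) := by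
    ext (i | i) (j | j) <;> simp [coordMatrix, Matrix.mul_apply, hS, hV]
  rw [h2, Matrix.det_fromBlocks_zero₁₂, gramDet]

theorem gramDet_sum_smul {n m : ℕ} (P : Matrix (Fin n) (Fin n) ℝ)
    (V V₀ : Fin n → EuclideanSpace ℝ (Fin m)) :
    gramDet (fun i => ∑ j, P i j • V j) V₀ = P.det * gramDet V V₀ := by
  rw [gramDet, gramDet, ← Matrix.det_mul]
  congr 1
  ext i j
  simp only [Matrix.of_apply, Matrix.mul_apply, WithLp.ofLp_sum, WithLp.ofLp_smul, Finset.sum_apply,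
    Pi.smul_apply, smul_eq_mul, Finset.sum_mul, Finset.mul_sum, mul_assoc]
  exact Finset.sum_comm

theorem gramDet_self_ne_zero {n m : ℕ} {V : Fin n → EuclideanSpace ℝ (Fin m)}
    (hV : LinearIndependent ℝ V) : gramDet V V ≠ 0 := by
  intro h0
  obtain ⟨v, hv, hv0⟩ := Matrix.exists_vecMul_eq_zero_iff.2 h0
  refine hv (funext fun i => Fintype.linearIndependent_iff.1 hV v ?_ i)
  set u := ∑ i, v i • V i
  have hu : ∀ l, u l = ∑ i, v i * V i l := fun l => by simp [u]
  have h1 : ∀ j, ∑ l, u l * V j l = 0 := by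
    intro j
    have := congrFun hv0 j
    simp only [Matrix.vecMul, dotProduct, Matrix.of_apply, Pi.zero_apply, Finset.mul_sum] at this
    rw [← this, Finset.sum_comm]
    refine Finset.sum_congr rfl fun l _ => ?_
    rw [hu, Finset.sum_mul]
    exact Finset.sum_congr rfl fun i _ => by ring
  have h2 : ∑ l, u l * u l = 0 := by
    calc ∑ l, u l * u l = ∑ l, ∑ j, v j * (u l * V j l) := by
          refine Finset.sum_congr rfl fun l _ => ?_
          rw [show u l * u l = (∑ j, v j * V j l) * u l by rw [← hu l], Finset.sum_mul]
          exact Finset.sum_congr rfl fun j _ => by ring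
      _ = ∑ j, v j * ∑ l, u l * V j l := by
          rw [Finset.sum_comm]
          simp only [Finset.mul_sum]
      _ = 0 := by simp [h1]
  have h3 := (Finset.sum_eq_zero_iff_of_nonneg fun l _ => mul_self_nonneg (u l)).1 h2
  ext l
  exact mul_self_eq_zero.1 (h3 l (Finset.mem_univ l))

end BlockDet
-- Smoothness of differentials along families of tangent vectors
section TangentSmooth
open Set Filter Topology Bundle

variable {E H EN HN : Type*} [NormedAddCommGroup E] [NormedSpace ℝ E] [NormedAddCommGroup H]
  [NormedSpace ℝ H] [NormedAddCommGroup EN] [NormedSpace ℝ EN] [TopologicalSpace HN]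
  {I : ModelWithCorners ℝ EN HN} {X N : Type*} [TopologicalSpace X] [ChartedSpace E X]
  [IsManifold 𝓘(ℝ, E) ∞ X] [TopologicalSpace N] [ChartedSpace HN N]

/-- The differential of a vector-valued map along a smooth family of tangent vectors is smooth. -/
theorem ContMDiffOn.mfderiv_apply_tangent {g : X → H} {O : Set X} (hO : IsOpen O)
    (hg : ContMDiffOn 𝓘(ℝ, E) 𝓘(ℝ, H) ∞ g O) {b : N → X} {v : N → E} {U : Set N}
    (hb : ContMDiffOn I 𝓘(ℝ, E).tangent ∞ (fun x => (⟨b x, v x⟩ : TangentBundle 𝓘(ℝ, E) X)) U)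
    (hU : MapsTo b U O) :
    ContMDiffOn I 𝓘(ℝ, H) ∞ (fun x => (mfderiv 𝓘(ℝ, E) 𝓘(ℝ, H) g (b x) (v x) : H)) U := by
  have h1 := hg.contMDiffOn_tangentMapWithin (m := ∞) (by simp) hO.uniqueMDiffOn
  have h2 := (contMDiff_snd_tangentBundle_modelSpace H 𝓘(ℝ, H) (n := ∞)).comp_contMDiffOn
    (h1.comp hb fun x hx => hU hx)
  refine h2.congr fun x hx => ?_
  change _ = mfderivWithin 𝓘(ℝ, E) 𝓘(ℝ, H) g O (b x) (v x)
  rw [mfderivWithin_of_isOpen hO (hU hx)]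

/-- The images of a constant vector under the differential of a smooth map form a smooth family of
tangent vectors. -/
theorem ContMDiffOn.tangent_mfderiv_apply {p : H → X} {O : Set H} (hO : IsOpen O)
    (hp : ContMDiffOn 𝓘(ℝ, H) 𝓘(ℝ, E) ∞ p O) {u : N → H} {U : Set N}
    (hu : ContMDiffOn I 𝓘(ℝ, H) ∞ u U) (hU : MapsTo u U O) (v : H) :
    ContMDiffOn I 𝓘(ℝ, E).tangent ∞ (fun x =>
      (⟨p (u x), mfderiv 𝓘(ℝ, H) 𝓘(ℝ, E) p (u x) v⟩ : TangentBundle 𝓘(ℝ, E) X)) U := by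
  have h1 := hp.contMDiffOn_tangentMapWithin (m := ∞) (by simp) hO.uniqueMDiffOn
  have h3 : ContMDiff 𝓘(ℝ, H) 𝓘(ℝ, H).tangent ∞
      (fun x => (⟨x, v⟩ : TangentBundle 𝓘(ℝ, H) H)) :=
    contMDiff_vectorSpace_iff_contDiff.2 contDiff_const
  refine (h1.comp (h3.comp_contMDiffOn hu) fun x hx => hU hx).congr fun x hx => ?_
  change _ = (⟨p (u x), mfderivWithin 𝓘(ℝ, H) 𝓘(ℝ, E) p O (u x) v⟩ : TangentBundle 𝓘(ℝ, E) X)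
  rw [mfderivWithin_of_isOpen hO (hU hx)]

theorem ContMDiffOn.det_coordMatrix {k : ℕ} {N' : N → H →ₗ[ℝ] EuclideanSpace ℝ (Fin k)}
    {Y : N → Fin k → H} {U : Set N}
    (h : ∀ i, ContMDiffOn I 𝓘(ℝ, EuclideanSpace ℝ (Fin k)) ∞ (fun x => N' x (Y x i)) U) :
    ContMDiffOn I 𝓘(ℝ, ℝ) ∞ (fun x => (coordMatrix (N' x) (Y x)).det) U := by
  have h1 : ∀ i j, ContMDiffOn I 𝓘(ℝ, ℝ) ∞ (fun x => N' x (Y x i) j) U := fun i j =>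
    ((EuclideanSpace.proj (𝕜 := ℝ) j).contDiff (n := ∞)).contMDiff.comp_contMDiffOn (h i)
  have h2 : ContDiff ℝ ∞ (fun A : Fin k → Fin k → ℝ => (Matrix.of A).det) := by
    simp only [Matrix.det_apply']
    refine ContDiff.sum fun i _ => contDiff_const.mul ?_
    refine contDiff_prod fun j _ => ?_
    exact (contDiff_apply ℝ ℝ j).comp (contDiff_apply ℝ (Fin k → ℝ) (i j))
  refine h2.contMDiff.comp_contMDiffOn (f := fun x i j => N' x (Y x i) j) ?_
  exact contMDiffOn_pi_space.2 fun i => contMDiffOn_pi_space.2 fun j => h1 i j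

theorem ContMDiffOn.abs_rpow {f : N → ℝ} {U : Set N} (hf : ContMDiffOn I 𝓘(ℝ, ℝ) ∞ f U)
    (h0 : ∀ x ∈ U, f x ≠ 0) (α : ℝ) : ContMDiffOn I 𝓘(ℝ, ℝ) ∞ (fun x => |f x| ^ α) U := by
  intro x hx
  have h1 : ContDiffAt ℝ ∞ (fun y : ℝ => |y| ^ α) (f x) :=
    (contDiffAt_abs (h0 x hx)).rpow_const_of_ne (abs_ne_zero.2 (h0 x hx))
  exact h1.contMDiffAt.comp_contMDiffWithinAt x (hf x hx)

end TangentSmooth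

/-! ### Manifold derivatives as maps of model spaces -/

section FlatDeriv
open Filter Topology

variable {X Y Z : Type*} [TopologicalSpace X] [TopologicalSpace Y] [TopologicalSpace Z]
  (E E' E'' : Type*) [NormedAddCommGroup E] [NormedSpace ℝ E] [NormedAddCommGroup E']
  [NormedSpace ℝ E'] [NormedAddCommGroup E''] [NormedSpace ℝ E'']
  [ChartedSpace E X] [ChartedSpace E' Y] [ChartedSpace E'' Z]

/-- The manifold derivative, as a linear map between the model spaces. -/
noncomputable def flatDeriv (f : X → Y) (x : X) : E →L[ℝ] E' := mfderiv 𝓘(ℝ, E) 𝓘(ℝ, E') f x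

variable {E E' E''}

theorem flatDeriv_comp {g : Y → Z} {f : X → Y} {x : X}
    (hg : MDifferentiableAt 𝓘(ℝ, E') 𝓘(ℝ, E'') g (f x))
    (hf : MDifferentiableAt 𝓘(ℝ, E) 𝓘(ℝ, E') f x) :
    flatDeriv E E'' (g ∘ f) x = (flatDeriv E' E'' g (f x)).comp (flatDeriv E E' f x) :=
  mfderiv_comp x hg hf

theorem flatDeriv_congr {f g : X → Y} {x : X} (h : f =ᶠ[𝓝 x] g) :
    flatDeriv E E' f x = flatDeriv E E' g x := h.mfderiv_eq

theorem flatDeriv_eq_fderiv (f : E → E') (x : E) : flatDeriv E E' f x = fderiv ℝ f x :=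
  mfderiv_eq_fderiv

theorem flatDeriv_const (y : Y) (x : X) : flatDeriv E E' (fun _ => y) x = 0 := mfderiv_const

theorem OpenPartialHomeomorph.MDifferentiable.flatDeriv_symm_apply {e : OpenPartialHomeomorph X Y}
    (he : e.MDifferentiable 𝓘(ℝ, E) 𝓘(ℝ, E')) {x : X} (hx : x ∈ e.source) (v : E) :
    flatDeriv E' E e.symm (e x) (flatDeriv E E' e x v) = v :=
  DFunLike.congr_fun (he.symm_comp_deriv hx) v

theorem OpenPartialHomeomorph.MDifferentiable.flatDeriv_apply_symm {e : OpenPartialHomeomorph X Y}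
    (he : e.MDifferentiable 𝓘(ℝ, E) 𝓘(ℝ, E')) {y : Y} (hy : y ∈ e.target) (v : E') :
    flatDeriv E E' e (e.symm y) (flatDeriv E' E e.symm y v) = v :=
  DFunLike.congr_fun (he.comp_symm_deriv hy) v

end FlatDeriv

/-! ### Frames of the algebroid and of the base from a chart near units -/

namespace LieGroupoid
section UnitFrame
open Set Filter Topology

variable {n₁ n₀ : ℕ} {G M : Type*}
    [TopologicalSpace G] [ChartedSpace (EuclideanSpace ℝ (Fin (n₁ + n₀))) G]
    [TopologicalSpace M] [ChartedSpace (EuclideanSpace ℝ (Fin n₀)) M]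
    {𝒢 : LieGroupoid n₁ n₀ G M}

namespace UnitChart
variable (c : 𝒢.UnitChart)

/-- The linear coordinates on the fibre of the algebroid at `x` that a chart near units induces. -/
noncomputable def algCoord (x : M) :
    EuclideanSpace ℝ (Fin (n₁ + n₀)) →ₗ[ℝ] EuclideanSpace ℝ (Fin n₁) :=
  (LinearMap.fst ℝ (EuclideanSpace ℝ (Fin n₁)) (EuclideanSpace ℝ (Fin n₀))).comp
    (flatDeriv (EuclideanSpace ℝ (Fin (n₁ + n₀)))
      (EuclideanSpace ℝ (Fin n₁) × EuclideanSpace ℝ (Fin n₀)) c.e (𝒢.unit x)).toLinearMap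

/-- The frame of the algebroid that a chart near units induces. -/
noncomputable def algFrame (x : M) (i : Fin n₁) : EuclideanSpace ℝ (Fin (n₁ + n₀)) :=
  flatDeriv (EuclideanSpace ℝ (Fin n₁) × EuclideanSpace ℝ (Fin n₀))
    (EuclideanSpace ℝ (Fin (n₁ + n₀))) c.e.symm (0, c.k x) (EuclideanSpace.single i (1 : ℝ), 0)

/-- The linear coordinates on `T_x M` that a chart near units induces. -/
noncomputable def baseCoord (x : M) :
    EuclideanSpace ℝ (Fin n₀) →ₗ[ℝ] EuclideanSpace ℝ (Fin n₀) :=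
  (flatDeriv (EuclideanSpace ℝ (Fin n₀)) (EuclideanSpace ℝ (Fin n₀)) c.k x).toLinearMap

/-- The frame of `TM` that a chart near units induces. -/
noncomputable def baseFrame (x : M) (i : Fin n₀) : EuclideanSpace ℝ (Fin n₀) :=
  flatDeriv (EuclideanSpace ℝ (Fin n₀)) (EuclideanSpace ℝ (Fin n₀)) c.k.symm (c.k x)
    (EuclideanSpace.single i (1 : ℝ))

theorem mdifferentiable_e : c.e.MDifferentiable (𝓡 (n₁ + n₀))
    𝓘(ℝ, EuclideanSpace ℝ (Fin n₁) × EuclideanSpace ℝ (Fin n₀)) :=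
  ⟨c.e_smooth.mdifferentiableOn (by simp), c.e_symm_smooth.mdifferentiableOn (by simp)⟩

theorem mdifferentiable_k : c.k.MDifferentiable (𝓡 n₀) (𝓡 n₀) :=
  ⟨c.k_smooth.mdifferentiableOn (by simp), c.k_symm_smooth.mdifferentiableOn (by simp)⟩

variable {c}

theorem mdifferentiableAt_s (γ : G) : MDifferentiableAt (𝓡 (n₁ + n₀)) (𝓡 n₀) 𝒢.s γ :=
  s_contMDiff.mdifferentiableAt (by simp)

theorem isCoordFrame_base {x : M} (hx : x ∈ c.k.source) :
    IsCoordFrame ⊤ (c.baseCoord x) (c.baseFrame x) := by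
  have h1 : ∀ i, c.baseCoord x (c.baseFrame x i) = EuclideanSpace.single i 1 := fun i => by
    have := c.mdifferentiable_k.flatDeriv_apply_symm (c.k.map_source hx) (EuclideanSpace.single i 1)
    rwa [c.k.left_inv hx] at this
  have h2 : LinearIndependent ℝ (c.baseFrame x) := by
    refine LinearIndependent.of_comp (c.baseCoord x) ?_
    have : (c.baseCoord x ∘ c.baseFrame x) = (EuclideanSpace.basisFun (Fin n₀) ℝ).toBasis := by
      ext i : 1
      simp [h1 i]
    rw [this]
    exact (EuclideanSpace.basisFun (Fin n₀) ℝ).toBasis.linearIndependent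
  exact ⟨⟨h2, h2.span_eq_top_of_card_eq_finrank' (by simp)⟩, h1⟩

theorem mem_algebroid_iff {x : M} {v : EuclideanSpace ℝ (Fin (n₁ + n₀))} :
    v ∈ 𝒢.algebroid x ↔ flatDeriv (EuclideanSpace ℝ (Fin (n₁ + n₀))) (EuclideanSpace ℝ (Fin n₀))
      𝒢.s (𝒢.unit x) v = 0 := Iff.rfl

/-- The differential of a chart near units, followed by the projection to the base. -/
theorem snd_flatDeriv {β : G} (hβ : β ∈ c.e.source) (v : EuclideanSpace ℝ (Fin (n₁ + n₀))) :
    (flatDeriv (EuclideanSpace ℝ (Fin (n₁ + n₀)))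
      (EuclideanSpace ℝ (Fin n₁) × EuclideanSpace ℝ (Fin n₀)) c.e β v).2 =
    flatDeriv (EuclideanSpace ℝ (Fin n₀)) (EuclideanSpace ℝ (Fin n₀)) c.k (𝒢.s β)
      (flatDeriv (EuclideanSpace ℝ (Fin (n₁ + n₀))) (EuclideanSpace ℝ (Fin n₀)) 𝒢.s β v) := by
  have h3 : (Prod.snd ∘ c.e) =ᶠ[𝓝 β] c.k ∘ 𝒢.s := by
    filter_upwards [c.e.open_source.mem_nhds hβ] with β hβ
    exact c.e_snd β hβ
  have h4 := flatDeriv_comp (E'' := EuclideanSpace ℝ (Fin n₀)) (x := β) (g := Prod.snd)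
    (ContDiff.contMDiff contDiff_snd |>.mdifferentiableAt (n := ∞) (by simp))
    (c.mdifferentiable_e.mdifferentiableAt hβ)
  rw [flatDeriv_congr h3, flatDeriv_comp (c.mdifferentiable_k.mdifferentiableAt (c.s_mem β hβ))
    (mdifferentiableAt_s β), flatDeriv_eq_fderiv, fderiv_snd] at h4
  exact (DFunLike.congr_fun h4 v).symm

/-- The second coordinate of the chart is the source read in a chart of M, so its differential at a
unit carries the kernel of ds onto the first factor. -/
theorem isCoordFrame_alg {x : M} (hx : x ∈ c.base) :
    IsCoordFrame (𝒢.algebroid x) (c.algCoord x) (c.algFrame x) := by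
  have hz := zero_mem hx
  have hkx := c.base_subset hx
  have hfl : ∀ i, flatDeriv (EuclideanSpace ℝ (Fin (n₁ + n₀)))
      (EuclideanSpace ℝ (Fin n₁) × EuclideanSpace ℝ (Fin n₀)) c.e (𝒢.unit x) (c.algFrame x i) =
      (EuclideanSpace.single i 1, 0) := fun i => by
    have := c.mdifferentiable_e.flatDeriv_apply_symm hz (EuclideanSpace.single i 1, 0)
    rwa [symm_zero hx] at this
  have h1 : ∀ i, c.algCoord x (c.algFrame x i) = EuclideanSpace.single i 1 := fun i =>
    congrArg Prod.fst (hfl i)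
  have h2 : LinearIndependent ℝ (c.algFrame x) := by
    refine LinearIndependent.of_comp (c.algCoord x) ?_
    have : (c.algCoord x ∘ c.algFrame x) = (EuclideanSpace.basisFun (Fin n₁) ℝ).toBasis := by
      ext i : 1
      simp [h1 i]
    rw [this]
    exact (EuclideanSpace.basisFun (Fin n₁) ℝ).toBasis.linearIndependent
  refine ⟨⟨h2, le_antisymm ?_ ?_⟩, h1⟩
  · rw [Submodule.span_le]
    rintro _ ⟨i, rfl⟩
    have h3 := snd_flatDeriv (c := c) hx (c.algFrame x i)
    rw [hfl i, 𝒢.s_unit] at h3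
    rw [SetLike.mem_coe, mem_algebroid_iff]
    have h4 := c.mdifferentiable_k.flatDeriv_symm_apply hkx (flatDeriv
      (EuclideanSpace ℝ (Fin (n₁ + n₀))) (EuclideanSpace ℝ (Fin n₀)) 𝒢.s (𝒢.unit x)
      (c.algFrame x i))
    rw [← h3] at h4
    rw [← h4]
    exact map_zero _
  · intro v hv
    rw [mem_algebroid_iff] at hv
    have h6 := snd_flatDeriv (c := c) hx v
    rw [hv, map_zero] at h6
    have h9 := c.mdifferentiable_e.flatDeriv_symm_apply hx v
    rw [c.e_unit x hx] at h9
    set w := flatDeriv (EuclideanSpace ℝ (Fin (n₁ + n₀)))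
      (EuclideanSpace ℝ (Fin n₁) × EuclideanSpace ℝ (Fin n₀)) c.e (𝒢.unit x) v
    have h10 : w = ∑ i, w.1 i • ((EuclideanSpace.single i (1 : ℝ), 0) :
      EuclideanSpace ℝ (Fin n₁) × EuclideanSpace ℝ (Fin n₀)) := by
      refine Prod.ext ?_ ?_
      · ext l
        simp [Prod.fst_sum, Pi.single_apply]
      · simp [Prod.snd_sum, h6]
    rw [h10, map_sum] at h9
    rw [← h9]
    refine Submodule.sum_mem _ fun i _ => ?_
    rw [map_smul]
    exact Submodule.smul_mem _ _ (Submodule.subset_span (mem_range_self i))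

variable [IsManifold (𝓡 (n₁ + n₀)) ∞ G]

variable (c) in
theorem isAlgebroidFrame_algFrame : 𝒢.IsAlgebroidFrame c.base c.algFrame where
  isOpen := c.isOpen_base
  frame x hx := (isCoordFrame_alg hx).frame
  smooth i := by
    have h1 : ContMDiffOn (𝓡 n₀) 𝓘(ℝ, EuclideanSpace ℝ (Fin n₁) × EuclideanSpace ℝ (Fin n₀)) ∞
        (fun x => ((0 : EuclideanSpace ℝ (Fin n₁)), c.k x)) c.base :=
      contMDiffOn_const.prodMk_space (c.k_smooth.mono c.base_subset)
    refine (ContMDiffOn.tangent_mfderiv_apply c.e.open_target c.e_symm_smooth h1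
      (fun x hx => zero_mem hx) (EuclideanSpace.single i (1 : ℝ), 0)).congr fun x hx => ?_
    rw [symm_zero hx]
    rfl

theorem contMDiffOn_coordDensity {U : Set M} {Y : M → Fin n₁ → EuclideanSpace ℝ (Fin (n₁ + n₀))}
    (hY : 𝒢.IsAlgebroidFrame U Y) (α : ℝ) :
    ContMDiffOn (𝓡 n₀) 𝓘(ℝ, ℝ) ∞ (fun x => coordDensity α (𝒢.algebroid x) (c.algCoord x) (Y x))
      (U ∩ c.base) := by
  have h1 : ∀ i, ContMDiffOn (𝓡 n₀) 𝓘(ℝ, EuclideanSpace ℝ (Fin n₁)) ∞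
      (fun x => c.algCoord x (Y x i)) (U ∩ c.base) := fun i =>
    (ContDiff.contMDiff contDiff_fst (n := ∞)).comp_contMDiffOn
      (ContMDiffOn.mfderiv_apply_tangent c.e.open_source c.e_smooth
        ((hY.smooth i).mono inter_subset_left) fun x hx => hx.2)
  have h2 := (ContMDiffOn.det_coordMatrix h1).abs_rpow
    (fun x hx => (isCoordFrame_alg hx.2).det_ne_zero (hY.frame x hx.1)) α
  exact h2.congr fun x hx => coordDensity_of_isFrame (hY.frame x hx.1)

end UnitChart
end UnitFrame
end LieGroupoid
-- Immersions with a left inverse on a subset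
section LeftInverse
open Set Filter Topology

variable {E E' E'' X Y Z : Type*} [TopologicalSpace X] [TopologicalSpace Y] [TopologicalSpace Z]
  [NormedAddCommGroup E] [NormedSpace ℝ E] [NormedAddCommGroup E']
  [NormedSpace ℝ E'] [NormedAddCommGroup E''] [NormedSpace ℝ E'']
  [ChartedSpace E X] [ChartedSpace E' Y] [ChartedSpace E'' Z]

variable (E E') in
/-- The manifold derivative within a subset, as a linear map between the model spaces. -/
noncomputable def flatDerivWithin (f : X → Y) (s : Set X) (x : X) : E →L[ℝ] E' :=
  mfderivWithin 𝓘(ℝ, E) 𝓘(ℝ, E') f s x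

/-- The chain rule for a map into a subset followed by a map that is differentiable on the
subset. -/
theorem flatDeriv_comp_within {f : X → Y} {g : Y → Z} {s : Set Y} {x : X}
    (hg : MDifferentiableWithinAt 𝓘(ℝ, E') 𝓘(ℝ, E'') g s (f x))
    (hf : MDifferentiableAt 𝓘(ℝ, E) 𝓘(ℝ, E') f x) (hs : ∀ᶠ y in 𝓝 x, f y ∈ s) (v : E) :
    flatDeriv E E'' (g ∘ f) x v =
      flatDerivWithin E' E'' g s (f x) (flatDeriv E E' f x v) := by
  have h1 := hg.hasMFDerivWithinAt.comp x (hf.hasMFDerivAt.hasMFDerivWithinAt (s := f ⁻¹' s))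
    Subset.rfl
  exact DFunLike.congr_fun (h1.hasMFDerivAt hs).mfderiv v

/-- The left inverse is required to be differentiable only within a set that contains the image.
This is needed because right multiplication is meaningful only on a source fibre. -/
theorem flatDeriv_injective_of_leftInverse {f : E → Y} {g : Y → E} {s : Set Y} {x : E}
    (hg : MDifferentiableWithinAt 𝓘(ℝ, E') 𝓘(ℝ, E) g s (f x))
    (hf : MDifferentiableAt 𝓘(ℝ, E) 𝓘(ℝ, E') f x) (hs : ∀ᶠ y in 𝓝 x, f y ∈ s)
    (hgf : ∀ᶠ y in 𝓝 x, g (f y) = y) : Function.Injective (flatDeriv E E' f x) := by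
  refine Function.LeftInverse.injective (g := flatDerivWithin E' E g s (f x)) fun v => ?_
  have h1 : g ∘ f =ᶠ[𝓝 x] id := hgf
  refine (flatDeriv_comp_within hg hf hs v).symm.trans ?_
  rw [flatDeriv_congr h1, flatDeriv_eq_fderiv, fderiv_id]
  rfl

end LeftInverse

/-! ### Inversion and the differentials of translations -/

namespace LieGroupoid
section Frames
open Set Filter Topology

variable {n₁ n₀ : ℕ} {G M : Type*}
    [TopologicalSpace G] [ChartedSpace (EuclideanSpace ℝ (Fin (n₁ + n₀))) G]
    [TopologicalSpace M] [ChartedSpace (EuclideanSpace ℝ (Fin n₀)) M]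
    {𝒢 : LieGroupoid n₁ n₀ G M} {H : Type*} [NormedAddCommGroup H] [NormedSpace ℝ H]

theorem IsSmoothChart.mdifferentiable {κ : OpenPartialHomeomorph G H}
    (hκ : IsSmoothChart (n₁ + n₀) κ) : κ.MDifferentiable (𝓡 (n₁ + n₀)) 𝓘(ℝ, H) :=
  ⟨hκ.smooth.mdifferentiableOn (by simp), hκ.symm_smooth.mdifferentiableOn (by simp)⟩

variable (𝒢) in
/-- Inversion as a homeomorphism. -/
def invHomeomorph : G ≃ₜ G where
  toFun := 𝒢.inv
  invFun := 𝒢.inv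
  left_inv := inv_inv
  right_inv := inv_inv
  continuous_toFun := 𝒢.inv_smooth.continuous
  continuous_invFun := 𝒢.inv_smooth.continuous

variable (𝒢) in
/-- A chart of `G`, precomposed with inversion. -/
def invChart {H : Type*} [TopologicalSpace H] (κ : OpenPartialHomeomorph G H) : OpenPartialHomeomorph G H :=
  (invHomeomorph 𝒢).toOpenPartialHomeomorph.trans κ

theorem invChart_apply {H : Type*} [TopologicalSpace H]
    (κ : OpenPartialHomeomorph G H) (γ : G) :
    invChart 𝒢 κ γ = κ (𝒢.inv γ) := rfl

theorem invChart_symm_apply {H : Type*} [TopologicalSpace H]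
    (κ : OpenPartialHomeomorph G H) (w : H) :
    (invChart 𝒢 κ).symm w = 𝒢.inv (κ.symm w) := rfl

theorem mem_invChart_source {H : Type*} [TopologicalSpace H]
    {κ : OpenPartialHomeomorph G H} {γ : G} :
    γ ∈ (invChart 𝒢 κ).source ↔ 𝒢.inv γ ∈ κ.source := by
  simp [invChart, invHomeomorph]

theorem invChart_target {H : Type*} [TopologicalSpace H]
    (κ : OpenPartialHomeomorph G H) :
    (invChart 𝒢 κ).target = κ.target := by
  simp [invChart]

variable (𝒢) in
theorem IsSmoothChart.invChart {κ : OpenPartialHomeomorph G H}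
    (hκ : IsSmoothChart (n₁ + n₀) κ) : IsSmoothChart (n₁ + n₀) (invChart 𝒢 κ) where
  smooth := hκ.smooth.comp 𝒢.inv_smooth.contMDiffOn fun _ hγ => mem_invChart_source.1 hγ
  symm_smooth := by
    rw [invChart_target]
    exact 𝒢.inv_smooth.comp_contMDiffOn hκ.symm_smooth

/-- Right translation is differentiable along the fibres of the source map. -/
theorem contMDiffOn_mul_right (γ : G) : ContMDiffOn (𝓡 (n₁ + n₀)) (𝓡 (n₁ + n₀)) ∞
    (fun β => 𝒢.mul β γ) (𝒢.s ⁻¹' {𝒢.r γ}) :=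
  𝒢.mul_smooth.comp (contMDiffOn_id.prodMk contMDiffOn_const) fun _ hβ => hβ

theorem contMDiffOn_mul_left_inv (γ : G) : ContMDiffOn (𝓡 (n₁ + n₀)) (𝓡 (n₁ + n₀)) ∞
    (fun β => 𝒢.mul γ (𝒢.inv β)) (𝒢.s ⁻¹' {𝒢.s γ}) := by
  refine 𝒢.mul_smooth.comp (contMDiffOn_const.prodMk 𝒢.inv_smooth.contMDiffOn) fun β hβ => ?_
  have h : 𝒢.s β = 𝒢.s γ := hβ
  simp [𝒢.r_inv, h]

namespace UnitChart
variable {c : 𝒢.UnitChart}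

theorem contMDiffAt_param {x : M} {u : EuclideanSpace ℝ (Fin n₁)} (h : (u, c.k x) ∈ c.e.target) :
    ContMDiffAt (𝓡 n₁) (𝓡 (n₁ + n₀)) ∞ (fun y => c.e.symm (y, c.k x)) u := by
  have h1 : ContMDiff (𝓡 n₁) 𝓘(ℝ, EuclideanSpace ℝ (Fin n₁) × EuclideanSpace ℝ (Fin n₀)) ∞
      (fun y : EuclideanSpace ℝ (Fin n₁) => (y, c.k x)) := ContDiff.contMDiff (by fun_prop)
  exact (c.e_symm_smooth.contMDiffAt (c.e.open_target.mem_nhds h)).comp u h1.contMDiffAt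

theorem eventually_mem_target {x : M} {u : EuclideanSpace ℝ (Fin n₁)}
    (h : (u, c.k x) ∈ c.e.target) : ∀ᶠ y in 𝓝 u, (y, c.k x) ∈ c.e.target := by
  have h1 : ContinuousAt (fun y : EuclideanSpace ℝ (Fin n₁) => (y, c.k x)) u := by fun_prop
  exact h1.eventually_mem (c.e.open_target.mem_nhds h)

theorem contMDiffAt_trans {γ : G} {u : EuclideanSpace ℝ (Fin n₁)} (h : (u, γ) ∈ c.transDomain) :
    ContMDiffAt (𝓡 n₁) (𝓡 (n₁ + n₀)) ∞ (fun y => c.trans y γ) u := by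
  have h1 : ContMDiffAt (𝓡 n₁) ((𝓡 n₁).prod (𝓡 (n₁ + n₀))) ∞
      (fun y : EuclideanSpace ℝ (Fin n₁) => (y, γ)) u := contMDiffAt_id.prodMk contMDiffAt_const
  exact ContMDiffAt.comp (g := fun q : EuclideanSpace ℝ (Fin n₁) × G => c.trans q.1 q.2) u
    (c.contMDiffOn_trans.contMDiffAt (c.isOpen_transDomain.mem_nhds h)) h1

theorem algFrame_eq {x : M} (hx : x ∈ c.base) (i : Fin n₁) :
    c.algFrame x i = flatDeriv (EuclideanSpace ℝ (Fin n₁)) (EuclideanSpace ℝ (Fin (n₁ + n₀)))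
      (fun y => c.e.symm (y, c.k x)) 0 (EuclideanSpace.single i 1) := by
  have h1 : HasFDerivAt (fun y : EuclideanSpace ℝ (Fin n₁) => (y, c.k x)) _ 0 :=
    hasFDerivAt_prodMk_left (𝕜 := ℝ) (0 : EuclideanSpace ℝ (Fin n₁)) (c.k x)
  have h2 := flatDeriv_comp (x := (0 : EuclideanSpace ℝ (Fin n₁)))
    (f := fun y : EuclideanSpace ℝ (Fin n₁) => (y, c.k x)) (g := c.e.symm)
    (E'' := EuclideanSpace ℝ (Fin (n₁ + n₀)))
    (c.mdifferentiable_e.mdifferentiableAt_symm (zero_mem hx))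
    h1.differentiableAt.mdifferentiableAt
  rw [flatDeriv_eq_fderiv, h1.fderiv] at h2
  exact (DFunLike.congr_fun h2 (EuclideanSpace.single i 1)).symm

/-- The derivative, along the algebroid, of a map that is differentiable on a source fibre. -/
theorem flatDeriv_mfderivWithin_algFrame {x : M} (hx : x ∈ c.base) {φ : G → G}
    (hφ : ContMDiffOn (𝓡 (n₁ + n₀)) (𝓡 (n₁ + n₀)) ∞ φ (𝒢.s ⁻¹' {x}))
    {κ : OpenPartialHomeomorph G H} (hκ : IsSmoothChart (n₁ + n₀) κ)
    (hk : φ (𝒢.unit x) ∈ κ.source) (i : Fin n₁) :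
    flatDeriv (EuclideanSpace ℝ (Fin (n₁ + n₀))) H κ (φ (𝒢.unit x))
      (flatDerivWithin (EuclideanSpace ℝ (Fin (n₁ + n₀))) (EuclideanSpace ℝ (Fin (n₁ + n₀)))
        φ (𝒢.s ⁻¹' {x}) (𝒢.unit x) (c.algFrame x i)) =
    fderiv ℝ (fun y => κ (φ (c.e.symm (y, c.k x)))) 0 (EuclideanSpace.single i 1) := by
  have h0 : c.e.symm ((0 : EuclideanSpace ℝ (Fin n₁)), c.k x) = 𝒢.unit x := symm_zero hx
  have hφ' : MDifferentiableWithinAt (𝓡 (n₁ + n₀)) (𝓡 (n₁ + n₀)) φ (𝒢.s ⁻¹' {x})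
      (c.e.symm ((0 : EuclideanSpace ℝ (Fin n₁)), c.k x)) := by
    rw [h0]
    exact (hφ _ (𝒢.s_unit x)).mdifferentiableWithinAt (by simp)
  have hp := (contMDiffAt_param (c := c) (zero_mem hx)).mdifferentiableAt (by simp)
  have hev : ∀ᶠ y in 𝓝 0, c.e.symm (y, c.k x) ∈ 𝒢.s ⁻¹' {x} := by
    filter_upwards [eventually_mem_target (zero_mem hx)] with y hy
    exact s_symm_of_mem (c.base_subset hx) hy
  have hcomp := hφ'.hasMFDerivWithinAt.comp (0 : EuclideanSpace ℝ (Fin n₁))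
    (hp.hasMFDerivAt.hasMFDerivWithinAt (s := (fun y => c.e.symm (y, c.k x)) ⁻¹' (𝒢.s ⁻¹' {x})))
    Subset.rfl
  have hd := (hcomp.hasMFDerivAt hev).mdifferentiableAt
  have hk' : MDifferentiableAt (𝓡 (n₁ + n₀)) 𝓘(ℝ, H) κ
      ((φ ∘ fun y => c.e.symm (y, c.k x)) (0 : EuclideanSpace ℝ (Fin n₁))) := by
    simp only [Function.comp, h0]
    exact hκ.mdifferentiable.mdifferentiableAt hk
  rw [algFrame_eq hx]
  have h1 := flatDeriv_comp_within (f := fun y : EuclideanSpace ℝ (Fin n₁) => c.e.symm (y, c.k x))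
    (x := 0) hφ' hp hev (EuclideanSpace.single i 1)
  have h2 := DFunLike.congr_fun (flatDeriv_comp hk' hd) (EuclideanSpace.single i 1)
  rw [flatDeriv_eq_fderiv, ContinuousLinearMap.comp_apply, h1] at h2
  simp only [Function.comp, h0] at h2
  exact h2.symm

theorem fderiv_trans {κ : OpenPartialHomeomorph G H} (hκ : IsSmoothChart (n₁ + n₀) κ)
    {γ : G} (hγ : γ ∈ κ.source) (hr : 𝒢.r γ ∈ c.base) (i : Fin n₁) :
    fderiv ℝ (fun y => κ (c.trans y γ)) 0 (EuclideanSpace.single i 1) =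
      c.transField κ i (κ γ) := by
  obtain ⟨L, hL, hLi⟩ := hasFDerivAt_trans hκ hγ hr
  rw [hL.fderiv, hLi]

/-- Both sides are the derivative at the unit of β ↦ βγ along the i-th fibre coordinate of β. -/
theorem flatDeriv_rightTrans {κ : OpenPartialHomeomorph G H} (hκ : IsSmoothChart (n₁ + n₀) κ)
    {γ : G} (hγ : γ ∈ κ.source) (hr : 𝒢.r γ ∈ c.base) (i : Fin n₁) :
    flatDeriv (EuclideanSpace ℝ (Fin (n₁ + n₀))) H κ γ (𝒢.rightTrans γ (c.algFrame (𝒢.r γ) i)) =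
      c.transField κ i (κ γ) := by
  have h1 := flatDeriv_mfderivWithin_algFrame (c := c) hr (contMDiffOn_mul_right γ) hκ
    (by rwa [𝒢.unit_mul]) i
  rw [𝒢.unit_mul] at h1
  exact h1.trans (fderiv_trans hκ hγ hr i)

/-- Since γβ⁻¹ = (βγ⁻¹)⁻¹, the map β ↦ γβ⁻¹ read in κ is a translation of γ⁻¹ read in the chart
precomposed with inversion. This reduces computations with `rForm` to those with `sForm`. -/
theorem flatDeriv_leftTransInv {κ : OpenPartialHomeomorph G H}
    (hκ : IsSmoothChart (n₁ + n₀) κ) {γ : G} (hγ : γ ∈ κ.source) (hs : 𝒢.s γ ∈ c.base)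
    (i : Fin n₁) :
    flatDeriv (EuclideanSpace ℝ (Fin (n₁ + n₀))) H κ γ
      (𝒢.leftTransInv γ (c.algFrame (𝒢.s γ) i)) = c.transField (invChart 𝒢 κ) i (κ γ) := by
  have hu : 𝒢.mul γ (𝒢.inv (𝒢.unit (𝒢.s γ))) = γ := by rw [inv_unit, 𝒢.mul_unit]
  have h1 := flatDeriv_mfderivWithin_algFrame (c := c) hs (contMDiffOn_mul_left_inv γ) hκ
    (by rwa [hu]) i
  simp only [hu] at h1
  refine h1.trans ?_
  have hr' : 𝒢.r (𝒢.inv γ) ∈ c.base := by rwa [𝒢.r_inv]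
  have h2 := fderiv_trans (c := c) (hκ.invChart 𝒢) (γ := 𝒢.inv γ)
    (mem_invChart_source.2 (by rwa [inv_inv])) hr' i
  rw [invChart_apply, inv_inv] at h2
  rw [← h2]
  have h3 : (fun y => κ (𝒢.mul γ (𝒢.inv (c.e.symm (y, c.k (𝒢.s γ)))))) =ᶠ[𝓝 0]
      fun y => invChart 𝒢 κ (c.trans y (𝒢.inv γ)) := by
    filter_upwards [eventually_mem_target (zero_mem hs)] with y hy
    have h4 := s_symm_of_mem (c.base_subset hs) hy
    rw [invChart_apply, trans, 𝒢.r_inv, mul_inv_rev (by rw [h4, 𝒢.r_inv]), inv_inv]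
  rw [h3.fderiv_eq]

end UnitChart
end Frames
end LieGroupoid
-- Smoothness of determinants
section TupleDet
open Set Filter Topology

theorem tupleDet_comp {n : ℕ} (T : EuclideanSpace ℝ (Fin n) →L[ℝ] EuclideanSpace ℝ (Fin n))
    (t : Fin n → EuclideanSpace ℝ (Fin n)) :
    tupleDet (fun l => T (t l)) =
      tupleDet (fun l => T (EuclideanSpace.single l 1)) * tupleDet t := by
  have h : ∀ l, T (t l) = ∑ m, t l m • T (EuclideanSpace.single m 1) := by
    intro l
    have h1 : t l = ∑ m, t l m • EuclideanSpace.single m (1 : ℝ) := by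
      ext m
      simp [Pi.single_apply]
    conv_lhs => rw [h1]
    simp
  rw [mul_comm, tupleDet, tupleDet, tupleDet, ← Matrix.det_mul]
  congr 1
  ext i j
  simp [coordMatrix, Matrix.mul_apply, h]

variable {EN HN N H : Type*} [NormedAddCommGroup EN] [NormedSpace ℝ EN] [TopologicalSpace HN]
  {I : ModelWithCorners ℝ EN HN} [TopologicalSpace N] [ChartedSpace HN N]
  [NormedAddCommGroup H] [NormedSpace ℝ H]

theorem ContDiffAt.matrix_det {k : ℕ} {f : H → Matrix (Fin k) (Fin k) ℝ} {w : H}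
    (hf : ∀ i j, ContDiffAt ℝ ∞ (fun x => f x i j) w) : ContDiffAt ℝ ∞ (fun x => (f x).det) w := by
  simp only [Matrix.det_apply']
  exact ContDiffAt.sum fun i _ => contDiffAt_const.mul (contDiffAt_prod fun j _ => hf _ _)

theorem ContDiffAt.gramDet {n m : ℕ} {V : H → Fin n → EuclideanSpace ℝ (Fin m)} {w : H}
    (hV : ∀ i, ContDiffAt ℝ ∞ (fun x => V x i) w) :
    ContDiffAt ℝ ∞ (fun x => gramDet (V x) (V x)) w := by
  have h1 : ∀ i l, ContDiffAt ℝ ∞ (fun x => V x i l) w := fun i l =>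
    ((EuclideanSpace.proj (𝕜 := ℝ) l).contDiff (n := ∞)).contDiffAt.comp w (hV i)
  refine ContDiffAt.matrix_det fun i j => ?_
  simp only [Matrix.of_apply]
  exact ContDiffAt.sum fun l _ => (h1 i l).mul (h1 j l)

theorem ContDiffAt.dualDet {n₁ n₀ : ℕ} {V : H → Fin n₁ → EuclideanSpace ℝ (Fin (n₁ + n₀))}
    {S : H → EuclideanSpace ℝ (Fin (n₁ + n₀)) →L[ℝ] EuclideanSpace ℝ (Fin n₀)} {w : H}
    (hV : ∀ i, ContDiffAt ℝ ∞ (fun x => V x i) w) (hS : ContDiffAt ℝ ∞ S w) :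
    ContDiffAt ℝ ∞ (fun x => dualDet (V x) (S x)) w := by
  refine ContDiffAt.matrix_det fun l j => ?_
  refine Fin.addCases (fun i => ?_) (fun i => ?_) j
  · simp only [Matrix.of_apply, Fin.append_left]
    exact ((EuclideanSpace.proj (𝕜 := ℝ) l).contDiff (n := ∞)).contDiffAt.comp w (hV i)
  · simp only [Matrix.of_apply, Fin.append_right]
    exact ((EuclideanSpace.proj (𝕜 := ℝ) i).contDiff (n := ∞)).contDiffAt.comp w
      (hS.clm_apply contDiffAt_const)

end TupleDet

/-! ### The Jacobian of the adapted frame -/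

namespace LieGroupoid
section Frames
open Set Filter Topology

variable {n₁ n₀ : ℕ} {G M : Type*}
    [TopologicalSpace G] [ChartedSpace (EuclideanSpace ℝ (Fin (n₁ + n₀))) G]
    [TopologicalSpace M] [ChartedSpace (EuclideanSpace ℝ (Fin n₀)) M]
    {𝒢 : LieGroupoid n₁ n₀ G M}

namespace UnitChart

/-- Right multiplication by γ⁻¹, followed by the chart, recovers y. It is differentiable within the
source fibre, which is all that `flatDeriv_injective_of_leftInverse` asks for. -/
theorem trans_injective {c : 𝒢.UnitChart} {u : EuclideanSpace ℝ (Fin n₁)} {γ : G}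
    (h : (u, γ) ∈ c.transDomain) : Function.Injective (flatDeriv (EuclideanSpace ℝ (Fin n₁))
      (EuclideanSpace ℝ (Fin (n₁ + n₀))) (fun y => c.trans y γ) u) := by
  have hd : MDifferentiableAt (𝓡 n₁) (𝓡 (n₁ + n₀)) (fun y => c.trans y γ) u :=
    (contMDiffAt_trans h).mdifferentiableAt (by simp)
  have hev : ∀ᶠ y in 𝓝 u, (y, γ) ∈ c.transDomain := by
    have h1 : ContinuousAt (fun y : EuclideanSpace ℝ (Fin n₁) => (y, γ)) u := by fun_prop
    exact h1.eventually_mem (c.isOpen_transDomain.mem_nhds h)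
  have hdiv : ∀ y, (y, γ) ∈ c.transDomain →
      𝒢.mul (c.trans y γ) (𝒢.inv γ) = c.e.symm (y, c.k (𝒢.r γ)) := fun y hy => by
    rw [trans, mul_inv_cancel_right (s_symm_of_mem (c.base_subset hy.1) hy.2)]
  have hg : MDifferentiableWithinAt (𝓡 (n₁ + n₀)) (𝓡 n₁)
      (fun α => (c.e (𝒢.mul α (𝒢.inv γ))).1) (𝒢.s ⁻¹' {𝒢.s γ}) (c.trans u γ) := by
    have h1 := (contMDiffOn_mul_right (𝒢 := 𝒢) (𝒢.inv γ)) (c.trans u γ)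
      (by rw [𝒢.r_inv]; exact c.s_trans h)
    rw [𝒢.r_inv] at h1
    have h2 : ContMDiffAt (𝓡 (n₁ + n₀)) 𝓘(ℝ, EuclideanSpace ℝ (Fin n₁) × EuclideanSpace ℝ (Fin n₀))
        ∞ c.e (𝒢.mul (c.trans u γ) (𝒢.inv γ)) :=
      c.e_smooth.contMDiffAt (c.e.open_source.mem_nhds (by
        rw [hdiv u h]; exact c.e.map_target h.2))
    have h3 := ContMDiffAt.comp_contMDiffWithinAt (f := fun β => 𝒢.mul β (𝒢.inv γ))
      (c.trans u γ) h2 h1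
    exact ((contDiff_fst.contMDiff (n := ∞)).contMDiffAt.comp_contMDiffWithinAt _
      h3).mdifferentiableWithinAt (by simp)
  refine flatDeriv_injective_of_leftInverse hg hd ?_ ?_
  · filter_upwards [hev] with y hy
    exact c.s_trans hy
  · filter_upwards [hev] with y hy
    rw [hdiv y hy, c.e.right_inv hy.2]

theorem linearIndependent_transField {c : 𝒢.UnitChart} {H : Type*} [NormedAddCommGroup H]
    [NormedSpace ℝ H] {κ : OpenPartialHomeomorph G H} (hκ : IsSmoothChart (n₁ + n₀) κ)
    {γ : G} (hγ : γ ∈ κ.source) (hr : 𝒢.r γ ∈ c.base) :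
    LinearIndependent ℝ fun i => c.transField κ i (κ γ) := by
  have h0 := c.zero_mem_transDomain hr
  have hd : MDifferentiableAt (𝓡 n₁) (𝓡 (n₁ + n₀)) (fun y => c.trans y γ) 0 :=
    (contMDiffAt_trans h0).mdifferentiableAt (by simp)
  have ht : c.trans 0 γ = γ := c.trans_zero hr
  have h1 := flatDeriv_comp (x := (0 : EuclideanSpace ℝ (Fin n₁)))
    (f := fun y => c.trans y γ) (g := κ) (E'' := H)
    (by rw [ht]; exact hκ.mdifferentiable.mdifferentiableAt hγ) hd
  have h2 : Function.Injective (flatDeriv (EuclideanSpace ℝ (Fin (n₁ + n₀))) H κ γ) :=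
    Function.LeftInverse.injective (hκ.mdifferentiable.flatDeriv_symm_apply hγ)
  have h3 : Function.Injective (fderiv ℝ (fun y => κ (c.trans y γ)) 0) := by
    rw [flatDeriv_eq_fderiv, ht] at h1
    change Function.Injective (fderiv ℝ (κ ∘ fun y => c.trans y γ) 0)
    rw [h1]
    exact h2.comp (trans_injective h0)
  have h4 := (EuclideanSpace.basisFun (Fin n₁) ℝ).toBasis.linearIndependent.map'
    (fderiv ℝ (fun y => κ (c.trans y γ)) 0).toLinearMap (LinearMap.ker_eq_bot.2 h3)
  have h5 : (fun i => c.transField κ i (κ γ)) = (fderiv ℝ (fun y => κ (c.trans y γ)) 0).toLinearMap ∘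
      (EuclideanSpace.basisFun (Fin n₁) ℝ).toBasis :=
    funext fun i => by simp [← fderiv_trans hκ hγ hr i]
  rw [h5]
  exact h4

/-- The determinant of the frame of `G` consisting of the translation fields and of lifts of a
coordinate frame of the base along the source map, read in a chart. -/
noncomputable def jac (c c' : 𝒢.UnitChart)
    (κ : OpenPartialHomeomorph G (EuclideanSpace ℝ (Fin (n₁ + n₀))))
    (w : EuclideanSpace ℝ (Fin (n₁ + n₀))) : ℝ :=
  gramDet (fun i => c.transField κ i w) (fun i => c.transField κ i w) /
    dualDet (fun i => c.transField κ i w) (fderiv ℝ (fun w => c'.k (𝒢.s (κ.symm w))) w)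

variable {c c' : 𝒢.UnitChart} {κ : OpenPartialHomeomorph G (EuclideanSpace ℝ (Fin (n₁ + n₀)))}

theorem contDiffAt_base {p : G → M} (hp : ContMDiff (𝓡 (n₁ + n₀)) (𝓡 n₀) ∞ p)
    (hκ : IsSmoothChart (n₁ + n₀) κ) {γ : G} (hγ : γ ∈ κ.source)
    (hs : p γ ∈ c'.k.source) : ContDiffAt ℝ ∞ (fun w => c'.k (p (κ.symm w))) (κ γ) := by
  have h1 : ContMDiffAt 𝓘(ℝ, EuclideanSpace ℝ (Fin (n₁ + n₀))) (𝓡 n₀) ∞ (fun w => p (κ.symm w))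
      (κ γ) := hp.contMDiffAt.comp (κ γ)
    (hκ.symm_smooth.contMDiffAt (κ.open_target.mem_nhds (κ.map_source hγ)))
  have h2 : ContMDiffAt (𝓡 n₀) (𝓡 n₀) ∞ c'.k (p (κ.symm (κ γ))) :=
    c'.k_smooth.contMDiffAt (c'.k.open_source.mem_nhds (by rwa [κ.left_inv hγ]))
  exact (ContMDiffAt.comp (f := fun w => p (κ.symm w)) (κ γ) h2 h1).contDiffAt

theorem fderiv_base_apply {p : G → M} (hp : ContMDiff (𝓡 (n₁ + n₀)) (𝓡 n₀) ∞ p)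
    (hκ : IsSmoothChart (n₁ + n₀) κ) {γ : G} (hγ : γ ∈ κ.source)
    (hs : p γ ∈ c'.k.source) (v : EuclideanSpace ℝ (Fin (n₁ + n₀))) :
    fderiv ℝ (fun w => c'.k (p (κ.symm w))) (κ γ)
      (flatDeriv (EuclideanSpace ℝ (Fin (n₁ + n₀))) (EuclideanSpace ℝ (Fin (n₁ + n₀))) κ γ v) =
    c'.baseCoord (p γ) (flatDeriv (EuclideanSpace ℝ (Fin (n₁ + n₀)))
      (EuclideanSpace ℝ (Fin n₀)) p γ v) := by
  have h1 := flatDeriv_comp (g := fun w => c'.k (p (κ.symm w))) (f := κ) (x := γ)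
    (E'' := EuclideanSpace ℝ (Fin n₀))
    ((contDiffAt_base (c' := c') hp hκ hγ hs).differentiableAt (by simp)).mdifferentiableAt
    (hκ.mdifferentiable.mdifferentiableAt hγ)
  have h2 := flatDeriv_comp (g := c'.k) (f := p) (x := γ)
    (c'.mdifferentiable_k.mdifferentiableAt hs) (hp.mdifferentiableAt (by simp))
  have h3 : (fun w => c'.k (p (κ.symm w))) ∘ κ =ᶠ[𝓝 γ] c'.k ∘ p := by
    filter_upwards [κ.open_source.mem_nhds hγ] with β hβ
    simp [κ.left_inv hβ]
  rw [flatDeriv_congr h3, h2, flatDeriv_eq_fderiv] at h1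
  exact (DFunLike.congr_fun h1 v).symm

/-- The translations that generate the field do not move the source. -/
theorem fderiv_source_transField (hκ : IsSmoothChart (n₁ + n₀) κ) {γ : G} (hγ : γ ∈ κ.source)
    (hr : 𝒢.r γ ∈ c.base) (hs : 𝒢.s γ ∈ c'.k.source) (i : Fin n₁) :
    fderiv ℝ (fun w => c'.k (𝒢.s (κ.symm w))) (κ γ) (c.transField κ i (κ γ)) = 0 := by
  obtain ⟨L, hL, hLi⟩ := hasFDerivAt_trans hκ hγ hr
  have h0 : κ (c.trans 0 γ) = κ γ := by rw [c.trans_zero hr]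
  have h1 := ((contDiffAt_base (c' := c') s_contMDiff hκ hγ hs).differentiableAt (by simp)).hasFDerivAt
  rw [← h0] at h1
  have h2 := h1.comp (0 : EuclideanSpace ℝ (Fin n₁)) hL
  have h3 : (fun w => c'.k (𝒢.s (κ.symm w))) ∘ (fun y => κ (c.trans y γ)) =ᶠ[𝓝 0]
      fun _ => c'.k (𝒢.s γ) := by
    filter_upwards [eventually_mem_transDomain hr,
      tendsto_trans hr (κ.open_source.mem_nhds hγ)] with y hy hy'
    simp [κ.left_inv hy', c.s_trans hy]
  have h4 := h2.unique ((hasFDerivAt_const _ _).congr_of_eventuallyEq h3)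
  rw [h0] at h4
  rw [← hLi]
  exact DFunLike.congr_fun h4 _

/-- The determinant formula is the block identity divided by `dualDet`. That divisor is nonzero: for
lifts of the standard basis, which exist as the source is a submersion, its product with `tupleDet`
is the Gram determinant of independent vectors. -/
theorem jac_spec (hκ : IsSmoothChart (n₁ + n₀) κ) {γ : G} (hγ : γ ∈ κ.source)
    (hr : 𝒢.r γ ∈ c.base) (hs : 𝒢.s γ ∈ c'.k.source) :
    ContDiffAt ℝ ∞ (jac c c' κ) (κ γ) ∧ jac c c' κ (κ γ) ≠ 0 ∧
    ∀ (P : Matrix (Fin n₁) (Fin n₁) ℝ) (L : Fin n₀ → EuclideanSpace ℝ (Fin (n₁ + n₀))),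
      tupleDet (Fin.append (fun i => ∑ j, P i j • c.transField κ j (κ γ)) L) =
        P.det * (coordMatrix LinearMap.id fun j =>
          fderiv ℝ (fun w => c'.k (𝒢.s (κ.symm w))) (κ γ) (L j)).det * jac c c' κ (κ γ) := by
  set S := fderiv ℝ (fun w => c'.k (𝒢.s (κ.symm w))) (κ γ)
  set V := fun i => c.transField κ i (κ γ)
  have hSV : ∀ i, S (V i) = 0 := fun i => fderiv_source_transField hκ hγ hr hs i
  have hg : gramDet V V ≠ 0 :=
    gramDet_self_ne_zero (linearIndependent_transField hκ hγ hr)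
  have hsurj : ∀ v, ∃ u, S u = v := by
    intro v
    obtain ⟨u, hu⟩ := (𝒢.s_submersion.isSubmersionAt γ).mfderiv_surjective
      (flatDeriv (EuclideanSpace ℝ (Fin n₀)) (EuclideanSpace ℝ (Fin n₀)) c'.k.symm
        (c'.k (𝒢.s γ)) v)
    refine ⟨_, (fderiv_base_apply s_contMDiff hκ hγ hs u).trans ?_⟩
    have h1 := c'.mdifferentiable_k.flatDeriv_apply_symm (c'.k.map_source hs) v
    rw [c'.k.left_inv hs, ← hu] at h1
    exact h1
  have hd : dualDet V S ≠ 0 := by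
    choose L hL using fun j : Fin n₀ => hsurj (EuclideanSpace.single j 1)
    have h1 := tupleDet_append_mul_dualDet (V₀ := V) (L := L) hSV
    have h2 : (coordMatrix LinearMap.id fun j => S (L j)) = 1 := by
      ext i j
      simp [coordMatrix, hL, Matrix.one_apply, eq_comm]
    rw [h2, Matrix.det_one, mul_one] at h1
    intro h0
    rw [h0, mul_zero] at h1
    exact hg h1.symm
  refine ⟨?_, div_ne_zero hg hd, fun P L => ?_⟩
  · have hw : κ γ ∈ c.fieldDomain κ :=
      ⟨κ.map_source hγ, by simpa only [mem_preimage, κ.left_inv hγ] using hr⟩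
    have hV : ∀ i, ContDiffAt ℝ ∞ (c.transField κ i) (κ γ) := fun i =>
      (contDiffOn_transField hκ i).contDiffAt ((c.isOpen_fieldDomain κ).mem_nhds hw)
    have hS : ContDiffAt ℝ ∞ (fderiv ℝ (fun w => c'.k (𝒢.s (κ.symm w)))) (κ γ) :=
      (contDiffAt_base s_contMDiff hκ hγ hs).fderiv_right (m := ∞) (by simp)
    exact (ContDiffAt.gramDet hV).div (ContDiffAt.dualDet hV hS) hd
  · have hSV' : ∀ i, S (∑ j, P i j • V j) = 0 := fun i => by simp [hSV]
    have h1 := tupleDet_append_mul_dualDet (V₀ := V) (L := L) hSV'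
    rw [gramDet_sum_smul] at h1
    change _ = _ * (gramDet V V / dualDet V S)
    field_simp
    rw [h1]
    ring

end UnitChart
end Frames
end LieGroupoid
-- Frames of the tangent bundle adapted to the two canonical isomorphisms
namespace LieGroupoid
section Frames
open Set Filter Topology

variable {n₁ n₀ : ℕ} {G M : Type*}
    [TopologicalSpace G] [ChartedSpace (EuclideanSpace ℝ (Fin (n₁ + n₀))) G]
    [TopologicalSpace M] [ChartedSpace (EuclideanSpace ℝ (Fin n₀)) M]
    {𝒢 : LieGroupoid n₁ n₀ G M}

theorem flatDeriv_sLift (γ : G) (v : EuclideanSpace ℝ (Fin n₀)) :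
    flatDeriv (EuclideanSpace ℝ (Fin (n₁ + n₀))) (EuclideanSpace ℝ (Fin n₀)) 𝒢.s γ
      (𝒢.sLift γ v) = v :=
  Function.invFun_eq ((𝒢.s_submersion.isSubmersionAt γ).mfderiv_surjective v)

theorem flatDeriv_rLift (γ : G) (v : EuclideanSpace ℝ (Fin n₀)) :
    flatDeriv (EuclideanSpace ℝ (Fin (n₁ + n₀))) (EuclideanSpace ℝ (Fin n₀)) 𝒢.r γ
      (𝒢.rLift γ v) = v :=
  Function.invFun_eq ((𝒢.r_submersion.isSubmersionAt γ).mfderiv_surjective v)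

variable (𝒢) in
/-- The tuple of tangent vectors that `sForm` assigns to frames of the algebroid and of the base. -/
noncomputable def sTuple (γ : G) (a : Fin n₁ → EuclideanSpace ℝ (Fin (n₁ + n₀)))
    (v : Fin n₀ → EuclideanSpace ℝ (Fin n₀)) :
    Fin (n₁ + n₀) → EuclideanSpace ℝ (Fin (n₁ + n₀)) :=
  Fin.append (fun i => 𝒢.rightTrans γ (a i)) (fun j => 𝒢.sLift γ (v j))

variable (𝒢) in
/-- The tuple of tangent vectors that `rForm` assigns to frames of the algebroid and of the base. -/
noncomputable def rTuple (γ : G) (b : Fin n₁ → EuclideanSpace ℝ (Fin (n₁ + n₀)))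
    (v : Fin n₀ → EuclideanSpace ℝ (Fin n₀)) :
    Fin (n₁ + n₀) → EuclideanSpace ℝ (Fin (n₁ + n₀)) :=
  Fin.append (fun i => 𝒢.leftTransInv γ (b i)) (fun j => 𝒢.rLift γ (v j))

theorem append_comp {α β : Type*} {n m : ℕ} (T : α → β) (u : Fin n → α) (v : Fin m → α) :
    (fun l => T (Fin.append u v l)) = Fin.append (fun i => T (u i)) fun j => T (v j) := by
  funext l
  refine Fin.addCases (fun i => ?_) (fun j => ?_) l <;> simp

namespace UnitChart
variable {c c' : 𝒢.UnitChart} {κ : OpenPartialHomeomorph G (EuclideanSpace ℝ (Fin (n₁ + n₀)))}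

theorem tupleDet_sTuple (hκ : IsSmoothChart (n₁ + n₀) κ) {γ : G} (hγ : γ ∈ κ.source)
    (hr : 𝒢.r γ ∈ c.base) (hs : 𝒢.s γ ∈ c'.k.source)
    {a : Fin n₁ → EuclideanSpace ℝ (Fin (n₁ + n₀))} (ha : ∀ i, a i ∈ 𝒢.algebroid (𝒢.r γ))
    (v : Fin n₀ → EuclideanSpace ℝ (Fin n₀)) :
    tupleDet (fun l => flatDeriv (EuclideanSpace ℝ (Fin (n₁ + n₀)))
      (EuclideanSpace ℝ (Fin (n₁ + n₀))) κ γ (𝒢.sTuple γ a v l)) =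
      (coordMatrix (c.algCoord (𝒢.r γ)) a).det * (coordMatrix (c'.baseCoord (𝒢.s γ)) v).det *
        jac c c' κ (κ γ) := by
  have h1 : ∀ i, flatDeriv (EuclideanSpace ℝ (Fin (n₁ + n₀)))
      (EuclideanSpace ℝ (Fin (n₁ + n₀))) κ γ (𝒢.rightTrans γ (a i)) =
      ∑ j, coordMatrix (c.algCoord (𝒢.r γ)) a i j • c.transField κ j (κ γ) := by
    intro i
    conv_lhs => rw [← (isCoordFrame_alg hr).sum_smul_eq (ha i)]
    simp only [map_sum, map_smul, flatDeriv_rightTrans hκ hγ hr]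
    rfl
  simp only [sTuple]
  rw [append_comp]
  simp only [h1]
  rw [(jac_spec hκ hγ hr hs).2.2]
  congr 3
  ext i j
  simp only [coordMatrix, Matrix.of_apply, LinearMap.id_apply,
    fderiv_base_apply s_contMDiff hκ hγ hs, flatDeriv_sLift]

/-- Inversion exchanges range and source, so this is `jac_spec` at γ⁻¹ in the inverted chart. -/
theorem tupleDet_rTuple (hκ : IsSmoothChart (n₁ + n₀) κ) {γ : G} (hγ : γ ∈ κ.source)
    (hs : 𝒢.s γ ∈ c'.base) (hr : 𝒢.r γ ∈ c.k.source)
    {b : Fin n₁ → EuclideanSpace ℝ (Fin (n₁ + n₀))} (hb : ∀ i, b i ∈ 𝒢.algebroid (𝒢.s γ))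
    (v : Fin n₀ → EuclideanSpace ℝ (Fin n₀)) :
    tupleDet (fun l => flatDeriv (EuclideanSpace ℝ (Fin (n₁ + n₀)))
      (EuclideanSpace ℝ (Fin (n₁ + n₀))) κ γ (𝒢.rTuple γ b v l)) =
      (coordMatrix (c'.algCoord (𝒢.s γ)) b).det * (coordMatrix (c.baseCoord (𝒢.r γ)) v).det *
        jac c' c (invChart 𝒢 κ) (κ γ) := by
  have h1 : ∀ i, flatDeriv (EuclideanSpace ℝ (Fin (n₁ + n₀)))
      (EuclideanSpace ℝ (Fin (n₁ + n₀))) κ γ (𝒢.leftTransInv γ (b i)) =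
      ∑ j, coordMatrix (c'.algCoord (𝒢.s γ)) b i j • c'.transField (invChart 𝒢 κ) j (κ γ) := by
    intro i
    conv_lhs => rw [← (isCoordFrame_alg hs).sum_smul_eq (hb i)]
    simp only [map_sum, map_smul, flatDeriv_leftTransInv hκ hγ hs]
    rfl
  have h2 := (jac_spec (c := c') (c' := c) (hκ.invChart 𝒢) (γ := 𝒢.inv γ)
    (mem_invChart_source.2 (by rwa [inv_inv])) (by rwa [𝒢.r_inv]) (by rwa [𝒢.s_inv])).2.2
  simp only [invChart_apply, inv_inv, invChart_symm_apply, 𝒢.s_inv] at h2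
  simp only [rTuple]
  rw [append_comp]
  simp only [h1]
  rw [h2]
  congr 3
  ext i j
  simp only [coordMatrix, Matrix.of_apply, LinearMap.id_apply,
    fderiv_base_apply r_contMDiff hκ hγ hr, flatDeriv_rLift]

end UnitChart

/-- `F` is a field of frames of `TG` over `O` whose volume element is smooth. -/
def IsDensityFrame (O : Set G) (F : G → Fin (n₁ + n₀) → EuclideanSpace ℝ (Fin (n₁ + n₀))) : Prop :=
  ∀ κ : OpenPartialHomeomorph G (EuclideanSpace ℝ (Fin (n₁ + n₀))), IsSmoothChart (n₁ + n₀) κ →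
    ∃ J : EuclideanSpace ℝ (Fin (n₁ + n₀)) → ℝ, ∀ γ ∈ κ.source, γ ∈ O →
      ContDiffAt ℝ ∞ J (κ γ) ∧ J (κ γ) ≠ 0 ∧ tupleDet (fun l => flatDeriv
        (EuclideanSpace ℝ (Fin (n₁ + n₀))) (EuclideanSpace ℝ (Fin (n₁ + n₀))) κ γ (F γ l)) = J (κ γ)

variable (c c' : 𝒢.UnitChart)

/-- The set of arrows between the base sets of two charts near units. -/
def arrows : Set G := 𝒢.r ⁻¹' c.base ∩ 𝒢.s ⁻¹' c'.base

theorem isOpen_arrows : IsOpen (arrows c c') :=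
  (c.isOpen_base.preimage r_contMDiff.continuous).inter
    (c'.isOpen_base.preimage s_contMDiff.continuous)

/-- The frame of `TG` adapted to `sForm`. -/
noncomputable def sFrame (γ : G) : Fin (n₁ + n₀) → EuclideanSpace ℝ (Fin (n₁ + n₀)) :=
  𝒢.sTuple γ (c.algFrame (𝒢.r γ)) (c'.baseFrame (𝒢.s γ))

/-- The frame of `TG` adapted to `rForm`. -/
noncomputable def rFrame (γ : G) : Fin (n₁ + n₀) → EuclideanSpace ℝ (Fin (n₁ + n₀)) :=
  𝒢.rTuple γ (c'.algFrame (𝒢.s γ)) (c.baseFrame (𝒢.r γ))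

variable {c c'}

theorem isDensityFrame_sFrame : IsDensityFrame (arrows c c') (sFrame c c') := by
  refine fun κ hκ => ⟨UnitChart.jac c c' κ, fun γ hγ hO => ?_⟩
  have hs := c'.base_subset hO.2
  have h1 := UnitChart.jac_spec (c := c) hκ hγ hO.1 hs
  refine ⟨h1.1, h1.2.1, ?_⟩
  have h2 := UnitChart.isCoordFrame_alg (c := c) hO.1
  rw [sFrame, UnitChart.tupleDet_sTuple hκ hγ hO.1 hs (fun i => h2.frame.mem i),
    h2.coordMatrix_self, (UnitChart.isCoordFrame_base hs).coordMatrix_self]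
  simp

theorem isDensityFrame_rFrame : IsDensityFrame (arrows c c') (rFrame c c') := by
  refine fun κ hκ => ⟨UnitChart.jac c' c (invChart 𝒢 κ), fun γ hγ hO => ?_⟩
  have hr := c.base_subset hO.1
  have h1 := UnitChart.jac_spec (c := c') (c' := c) (hκ.invChart 𝒢) (γ := 𝒢.inv γ)
    (mem_invChart_source.2 (by rwa [inv_inv])) (by rw [𝒢.r_inv]; exact hO.2) (by rwa [𝒢.s_inv])
  rw [invChart_apply, inv_inv] at h1
  refine ⟨h1.1, h1.2.1, ?_⟩
  have h2 := UnitChart.isCoordFrame_alg (c := c') hO.2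
  rw [rFrame, UnitChart.tupleDet_rTuple hκ hγ hO.2 hr (fun i => h2.frame.mem i),
    h2.coordMatrix_self, (UnitChart.isCoordFrame_base hr).coordMatrix_self]
  simp

end Frames
end LieGroupoid
-- Sections of the density bundles from scalar coefficients
namespace LieGroupoid
section TestFunctions
open Set Filter Topology

variable {n₁ n₀ : ℕ} {G M : Type*}
    [TopologicalSpace G] [ChartedSpace (EuclideanSpace ℝ (Fin (n₁ + n₀))) G]
    [TopologicalSpace M] [ChartedSpace (EuclideanSpace ℝ (Fin n₀)) M]
    {𝒢 : LieGroupoid n₁ n₀ G M}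

theorem isCoordFrame_std (n : ℕ) : IsCoordFrame (⊤ : Submodule ℝ (EuclideanSpace ℝ (Fin n)))
    LinearMap.id (fun i => EuclideanSpace.single i 1) := by
  refine ⟨?_, fun i => rfl⟩
  have h : (fun i => EuclideanSpace.single i 1) = (EuclideanSpace.basisFun (Fin n) ℝ).toBasis := by
    ext i : 1
    simp
  rw [h]
  exact ⟨(EuclideanSpace.basisFun (Fin n) ℝ).toBasis.linearIndependent,
    (EuclideanSpace.basisFun (Fin n) ℝ).toBasis.span_eq⟩

theorem isFrame_top_iff {n : ℕ} {t : Fin n → EuclideanSpace ℝ (Fin n)} :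
    IsFrame ⊤ t ↔ tupleDet t ≠ 0 :=
  ⟨(isCoordFrame_std n).det_ne_zero, (isCoordFrame_std n).isFrame fun _ => trivial⟩

theorem coordDensity_one_std {n : ℕ} (t : Fin n → EuclideanSpace ℝ (Fin n)) :
    coordDensity 1 ⊤ LinearMap.id t = |tupleDet t| := by
  by_cases ht : IsFrame ⊤ t
  · rw [coordDensity_of_isFrame ht, Real.rpow_one]; rfl
  · rw [coordDensity_of_not_isFrame ht]
    rw [isFrame_top_iff, not_not] at ht
    simp [ht]

/-- The ratio of the volume elements of two tuples of tangent vectors can be computed in a chart. -/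
theorem abs_tupleDet_div {κ : OpenPartialHomeomorph G (EuclideanSpace ℝ (Fin (n₁ + n₀)))} {γ : G}
    {t F : Fin (n₁ + n₀) → EuclideanSpace ℝ (Fin (n₁ + n₀))}
    (hF : tupleDet (fun l => flatDeriv (EuclideanSpace ℝ (Fin (n₁ + n₀)))
      (EuclideanSpace ℝ (Fin (n₁ + n₀))) κ γ (F l)) ≠ 0) :
    |tupleDet t| / |tupleDet F| = |tupleDet (fun l => flatDeriv (EuclideanSpace ℝ (Fin (n₁ + n₀)))
      (EuclideanSpace ℝ (Fin (n₁ + n₀))) κ γ (t l))| /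
      |tupleDet (fun l => flatDeriv (EuclideanSpace ℝ (Fin (n₁ + n₀)))
      (EuclideanSpace ℝ (Fin (n₁ + n₀))) κ γ (F l))| := by
  rw [tupleDet_comp] at hF
  rw [tupleDet_comp _ t, tupleDet_comp _ F, abs_mul, abs_mul,
    mul_div_mul_left _ _ (abs_ne_zero.2 (left_ne_zero_of_mul hF))]

variable (c c' : 𝒢.UnitChart)
  (F : G → Fin (n₁ + n₀) → EuclideanSpace ℝ (Fin (n₁ + n₀)))

/-- The section of `Ω_0^{1/2}` with coefficient `D` with respect to the frames of the algebroid
given by two charts near units and the frame `F` of `TG`. -/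
noncomputable def testOf (D : G → ℂ) : TestField n₁ n₀ G := fun γ a b t =>
  D γ * ((coordDensity (-1 / 2) (𝒢.algebroid (𝒢.r γ)) (c.algCoord (𝒢.r γ)) a *
    coordDensity (-1 / 2) (𝒢.algebroid (𝒢.s γ)) (c'.algCoord (𝒢.s γ)) b *
    (coordDensity 1 ⊤ LinearMap.id t / |tupleDet (F γ)|) : ℝ) : ℂ)

/-- The section of `Ω^{1/2}` with coefficient `g` with respect to the frames of the algebroid
given by two charts near units. -/
noncomputable def halfOf (g : G → ℂ) : HalfField n₁ n₀ G := fun γ a b =>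
  g γ * ((coordDensity (1 / 2) (𝒢.algebroid (𝒢.r γ)) (c.algCoord (𝒢.r γ)) a *
    coordDensity (1 / 2) (𝒢.algebroid (𝒢.s γ)) (c'.algCoord (𝒢.s γ)) b : ℝ) : ℂ)

theorem support_testOf_subset (D : G → ℂ) :
    Function.support (testOf c c' F D) ⊆ Function.support D := fun γ hγ h0 =>
  hγ (by funext a b t; simp [testOf, h0])

theorem support_halfOf_subset (g : G → ℂ) :
    Function.support (halfOf c c' g) ⊆ Function.support g := fun γ hγ h0 =>
  hγ (by funext a b; simp [halfOf, h0])

variable {c c' F}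

theorem testOf_sum {ι : Type*} (s : Finset ι) (D : ι → G → ℂ) :
    testOf c c' F (fun γ => ∑ i ∈ s, D i γ) = ∑ i ∈ s, testOf c c' F (D i) := by
  funext γ a b t
  simp [testOf, Finset.sum_mul]

theorem contMDiffOn_of_contMDiffAt_mul {D : G → ℂ} (hD : ContMDiff (𝓡 (n₁ + n₀)) 𝓘(ℝ, ℂ) ∞ D)
    {R : G → ℝ} {S : Set G} (hR : ∀ γ ∈ S, γ ∈ tsupport D →
      ContMDiffAt (𝓡 (n₁ + n₀)) 𝓘(ℝ, ℝ) ∞ R γ) :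
    ContMDiffOn (𝓡 (n₁ + n₀)) 𝓘(ℝ, ℂ) ∞ (fun γ => D γ * (R γ : ℂ)) S := by
  intro γ hγ
  refine ContMDiffAt.contMDiffWithinAt ?_
  by_cases h : γ ∈ tsupport D
  · refine ((hR γ hγ h).smul hD.contMDiffAt).congr_of_eventuallyEq (.of_forall fun β => ?_)
    simp only [Complex.real_smul, mul_comm, Pi.smul_apply']
  · refine (contMDiffAt_const (c := (0 : ℂ))).congr_of_eventuallyEq ?_
    filter_upwards [(isClosed_tsupport D).isOpen_compl.mem_nhds h] with β hβ
    rw [image_eq_zero_of_notMem_tsupport hβ, zero_mul]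

variable [IsManifold (𝓡 (n₁ + n₀)) ∞ G]

theorem contMDiffAt_coordDensity_r {U : Set M}
    {Y : M → Fin n₁ → EuclideanSpace ℝ (Fin (n₁ + n₀))} (hY : 𝒢.IsAlgebroidFrame U Y) (α : ℝ)
    {p : G → M} (hp : ContMDiff (𝓡 (n₁ + n₀)) (𝓡 n₀) ∞ p) {γ : G} (h1 : p γ ∈ U)
    (h2 : p γ ∈ c.base) :
    ContMDiffAt (𝓡 (n₁ + n₀)) 𝓘(ℝ, ℝ) ∞
      (fun γ => coordDensity α (𝒢.algebroid (p γ)) (c.algCoord (p γ)) (Y (p γ))) γ :=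
  ContMDiffAt.comp (g := fun x => coordDensity α (𝒢.algebroid x) (c.algCoord x) (Y x)) γ
    ((UnitChart.contMDiffOn_coordDensity hY α).contMDiffAt
      ((hY.isOpen.inter c.isOpen_base).mem_nhds ⟨h1, h2⟩)) hp.contMDiffAt

/-- The two determinants refer to an identification of the tangent space with the model space that
need not vary continuously with the point. Their ratio does not depend on it and can be computed in
one chart around γ, where numerator and denominator are smooth. -/
theorem contMDiffAt_volumeRatio (hF : IsDensityFrame (arrows c c') F) {W : Set G}
    {Z : G → Fin (n₁ + n₀) → EuclideanSpace ℝ (Fin (n₁ + n₀))} (hZ : IsTangentFrame W Z) {γ : G}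
    (h1 : γ ∈ W) (h2 : γ ∈ arrows c c') :
    ContMDiffAt (𝓡 (n₁ + n₀)) 𝓘(ℝ, ℝ) ∞
      (fun γ => coordDensity 1 ⊤ LinearMap.id (Z γ) / |tupleDet (F γ)|) γ := by
  set κ := chartAt (EuclideanSpace ℝ (Fin (n₁ + n₀))) γ
  have hκ : IsSmoothChart (n₁ + n₀) κ := isSmoothChart_chartAt γ
  have hγ : γ ∈ κ.source := mem_chart_source _ γ
  obtain ⟨J, hJ⟩ := hF κ hκ
  have h3 : ContMDiffOn (𝓡 (n₁ + n₀)) 𝓘(ℝ, ℝ) ∞ (fun γ => tupleDet fun l =>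
      flatDeriv (EuclideanSpace ℝ (Fin (n₁ + n₀))) (EuclideanSpace ℝ (Fin (n₁ + n₀))) κ γ (Z γ l))
      (κ.source ∩ W) := by
    refine ContMDiffOn.det_coordMatrix (N' := fun _ => LinearMap.id) fun i => ?_
    exact ContMDiffOn.mfderiv_apply_tangent κ.open_source hκ.smooth
      ((hZ.smooth i).mono inter_subset_right) fun x hx => hx.1
  have hopen := κ.open_source.inter hZ.isOpen
  have hiso : ∀ β ∈ κ.source, ∀ t : Fin (n₁ + n₀) → EuclideanSpace ℝ (Fin (n₁ + n₀)),
      IsFrame ⊤ t → tupleDet (fun l => flatDeriv (EuclideanSpace ℝ (Fin (n₁ + n₀)))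
        (EuclideanSpace ℝ (Fin (n₁ + n₀))) κ β (t l)) ≠ 0 := by
    intro β hβ t ht
    rw [← isFrame_top_iff]
    have hinj : Function.Injective (flatDeriv (EuclideanSpace ℝ (Fin (n₁ + n₀)))
        (EuclideanSpace ℝ (Fin (n₁ + n₀))) κ β) :=
      Function.LeftInverse.injective (hκ.mdifferentiable.flatDeriv_symm_apply hβ)
    have h5 := ht.1.map' (flatDeriv (EuclideanSpace ℝ (Fin (n₁ + n₀)))
      (EuclideanSpace ℝ (Fin (n₁ + n₀))) κ β).toLinearMap (LinearMap.ker_eq_bot.2 hinj)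
    exact ⟨h5, h5.span_eq_top_of_card_eq_finrank' (by simp)⟩
  have h4 : ContMDiffAt (𝓡 (n₁ + n₀)) 𝓘(ℝ, ℝ) ∞ (fun γ => |tupleDet fun l =>
      flatDeriv (EuclideanSpace ℝ (Fin (n₁ + n₀))) (EuclideanSpace ℝ (Fin (n₁ + n₀))) κ γ (Z γ l)|)
      γ := by
    have h5 := (h3.abs_rpow (fun β hβ => hiso β hβ.1 _ (hZ.frame β hβ.2)) 1).contMDiffAt
      (hopen.mem_nhds ⟨hγ, h1⟩)
    simpa only [Real.rpow_one] using h5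
  obtain ⟨hJ1, hJ2, -⟩ := hJ γ hγ h2
  have h6 : ContMDiffAt (𝓡 (n₁ + n₀)) 𝓘(ℝ, ℝ) ∞ (fun γ => |J (κ γ)|⁻¹) γ := by
    have h7 : ContDiffAt ℝ ∞ (fun w => |J w|⁻¹) (κ γ) :=
      (((contDiffAt_abs hJ2).comp (κ γ) hJ1).inv (abs_ne_zero.2 hJ2))
    exact h7.contMDiffAt.comp γ (hκ.smooth.contMDiffAt (κ.open_source.mem_nhds hγ))
  refine (h4.mul h6).congr_of_eventuallyEq ?_
  filter_upwards [κ.open_source.mem_nhds hγ, (isOpen_arrows c c').mem_nhds h2] with β hβ hβ'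
  obtain ⟨-, hJ2, hJ3⟩ := hJ β hβ hβ'
  rw [coordDensity_one_std, abs_tupleDet_div (κ := κ) (γ := β) (by rw [hJ3]; exact hJ2), hJ3,
    div_eq_mul_inv]
  rfl

theorem isTestFunction_testOf (hF : IsDensityFrame (arrows c c') F) {D : G → ℂ}
    (hD : ContMDiff (𝓡 (n₁ + n₀)) 𝓘(ℝ, ℂ) ∞ D) (hc : HasCompactSupport D)
    (hs : tsupport D ⊆ arrows c c') : 𝒢.IsTestFunction (testOf c c' F D) where
  density_r γ b t := by
    convert isDensity_coordDensity_mul (-1 / 2) (𝒢.algebroid (𝒢.r γ)) (c.algCoord (𝒢.r γ))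
      (D γ * ((coordDensity (-1 / 2) (𝒢.algebroid (𝒢.s γ)) (c'.algCoord (𝒢.s γ)) b *
        (coordDensity 1 ⊤ LinearMap.id t / |tupleDet (F γ)|) : ℝ) : ℂ)) using 2 with a
    simp only [testOf]; push_cast; ring
  density_s γ a t := by
    convert isDensity_coordDensity_mul (-1 / 2) (𝒢.algebroid (𝒢.s γ)) (c'.algCoord (𝒢.s γ))
      (D γ * ((coordDensity (-1 / 2) (𝒢.algebroid (𝒢.r γ)) (c.algCoord (𝒢.r γ)) a *
        (coordDensity 1 ⊤ LinearMap.id t / |tupleDet (F γ)|) : ℝ) : ℂ)) using 2 with b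
    simp only [testOf]; push_cast; ring
  density_G γ a b := by
    convert isDensity_coordDensity_mul 1 (⊤ : Submodule ℝ (EuclideanSpace ℝ (Fin (n₁ + n₀))))
      LinearMap.id (D γ * ((coordDensity (-1 / 2) (𝒢.algebroid (𝒢.r γ)) (c.algCoord (𝒢.r γ)) a *
        coordDensity (-1 / 2) (𝒢.algebroid (𝒢.s γ)) (c'.algCoord (𝒢.s γ)) b /
          |tupleDet (F γ)| : ℝ) : ℂ)) using 2 with t
    simp only [testOf]; push_cast; ring
  smooth U X U' X' W Z hX hX' hZ := by
    refine contMDiffOn_of_contMDiffAt_mul hD fun γ hγ hγ' => ?_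
    have hO := hs hγ'
    exact ((contMDiffAt_coordDensity_r hX _ r_contMDiff hγ.1.1 hO.1).mul
      (contMDiffAt_coordDensity_r hX' _ s_contMDiff hγ.1.2 hO.2)).mul
      (contMDiffAt_volumeRatio hF hZ hγ.2 hO)
  compact := hc.mono (support_testOf_subset c c' F D)

theorem isCompactHalfDensity_halfOf {g : G → ℂ}
    (hg : ContMDiff (𝓡 (n₁ + n₀)) 𝓘(ℝ, ℂ) ∞ g) (hc : HasCompactSupport g)
    (hs : tsupport g ⊆ arrows c c') : 𝒢.IsCompactHalfDensity (halfOf c c' g) where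
  density_r γ b := by
    convert isDensity_coordDensity_mul (1 / 2) (𝒢.algebroid (𝒢.r γ)) (c.algCoord (𝒢.r γ))
      (g γ * ((coordDensity (1 / 2) (𝒢.algebroid (𝒢.s γ)) (c'.algCoord (𝒢.s γ)) b : ℝ) : ℂ))
      using 2 with a
    simp only [halfOf]; push_cast; ring
  density_s γ a := by
    convert isDensity_coordDensity_mul (1 / 2) (𝒢.algebroid (𝒢.s γ)) (c'.algCoord (𝒢.s γ))
      (g γ * ((coordDensity (1 / 2) (𝒢.algebroid (𝒢.r γ)) (c.algCoord (𝒢.r γ)) a : ℝ) : ℂ))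
      using 2 with b
    simp only [halfOf]; push_cast; ring
  smooth U X U' X' hX hX' := by
    refine contMDiffOn_of_contMDiffAt_mul hg fun γ hγ hγ' => ?_
    have hO := hs hγ'
    exact (contMDiffAt_coordDensity_r hX _ r_contMDiff hγ.1 hO.1).mul
      (contMDiffAt_coordDensity_r hX' _ s_contMDiff hγ.2 hO.2)
  compact := hc.mono (support_halfOf_subset c c' g)

end TestFunctions
end LieGroupoid
-- The canonical isomorphisms on coefficients, and coefficients of test functions
namespace LieGroupoid
section Scalars
open Set Filter Topology

variable {n₁ n₀ : ℕ} {G M : Type*}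
    [TopologicalSpace G] [ChartedSpace (EuclideanSpace ℝ (Fin (n₁ + n₀))) G]
    [TopologicalSpace M] [ChartedSpace (EuclideanSpace ℝ (Fin n₀)) M]
    {𝒢 : LieGroupoid n₁ n₀ G M}
    {c c' : 𝒢.UnitChart} {F : G → Fin (n₁ + n₀) → EuclideanSpace ℝ (Fin (n₁ + n₀))}

/-- Relative to the adapted frame the Jacobian cancels, and the one-density on TG yields the volume
elements of a and of v. The first of these raises the exponent at r(γ) from -1/2 to 1/2. -/
theorem sForm_testOf [IsManifold (𝓡 (n₁ + n₀)) ∞ G] (D : G → ℂ) {γ : G} (hγ : γ ∈ arrows c c')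
    {a : Fin n₁ → EuclideanSpace ℝ (Fin (n₁ + n₀))} (ha : IsFrame (𝒢.algebroid (𝒢.r γ)) a)
    (b : Fin n₁ → EuclideanSpace ℝ (Fin (n₁ + n₀)))
    {v : Fin n₀ → EuclideanSpace ℝ (Fin n₀)} (hv : IsFrame ⊤ v) :
    𝒢.sForm (testOf c c' (sFrame c c') D) γ a b v =
      D γ * ((coordDensity (1 / 2) (𝒢.algebroid (𝒢.r γ)) (c.algCoord (𝒢.r γ)) a *
        coordDensity (-1 / 2) (𝒢.algebroid (𝒢.s γ)) (c'.algCoord (𝒢.s γ)) b *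
        coordDensity 1 ⊤ (c'.baseCoord (𝒢.s γ)) v : ℝ) : ℂ) := by
  have hκ := isSmoothChart_chartAt (n₁ := n₁) (n₀ := n₀) γ
  have hγ' := mem_chart_source (EuclideanSpace ℝ (Fin (n₁ + n₀))) γ
  have hs := c'.base_subset hγ.2
  have h0 := UnitChart.isCoordFrame_alg (c := c) hγ.1
  have hJ := (UnitChart.jac_spec (c := c) hκ hγ' hγ.1 hs).2.1
  have h1 := UnitChart.tupleDet_sTuple hκ hγ' hγ.1 hs (fun i => h0.frame.mem i)
    (c'.baseFrame (𝒢.s γ))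
  rw [h0.coordMatrix_self, (UnitChart.isCoordFrame_base hs).coordMatrix_self, Matrix.det_one,
    Matrix.det_one, one_mul, one_mul] at h1
  have h2 := UnitChart.tupleDet_sTuple hκ hγ' hγ.1 hs (fun i => ha.mem i) v
  change D γ * ((coordDensity (-1 / 2) (𝒢.algebroid (𝒢.r γ)) (c.algCoord (𝒢.r γ)) a *
    coordDensity (-1 / 2) (𝒢.algebroid (𝒢.s γ)) (c'.algCoord (𝒢.s γ)) b *
    (coordDensity 1 ⊤ LinearMap.id (𝒢.sTuple γ a v) / |tupleDet (sFrame c c' γ)|) : ℝ) : ℂ) = _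
  rw [coordDensity_one_std, abs_tupleDet_div (by rw [sFrame, h1]; exact hJ), sFrame, h1, h2,
    abs_mul, mul_div_cancel_right₀ _ (abs_ne_zero.2 hJ), abs_mul, coordDensity_of_isFrame hv,
    Real.rpow_one, show (1 / 2 : ℝ) = -1 / 2 + 1 by norm_num, ← coordDensity_mul h0,
    coordDensity_of_isFrame ha (α := 1), Real.rpow_one]
  push_cast
  ring

theorem rForm_testOf [IsManifold (𝓡 (n₁ + n₀)) ∞ G] (D : G → ℂ) {γ : G} (hγ : γ ∈ arrows c c')
    (a : Fin n₁ → EuclideanSpace ℝ (Fin (n₁ + n₀)))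
    {b : Fin n₁ → EuclideanSpace ℝ (Fin (n₁ + n₀))} (hb : IsFrame (𝒢.algebroid (𝒢.s γ)) b)
    {v : Fin n₀ → EuclideanSpace ℝ (Fin n₀)} (hv : IsFrame ⊤ v) :
    𝒢.rForm (testOf c c' (rFrame c c') D) γ a b v =
      D γ * ((coordDensity (-1 / 2) (𝒢.algebroid (𝒢.r γ)) (c.algCoord (𝒢.r γ)) a *
        coordDensity (1 / 2) (𝒢.algebroid (𝒢.s γ)) (c'.algCoord (𝒢.s γ)) b *
        coordDensity 1 ⊤ (c.baseCoord (𝒢.r γ)) v : ℝ) : ℂ) := by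
  have hκ := isSmoothChart_chartAt (n₁ := n₁) (n₀ := n₀) γ
  have hγ' := mem_chart_source (EuclideanSpace ℝ (Fin (n₁ + n₀))) γ
  have hr := c.base_subset hγ.1
  have h0 := UnitChart.isCoordFrame_alg (c := c') hγ.2
  have hJ := (UnitChart.jac_spec (c := c') (c' := c) (hκ.invChart 𝒢) (γ := 𝒢.inv γ)
    (mem_invChart_source.2 (by rwa [inv_inv])) (by rw [𝒢.r_inv]; exact hγ.2)
    (by rwa [𝒢.s_inv])).2.1
  rw [invChart_apply, inv_inv] at hJ
  have h1 := UnitChart.tupleDet_rTuple hκ hγ' hγ.2 hr (fun i => h0.frame.mem i)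
    (c.baseFrame (𝒢.r γ))
  rw [h0.coordMatrix_self, (UnitChart.isCoordFrame_base hr).coordMatrix_self, Matrix.det_one,
    Matrix.det_one, one_mul, one_mul] at h1
  have h2 := UnitChart.tupleDet_rTuple hκ hγ' hγ.2 hr (fun i => hb.mem i) v
  change D γ * ((coordDensity (-1 / 2) (𝒢.algebroid (𝒢.r γ)) (c.algCoord (𝒢.r γ)) a *
    coordDensity (-1 / 2) (𝒢.algebroid (𝒢.s γ)) (c'.algCoord (𝒢.s γ)) b *
    (coordDensity 1 ⊤ LinearMap.id (𝒢.rTuple γ b v) / |tupleDet (rFrame c c' γ)|) : ℝ) : ℂ) = _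
  rw [coordDensity_one_std, abs_tupleDet_div (by rw [rFrame, h1]; exact hJ), rFrame, h1, h2,
    abs_mul, mul_div_cancel_right₀ _ (abs_ne_zero.2 hJ), abs_mul, coordDensity_of_isFrame hv,
    Real.rpow_one, show (1 / 2 : ℝ) = -1 / 2 + 1 by norm_num, ← coordDensity_mul h0,
    coordDensity_of_isFrame hb (α := 1), Real.rpow_one]
  push_cast
  ring

variable [IsManifold (𝓡 (n₁ + n₀)) ∞ G] {τ : TestField n₁ n₀ G}

theorem IsDensityFrame.tupleDet_ne_zero {O : Set G} (hF : IsDensityFrame O F) {γ : G}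
    (hγ : γ ∈ O) : tupleDet (F γ) ≠ 0 := by
  obtain ⟨J, hJ⟩ := hF _ (isSmoothChart_chartAt γ)
  obtain ⟨-, h1, h2⟩ := hJ γ (mem_chart_source _ γ) hγ
  rw [← h2, tupleDet_comp] at h1
  exact right_ne_zero_of_mul h1

/-- The coefficient of a section of `Ω_0^{1/2}`. -/
noncomputable def coeffOf (c c' : 𝒢.UnitChart)
    (F : G → Fin (n₁ + n₀) → EuclideanSpace ℝ (Fin (n₁ + n₀))) (τ : TestField n₁ n₀ G) (γ : G) : ℂ :=
  τ γ (c.algFrame (𝒢.r γ)) (c'.algFrame (𝒢.s γ)) (F γ)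

theorem IsTestFunction.eq_testOf (hτ : 𝒢.IsTestFunction τ)
    (hF : IsDensityFrame (arrows c c') F) {γ : G} (hγ : γ ∈ arrows c c') :
    τ γ = testOf c c' F (coeffOf c c' F τ) γ := by
  funext a b t
  have h1 := hF.tupleDet_ne_zero hγ
  have h2 : ∀ a b t, τ γ a b t = τ γ a b (F γ) *
      ((coordDensity 1 ⊤ LinearMap.id t / |tupleDet (F γ)| : ℝ) : ℂ) := by
    intro a b t
    rw [(hτ.density_G γ a b).eq_mul_coordDensity (isCoordFrame_std _) t,
      (hτ.density_G γ a b).eq_mul_coordDensity (isCoordFrame_std _) (F γ),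
      coordDensity_one_std (F γ)]
    have h3 : ((|tupleDet (F γ)| : ℝ) : ℂ) ≠ 0 := by exact_mod_cast abs_ne_zero.2 h1
    push_cast
    field_simp
  rw [h2, (hτ.density_r γ b (F γ)).eq_mul_coordDensity (UnitChart.isCoordFrame_alg hγ.1) a,
    (hτ.density_s γ _ (F γ)).eq_mul_coordDensity (UnitChart.isCoordFrame_alg hγ.2) b]
  simp only [testOf, coeffOf]
  push_cast
  ring

theorem isTangentFrame_chart {κ : OpenPartialHomeomorph G (EuclideanSpace ℝ (Fin (n₁ + n₀)))}
    (hκ : IsSmoothChart (n₁ + n₀) κ) : IsTangentFrame κ.source (fun γ i =>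
      flatDeriv (EuclideanSpace ℝ (Fin (n₁ + n₀))) (EuclideanSpace ℝ (Fin (n₁ + n₀))) κ.symm (κ γ)
        (EuclideanSpace.single i 1)) where
  isOpen := κ.open_source
  frame γ hγ := by
    have hinj := (Function.LeftInverse.injective
      (hκ.mdifferentiable.flatDeriv_apply_symm (κ.map_source hγ)))
    have h5 := (isCoordFrame_std (n₁ + n₀)).frame.1.map' (flatDeriv
      (EuclideanSpace ℝ (Fin (n₁ + n₀))) (EuclideanSpace ℝ (Fin (n₁ + n₀))) κ.symm
        (κ γ)).toLinearMap (LinearMap.ker_eq_bot.2 hinj)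
    exact ⟨h5, h5.span_eq_top_of_card_eq_finrank' (by simp)⟩
  smooth i := by
    have h1 := ContMDiffOn.tangent_mfderiv_apply (p := κ.symm) (u := κ) κ.open_target
      hκ.symm_smooth hκ.smooth κ.mapsTo (EuclideanSpace.single i 1)
    refine h1.congr fun γ hγ => ?_
    rw [κ.left_inv hγ]
    rfl

/-- The frame F contains arbitrary lifts and need not be smooth. Smoothness is taken from the
coordinate frame of a chart, and homogeneity passes to F with the smooth factor |J|. -/
theorem IsTestFunction.contMDiffOn_coeffOf (hτ : 𝒢.IsTestFunction τ)
    (hF : IsDensityFrame (arrows c c') F) :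
    ContMDiffOn (𝓡 (n₁ + n₀)) 𝓘(ℝ, ℂ) ∞ (coeffOf c c' F τ) (arrows c c') := by
  intro γ hγ
  refine ContMDiffAt.contMDiffWithinAt ?_
  set κ := chartAt (EuclideanSpace ℝ (Fin (n₁ + n₀))) γ
  have hκ : IsSmoothChart (n₁ + n₀) κ := isSmoothChart_chartAt γ
  have hγ' : γ ∈ κ.source := mem_chart_source _ γ
  have hZ := isTangentFrame_chart hκ
  obtain ⟨J, hJ⟩ := hF κ hκ
  have h1 := (hτ.smooth _ _ _ _ _ _ c.isAlgebroidFrame_algFrame c'.isAlgebroidFrame_algFrame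
    hZ).contMDiffAt (((isOpen_arrows c c').inter κ.open_source).mem_nhds ⟨hγ, hγ'⟩)
  obtain ⟨hJ1, hJ2, -⟩ := hJ γ hγ' hγ
  have h6 : ContMDiffAt (𝓡 (n₁ + n₀)) 𝓘(ℝ, ℝ) ∞ (fun γ => |J (κ γ)|) γ := by
    have h7 : ContDiffAt ℝ ∞ (fun w => |J w|) (κ γ) := (contDiffAt_abs hJ2).comp (κ γ) hJ1
    exact h7.contMDiffAt.comp γ (hκ.smooth.contMDiffAt (κ.open_source.mem_nhds hγ'))
  refine (h6.smul h1).congr_of_eventuallyEq ?_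
  filter_upwards [κ.open_source.mem_nhds hγ', (isOpen_arrows c c').mem_nhds hγ] with β hβ hβ'
  obtain ⟨-, hJ2, hJ3⟩ := hJ β hβ hβ'
  have h8 : IsCoordFrame (⊤ : Submodule ℝ (EuclideanSpace ℝ (Fin (n₁ + n₀))))
      (flatDeriv (EuclideanSpace ℝ (Fin (n₁ + n₀))) (EuclideanSpace ℝ (Fin (n₁ + n₀))) κ
        β).toLinearMap (fun i => flatDeriv (EuclideanSpace ℝ (Fin (n₁ + n₀)))
          (EuclideanSpace ℝ (Fin (n₁ + n₀))) κ.symm (κ β) (EuclideanSpace.single i 1)) :=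
    ⟨hZ.frame β hβ, fun i => by
      have h10 := hκ.mdifferentiable.flatDeriv_apply_symm (κ.map_source hβ)
        (EuclideanSpace.single i (1 : ℝ))
      rwa [κ.left_inv hβ] at h10⟩
  have h9 := (hτ.density_G β (c.algFrame (𝒢.r β)) (c'.algFrame (𝒢.s β))).eq_mul_coordDensity h8
    (F β)
  rw [coordDensity_of_isFrame (isFrame_top_iff.2 (hF.tupleDet_ne_zero hβ')), Real.rpow_one] at h9
  simp only [coeffOf, Pi.smul_apply', Complex.real_smul]
  rw [h9, ← hJ3, mul_comm]
  rfl

end Scalars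
end LieGroupoid
-- Charts of the source fibres
namespace LieGroupoid
section FiberChart
open Set Filter Topology

variable {n₁ n₀ : ℕ} {G M : Type*}
    [TopologicalSpace G] [ChartedSpace (EuclideanSpace ℝ (Fin (n₁ + n₀))) G]
    [TopologicalSpace M] [ChartedSpace (EuclideanSpace ℝ (Fin n₀)) M]
    {𝒢 : LieGroupoid n₁ n₀ G M}

namespace UnitChart
variable (c : 𝒢.UnitChart)

/-- The frame of the algebroid at `r(β)` that is given by the coordinates of the chart along the
source fibre at `β`. -/
noncomputable def transFrame (β : G) (i : Fin n₁) : EuclideanSpace ℝ (Fin (n₁ + n₀)) :=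
  flatDeriv (EuclideanSpace ℝ (Fin n₁)) (EuclideanSpace ℝ (Fin (n₁ + n₀)))
    (fun y => c.trans y (𝒢.inv β)) (c.e β).1 (EuclideanSpace.single i 1)

variable {c}

theorem mk_fst_e {β : G} (hβ : β ∈ c.e.source) : ((c.e β).1, c.k (𝒢.s β)) = c.e β := by
  rw [← c.e_snd β hβ]

theorem mem_transDomain_inv {β : G} (hβ : β ∈ c.e.source) (hs : 𝒢.s β ∈ c.base) :
    ((c.e β).1, 𝒢.inv β) ∈ c.transDomain := by
  refine ⟨by rwa [𝒢.r_inv], ?_⟩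
  rw [𝒢.r_inv, mk_fst_e hβ]
  exact c.e.map_source hβ

theorem trans_inv_self {β : G} (hβ : β ∈ c.e.source) :
    c.trans (c.e β).1 (𝒢.inv β) = 𝒢.unit (𝒢.r β) := by
  rw [trans, 𝒢.r_inv, mk_fst_e hβ, c.e.left_inv hβ, 𝒢.mul_inv]

theorem eventually_mem_transDomain_left {u : EuclideanSpace ℝ (Fin n₁)} {γ : G}
    (h : (u, γ) ∈ c.transDomain) : ∀ᶠ y in 𝓝 u, (y, γ) ∈ c.transDomain := by
  have h1 : ContinuousAt (fun y : EuclideanSpace ℝ (Fin n₁) => (y, γ)) u := by fun_prop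
  exact h1.eventually_mem (c.isOpen_transDomain.mem_nhds h)

/-- Independence is the injectivity of the differential of translations, membership is constancy of
the source, and spanning is equality of dimensions. -/
theorem isFrame_transFrame {β : G} (hβ : β ∈ c.e.source) (hs : 𝒢.s β ∈ c.base)
    (hr : 𝒢.r β ∈ c.base) : IsFrame (𝒢.algebroid (𝒢.r β)) (c.transFrame β) := by
  have hd := mem_transDomain_inv hβ hs
  have hm : MDifferentiableAt (𝓡 n₁) (𝓡 (n₁ + n₀)) (fun y => c.trans y (𝒢.inv β)) (c.e β).1 :=
    (contMDiffAt_trans hd).mdifferentiableAt (by simp)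
  have hli : LinearIndependent ℝ (c.transFrame β) :=
    (isCoordFrame_std n₁).frame.1.map' (flatDeriv (EuclideanSpace ℝ (Fin n₁))
      (EuclideanSpace ℝ (Fin (n₁ + n₀))) (fun y => c.trans y (𝒢.inv β)) (c.e β).1).toLinearMap
      (LinearMap.ker_eq_bot.2 (trans_injective hd))
  refine ⟨hli, Submodule.eq_of_le_of_finrank_eq ?_ ?_⟩
  · rw [Submodule.span_le]
    rintro _ ⟨i, rfl⟩
    have h1 := flatDeriv_comp (E'' := EuclideanSpace ℝ (Fin n₀))
      (mdifferentiableAt_s (𝒢 := 𝒢) _) hm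
    have h2 : (𝒢.s ∘ fun y => c.trans y (𝒢.inv β)) =ᶠ[𝓝 (c.e β).1] fun _ => 𝒢.s (𝒢.inv β) := by
      filter_upwards [eventually_mem_transDomain_left hd] with y hy
      exact c.s_trans hy
    rw [flatDeriv_congr h2, flatDeriv_const, trans_inv_self hβ] at h1
    rw [SetLike.mem_coe, mem_algebroid_iff]
    exact (DFunLike.congr_fun h1 (EuclideanSpace.single i 1)).symm
  · rw [finrank_span_eq_card hli, ← (isCoordFrame_alg hr).frame.2,
      finrank_span_eq_card (isCoordFrame_alg hr).frame.1]

theorem contMDiffOn_transFrame : ContMDiffOn (𝓡 (n₁ + n₀)) 𝓘(ℝ, ℝ) ∞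
    (fun β => (coordMatrix (c.algCoord (𝒢.r β)) (c.transFrame β)).det)
    (c.e.source ∩ arrows c c) := by
  refine ContMDiffOn.det_coordMatrix fun i => ?_
  intro β₀ hβ₀
  refine ContMDiffAt.contMDiffWithinAt ?_
  -- The frame at β is a partial derivative of this jointly smooth function, taken in the second
  -- variable at the fibre coordinate of β itself.
  set Ψ : (EuclideanSpace ℝ (Fin n₁) × EuclideanSpace ℝ (Fin n₀)) → EuclideanSpace ℝ (Fin n₁) →
    EuclideanSpace ℝ (Fin n₁) := fun q w => (c.e (c.trans w (𝒢.inv (c.e.symm q)))).1 with hΨ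
  have h1 : ContDiffAt ℝ ∞ (Function.uncurry Ψ) (c.e β₀, (c.e β₀).1) := by
    rw [← contMDiffAt_iff_contDiffAt]
    have h2 : ContMDiffAt 𝓘(ℝ, (EuclideanSpace ℝ (Fin n₁) × EuclideanSpace ℝ (Fin n₀)) ×
        EuclideanSpace ℝ (Fin n₁)) (𝓡 (n₁ + n₀)) ∞
        (fun q : (EuclideanSpace ℝ (Fin n₁) × EuclideanSpace ℝ (Fin n₀)) ×
        EuclideanSpace ℝ (Fin n₁) => 𝒢.inv (c.e.symm q.1)) (c.e β₀, (c.e β₀).1) :=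
      𝒢.inv_smooth.contMDiffAt.comp _ (ContMDiffAt.comp (g := c.e.symm) _
        (c.e_symm_smooth.contMDiffAt (c.e.open_target.mem_nhds (c.e.map_source hβ₀.1)))
        contDiff_fst.contMDiff.contMDiffAt)
    have h3 := (contDiff_snd.contMDiff (n := ∞)).contMDiffAt.prodMk h2
    have h4 : ContMDiffAt (𝓘(ℝ, EuclideanSpace ℝ (Fin n₁)).prod (𝓡 (n₁ + n₀))) (𝓡 (n₁ + n₀)) ∞
        (fun q : EuclideanSpace ℝ (Fin n₁) × G => c.trans q.1 q.2)
        ((c.e β₀).1, 𝒢.inv (c.e.symm (c.e β₀))) := by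
      rw [c.e.left_inv hβ₀.1]
      exact c.contMDiffOn_trans.contMDiffAt
        (c.isOpen_transDomain.mem_nhds (mem_transDomain_inv hβ₀.1 hβ₀.2.2))
    have h5 := ContMDiffAt.comp (f := fun q : (EuclideanSpace ℝ (Fin n₁) ×
      EuclideanSpace ℝ (Fin n₀)) × EuclideanSpace ℝ (Fin n₁) => (q.2, 𝒢.inv (c.e.symm q.1)))
      (c.e β₀, (c.e β₀).1) h4 h3
    have h6 : ContMDiffAt (𝓡 (n₁ + n₀)) 𝓘(ℝ, EuclideanSpace ℝ (Fin n₁) ×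
        EuclideanSpace ℝ (Fin n₀)) ∞ c.e
        (c.trans (c.e β₀).1 (𝒢.inv (c.e.symm (c.e β₀)))) := by
      rw [c.e.left_inv hβ₀.1, trans_inv_self hβ₀.1]
      exact c.e_smooth.contMDiffAt (c.e.open_source.mem_nhds hβ₀.2.1)
    exact (contDiff_fst.contMDiff (n := ∞)).contMDiffAt.comp _ (ContMDiffAt.comp _ h6 h5)
  have h7 := (ContDiffAt.fderiv (m := ∞) (n := ∞) h1 contDiffAt_fst (by simp)).clm_apply
    (contDiffAt_const (c := EuclideanSpace.single i (1 : ℝ)))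
  have h8 := h7.contMDiffAt.comp β₀ (c.e_smooth.contMDiffAt (c.e.open_source.mem_nhds hβ₀.1))
  refine h8.congr_of_eventuallyEq ?_
  filter_upwards [c.e.open_source.mem_nhds hβ₀.1, (isOpen_arrows c c).mem_nhds hβ₀.2] with β hβ hβ'
  have hd := mem_transDomain_inv hβ hβ'.2
  have hm : MDifferentiableAt (𝓡 n₁) (𝓡 (n₁ + n₀)) (fun y => c.trans y (𝒢.inv β)) (c.e β).1 :=
    (contMDiffAt_trans hd).mdifferentiableAt (by simp)
  have he : MDifferentiableAt (𝓡 (n₁ + n₀)) 𝓘(ℝ, EuclideanSpace ℝ (Fin n₁) ×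
      EuclideanSpace ℝ (Fin n₀)) c.e (c.trans (c.e β).1 (𝒢.inv β)) := by
    rw [trans_inv_self hβ]
    exact c.mdifferentiable_e.mdifferentiableAt hβ'.1
  have h9 := flatDeriv_comp (g := c.e) (x := (c.e β).1)
    (f := fun y => c.trans y (𝒢.inv β))
    (E'' := EuclideanSpace ℝ (Fin n₁) × EuclideanSpace ℝ (Fin n₀)) he hm
  have hdiff : DifferentiableAt ℝ (c.e ∘ fun y => c.trans y (𝒢.inv β)) (c.e β).1 :=
    (MDifferentiableAt.comp (c.e β).1 (g := c.e) (f := fun y => c.trans y (𝒢.inv β)) he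
      hm).differentiableAt
  rw [flatDeriv_eq_fderiv, trans_inv_self hβ] at h9
  simp only [Function.comp, hΨ, c.e.left_inv hβ, algCoord]
  have h10 : fderiv ℝ (fun w => (c.e (c.trans w (𝒢.inv β))).1) (c.e β).1 =
    (ContinuousLinearMap.fst ℝ _ _).comp (fderiv ℝ (c.e ∘ fun y => c.trans y (𝒢.inv β)) (c.e β).1) :=
    hdiff.hasFDerivAt.fst.fderiv
  rw [h10, h9]
  rfl

theorem continuous_mul_inv_fiber (γ : G) :
    Continuous fun α : {α : G // 𝒢.s α = 𝒢.s γ} => 𝒢.mul α (𝒢.inv γ) :=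
  (contMDiffOn_mul_right (𝒢 := 𝒢) (𝒢.inv γ)).continuousOn.comp_continuous continuous_subtype_val
    fun α => by rw [𝒢.r_inv]; exact α.2

variable (c) in
open Classical in
/-- The chart of a source fibre through `γ` that is given by left translations of `γ`. -/
noncomputable def fiberChart (γ : G) (hr : 𝒢.r γ ∈ c.base) (x : M) (hx : 𝒢.s γ = x) :
    𝒢.FiberChart x where
  toFun α := (c.e (𝒢.mul α (𝒢.inv γ))).1
  -- Off the target the value is immaterial, and γ is a point of the fibre that is at hand.
  invFun u := if h : (u, c.k (𝒢.r γ)) ∈ c.e.target then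
    ⟨c.trans u γ, (c.s_trans (γ := γ) ⟨hr, h⟩).trans hx⟩ else ⟨γ, hx⟩
  source := {α | 𝒢.mul α (𝒢.inv γ) ∈ c.e.source}
  target := {u | (u, c.k (𝒢.r γ)) ∈ c.e.target}
  map_source' α hα := by
    have h := c.e.map_source hα
    have h1 : 𝒢.s (𝒢.mul α (𝒢.inv γ)) = 𝒢.r γ := by
      rw [𝒢.s_mul _ _ (by rw [α.2, 𝒢.r_inv, hx]), 𝒢.s_inv]
    rw [← mk_fst_e hα, h1] at h
    exact h
  map_target' u hu := by
    have hu' : (u, c.k (𝒢.r γ)) ∈ c.e.target := hu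
    simp only [hu', dite_true, mem_ofPred_eq]
    rw [trans, mul_inv_cancel_right (s_symm_of_mem (c.base_subset hr) hu')]
    exact c.e.map_target hu'
  left_inv' α hα := by
    have h := c.e.map_source hα
    have h1 : 𝒢.s (𝒢.mul α (𝒢.inv γ)) = 𝒢.r γ := by
      rw [𝒢.s_mul _ _ (by rw [α.2, 𝒢.r_inv, hx]), 𝒢.s_inv]
    have h2 := mk_fst_e hα
    rw [h1] at h2
    rw [← h2] at h
    rw [dif_pos h]
    refine Subtype.ext ?_
    simp only [trans, h2]
    rw [c.e.left_inv hα, inv_mul_cancel_right (by rw [α.2, hx])]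
  right_inv' u hu := by
    have hu' : (u, c.k (𝒢.r γ)) ∈ c.e.target := hu
    simp only [hu', dite_true]
    rw [trans, mul_inv_cancel_right (s_symm_of_mem (c.base_subset hr) hu'), c.e.right_inv hu']
  open_source := by
    subst hx
    exact c.e.open_source.preimage (continuous_mul_inv_fiber γ)
  open_target := by
    have h1 : Continuous fun u : EuclideanSpace ℝ (Fin n₁) => (u, c.k (𝒢.r γ)) := by fun_prop
    exact c.e.open_target.preimage h1
  continuousOn_toFun := by
    subst hx
    exact continuous_fst.comp_continuousOn
      (c.e.continuousOn.comp (continuous_mul_inv_fiber γ).continuousOn fun α hα => hα)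
  continuousOn_invFun := by
    refine Topology.IsInducing.subtypeVal.continuousOn_iff.2 ?_
    refine ContinuousOn.congr (f := fun u => c.trans u γ) (fun u hu => ?_) fun u hu => ?_
    · exact (contMDiffAt_trans ⟨hr, hu⟩).continuousAt.continuousWithinAt
    · have hu' : (u, c.k (𝒢.r γ)) ∈ c.e.target := hu
      simp only [Function.comp, hu', dite_true]
  smooth_symm := by
    refine ContMDiffOn.congr (f := fun u => c.trans u γ) (fun u hu => ?_) fun u hu => ?_
    · exact (contMDiffAt_trans ⟨hr, hu⟩).contMDiffWithinAt
    · have hu' : (u, c.k (𝒢.r γ)) ∈ c.e.target := hu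
      simp [hu']
  immersion_symm := by
    intro u hu
    have h1 : (fun w => c.trans w γ) =ᶠ[𝓝 u] fun w => ((if h : (w, c.k (𝒢.r γ)) ∈ c.e.target then
        ⟨c.trans w γ, (c.s_trans (γ := γ) ⟨hr, h⟩).trans hx⟩ else ⟨γ, hx⟩ :
          {α : G // 𝒢.s α = x}) : G) := by
      filter_upwards [eventually_mem_target (x := 𝒢.r γ) hu] with w hw
      simp only [hw, dite_true]
    have h2 := trans_injective (c := c) (γ := γ) ⟨hr, hu⟩
    rw [flatDeriv_congr h1] at h2
    exact h2

variable {γ : G} {hr : 𝒢.r γ ∈ c.base} {x : M} {hx : 𝒢.s γ = x}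

theorem param_fiberChart {u : EuclideanSpace ℝ (Fin n₁)} (hu : (u, c.k (𝒢.r γ)) ∈ c.e.target) :
    (c.fiberChart γ hr x hx).param u = c.trans u γ :=
  congrArg Subtype.val (dif_pos hu)

/-- Since (wγ)(uγ)⁻¹ = wu⁻¹, the frame depends on the translating element and not on γ. This is why
one kernel serves for all γ. -/
theorem coordFrame_fiberChart {u : EuclideanSpace ℝ (Fin n₁)}
    (hu : (u, c.k (𝒢.r γ)) ∈ c.e.target) :
    (c.fiberChart γ hr x hx).coordFrame u = c.transFrame (c.e.symm (u, c.k (𝒢.r γ))) := by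
  funext i
  have hp : ∀ w, (w, c.k (𝒢.r γ)) ∈ c.e.target → 𝒢.s (c.e.symm (w, c.k (𝒢.r γ))) = 𝒢.r γ :=
    fun w hw => s_symm_of_mem (c.base_subset hr) hw
  have h1 : (fun w => 𝒢.mul ((c.fiberChart γ hr x hx).param w)
      (𝒢.inv ((c.fiberChart γ hr x hx).param u))) =ᶠ[𝓝 u]
      fun w => c.trans w (𝒢.inv (c.e.symm (u, c.k (𝒢.r γ)))) := by
    filter_upwards [eventually_mem_target hu] with w hw
    rw [param_fiberChart hw, param_fiberChart hu, trans, trans, trans,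
      mul_inv_rev (hp u hu), 𝒢.r_inv, hp u hu,
      ← 𝒢.mul_assoc _ _ _ (by rw [𝒢.s_mul _ _ (hp w hw), 𝒢.r_inv]) (by rw [𝒢.s_inv, 𝒢.r_inv, hp u hu]),
      mul_inv_cancel_right (hp w hw)]
  change flatDeriv (EuclideanSpace ℝ (Fin n₁)) (EuclideanSpace ℝ (Fin (n₁ + n₀))) (fun w =>
    𝒢.mul ((c.fiberChart γ hr x hx).param w) (𝒢.inv ((c.fiberChart γ hr x hx).param u))) u
    (EuclideanSpace.single i 1) = _
  rw [flatDeriv_congr h1, transFrame, c.e.right_inv hu]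

end UnitChart
end FiberChart
end LieGroupoid
-- Kernels and averages in a flow box
namespace LieGroupoid
section Average
open Set Filter Topology MeasureTheory

/-- A function that is smooth on an open neighborhood of a closed set that contains its support is
smooth. -/
theorem contMDiff_of_support_subset {E X : Type*} [NormedAddCommGroup E] [NormedSpace ℝ E]
    [TopologicalSpace X] [ChartedSpace E X] {F : X → ℂ} {O K : Set X} (hO : IsOpen O)
    (hK : IsClosed K) (hKO : K ⊆ O) (hF : ContMDiffOn 𝓘(ℝ, E) 𝓘(ℝ, ℂ) ∞ F O)
    (hs : Function.support F ⊆ K) : ContMDiff 𝓘(ℝ, E) 𝓘(ℝ, ℂ) ∞ F ∧ tsupport F ⊆ K :=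
  ⟨contMDiff_of_tsupport fun _ hx =>
    hF.contMDiffAt (hO.mem_nhds (hKO (closure_minimal hs hK hx))), closure_minimal hs hK⟩

/-- Smooth dependence on a parameter of an integral with integrand supported in a fixed compact
set. -/
theorem contDiffOn_integral_param {A P : Type*} [NormedAddCommGroup A] [InnerProductSpace ℝ A]
    [FiniteDimensional ℝ A] [MeasurableSpace A] [BorelSpace A] [NormedAddCommGroup P]
    [NormedSpace ℝ P] {g : P → A → ℂ} {s : Set P} (hs : IsOpen s) {k : Set A} (hk : IsCompact k)
    (hgs : ∀ p ∈ s, ∀ t ∉ k, g p t = 0)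
    (hg : ContDiffOn ℝ ∞ (Function.uncurry g) (s ×ˢ univ)) :
    ContDiffOn ℝ ∞ (fun p => ∫ t, g p t) s := by
  -- The integral is the value at 0 of the convolution of the constant 1 with the reflected
  -- integrand.
  have h := contDiffOn_convolution_right_with_param_comp (n := ⊤) (μ := volume)
    (ContinuousLinearMap.lsmul ℝ ℝ : ℝ →L[ℝ] ℂ →L[ℝ] ℂ) (v := fun _ : P => (0 : A))
    contDiffOn_const (f := fun _ => (1 : ℝ)) (g := fun p t => g p (-t)) hs hk.neg
    (fun p t hp ht => hgs p hp _ ht) (locallyIntegrable_const 1)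
    (hg.comp (f := fun q : P × A => (q.1, -q.2)) (contDiff_fst.prodMk contDiff_snd.neg).contDiffOn
      fun q hq => ⟨hq.1, trivial⟩)
  simpa [convolution] using h

variable {n₁ n₀ : ℕ} {G M : Type*}
    [TopologicalSpace G] [ChartedSpace (EuclideanSpace ℝ (Fin (n₁ + n₀))) G]
    [TopologicalSpace M] [ChartedSpace (EuclideanSpace ℝ (Fin n₀)) M]
    {𝒢 : LieGroupoid n₁ n₀ G M} {W : Set G}

/-- A cutoff function on the base and a weight on the fibres, for use in a flow box. -/
structure FlowBox.IsWeight (b : 𝒢.FlowBox W) (f : EuclideanSpace ℝ (Fin n₁) → ℝ) (φ : M → ℝ) :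
    Prop where
  smooth : ContDiff ℝ ∞ f
  support : Function.support f ⊆ euclideanBox n₁ b.δ
  cutoff_smooth : ContMDiff (𝓡 n₀) 𝓘(ℝ, ℝ) ∞ φ
  cutoff_compact : HasCompactSupport φ
  cutoff_support : tsupport φ ⊆ b.B

namespace FlowBox
variable (b : 𝒢.FlowBox W) (f : EuclideanSpace ℝ (Fin n₁) → ℝ) (φ : M → ℝ)

/-- The set of arrows near units on which the kernel lives. -/
def kernelSet : Set G := (fun q : EuclideanSpace ℝ (Fin n₁) × M => b.c.e.symm (q.1, b.c.k q.2)) ''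
  (euclideanBox n₁ b.δ ×ˢ tsupport φ)

/-- The coefficient of the half-density that averages over translates with weight `f`. -/
noncomputable def kernel : G → ℂ := b.c.e.source.indicator fun β =>
  ((f (b.c.e β).1 * φ (𝒢.s β) /
    |(coordMatrix (b.c.algCoord (𝒢.r β)) (b.c.transFrame β)).det| : ℝ) : ℂ)

/-- The average of the translates of a function with weight `f`. -/
noncomputable def average (D : G → ℂ) (γ : G) : ℂ :=
  φ (𝒢.r γ) • ∫ t, f t • D (b.c.trans t γ)

variable {b f φ}

theorem mem_domain {t : EuclideanSpace ℝ (Fin n₁)} (ht : t ∈ euclideanBox n₁ b.δ) {x : M}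
    (hx : x ∈ b.B) : (t, b.c.k x) ∈ b.c.e.target ∧ 𝒢.r (b.c.e.symm (t, b.c.k x)) ∈ b.c.base :=
  b.box_mem t ht x hx

theorem mem_arrows {t : EuclideanSpace ℝ (Fin n₁)} (ht : t ∈ euclideanBox n₁ b.δ) {x : M}
    (hx : x ∈ b.B) : b.c.e.symm (t, b.c.k x) ∈ b.c.e.source ∩ arrows b.c b.c := by
  obtain ⟨h1, h2⟩ := mem_domain ht hx
  refine ⟨b.c.e.map_target h1, h2, ?_⟩
  rw [mem_preimage, UnitChart.s_symm_of_mem (b.c.base_subset (b.B_subset hx)) h1]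
  exact b.B_subset hx

theorem continuousOn_symm : ContinuousOn
    (fun q : EuclideanSpace ℝ (Fin n₁) × M => b.c.e.symm (q.1, b.c.k q.2))
    (euclideanBox n₁ b.δ ×ˢ b.B) := by
  refine b.c.e.continuousOn_symm.comp (continuousOn_fst.prodMk
    (b.c.k.continuousOn.comp continuousOn_snd fun q hq => b.c.base_subset (b.B_subset hq.2))) ?_
  exact fun q hq => (mem_domain hq.1 hq.2).1

theorem isCompact_kernelSet (h : b.IsWeight f φ) : IsCompact (b.kernelSet φ) :=
  ((isCompact_euclideanBox n₁ b.δ).prod h.cutoff_compact).image_of_continuousOn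
    (continuousOn_symm.mono (prod_mono_right h.cutoff_support))

theorem kernelSet_subset (h : b.IsWeight f φ) :
    b.kernelSet φ ⊆ b.c.e.source ∩ arrows b.c b.c := by
  rintro _ ⟨q, hq, rfl⟩
  exact mem_arrows hq.1 (h.cutoff_support hq.2)

theorem support_kernel_subset (h : b.IsWeight f φ) :
    Function.support (b.kernel f φ) ⊆ b.kernelSet φ := by
  intro β hβ
  have h1 : β ∈ b.c.e.source := by
    by_contra h1
    exact hβ (indicator_of_notMem h1 _)
  rw [Function.mem_support, kernel, indicator_of_mem h1, Complex.ofReal_ne_zero] at hβ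
  have h2 := left_ne_zero_of_mul (div_ne_zero_iff.1 hβ).1
  have h3 := right_ne_zero_of_mul (div_ne_zero_iff.1 hβ).1
  refine ⟨((b.c.e β).1, 𝒢.s β), ⟨h.support h2, subset_tsupport _ h3⟩, ?_⟩
  simp only [UnitChart.mk_fst_e h1, b.c.e.left_inv h1]

theorem transFrame_det_ne_zero {β : G} (hβ : β ∈ b.c.e.source ∩ arrows b.c b.c) :
    (coordMatrix (b.c.algCoord (𝒢.r β)) (b.c.transFrame β)).det ≠ 0 :=
  (UnitChart.isCoordFrame_alg hβ.2.1).det_ne_zero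
    (UnitChart.isFrame_transFrame hβ.1 hβ.2.2 hβ.2.1)

theorem contMDiff_kernel [T2Space G] (h : b.IsWeight f φ) :
    ContMDiff (𝓡 (n₁ + n₀)) 𝓘(ℝ, ℂ) ∞ (b.kernel f φ) ∧
      tsupport (b.kernel f φ) ⊆ b.kernelSet φ := by
  refine contMDiff_of_support_subset (b.c.e.open_source.inter (isOpen_arrows b.c b.c))
    (isCompact_kernelSet h).isClosed (kernelSet_subset h) ?_ (support_kernel_subset h)
  have h1 : ContMDiffOn (𝓡 (n₁ + n₀)) 𝓘(ℝ, ℝ) ∞ (fun β => f (b.c.e β).1)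
      (b.c.e.source ∩ arrows b.c b.c) :=
    (h.smooth.comp contDiff_fst).contMDiff.comp_contMDiffOn (b.c.e_smooth.mono inter_subset_left)
  have h2 : ContMDiffOn (𝓡 (n₁ + n₀)) 𝓘(ℝ, ℝ) ∞ (fun β => φ (𝒢.s β))
      (b.c.e.source ∩ arrows b.c b.c) := (h.cutoff_smooth.comp (s_contMDiff (𝒢 := 𝒢))).contMDiffOn
  have h3 := (UnitChart.contMDiffOn_transFrame (c := b.c)).abs_rpow
    (fun β hβ => transFrame_det_ne_zero hβ) (-1)
  refine ((Complex.ofRealCLM.contDiff.contMDiff (n := ∞)).comp_contMDiffOn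
    ((h1.mul h2).mul h3)).congr fun β hβ => ?_
  simp only [kernel, indicator_of_mem hβ.1, Function.comp, Pi.mul_apply, Real.rpow_neg_one,
    div_eq_mul_inv]
  rfl

variable {D : G → ℂ}

theorem contMDiffOn_average [IsManifold (𝓡 (n₁ + n₀)) ∞ G] (h : b.IsWeight f φ)
    (hD : ContMDiff (𝓡 (n₁ + n₀)) 𝓘(ℝ, ℂ) ∞ D) :
    ContMDiffOn (𝓡 (n₁ + n₀)) 𝓘(ℝ, ℂ) ∞ (b.average f φ D) (𝒢.r ⁻¹' b.B) := by
  intro γ₀ hγ₀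
  refine ContMDiffAt.contMDiffWithinAt ?_
  set κ := chartAt (EuclideanSpace ℝ (Fin (n₁ + n₀))) γ₀
  have hκ : IsSmoothChart (n₁ + n₀) κ := isSmoothChart_chartAt γ₀
  have hγ' : γ₀ ∈ κ.source := mem_chart_source _ γ₀
  have hs : IsOpen (κ.target ∩ κ.symm ⁻¹' (𝒢.r ⁻¹' b.B)) :=
    κ.isOpen_inter_preimage_symm (b.isOpen_B.preimage r_contMDiff.continuous)
  have hbox := isCompact_euclideanBox n₁ b.δ
  have h1 : ContDiffOn ℝ ∞ (fun w => ∫ t, f t • D (b.c.trans t (κ.symm w)))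
      (κ.target ∩ κ.symm ⁻¹' (𝒢.r ⁻¹' b.B)) := by
    refine contDiffOn_integral_param hs hbox (fun w hw t ht => ?_) ?_
    · rw [Function.notMem_support.1 fun h' => ht (h.support h'), zero_smul]
    rintro ⟨w, t⟩ hw
    refine ContDiffAt.contDiffWithinAt ?_
    -- The translation is known to be smooth only on its domain, which contains the box; off the
    -- closed box the weight vanishes locally.
    by_cases ht : t ∈ euclideanBox n₁ b.δ
    · have hm : (t, κ.symm w) ∈ b.c.transDomain := ⟨b.B_subset hw.1.2, (mem_domain ht hw.1.2).1⟩
      have h2 : ContMDiffAt 𝓘(ℝ, EuclideanSpace ℝ (Fin (n₁ + n₀)) × EuclideanSpace ℝ (Fin n₁))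
          ((𝓡 n₁).prod (𝓡 (n₁ + n₀))) ∞ (fun q => (q.2, κ.symm q.1)) (w, t) :=
        contDiff_snd.contMDiff.contMDiffAt.prodMk (ContMDiffAt.comp (g := κ.symm) _
          (hκ.symm_smooth.contMDiffAt (κ.open_target.mem_nhds hw.1.1))
          contDiff_fst.contMDiff.contMDiffAt)
      have h3 := ContMDiffAt.comp
        (f := fun q : EuclideanSpace ℝ (Fin (n₁ + n₀)) × EuclideanSpace ℝ (Fin n₁) =>
          (q.2, κ.symm q.1)) (g := fun q : EuclideanSpace ℝ (Fin n₁) × G => b.c.trans q.1 q.2)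
        (w, t) (b.c.contMDiffOn_trans.contMDiffAt (b.c.isOpen_transDomain.mem_nhds hm)) h2
      have h4 := (hD.contMDiffAt.comp _ h3).contDiffAt
      exact (h.smooth.comp contDiff_snd).contDiffAt.smul h4
    · refine (contDiffAt_const (c := (0 : ℂ))).congr_of_eventuallyEq ?_
      have h5 : ∀ᶠ q : EuclideanSpace ℝ (Fin (n₁ + n₀)) × EuclideanSpace ℝ (Fin n₁) in 𝓝 (w, t),
          q.2 ∈ (euclideanBox n₁ b.δ)ᶜ :=
        continuousAt_snd.eventually_mem (hbox.isClosed.isOpen_compl.mem_nhds ht)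
      filter_upwards [h5] with q hq
      rw [Function.uncurry, Function.notMem_support.1 fun h' => hq (h.support h'), zero_smul]
  have h6 := (h1.contDiffAt (hs.mem_nhds (x := κ γ₀) ⟨κ.map_source hγ', by
    rw [mem_preimage, κ.left_inv hγ']; exact hγ₀⟩)).contMDiffAt.comp γ₀
    (hκ.smooth.contMDiffAt (κ.open_source.mem_nhds hγ'))
  refine ((h.cutoff_smooth.comp (r_contMDiff (𝒢 := 𝒢))).contMDiffAt.smul h6).congr_of_eventuallyEq ?_
  filter_upwards [κ.open_source.mem_nhds hγ'] with γ hγ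
  simp only [average, Pi.smul_apply', Function.comp, κ.left_inv hγ]

theorem average_eq_zero {γ : G} (h : φ (𝒢.r γ) = 0 ∨ ∀ t ∈ euclideanBox n₁ b.δ,
    D (b.c.trans t γ) = 0) (hf : b.IsWeight f φ) : b.average f φ D γ = 0 := by
  rcases h with h | h
  · rw [average, h, zero_smul]
  · rw [average, integral_eq_zero_of_ae, smul_zero]
    refine .of_forall fun t => ?_
    by_cases ht : t ∈ euclideanBox n₁ b.δ
    · simp [h t ht]
    · simp [Function.notMem_support.1 fun h' => ht (hf.support h')]

/-- The set of arrows with a translate in a set `K`. -/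
def averageSet (b : 𝒢.FlowBox W) (φ : M → ℝ) (K : Set G) : Set G :=
  (fun q : (EuclideanSpace ℝ (Fin n₁) × M) × G =>
    𝒢.mul (𝒢.inv (b.c.e.symm (q.1.1, b.c.k q.1.2))) q.2) ''
  {q | q ∈ (euclideanBox n₁ b.δ ×ˢ tsupport φ) ×ˢ K ∧
    𝒢.r (b.c.e.symm (q.1.1, b.c.k q.1.2)) = 𝒢.r q.2}

/-- The products β⁻¹α are formed on the part of a compact product where r(β) = r(α), which is closed
as M is Hausdorff. -/
theorem isCompact_averageSet [T2Space G] [T2Space M] (h : b.IsWeight f φ) {K : Set G} (hK : IsCompact K) :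
    IsCompact (b.averageSet φ K) := by
  have hc : ContinuousOn (fun q : (EuclideanSpace ℝ (Fin n₁) × M) × G =>
      b.c.e.symm (q.1.1, b.c.k q.1.2)) ((euclideanBox n₁ b.δ ×ˢ tsupport φ) ×ˢ K) :=
    continuousOn_symm.comp continuousOn_fst fun q hq => ⟨hq.1.1, h.cutoff_support hq.1.2⟩
  have hA : IsCompact ((euclideanBox n₁ b.δ ×ˢ tsupport φ) ×ˢ K) :=
    ((isCompact_euclideanBox n₁ b.δ).prod h.cutoff_compact).prod hK
  refine IsCompact.image_of_continuousOn ?_ ?_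
  · refine hA.of_isClosed_subset ?_ fun q hq => hq.1
    exact ((r_contMDiff (𝒢 := 𝒢)).continuous.comp_continuousOn hc |>.prodMk
      ((r_contMDiff (𝒢 := 𝒢)).continuous.comp continuous_snd).continuousOn
      ).preimage_isClosed_of_isClosed hA.isClosed isClosed_diagonal
  · refine 𝒢.mul_smooth.continuousOn.comp (t := {p : G × G | 𝒢.s p.1 = 𝒢.r p.2})
      (((𝒢.inv_smooth.continuous.comp_continuousOn hc).prodMk continuousOn_snd).mono
        fun q hq => hq.1) fun q hq => (𝒢.s_inv _).trans hq.2

theorem averageSet_subset (h : b.IsWeight f φ) {K : Set G} {c' : 𝒢.UnitChart}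
    (hK : K ⊆ 𝒢.s ⁻¹' c'.base) :
    b.averageSet φ K ⊆ 𝒢.r ⁻¹' b.B ∩ arrows b.c c' := by
  rintro _ ⟨⟨⟨t, x⟩, α⟩, ⟨⟨⟨ht, hx⟩, hα⟩, he⟩, rfl⟩
  have hx' := h.cutoff_support hx
  have h1 : 𝒢.s (𝒢.inv (b.c.e.symm (t, b.c.k x))) = 𝒢.r α := by rw [𝒢.s_inv]; exact he
  have h2 : 𝒢.r (𝒢.mul (𝒢.inv (b.c.e.symm (t, b.c.k x))) α) = x := by
    rw [𝒢.r_mul _ _ h1, 𝒢.r_inv, UnitChart.s_symm_of_mem (b.c.base_subset (b.B_subset hx'))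
      (mem_domain ht hx').1]
  refine ⟨?_, ?_, ?_⟩
  · simp only [mem_preimage, h2, hx']
  · simp only [mem_preimage, h2]; exact b.B_subset hx'
  · simp only [mem_preimage, 𝒢.s_mul _ _ h1]; exact hK hα

/-- A nonzero average at γ needs a β in the box over r(γ) with βγ in the support of D, and γ =
β⁻¹(βγ). -/
theorem support_average_subset (h : b.IsWeight f φ) :
    Function.support (b.average f φ D) ⊆ b.averageSet φ (tsupport D) := by
  intro γ hγ
  by_contra hn
  refine hγ (average_eq_zero (or_iff_not_imp_left.2 fun h1 t ht => ?_) h)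
  by_contra h2
  have hx := subset_tsupport _ h1
  have hd := (mem_domain ht (h.cutoff_support hx)).1
  have h3 := UnitChart.s_symm_of_mem (b.c.base_subset (b.B_subset (h.cutoff_support hx))) hd
  refine hn ⟨((t, 𝒢.r γ), b.c.trans t γ), ⟨⟨⟨ht, hx⟩, subset_tsupport _ h2⟩, ?_⟩, ?_⟩
  · simp only [UnitChart.trans, 𝒢.r_mul _ _ h3]
  · simp only [UnitChart.trans]
    rw [← 𝒢.mul_assoc _ _ _ (by rw [𝒢.s_inv]) h3, 𝒢.inv_mul, h3, 𝒢.unit_mul]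

theorem contMDiff_average [T2Space G] [T2Space M] [IsManifold (𝓡 (n₁ + n₀)) ∞ G]
    (h : b.IsWeight f φ) (hD : ContMDiff (𝓡 (n₁ + n₀)) 𝓘(ℝ, ℂ) ∞ D) (hc : HasCompactSupport D)
    {c' : 𝒢.UnitChart} (hs : tsupport D ⊆ 𝒢.s ⁻¹' c'.base) :
    ContMDiff (𝓡 (n₁ + n₀)) 𝓘(ℝ, ℂ) ∞ (b.average f φ D) ∧
      HasCompactSupport (b.average f φ D) ∧ tsupport (b.average f φ D) ⊆ arrows b.c c' := by
  have h1 := isCompact_averageSet h hc.isCompact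
  have h2 := averageSet_subset h hs
  have h3 := contMDiff_of_support_subset (b.isOpen_B.preimage r_contMDiff.continuous) h1.isClosed
    (h2.trans inter_subset_left) (contMDiffOn_average h hD) (support_average_subset h)
  exact ⟨h3.1, h1.of_isClosed_subset (isClosed_tsupport _) h3.2,
    h3.2.trans (h2.trans inter_subset_right)⟩

end FlowBox
end Average
end LieGroupoid
-- Averages as convolutions
namespace LieGroupoid
section Convolution
open Set Filter Topology MeasureTheory

variable {n₁ n₀ : ℕ} {G M : Type*}
    [TopologicalSpace G] [ChartedSpace (EuclideanSpace ℝ (Fin (n₁ + n₀))) G]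
    [TopologicalSpace M] [ChartedSpace (EuclideanSpace ℝ (Fin n₀)) M]
    {𝒢 : LieGroupoid n₁ n₀ G M} {W : Set G}

theorem hasFiberIntegral_zero {x : M}
    {θ : G → (Fin n₁ → EuclideanSpace ℝ (Fin (n₁ + n₀))) → ℂ}
    (h : ∀ α, 𝒢.s α = x → θ α = 0) : 𝒢.HasFiberIntegral x θ 0 :=
  ⟨0, Fin.elim0, Fin.elim0, fun j => j.elim0, fun α hα h0 => absurd (h α hα) h0,
    fun j => j.elim0, by simp⟩

namespace FlowBox
variable {b : 𝒢.FlowBox W} {f : EuclideanSpace ℝ (Fin n₁) → ℝ} {φ : M → ℝ}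

theorem kernel_of_mem {β : G} (h1 : β ∈ b.c.e.source) : b.kernel f φ β =
    ((f (b.c.e β).1 * φ (𝒢.s β) /
      |(coordMatrix (b.c.algCoord (𝒢.r β)) (b.c.transFrame β)).det| : ℝ) : ℂ) :=
  indicator_of_mem h1 _

theorem kernel_ne_zero (h : b.IsWeight f φ) {β : G} (hβ : b.kernel f φ β ≠ 0) :
    β ∈ b.c.e.source ∧ (b.c.e β).1 ∈ euclideanBox n₁ b.δ ∧ 𝒢.s β ∈ b.B := by
  have h1 : β ∈ b.c.e.source := by
    by_contra h1
    exact hβ (indicator_of_notMem h1 _)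
  rw [kernel_of_mem h1, Complex.ofReal_ne_zero] at hβ
  exact ⟨h1, h.support (left_ne_zero_of_mul (div_ne_zero_iff.1 hβ).1),
    h.cutoff_support (subset_tsupport _ (right_ne_zero_of_mul (div_ne_zero_iff.1 hβ).1))⟩

/-- The two half-densities in the integrand, one from each factor of the convolution, multiply to
the volume element of the coordinate frame. The determinant in the denominator of the kernel cancels
it, which leaves Lebesgue measure with weight f. -/
theorem kernel_mul_coordDensity {u : EuclideanSpace ℝ (Fin n₁)} (hu : u ∈ euclideanBox n₁ b.δ)
    {x : M} (hx : x ∈ b.B) {β : G} (hβ : b.c.e.symm (u, b.c.k x) = β) :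
    b.kernel f φ β * ((coordDensity (1 / 2) (𝒢.algebroid (𝒢.r β)) (b.c.algCoord (𝒢.r β))
        (b.c.transFrame β) : ℝ) : ℂ) *
      ((coordDensity (1 / 2) (𝒢.algebroid (𝒢.r β)) (b.c.algCoord (𝒢.r β))
        (b.c.transFrame β) : ℝ) : ℂ) = ((f u * φ x : ℝ) : ℂ) := by
  have h1 := mem_arrows hu hx
  have h2 := mem_domain hu hx
  have h3 := UnitChart.s_symm_of_mem (b.c.base_subset (b.B_subset hx)) h2.1
  have h4 : b.c.e β = (u, b.c.k x) := by rw [← hβ, b.c.e.right_inv h2.1]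
  rw [hβ] at h1 h3
  have hfr := UnitChart.isFrame_transFrame h1.1 h1.2.2 h1.2.1
  rw [_root_.mul_assoc, ← Complex.ofReal_mul, coordDensity_mul (UnitChart.isCoordFrame_alg h1.2.1),
    coordDensity_of_isFrame hfr, kernel_of_mem h1.1, ← Complex.ofReal_mul, h4, h3,
    show (1 / 2 + 1 / 2 : ℝ) = 1 by norm_num, Real.rpow_one,
    div_mul_cancel₀ _ (abs_ne_zero.2 (transFrame_det_ne_zero h1))]

/-- One chart of the fibre, that of the translates of γ, carries the whole integral: the kernel
confines the integrand to the image of the compact box. -/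
theorem hasFiberIntegral (h : b.IsWeight f φ) {γ : G} (hγ : 𝒢.r γ ∈ b.B) {x : M} (hx : 𝒢.s γ = x)
    {θ : G → (Fin n₁ → EuclideanSpace ℝ (Fin (n₁ + n₀))) → ℂ}
    {F : EuclideanSpace ℝ (Fin n₁) → ℂ}
    (h1 : ∀ α, 𝒢.s α = x → θ α ≠ 0 → b.kernel f φ (𝒢.mul α (𝒢.inv γ)) ≠ 0)
    (h2 : ∀ u ∈ euclideanBox n₁ b.δ,
      θ (b.c.trans u γ) (b.c.transFrame (b.c.e.symm (u, b.c.k (𝒢.r γ)))) = F u)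
    (hF : ∀ u ∉ euclideanBox n₁ b.δ, F u = 0) : 𝒢.HasFiberIntegral x θ (∫ u, F u) := by
  have hr := b.B_subset hγ
  have hbox : euclideanBox n₁ b.δ ⊆
      (b.c.fiberChart γ hr x hx).toOpenPartialHomeomorph.target :=
    fun u hu => (mem_domain hu hγ).1
  refine ⟨1, fun _ => b.c.fiberChart γ hr x hx, fun _ _ => 1, fun _ => contMDiff_const,
    fun _ _ _ => by simp, fun _ => ⟨(b.c.fiberChart γ hr x hx).toOpenPartialHomeomorph.symm ''
      euclideanBox n₁ b.δ, ?_, ?_, fun α hα => ?_⟩, ?_⟩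
  · exact (isCompact_euclideanBox n₁ b.δ).image_of_continuousOn
      ((b.c.fiberChart γ hr x hx).toOpenPartialHomeomorph.continuousOn_symm.mono hbox)
  · rintro _ ⟨u, hu, rfl⟩
    exact (b.c.fiberChart γ hr x hx).toOpenPartialHomeomorph.map_target (hbox hu)
  · by_contra h0
    rw [one_smul] at h0
    obtain ⟨h3, h4, -⟩ := kernel_ne_zero h (h1 α α.2 h0)
    exact hα ⟨_, h4, (b.c.fiberChart γ hr x hx).toOpenPartialHomeomorph.left_inv h3⟩
  · simp only [Finset.univ_unique, Finset.sum_const, Finset.card_singleton, one_smul,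
      Complex.ofReal_one, one_mul]
    rw [← setIntegral_eq_integral_of_forall_compl_eq_zero (s :=
      (b.c.fiberChart γ hr x hx).toOpenPartialHomeomorph.target) fun u hu => hF u fun hu' =>
        hu (hbox hu')]
    refine (setIntegral_congr_fun
      (b.c.fiberChart γ hr x hx).toOpenPartialHomeomorph.open_target.measurableSet fun u hu => ?_).symm
    have hu' : (u, b.c.k (𝒢.r γ)) ∈ b.c.e.target := hu
    simp only [UnitChart.param_fiberChart hu', UnitChart.coordFrame_fiberChart hu']
    by_cases hub : u ∈ euclideanBox n₁ b.δ
    · exact h2 u hub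
    · rw [hF u hub]
      by_contra h0
      have h3 := kernel_ne_zero h (h1 (b.c.trans u γ) ((b.c.s_trans (γ := γ) ⟨hr, hu'⟩).trans hx)
        fun h' => h0 (by rw [h']; rfl))
      rw [UnitChart.trans, mul_inv_cancel_right
        (UnitChart.s_symm_of_mem (b.c.base_subset hr) hu'), b.c.e.right_inv hu'] at h3
      exact hub h3.2.1

variable {D : G → ℂ} {c' : 𝒢.UnitChart} [T2Space G]

theorem isCompactHalfDensity_kernel [IsManifold (𝓡 (n₁ + n₀)) ∞ G] (h : b.IsWeight f φ) :
    𝒢.IsCompactHalfDensity (halfOf b.c b.c (b.kernel f φ)) := by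
  obtain ⟨h1, h2⟩ := contMDiff_kernel h
  exact isCompactHalfDensity_halfOf h1
    ((isCompact_kernelSet h).of_isClosed_subset (isClosed_tsupport _) h2)
    (h2.trans ((kernelSet_subset h).trans inter_subset_right))

theorem isCompactHalfDensity_kernel_inv [IsManifold (𝓡 (n₁ + n₀)) ∞ G] (h : b.IsWeight f φ) :
    𝒢.IsCompactHalfDensity (halfOf b.c b.c (b.kernel f φ ∘ 𝒢.inv)) := by
  obtain ⟨h1, h2⟩ := contMDiff_kernel h
  have h3 : tsupport (b.kernel f φ ∘ 𝒢.inv) = 𝒢.inv ⁻¹' tsupport (b.kernel f φ) :=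
    (tsupport_comp_eq_preimage (b.kernel f φ) (invHomeomorph 𝒢))
  refine isCompactHalfDensity_halfOf (h1.comp 𝒢.inv_smooth) ?_ ?_
  · exact HasCompactSupport.comp_homeomorph (f := b.kernel f φ)
      ((isCompact_kernelSet h).of_isClosed_subset (isClosed_tsupport _) h2) (invHomeomorph 𝒢)
  · rw [h3]
    intro γ hγ
    have h4 := (kernelSet_subset h (h2 hγ)).2
    refine ⟨?_, ?_⟩
    · rw [mem_preimage, ← 𝒢.s_inv]; exact h4.2
    · rw [mem_preimage, ← 𝒢.r_inv]; exact h4.1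

theorem tsupport_halfOf_kernel_subset (h : b.IsWeight f φ) :
    tsupport (halfOf b.c b.c (b.kernel f φ)) ⊆ W :=
  (closure_mono (support_halfOf_subset _ _ _)).trans ((contMDiff_kernel h).2.trans
    ((kernelSet_subset h).trans (inter_subset_left.trans b.source_subset)))

theorem tsupport_halfOf_kernel_inv_subset (h : b.IsWeight f φ) :
    tsupport (halfOf b.c b.c (b.kernel f φ ∘ 𝒢.inv)) ⊆ 𝒢.inv ⁻¹' W := by
  refine (closure_mono (support_halfOf_subset _ _ _)).trans ?_
  change tsupport (b.kernel f φ ∘ 𝒢.inv) ⊆ _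
  rw [show tsupport (b.kernel f φ ∘ 𝒢.inv) = 𝒢.inv ⁻¹' tsupport (b.kernel f φ) from
    tsupport_comp_eq_preimage (b.kernel f φ) (invHomeomorph 𝒢)]
  exact preimage_mono ((contMDiff_kernel h).2.trans
    ((kernelSet_subset h).trans (inter_subset_left.trans b.source_subset)))

/-- With α = βγ one has γα⁻¹ = β⁻¹, so the half-density must take at β⁻¹ the value of the kernel at
β; hence the composition with inversion. -/
theorem isLeftConvolution [T2Space M] [IsManifold (𝓡 (n₁ + n₀)) ∞ G] (h : b.IsWeight f φ)
    (hD : ContMDiff (𝓡 (n₁ + n₀)) 𝓘(ℝ, ℂ) ∞ D) (hc : HasCompactSupport D)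
    (hs : tsupport D ⊆ arrows b.c c') :
    𝒢.IsLeftConvolution (halfOf b.c b.c (b.kernel f φ ∘ 𝒢.inv))
      (testOf b.c c' (sFrame b.c c') D)
      (testOf b.c c' (sFrame b.c c') (b.average f φ D)) := by
  obtain ⟨a1, a2, a3⟩ := contMDiff_average h hD hc (hs.trans inter_subset_right)
  refine ⟨isTestFunction_testOf isDensityFrame_sFrame a1 a2 a3, fun γ a b' v ha hb hv => ?_⟩
  have hker : ∀ α, 𝒢.s α = 𝒢.s γ → (fun e => halfOf b.c b.c (b.kernel f φ ∘ 𝒢.inv)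
      (𝒢.mul γ (𝒢.inv α)) a e * 𝒢.sForm (testOf b.c c' (sFrame b.c c') D) α e b' v) ≠ 0 →
      b.kernel f φ (𝒢.mul α (𝒢.inv γ)) ≠ 0 ∧ D α ≠ 0 := by
    intro α hα h0
    constructor
    · contrapose! h0
      funext e
      simp [halfOf, mul_inv_rev (𝒢 := 𝒢) (α := γ) (β := 𝒢.inv α) (by rw [𝒢.r_inv, hα]),
        inv_inv, h0]
    · contrapose! h0
      funext e
      simp [sForm, testOf, h0]
  -- When this fails, the average vanishes at γ and so does the integrand on the whole fibre.
  by_cases hγ : 𝒢.r γ ∈ b.B ∧ 𝒢.s γ ∈ c'.base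
  · set C : ℝ := coordDensity (1 / 2) (𝒢.algebroid (𝒢.r γ)) (b.c.algCoord (𝒢.r γ)) a *
        coordDensity (-1 / 2) (𝒢.algebroid (𝒢.s γ)) (c'.algCoord (𝒢.s γ)) b' *
        coordDensity 1 ⊤ (c'.baseCoord (𝒢.s γ)) v with hC
    have hI : 𝒢.sForm (testOf b.c c' (sFrame b.c c') (b.average f φ D)) γ a b' v =
        ∫ u, (φ (𝒢.r γ) • (f u • D (b.c.trans u γ))) * (C : ℂ) := by
      rw [sForm_testOf _ ⟨b.B_subset hγ.1, hγ.2⟩ ha b' hv, average, ← integral_smul,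
        integral_mul_const]
    rw [hI]
    refine hasFiberIntegral h hγ.1 rfl (fun α hα h0 => (hker α hα h0).1) (fun u hu => ?_)
      fun u hu => ?_
    · have hd := mem_domain hu hγ.1
      have hsβ := UnitChart.s_symm_of_mem (b.c.base_subset (b.B_subset hγ.1)) hd.1
      set β := b.c.e.symm (u, b.c.k (𝒢.r γ)) with hβ
      have hα : b.c.trans u γ = 𝒢.mul β γ := rfl
      have hinv : 𝒢.mul γ (𝒢.inv (𝒢.mul β γ)) = 𝒢.inv β := by
        rw [mul_inv_rev hsβ, ← 𝒢.mul_assoc _ _ _ (by rw [𝒢.r_inv]) (by rw [𝒢.s_inv, 𝒢.r_inv, hsβ]),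
          𝒢.mul_inv, ← hsβ, ← 𝒢.r_inv, 𝒢.unit_mul]
      have hrα := 𝒢.r_mul _ _ hsβ
      have hsα := 𝒢.s_mul _ _ hsβ
      have hβm := mem_arrows hu hγ.1
      have hfr := UnitChart.isFrame_transFrame hβm.1 hβm.2.2 hβm.2.1
      have hk := kernel_mul_coordDensity (f := f) (φ := φ) hu hγ.1 hβ.symm
      have hform := sForm_testOf (c := b.c) (c' := c') D (γ := 𝒢.mul β γ)
        ⟨by rw [mem_preimage, hrα]; exact hβm.2.1, by rw [mem_preimage, hsα]; exact hγ.2⟩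
        (a := b.c.transFrame β) (by rw [hrα]; exact hfr) b' hv
      rw [hrα, hsα] at hform
      simp only [hα, hinv, hform]
      simp only [halfOf, Function.comp, inv_inv, 𝒢.r_inv, 𝒢.s_inv, hsβ, Complex.real_smul]
      rw [hC]
      push_cast at hk ⊢
      linear_combination (D (𝒢.mul β γ) *
        (coordDensity (1 / 2) (𝒢.algebroid (𝒢.r γ)) (b.c.algCoord (𝒢.r γ)) a : ℂ) *
        (coordDensity (-1 / 2) (𝒢.algebroid (𝒢.s γ)) (c'.algCoord (𝒢.s γ)) b' : ℂ) *
        (coordDensity 1 ⊤ (c'.baseCoord (𝒢.s γ)) v : ℂ)) * hk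
    · simp [Function.notMem_support.1 fun h' => hu (h.support h')]
  · have h0 : b.average f φ D γ = 0 := by
      by_contra h0
      have h1 := averageSet_subset h (hs.trans inter_subset_right) (support_average_subset h h0)
      exact hγ ⟨h1.1, h1.2.2⟩
    have h2 : 𝒢.sForm (testOf b.c c' (sFrame b.c c') (b.average f φ D)) γ a b' v = 0 := by
      simp [sForm, testOf, h0]
    rw [h2]
    refine hasFiberIntegral_zero fun α hα => ?_
    by_contra h3
    obtain ⟨h4, h5⟩ := hker α hα h3
    refine hγ ⟨?_, ?_⟩
    · have h6 := (kernel_ne_zero h h4).2.2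
      rwa [𝒢.s_mul _ _ (by rw [𝒢.r_inv, hα]), 𝒢.s_inv] at h6
    · have h7 := (hs (subset_tsupport _ h5)).2
      rwa [mem_preimage, hα] at h7

theorem contMDiff_average_inv [T2Space M] [IsManifold (𝓡 (n₁ + n₀)) ∞ G] (h : b.IsWeight f φ)
    (hD : ContMDiff (𝓡 (n₁ + n₀)) 𝓘(ℝ, ℂ) ∞ D) (hc : HasCompactSupport D)
    (hs : tsupport D ⊆ arrows c' b.c) :
    ContMDiff (𝓡 (n₁ + n₀)) 𝓘(ℝ, ℂ) ∞ (b.average f φ (D ∘ 𝒢.inv) ∘ 𝒢.inv) ∧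
      HasCompactSupport (b.average f φ (D ∘ 𝒢.inv) ∘ 𝒢.inv) ∧
      tsupport (b.average f φ (D ∘ 𝒢.inv) ∘ 𝒢.inv) ⊆ 𝒢.s ⁻¹' b.B ∩ arrows c' b.c := by
  have h3 : ∀ E : G → ℂ, tsupport (E ∘ 𝒢.inv) = 𝒢.inv ⁻¹' tsupport E := fun E =>
    tsupport_comp_eq_preimage E (invHomeomorph 𝒢)
  have hs' : tsupport (D ∘ 𝒢.inv) ⊆ 𝒢.s ⁻¹' c'.base := by
    rw [h3]
    intro γ hγ
    have h4 := (hs hγ).1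
    rwa [mem_preimage, 𝒢.r_inv] at h4
  have hc' : HasCompactSupport (D ∘ 𝒢.inv) := hc.comp_homeomorph (invHomeomorph 𝒢)
  obtain ⟨a1, a2, -⟩ := contMDiff_average h (hD.comp 𝒢.inv_smooth) hc' hs'
  refine ⟨a1.comp 𝒢.inv_smooth, a2.comp_homeomorph (invHomeomorph 𝒢), ?_⟩
  rw [h3]
  intro γ hγ
  have h5 : tsupport (b.average f φ (D ∘ 𝒢.inv)) ⊆ 𝒢.r ⁻¹' b.B ∩ arrows b.c c' :=
    (closure_minimal (support_average_subset h)
      (isCompact_averageSet h hc'.isCompact).isClosed).trans (averageSet_subset h hs')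
  have h6 := h5 hγ
  refine ⟨?_, ?_, ?_⟩
  · have h7 := h6.1
    rwa [mem_preimage, 𝒢.r_inv] at h7
  · have h7 := h6.2.2
    rwa [mem_preimage, 𝒢.s_inv] at h7
  · have h7 := h6.2.1
    rwa [mem_preimage, 𝒢.r_inv] at h7

/-- Here the integration variable is the translating element β itself, so the fibre chart is the one
through the unit at s(γ). Since γβ⁻¹ = (βγ⁻¹)⁻¹, the result is the average of D composed with
inversion, evaluated at γ⁻¹. -/
theorem isRightConvolution [T2Space M] [IsManifold (𝓡 (n₁ + n₀)) ∞ G] (h : b.IsWeight f φ)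
    (hD : ContMDiff (𝓡 (n₁ + n₀)) 𝓘(ℝ, ℂ) ∞ D) (hc : HasCompactSupport D)
    (hs : tsupport D ⊆ arrows c' b.c) :
    𝒢.IsRightConvolution (testOf c' b.c (rFrame c' b.c) D) (halfOf b.c b.c (b.kernel f φ))
      (testOf c' b.c (rFrame c' b.c) (b.average f φ (D ∘ 𝒢.inv) ∘ 𝒢.inv)) := by
  obtain ⟨a1, a2, a3⟩ := contMDiff_average_inv h hD hc hs
  refine ⟨isTestFunction_testOf isDensityFrame_rFrame a1 a2 (a3.trans inter_subset_right),
    fun γ a b' v ha hb hv => ?_⟩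
  have hker : ∀ α, 𝒢.s α = 𝒢.s γ → (fun e => 𝒢.rForm (testOf c' b.c (rFrame c' b.c) D)
      (𝒢.mul γ (𝒢.inv α)) a e v * halfOf b.c b.c (b.kernel f φ) α e b') ≠ 0 →
      b.kernel f φ α ≠ 0 ∧ D (𝒢.mul γ (𝒢.inv α)) ≠ 0 := by
    intro α hα h0
    constructor
    · contrapose! h0
      funext e
      simp [halfOf, h0]
    · contrapose! h0
      funext e
      simp [rForm, testOf, h0]
  by_cases hγ : 𝒢.s γ ∈ b.B ∧ 𝒢.r γ ∈ c'.base
  · set C : ℝ := coordDensity (-1 / 2) (𝒢.algebroid (𝒢.r γ)) (c'.algCoord (𝒢.r γ)) a *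
        coordDensity (1 / 2) (𝒢.algebroid (𝒢.s γ)) (b.c.algCoord (𝒢.s γ)) b' *
        coordDensity 1 ⊤ (c'.baseCoord (𝒢.r γ)) v with hC
    have hI : 𝒢.rForm (testOf c' b.c (rFrame c' b.c) (b.average f φ (D ∘ 𝒢.inv) ∘ 𝒢.inv))
        γ a b' v = ∫ u, (φ (𝒢.s γ) • (f u • D (𝒢.inv (b.c.trans u (𝒢.inv γ))))) * (C : ℂ) := by
      rw [rForm_testOf _ ⟨hγ.2, b.B_subset hγ.1⟩ a hb hv, Function.comp, average, 𝒢.r_inv,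
        ← integral_smul, integral_mul_const]
      rfl
    rw [hI]
    have hu0 : 𝒢.r (𝒢.unit (𝒢.s γ)) = 𝒢.s γ := 𝒢.r_unit _
    refine hasFiberIntegral (γ := 𝒢.unit (𝒢.s γ)) h (by rw [hu0]; exact hγ.1) (𝒢.s_unit _)
      (fun α hα h0 => ?_) (fun u hu => ?_) fun u hu => ?_
    · rw [inv_unit, ← hα, 𝒢.mul_unit]
      exact (hker α hα h0).1
    · have hd := mem_domain hu hγ.1
      have hsβ := UnitChart.s_symm_of_mem (b.c.base_subset (b.B_subset hγ.1)) hd.1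
      simp only [UnitChart.trans, hu0, 𝒢.r_inv]
      set β := b.c.e.symm (u, b.c.k (𝒢.s γ)) with hβ
      have hα : 𝒢.mul β (𝒢.unit (𝒢.s γ)) = β := by rw [← hsβ, 𝒢.mul_unit]
      have hinv : 𝒢.inv (𝒢.mul β (𝒢.inv γ)) = 𝒢.mul γ (𝒢.inv β) := by
        rw [mul_inv_rev (by rw [𝒢.r_inv, hsβ]), inv_inv]
      have hcomp : 𝒢.s γ = 𝒢.r (𝒢.inv β) := by rw [𝒢.r_inv, hsβ]
      have hr := 𝒢.r_mul _ _ hcomp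
      have hs' := 𝒢.s_mul _ _ hcomp
      rw [𝒢.s_inv] at hs'
      have hβm := mem_arrows hu hγ.1
      have hfr := UnitChart.isFrame_transFrame hβm.1 hβm.2.2 hβm.2.1
      have hk := kernel_mul_coordDensity (f := f) (φ := φ) hu hγ.1 hβ.symm
      have hform := rForm_testOf (c := c') (c' := b.c) D (γ := 𝒢.mul γ (𝒢.inv β))
        ⟨by rw [mem_preimage, hr]; exact hγ.2, by rw [mem_preimage, hs']; exact hβm.2.1⟩
        a (b := b.c.transFrame β) (by rw [hs']; exact hfr) hv
      rw [hr, hs'] at hform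
      simp only [hα, hinv, hform]
      simp only [halfOf, hsβ, Complex.real_smul]
      rw [hC]
      push_cast at hk ⊢
      linear_combination (D (𝒢.mul γ (𝒢.inv β)) *
        (coordDensity (-1 / 2) (𝒢.algebroid (𝒢.r γ)) (c'.algCoord (𝒢.r γ)) a : ℂ) *
        (coordDensity (1 / 2) (𝒢.algebroid (𝒢.s γ)) (b.c.algCoord (𝒢.s γ)) b' : ℂ) *
        (coordDensity 1 ⊤ (c'.baseCoord (𝒢.r γ)) v : ℂ)) * hk
    · simp [Function.notMem_support.1 fun h' => hu (h.support h')]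
  · have h0 : (b.average f φ (D ∘ 𝒢.inv) ∘ 𝒢.inv) γ = 0 := by
      by_contra h0
      have h1 := a3 (subset_tsupport _ h0)
      exact hγ ⟨h1.1, h1.2.1⟩
    have h2 : 𝒢.rForm (testOf c' b.c (rFrame c' b.c) (b.average f φ (D ∘ 𝒢.inv) ∘ 𝒢.inv))
        γ a b' v = 0 := by
      simp only [rForm, testOf, h0, zero_mul]
    rw [h2]
    refine hasFiberIntegral_zero fun α hα => ?_
    by_contra h3
    obtain ⟨h4, h5⟩ := hker α hα h3
    refine hγ ⟨?_, ?_⟩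
    · have h6 := (kernel_ne_zero h h4).2.2
      rwa [hα] at h6
    · have h7 := (hs (subset_tsupport _ h5)).1
      rwa [mem_preimage, 𝒢.r_mul _ _ (by rw [𝒢.r_inv, hα])] at h7

end FlowBox
end Convolution
end LieGroupoid
-- Localization and decomposition of test functions
namespace LieGroupoid
section Decomposition
open Set Filter Topology MeasureTheory

variable {n₁ n₀ : ℕ} {G M : Type*}
    [TopologicalSpace G] [ChartedSpace (EuclideanSpace ℝ (Fin (n₁ + n₀))) G]
    [TopologicalSpace M] [ChartedSpace (EuclideanSpace ℝ (Fin n₀)) M]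
    {𝒢 : LieGroupoid n₁ n₀ G M} {W : Set G}

theorem tsupport_comp_inv (H : G → ℂ) : tsupport (H ∘ 𝒢.inv) = 𝒢.inv ⁻¹' tsupport H :=
  tsupport_comp_eq_preimage H (invHomeomorph 𝒢)

/-- A smooth function supported in a chart over a flow box is a finite sum of averages. -/
theorem FlowBox.exists_average_decomposition [T2Space G] [IsManifold (𝓡 n₀) ∞ M]
    [T2Space M] [SecondCountableTopology M] [CompactSpace M] (b : 𝒢.FlowBox W)
    {κ : OpenPartialHomeomorph G (EuclideanSpace ℝ (Fin (n₁ + n₀)))}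
    (hκ : IsSmoothChart (n₁ + n₀) κ) {H : G → ℂ} (hH : ContMDiff (𝓡 (n₁ + n₀)) 𝓘(ℝ, ℂ) ∞ H)
    (hc : HasCompactSupport H) (hs : tsupport H ⊆ κ.source ∩ 𝒢.r ⁻¹' b.B) :
    ∃ (J : Type) (_ : Fintype J) (f : J → EuclideanSpace ℝ (Fin n₁) → ℝ) (φ : M → ℝ)
      (D : J → G → ℂ), (∀ j, b.IsWeight (f j) φ ∧ ContMDiff (𝓡 (n₁ + n₀)) 𝓘(ℝ, ℂ) ∞ (D j) ∧
        HasCompactSupport (D j) ∧ tsupport (D j) ⊆ tsupport H) ∧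
      H = fun γ => ∑ j, b.average (f j) φ (D j) γ := by
  set h : EuclideanSpace ℝ (Fin (n₁ + n₀)) → ℂ := chartExt κ.target κ.symm H
  have hmem : ∀ w ∈ κ.target, h w = H (κ.symm w) := fun w hw => chartExt_of_mem _ hw
  have hK : IsCompact (κ '' tsupport H) :=
    hc.isCompact.image_of_continuousOn (κ.continuousOn.mono fun γ hγ => (hs hγ).1)
  have hKt : κ '' tsupport H ⊆ κ.target := by
    rintro _ ⟨γ, hγ, rfl⟩
    exact κ.map_source (hs hγ).1
  have hsupp : Function.support h ⊆ κ '' tsupport H := by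
    intro w hw
    have hwt : w ∈ κ.target := by
      by_contra hwt
      exact hw (chartExt_of_notMem _ hwt)
    rw [Function.mem_support, hmem w hwt] at hw
    exact ⟨κ.symm w, subset_tsupport _ hw, κ.right_inv hwt⟩
  obtain ⟨hh1, hh2⟩ := contMDiff_of_support_subset (F := h) κ.open_target hK.isClosed hKt
    ((hH.comp_contMDiffOn hκ.symm_smooth).congr fun w hw => hmem w hw) hsupp
  have hhc : HasCompactSupport h := hK.of_isClosed_subset (isClosed_tsupport _) hh2
  have hHh : chartExt κ.source κ h = H := by
    funext γ
    by_cases hγ : γ ∈ κ.source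
    · rw [chartExt_of_mem _ hγ, hmem _ (κ.map_source hγ), κ.left_inv hγ]
    · rw [chartExt_of_notMem _ hγ,
        image_eq_zero_of_notMem_tsupport fun h' => hγ (hs h').1]
  obtain ⟨J, hJ, f, χ, hf, hfac⟩ := b.factor κ hκ h hh1.contDiff hhc (by
    intro w hw
    obtain ⟨γ, hγ, rfl⟩ := hh2 hw
    refine ⟨κ.map_source (hs hγ).1, ?_⟩
    rw [mem_preimage, κ.left_inv (hs hγ).1]
    exact (hs hγ).2)
  -- The cutoff makes each average supported over the box. Being 1 on the range of the support of H,
  -- it does not change the sum, which equals H over B.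
  obtain ⟨φ, hφ1, hφ2, hφ3⟩ : ∃ φ : M → ℝ, ContMDiff (𝓡 n₀) 𝓘(ℝ, ℝ) ∞ φ ∧ tsupport φ ⊆ b.B ∧
      ∀ γ ∈ tsupport H, φ (𝒢.r γ) = 1 := by
    have hL : IsCompact (𝒢.r '' tsupport H) := hc.isCompact.image r_contMDiff.continuous
    obtain ⟨U, hU, hLU, hUB⟩ := normal_exists_closure_subset hL.isClosed b.isOpen_B (by
      rintro _ ⟨γ, hγ, rfl⟩
      exact (hs hγ).2)
    obtain ⟨φ, h0, h1, -⟩ := exists_contMDiffMap_zero_one_of_isClosed (n := ⊤) (𝓡 n₀)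
      hU.isClosed_compl hL.isClosed (disjoint_compl_left_iff_subset.2 hLU)
    refine ⟨φ, φ.contMDiff, (closure_mono fun x hx => ?_).trans hUB, fun γ hγ =>
      h1 ⟨γ, hγ, rfl⟩⟩
    by_contra hxU
    exact hx (h0 hxU)
  refine ⟨J, hJ, f, φ, fun j => chartExt κ.source κ (χ j), fun j => ?_, ?_⟩
  · obtain ⟨h1, h2, h3, h4⟩ := hf j
    have h5 : HasCompactSupport (χ j) := hhc.isCompact.of_isClosed_subset (isClosed_tsupport _) h4
    obtain ⟨h6, h7⟩ := contMDiff_chartExt hκ h3 h5 ((h4.trans hh2).trans hKt)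
    have h8 : tsupport (chartExt κ.source κ (χ j)) ⊆ tsupport H := by
      intro γ hγ
      obtain ⟨w, hw, rfl⟩ := h7 hγ
      obtain ⟨β, hβ, rfl⟩ := hh2 (h4 hw)
      rwa [κ.left_inv (hs hβ).1]
    exact ⟨⟨h1, h2, hφ1, (isClosed_tsupport φ).isCompact, hφ2⟩, h6,
      hc.isCompact.of_isClosed_subset (isClosed_tsupport _) h8, h8⟩
  · funext γ
    simp only [FlowBox.average]
    rw [← Finset.smul_sum]
    by_cases hγ : 𝒢.r γ ∈ b.B
    · rw [← hfac γ hγ, hHh]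
      by_cases hγH : γ ∈ tsupport H
      · rw [hφ3 γ hγH, one_smul]
      · rw [image_eq_zero_of_notMem_tsupport hγH, smul_zero]
    · rw [image_eq_zero_of_notMem_tsupport fun h' => hγ (hφ2 h'), zero_smul,
        image_eq_zero_of_notMem_tsupport fun h' => hγ (hs h').2]

variable [IsManifold (𝓡 (n₁ + n₀)) ∞ G] {τ : TestField n₁ n₀ G} {c c' : 𝒢.UnitChart}
  {F : G → Fin (n₁ + n₀) → EuclideanSpace ℝ (Fin (n₁ + n₀))}

/-- The coefficient of a localization of a test function. -/
theorem IsTestFunction.exists_coefficient (hτ : 𝒢.IsTestFunction τ)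
    (hF : IsDensityFrame (arrows c c') F) {ψ : G → ℝ}
    (hψ : ContMDiff (𝓡 (n₁ + n₀)) 𝓘(ℝ, ℝ) ∞ ψ) (hs : tsupport ψ ⊆ arrows c c') :
    ∃ H : G → ℂ, ContMDiff (𝓡 (n₁ + n₀)) 𝓘(ℝ, ℂ) ∞ H ∧ HasCompactSupport H ∧
      tsupport H ⊆ tsupport ψ ∧ tsupport H ⊆ tsupport τ ∧
      (fun γ => ψ γ • τ γ) = testOf c c' F H := by
  have h1 : Function.support (fun γ => ψ γ • coeffOf c c' F τ γ) ⊆ Function.support τ := by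
    intro γ hγ h0
    exact hγ (by simp [coeffOf, h0])
  obtain ⟨h2, h3⟩ := contMDiff_of_support_subset (F := fun γ => ψ γ • coeffOf c c' F τ γ)
    (isOpen_arrows c c') (isClosed_tsupport ψ) hs
    (hψ.contMDiffOn.smul (hτ.contMDiffOn_coeffOf hF)) fun γ hγ => subset_tsupport _ fun h0 =>
      hγ (by simp [h0])
  refine ⟨_, h2, hτ.compact.mono h1, h3, closure_mono h1, ?_⟩
  funext γ
  by_cases hγ : γ ∈ arrows c c'
  · rw [hτ.eq_testOf hF hγ]
    funext a b' t
    simp [testOf, _root_.mul_assoc]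
  · have h0 : ψ γ = 0 := image_eq_zero_of_notMem_tsupport fun h' => hγ (hs h')
    funext a b' t
    simp [testOf, h0]

/-- A property of test functions that is additive and local holds for all of them. -/
theorem IsTestFunction.mem_of_local [T2Space G] [SecondCountableTopology G]
    (hτ : 𝒢.IsTestFunction τ)
    (S : AddSubmonoid (TestField n₁ n₀ G))
    (h : ∀ γ₀ : G, ∃ O : Set G, IsOpen O ∧ γ₀ ∈ O ∧ ∀ ψ : G → ℝ,
      ContMDiff (𝓡 (n₁ + n₀)) 𝓘(ℝ, ℝ) ∞ ψ → tsupport ψ ⊆ O → (fun γ => ψ γ • τ γ) ∈ S) :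
    τ ∈ S := by
  choose O hO hmem hψ using h
  obtain ⟨t, ht⟩ := IsCompact.elim_finite_subcover (s := tsupport τ) hτ.compact O hO
    fun γ _ => mem_iUnion.2 ⟨γ, hmem γ⟩
  have := ChartedSpace.locallyCompactSpace (EuclideanSpace ℝ (Fin (n₁ + n₀))) G
  obtain ⟨ρ, hρ⟩ := SmoothPartitionOfUnity.exists_isSubordinate (𝓡 (n₁ + n₀))
    (isClosed_tsupport τ) (fun i : t => O i) (fun i => hO i) (by simpa [iUnion_subtype] using ht)
  have h1 : τ = ∑ i, fun γ => ρ i γ • τ γ := by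
    funext γ
    rw [Finset.sum_apply, ← Finset.sum_smul]
    by_cases hγ : γ ∈ tsupport τ
    · rw [← finsum_eq_sum_of_fintype, ρ.sum_eq_one hγ, one_smul]
    · rw [image_eq_zero_of_notMem_tsupport hγ, smul_zero]
  rw [h1]
  exact S.sum_mem fun i _ => hψ i _ (ρ i).contMDiff (hρ i)

theorem exists_sum_of_mem_closure {A : Type*} [AddCommMonoid A] {S : Set A} {a : A}
    (ha : a ∈ AddSubmonoid.closure S) : ∃ (N : ℕ) (η : Fin N → A), (∀ j, η j ∈ S) ∧
      a = ∑ j, η j := by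
  obtain ⟨l, hl, rfl⟩ := AddSubmonoid.exists_list_of_mem_closure ha
  exact ⟨l.length, fun j => l[j], fun j => hl _ (l.getElem_mem _), by simp⟩

variable [T2Space G] [SecondCountableTopology G] [IsManifold (𝓡 n₀) ∞ M] [T2Space M]
  [SecondCountableTopology M] [CompactSpace M] {V : Set G}

/-- Near γ₀ the test function has a scalar coefficient, which is a sum of averages in a flow box at
r(γ₀). The box is taken inside the inverse of V because the half-density is the kernel composed with
inversion. -/
theorem IsTestFunction.mem_closure_leftConvolution (hV : IsOpen V) (hMV : ∀ x, 𝒢.unit x ∈ V)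
    (hτ : 𝒢.IsTestFunction τ) : τ ∈ AddSubmonoid.closure {η | ∃ ξ χ,
      𝒢.IsCompactHalfDensity ξ ∧ tsupport ξ ⊆ V ∧ 𝒢.IsTestFunction χ ∧
      tsupport χ ⊆ tsupport τ ∧ 𝒢.IsLeftConvolution ξ χ η} := by
  refine hτ.mem_of_local _ fun γ₀ => ?_
  obtain ⟨b, hb⟩ := exists_flowBox (𝒢 := 𝒢) (hV.preimage 𝒢.inv_smooth.continuous) (𝒢.r γ₀)
    (by rw [mem_preimage, inv_unit]; exact hMV _)
  obtain ⟨c', hc'⟩ := UnitChart.exists_mem_source (𝒢 := 𝒢) (𝒢.s γ₀)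
  set κ := chartAt (EuclideanSpace ℝ (Fin (n₁ + n₀))) γ₀
  refine ⟨κ.source ∩ (𝒢.r ⁻¹' b.B ∩ 𝒢.s ⁻¹' c'.base), κ.open_source.inter
    ((b.isOpen_B.preimage r_contMDiff.continuous).inter
      (c'.isOpen_base.preimage s_contMDiff.continuous)), ⟨mem_chart_source _ γ₀, hb, hc'⟩,
    fun ψ hψ hs => ?_⟩
  have hO : tsupport ψ ⊆ arrows b.c c' := fun γ hγ => ⟨b.B_subset (hs hγ).2.1, (hs hγ).2.2⟩
  obtain ⟨H, h1, h2, h3, h4, h5⟩ := hτ.exists_coefficient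
    (isDensityFrame_sFrame (c := b.c) (c' := c')) hψ hO
  obtain ⟨J, _, f, φ, D, hD, hsum⟩ := b.exists_average_decomposition
    (isSmoothChart_chartAt γ₀) h1 h2 fun γ hγ => ⟨(hs (h3 hγ)).1, (hs (h3 hγ)).2.1⟩
  rw [h5, hsum, testOf_sum]
  refine AddSubmonoid.sum_mem _ fun j _ => AddSubmonoid.subset_closure ?_
  obtain ⟨d1, d2, d3, d4⟩ := hD j
  have d5 := d4.trans (h3.trans hO)
  refine ⟨halfOf b.c b.c (b.kernel (f j) φ ∘ 𝒢.inv), testOf b.c c' (sFrame b.c c') (D j),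
    FlowBox.isCompactHalfDensity_kernel_inv d1, ?_,
    isTestFunction_testOf isDensityFrame_sFrame d2 d3 d5,
    (closure_mono (support_testOf_subset _ _ _ _)).trans (d4.trans h4),
    FlowBox.isLeftConvolution d1 d2 d3 d5⟩
  intro γ hγ
  have h6 := FlowBox.tsupport_halfOf_kernel_inv_subset d1 hγ
  rwa [mem_preimage, mem_preimage, inv_inv] at h6

/-- Inversion exchanges range and source: the coefficient composed with inversion is decomposed in
the inverted chart, with a flow box at s(γ₀), and the summands are transported back. The kernel
itself is the half-density, so the box lies in V. -/
theorem IsTestFunction.mem_closure_rightConvolution (hV : IsOpen V) (hMV : ∀ x, 𝒢.unit x ∈ V)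
    (hτ : 𝒢.IsTestFunction τ) : τ ∈ AddSubmonoid.closure {η | ∃ ξ χ,
      𝒢.IsCompactHalfDensity ξ ∧ tsupport ξ ⊆ V ∧ 𝒢.IsTestFunction χ ∧
      tsupport χ ⊆ tsupport τ ∧ 𝒢.IsRightConvolution χ ξ η} := by
  refine hτ.mem_of_local _ fun γ₀ => ?_
  obtain ⟨b, hb⟩ := exists_flowBox (𝒢 := 𝒢) hV (𝒢.s γ₀) (hMV _)
  obtain ⟨c', hc'⟩ := UnitChart.exists_mem_source (𝒢 := 𝒢) (𝒢.r γ₀)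
  set κ := chartAt (EuclideanSpace ℝ (Fin (n₁ + n₀))) γ₀
  refine ⟨κ.source ∩ (𝒢.r ⁻¹' c'.base ∩ 𝒢.s ⁻¹' b.B), κ.open_source.inter
    ((c'.isOpen_base.preimage r_contMDiff.continuous).inter
      (b.isOpen_B.preimage s_contMDiff.continuous)), ⟨mem_chart_source _ γ₀, hc', hb⟩,
    fun ψ hψ hs => ?_⟩
  have hO : tsupport ψ ⊆ arrows c' b.c := fun γ hγ => ⟨(hs hγ).2.1, b.B_subset (hs hγ).2.2⟩
  obtain ⟨H, h1, h2, h3, h4, h5⟩ := hτ.exists_coefficient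
    (isDensityFrame_rFrame (c := c') (c' := b.c)) hψ hO
  obtain ⟨J, _, f, φ, D, hD, hsum⟩ := b.exists_average_decomposition
    ((isSmoothChart_chartAt γ₀).invChart 𝒢) (h1.comp 𝒢.inv_smooth)
    (h2.comp_homeomorph (invHomeomorph 𝒢)) (by
      intro γ hγ
      rw [tsupport_comp_inv] at hγ
      refine ⟨mem_invChart_source.2 (hs (h3 hγ)).1, ?_⟩
      rw [mem_preimage, ← 𝒢.s_inv]
      exact (hs (h3 hγ)).2.2)
  have hD' : ∀ j, (D j ∘ 𝒢.inv) ∘ 𝒢.inv = D j := fun j => by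
    funext γ
    simp only [Function.comp, inv_inv]
  have hsum' : H = fun γ => ∑ j,
      (b.average (f j) φ ((D j ∘ 𝒢.inv) ∘ 𝒢.inv) ∘ 𝒢.inv) γ := by
    funext γ
    have h6 := congrFun hsum (𝒢.inv γ)
    simp only [Function.comp, inv_inv] at h6
    simp only [hD', h6, Function.comp]
  rw [h5, hsum', testOf_sum]
  refine AddSubmonoid.sum_mem _ fun j _ => AddSubmonoid.subset_closure ?_
  obtain ⟨d1, d2, d3, d4⟩ := hD j
  have d4' : tsupport (D j ∘ 𝒢.inv) ⊆ tsupport H := by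
    rw [tsupport_comp_inv]
    intro γ hγ
    have h6 := d4 hγ
    rwa [tsupport_comp_inv, mem_preimage, inv_inv] at h6
  have d5 := d4'.trans (h3.trans hO)
  have d2' := d2.comp 𝒢.inv_smooth
  have d3' : HasCompactSupport (D j ∘ 𝒢.inv) := d3.comp_homeomorph (invHomeomorph 𝒢)
  exact ⟨halfOf b.c b.c (b.kernel (f j) φ), testOf c' b.c (rFrame c' b.c) (D j ∘ 𝒢.inv),
    FlowBox.isCompactHalfDensity_kernel d1, FlowBox.tsupport_halfOf_kernel_subset d1,
    isTestFunction_testOf isDensityFrame_rFrame d2' d3' d5,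
    (closure_mono (support_testOf_subset _ _ _ _)).trans (d4'.trans h4),
    FlowBox.isRightConvolution d1 d2' d3' d5⟩

end Decomposition
end LieGroupoid

theorem mainTheorem3 {n₁ n₀ : ℕ} {G M : Type*}
    [TopologicalSpace G] [ChartedSpace (EuclideanSpace ℝ (Fin (n₁ + n₀))) G]
    [IsManifold (𝓡 (n₁ + n₀)) ∞ G] [T2Space G] [SecondCountableTopology G]
    [TopologicalSpace M] [ChartedSpace (EuclideanSpace ℝ (Fin n₀)) M]
    [IsManifold (𝓡 n₀) ∞ M] [T2Space M] [SecondCountableTopology M] [CompactSpace M]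
    (𝒢 : LieGroupoid n₁ n₀ G M)
    (V : Set G) (hV : IsOpen V) (hMV : ∀ x, 𝒢.unit x ∈ V)
    (τ : LieGroupoid.TestField n₁ n₀ G) (hτ : 𝒢.IsTestFunction τ) :
    (∃ (N : ℕ) (ξ : Fin N → LieGroupoid.HalfField n₁ n₀ G)
        (χ η : Fin N → LieGroupoid.TestField n₁ n₀ G),
      (∀ j, 𝒢.IsCompactHalfDensity (ξ j) ∧ tsupport (ξ j) ⊆ V ∧
        𝒢.IsTestFunction (χ j) ∧ tsupport (χ j) ⊆ tsupport τ ∧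
        𝒢.IsLeftConvolution (ξ j) (χ j) (η j)) ∧
      τ = ∑ j, η j) ∧
    (∃ (N : ℕ) (ξ : Fin N → LieGroupoid.HalfField n₁ n₀ G)
        (χ η : Fin N → LieGroupoid.TestField n₁ n₀ G),
      (∀ j, 𝒢.IsCompactHalfDensity (ξ j) ∧ tsupport (ξ j) ⊆ V ∧
        𝒢.IsTestFunction (χ j) ∧ tsupport (χ j) ⊆ tsupport τ ∧
        𝒢.IsRightConvolution (χ j) (ξ j) (η j)) ∧
      τ = ∑ j, η j) := by
  constructor
  · obtain ⟨N, η, h, hsum⟩ := LieGroupoid.exists_sum_of_mem_closure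
      (hτ.mem_closure_leftConvolution hV hMV)
    choose ξ χ h using h
    exact ⟨N, ξ, χ, η, h, hsum⟩
  · obtain ⟨N, η, h, hsum⟩ := LieGroupoid.exists_sum_of_mem_closure
      (hτ.mem_closure_rightConvolution hV hMV)
    choose ξ χ h using h
    exact ⟨N, ξ, χ, η, h, hsum⟩
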